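/- Let $p,q\ge 2$ be integers, let $\mathbf w=x^py+y^qx\in S=\mathbb C[x,y]$, and let $\Gamma_{\mathbf w}=\{(s,t)\in(\mathbb C^*)^2: s^pt=t^qs\}$. Let $\Gamma\subseteq\Gamma_{\mathbf w}$ be a subgroup of finite index $\ell$. Then $\ell$ divides $p-1$ and $q-1$; put $m=\frac{p-1}{\ell}$ and $n=\frac{q-1}{\ell}$. The characters $(s,t)\mapsto s$ and $(s,t)\mapsto t$ of $\Gamma$ generate the group $L$ with generators $\vec x,\vec y$ and the single relation $m\vec x=n\vec y$. Grade $S$ by $|x|=\vec x$, $|y|=\vec y$, so that $\mathbf w$ has degree $\vec c=p\vec x+\vec y=\vec x+q\vec y$, and write $S(l)_j=S_{l+j}$. Let $\mathrm{mf}(\mathbb C^2,\Gamma,\mathbf w)$ be the dg category of $L$-graded matrix factorisations of $\mathbf w$: an object is a sequence $K^\bullet=(\cdots\to K^i\xrightarrow{k^i}K^{i+1}\to\cdots)$ of degree-preserving maps of graded free $S$-modules of a fixed finite rank, with $k^{i+1}k^i=\mathbf w$ and $K^\bullet[2]=K^\bullet(\vec c)$; morphisms of degree $d$ are families of graded maps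 $K^i\to K'^{\,i+d}$ compatible with the two-periodicity, with the usual differential $\delta f=k'f-(-1)^dfk$. Fix a primitive $\ell$-th root of unity $\eta$, put $\lambda_r=e^{\pi\sqrt{-1}/\ell}\eta^r$ and $w_r=x^{m}-\lambda_r y^{n}$ for $r=1,\dots,\ell$, so that $\mathbf w=xyw_1\cdots w_\ell$. Consider the following matrix factorisations (the last displayed term is in cohomological degree $0$). * $K_x=(\cdots\to S(-\vec c)\xrightarrow{\mathbf w/x}S(-\vec x)\xrightarrow{x}S\to\cdots)$ and $K_x^i=K_x((i+1-p)\vec x)$, for $p-m\le i\le p-1$; * $K_y=(\cdots\to S(-\vec c)\xrightarrow{\mathbf w/y}S(-\vec y)\xrightarrow{y}S\to\cdots)$ and $K_y^j=K_y((j+1-q)\vec y)$, for $q-n\le j\le q-1$; * $K_{w_r}=(\cdots\to S(-\vec c)\xrightarrow{\mathbf w/w_r}S(-m\vec x)\xrightarrow{w_r}S\to\cdots)$, for $r=1,\dots,\ell$; * for $p-m\le i\le p-1$ and $1\le j\le q-1$, with $k=\lfloor\frac{(j-1)\ell}{q-1}\rfloor$, the rank $k+2$ matrix factorisation $K_0^{i,j}$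 $$S(\vec c-m\vec x)^{\oplus (k+1)}\oplus S((i+1)\vec x+(j+1)\vec y-\vec c)\xrightarrow{d_0}S(\vec c-(k+1)m\vec x+j\vec y)\oplus S(\vec c)^{\oplus k}\oplus S((i+1)\vec x+\vec y)\xrightarrow{d_1}S(2\vec c-m\vec x)^{\oplus(k+1)}\oplus S((i+1)\vec x+(j+1)\vec y),$$ where $d_1$ is the adjugate of $d_0$, and $d_0$ is the $(k+2)\times(k+2)$-matrix with diagonal entries $y^{j-kn},y^{n},\dots,y^{n},xy^{q-j}$ ($k$ entries $y^n$), entries $-x^{m},\dots,-x^{m},-x^{i-(\ell-1)m}$ directly below the diagonal ($k$ entries $-x^m$), upper right entry $x^{p-i+m(\ell-1-k)}y$, and zeros elsewhere. Let $\mathcal B$ be the full dg subcategory of $\mathrm{mf}(\mathbb C^2,\Gamma,\mathbf w)$ on the objects $K_0^{i,j}$, $K_x^i[3]$, $K_y^{j}[3]$ and $K_{w_r}[3]$, with all indices as above. Let $Q$ be the quiver whose vertices are these objects and whose arrows are: * $x:K_0^{i,j}\to K_0^{i+1,j}$ for $p-m\le i<p-1$ and $1\le j\le q-1$, and $x:K_0^{p-1,j}\to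 K_0^{p-m,j+n}$ for $1\le j\le q-1-n$; * $y:K_0^{i,j}\to K_0^{i,j+1}$ for $p-m\le i\le p-1$ and $1\le j<q-1$; * $a:K_0^{p-1,j}\to K_y^j[3]$ for $q-n\le j\le q-1$; * $b:K_0^{i,q-1}\to K_x^i[3]$ for $p-m\le i\le p-1$; * $c_r:K_0^{p-1,q-1}\to K_{w_r}[3]$ for $1\le r\le\ell$. Let $A$ be the path algebra of $Q$ over $\mathbb C$ (a product $\alpha\beta$ runs through $\beta$ first) modulo the relations $$xy=yx,\qquad ay=0,\qquad bx=0,\qquad c_r\big(x^{(p-1)/\ell}-e^{\pi\sqrt{-1}/\ell}\eta^r\,y^{(q-1)/\ell}\big)=0\quad(r=1,\dots,\ell),$$ where each letter stands for the sum of all arrows with that label; equivalently, the relations are imposed on all paths with fixed ends, an undefined path being read as $0$. Then $\mathcal B$ has $\frac{pq-1}{\ell}+\ell$ objects, and there is an isomorphism of $\mathbb C$-algebras from $A$ to the total endomorphism algebra $\bigoplus_{d\in\mathbb Z}\bigoplus_{X,Y\in\mathcal B}H^d(\hom_{\mathcal B}(X,Y))$ which sends the trivial path at each vertex to the identity of the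 corresponding object, and all arrows to elements of degree $0$. In particular, $H^d(\hom_{\mathcal B}(X,Y))=0$ for all $X,Y\in\mathcal B$ and all $d\ne0$. The graded category $H(\mathcal B)$ is intrinsically formal: every $\mathbb Z$-graded $A_\infty$-category over $\mathbb C$ with the same objects whose cohomology category is isomorphic to $H(\mathcal B)$, by an isomorphism that is the identity on objects, is quasi-isomorphic to $H(\mathcal B)$ (with all operations other than composition zero). In particular, $\mathcal B$ is quasi-isomorphic to $H(\mathcal B)$. -/

import Mathlib

open scoped DirectSum

noncomputable section

/-! ### Differential graded categories over `ℂ` -/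

/-- The sign `(-1)^n`. -/
def sgn (n : ℤ) : ℂ := (-1 : ℂ) ^ n

lemma sgn_add (m n : ℤ) : sgn (m + n) = sgn m * sgn n := by
  unfold sgn; exact zpow_add₀ (by norm_num) m n

lemma sgn_one : sgn 1 = -1 := by simp [sgn]

lemma sgn_zero : sgn 0 = 1 := by simp [sgn]

lemma sgn_mul_self (n : ℤ) : sgn n * sgn n = 1 := by
  unfold sgn
  rw [← mul_zpow]; simp

lemma sgn_neg (n : ℤ) : sgn (-n) = sgn n := by
  unfold sgn
  rw [zpow_neg, ← inv_zpow]; norm_num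

/-- A `ℤ`-graded differential graded category over `ℂ` with set of objects `O`
(cohomological grading). The target degree of the differential and of a composition is an explicit
argument together with a proof that it is the right one. A graded linear category is a dg category
whose differential vanishes. -/
structure DGCat (O : Type) where
  hom : O → O → ℤ → Type
  [addCommGroup : ∀ X Y n, AddCommGroup (hom X Y n)]
  [module : ∀ X Y n, Module ℂ (hom X Y n)]
  /-- the differential, of degree one -/
  d : ∀ {X Y : O} {n k : ℤ}, n + 1 = k → hom X Y n →ₗ[ℂ] hom X Y k
  /-- composition, `comp _ g f = g ∘ f` -/
  comp : ∀ {X Y Z : O} {m n k : ℤ}, m + n = k → hom Y Z m →ₗ[ℂ] hom X Y n →ₗ[ℂ] hom X Z k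
  /-- identities -/
  one : ∀ X : O, hom X X 0
  d_d : ∀ {X Y : O} {n k l : ℤ} (h : n + 1 = k) (h' : k + 1 = l) (f : hom X Y n),
    d h' (d h f) = 0
  leibniz : ∀ {X Y Z : O} {m n k m' n' l : ℤ} (h : m + n = k) (hl : k + 1 = l)
    (hm : m + 1 = m') (hn : n + 1 = n') (h₁ : m' + n = l) (h₂ : m + n' = l)
    (g : hom Y Z m) (f : hom X Y n),
    d hl (comp h g f) = comp h₁ (d hm g) f + sgn m • comp h₂ g (d hn f)
  assoc : ∀ {X Y Z T : O} {a b c ab bc abc : ℤ} (h₁ : a + b = ab) (h₂ : ab + c = abc)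
    (h₃ : b + c = bc) (h₄ : a + bc = abc) (h : hom Z T a) (g : hom Y Z b) (f : hom X Y c),
    comp h₂ (comp h₁ h g) f = comp h₄ h (comp h₃ g f)
  one_comp : ∀ {X Y : O} {n : ℤ} (h : 0 + n = n) (f : hom X Y n), comp h (one Y) f = f
  comp_one : ∀ {X Y : O} {n : ℤ} (h : n + 0 = n) (f : hom X Y n), comp h f (one X) = f

namespace DGCat

attribute [instance] DGCat.addCommGroup DGCat.module

variable {O : Type}

/-- The full dg subcategory on a family of objects. -/
def full {O' : Type} (A : DGCat O) (F : O' → O) : DGCat O' where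
  hom X Y n := A.hom (F X) (F Y) n
  d h := A.d h
  comp h := A.comp h
  one X := A.one (F X)
  d_d h h' f := A.d_d h h' f
  leibniz h hl hm hn h₁ h₂ g f := A.leibniz h hl hm hn h₁ h₂ g f
  assoc h₁ h₂ h₃ h₄ h g f := A.assoc h₁ h₂ h₃ h₄ h g f
  one_comp h f := A.one_comp h f
  comp_one h f := A.comp_one h f

/-- The identity of a dg category is closed. -/
lemma d_one (A : DGCat O) (X : O) {k : ℤ} (h : 0 + 1 = k) : A.d h (A.one X) = 0 := by
  have h1 := A.leibniz (zero_add 0) h h h (by omega) (by omega) (A.one X) (A.one X)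
  rw [A.one_comp] at h1
  subst h
  have e : ∀ (a b : ℤ) (ha : 0 + b = a) (hb : b = a) (f : A.hom X X b), hb ▸ f = A.comp ha (A.one X) f := by
    intro a b ha hb f
    subst hb
    rw [A.one_comp]
  have e' : ∀ (a b : ℤ) (ha : b + 0 = a) (hb : b = a) (f : A.hom X X b), hb ▸ f = A.comp ha f (A.one X) := by
    intro a b ha hb f
    subst hb
    rw [A.comp_one]
  rw [← e _ _ _ rfl, ← e' _ _ _ rfl, sgn_zero, one_smul] at h1
  simpa using h1

/-- Closed morphisms of degree `n`. -/
def Z (A : DGCat O) (X Y : O) (n : ℤ) : Submodule ℂ (A.hom X Y n) :=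
  LinearMap.ker (A.d (rfl : n + 1 = n + 1))

/-- Exact morphisms of degree `n`. -/
def B (A : DGCat O) (X Y : O) (n : ℤ) : Submodule ℂ (A.hom X Y n) :=
  LinearMap.range (A.d (sub_add_cancel n 1) : A.hom X Y (n - 1) →ₗ[ℂ] A.hom X Y n)

/-- The cohomology `H^n(hom(X, Y))`, closed morphisms modulo exact ones. -/
abbrev H (A : DGCat O) (X Y : O) (n : ℤ) : Type :=
  A.Z X Y n ⧸ (A.B X Y n).submoduleOf (A.Z X Y n)

lemma mem_Z {A : DGCat O} {X Y : O} {n k : ℤ} (h : n + 1 = k) {f : A.hom X Y n} :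
    f ∈ A.Z X Y n ↔ A.d h f = 0 := by
  subst h; rfl

lemma mem_B {A : DGCat O} {X Y : O} {n k : ℤ} (h : k + 1 = n) {f : A.hom X Y n} :
    f ∈ A.B X Y n ↔ ∃ g : A.hom X Y k, A.d h g = f := by
  obtain rfl : k = n - 1 := by omega
  rfl

lemma comp_mem_Z {A : DGCat O} {X Y W : O} {m n k : ℤ} (h : m + n = k) {g : A.hom Y W m}
    {f : A.hom X Y n} (hg : g ∈ A.Z Y W m) (hf : f ∈ A.Z X Y n) :
    A.comp h g f ∈ A.Z X W k := by
  rw [mem_Z rfl, A.leibniz h rfl rfl rfl (by omega) (by omega), (mem_Z rfl).1 hg,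
    (mem_Z rfl).1 hf]
  simp

lemma comp_mem_B_left {A : DGCat O} {X Y W : O} {m n k : ℤ} (h : m + n = k) {g : A.hom Y W m}
    {f : A.hom X Y n} (hg : g ∈ A.B Y W m) (hf : f ∈ A.Z X Y n) :
    A.comp h g f ∈ A.B X W k := by
  obtain ⟨g', rfl⟩ := (mem_B (sub_add_cancel m 1)).1 hg
  rw [mem_B (k := m - 1 + n) (by omega)]
  refine ⟨A.comp rfl g' f, ?_⟩
  rw [A.leibniz rfl _ (sub_add_cancel m 1) rfl h (by omega), (mem_Z rfl).1 hf]
  simp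

lemma comp_mem_B_right {A : DGCat O} {X Y W : O} {m n k : ℤ} (h : m + n = k) {g : A.hom Y W m}
    {f : A.hom X Y n} (hg : g ∈ A.Z Y W m) (hf : f ∈ A.B X Y n) :
    A.comp h g f ∈ A.B X W k := by
  obtain ⟨f', rfl⟩ := (mem_B (sub_add_cancel n 1)).1 hf
  rw [mem_B (k := m + (n - 1)) (by omega)]
  refine ⟨sgn m • A.comp rfl g f', ?_⟩
  rw [map_smul, A.leibniz rfl _ rfl (sub_add_cancel n 1) (by omega) h, (mem_Z rfl).1 hg]
  simp [smul_smul, sgn_mul_self]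

/-- The class of a composition of closed morphisms. -/
def Zcomp (A : DGCat O) {X Y W : O} {m n k : ℤ} (h : m + n = k) :
    A.Z Y W m →ₗ[ℂ] A.Z X Y n →ₗ[ℂ] A.H X W k :=
  LinearMap.mk₂ ℂ
    (fun (g : A.Z Y W m) (f : A.Z X Y n) =>
      (Submodule.Quotient.mk ⟨A.comp h g.1 f.1, comp_mem_Z h g.2 f.2⟩ : A.H X W k))
    (fun g g' f => by
      rw [← Submodule.Quotient.mk_add]; congr 1; ext; simp)
    (fun c g f => by
      rw [← Submodule.Quotient.mk_smul]; congr 1; ext; simp)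
    (fun g f f' => by
      rw [← Submodule.Quotient.mk_add]; congr 1; ext; simp)
    (fun c g f => by
      rw [← Submodule.Quotient.mk_smul]; congr 1; ext; simp)

/-- Composition of cohomology classes. -/
def Hcomp (A : DGCat O) {X Y W : O} {m n k : ℤ} (h : m + n = k) :
    A.H Y W m →ₗ[ℂ] A.H X Y n →ₗ[ℂ] A.H X W k :=
  (Submodule.liftQ _
    (Submodule.liftQ _ (A.Zcomp h) (by
      intro g hg
      rw [LinearMap.mem_ker]
      ext f
      exact (Submodule.Quotient.mk_eq_zero _).2 (comp_mem_B_left h hg f.2))).flip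
    (by
      intro f hf
      rw [LinearMap.mem_ker]
      ext g
      exact (Submodule.Quotient.mk_eq_zero _).2 (comp_mem_B_right h g.2 hf))).flip

lemma Hcomp_mk (A : DGCat O) {X Y W : O} {m n k : ℤ} (h : m + n = k) (g : A.Z Y W m)
    (f : A.Z X Y n) :
    A.Hcomp h (Submodule.Quotient.mk g) (Submodule.Quotient.mk f) =
      Submodule.Quotient.mk ⟨A.comp h g.1 f.1, comp_mem_Z h g.2 f.2⟩ := rfl

/-- The cohomology category `H(A)`: the graded linear category with morphism spaces
`H^n(hom(X, Y))`. -/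
def cohomology (A : DGCat O) : DGCat O where
  hom X Y n := A.H X Y n
  d _ := 0
  comp h := A.Hcomp h
  one X := Submodule.Quotient.mk ⟨A.one X, (mem_Z rfl).2 (A.d_one X _)⟩
  d_d _ _ _ := rfl
  leibniz := by intros; simp
  assoc h₁ h₂ h₃ h₄ h g f := by
    obtain ⟨h, rfl⟩ := Submodule.Quotient.mk_surjective _ h
    obtain ⟨g, rfl⟩ := Submodule.Quotient.mk_surjective _ g
    obtain ⟨f, rfl⟩ := Submodule.Quotient.mk_surjective _ f
    simp only [Hcomp_mk]
    congr 1
    ext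
    exact A.assoc h₁ h₂ h₃ h₄ _ _ _
  one_comp h f := by
    obtain ⟨f, rfl⟩ := Submodule.Quotient.mk_surjective _ f
    simp only [Hcomp_mk]
    congr 1
    ext
    exact A.one_comp h _
  comp_one h f := by
    obtain ⟨f, rfl⟩ := Submodule.Quotient.mk_surjective _ f
    simp only [Hcomp_mk]
    congr 1
    ext
    exact A.comp_one h _

/-! #### The total endomorphism algebra -/

/-- The degree `n` part `⨁_{X, Y} hom^n(X, Y)` of the total endomorphism algebra of a finite set
of objects. -/
def totalPart (A : DGCat O) (n : ℤ) : Type := ∀ X Y : O, A.hom X Y n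

instance (A : DGCat O) (n : ℤ) : AddCommGroup (A.totalPart n) :=
  inferInstanceAs (AddCommGroup (∀ X Y : O, A.hom X Y n))

instance (A : DGCat O) (n : ℤ) : Module ℂ (A.totalPart n) :=
  inferInstanceAs (Module ℂ (∀ X Y : O, A.hom X Y n))

open Classical in
/-- The identity of the object `X`, as an element of the total endomorphism algebra. -/
def totalIdem (A : DGCat O) (X : O) : A.totalPart 0 :=
  fun Y Z => if h : X = Y ∧ X = Z then h.1 ▸ h.2 ▸ A.one X else 0

section
variable [Fintype O]

/-- Multiplication in the total endomorphism algebra: composition of morphisms where they are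
composable, and zero otherwise. -/
def totalMul (A : DGCat O) {m n k : ℤ} (h : m + n = k) :
    A.totalPart m →ₗ[ℂ] A.totalPart n →ₗ[ℂ] A.totalPart k :=
  LinearMap.mk₂ ℂ (fun g f X Z => ∑ Y : O, A.comp h (g Y Z) (f X Y))
    (fun g g' f => by
      funext X Z
      change ∑ Y : O, A.comp h (g Y Z + g' Y Z) (f X Y) = (∑ Y : O, _) + ∑ Y : O, _
      simp [Finset.sum_add_distrib])
    (fun c g f => by
      funext X Z
      change ∑ Y : O, A.comp h (c • g Y Z) (f X Y) = c • ∑ Y : O, _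
      simp [Finset.smul_sum])
    (fun g f f' => by
      funext X Z
      change ∑ Y : O, A.comp h (g Y Z) (f X Y + f' X Y) = (∑ Y : O, _) + ∑ Y : O, _
      simp [Finset.sum_add_distrib])
    (fun c g f => by
      funext X Z
      change ∑ Y : O, A.comp h (g Y Z) (c • f X Y) = c • ∑ Y : O, _
      simp [Finset.smul_sum])

lemma totalMul_apply (A : DGCat O) {m n k : ℤ} (h : m + n = k) (g : A.totalPart m)
    (f : A.totalPart n) (X Z : O) :
    A.totalMul h g f X Z = ∑ Y : O, A.comp h (g Y Z) (f X Y) := rfl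

/-- The unit of the total endomorphism algebra, the sum of all identities. -/
def totalOne (A : DGCat O) : A.totalPart 0 := ∑ X : O, A.totalIdem X

lemma totalOne_apply (A : DGCat O) (X Y : O) : A.totalOne X Y = A.totalIdem X X Y := by
  have : A.totalOne X Y = ∑ T : O, A.totalIdem T X Y := by
    unfold totalOne
    have h1 : ∀ s : Finset O, (∑ T ∈ s, A.totalIdem T) X Y = ∑ T ∈ s, A.totalIdem T X Y := by
      classical
      intro s
      induction s using Finset.induction_on with
      | empty => rfl
      | insert T s hT ih => rw [Finset.sum_insert hT, Finset.sum_insert hT, ← ih]; rfl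
    exact h1 _
  rw [this]
  refine Finset.sum_eq_single X (fun T _ hT => ?_) (by simp)
  unfold totalIdem
  exact dif_neg fun h => hT h.1

lemma totalOne_self (A : DGCat O) (X : O) : A.totalOne X X = A.one X := by
  rw [totalOne_apply]
  unfold totalIdem
  exact dif_pos ⟨rfl, rfl⟩

lemma totalOne_ne (A : DGCat O) {X Y : O} (h : X ≠ Y) : A.totalOne X Y = 0 := by
  rw [totalOne_apply]
  unfold totalIdem
  exact dif_neg fun h' => h h'.2

lemma totalOne_mul (A : DGCat O) {n : ℤ} (h : 0 + n = n) (f : A.totalPart n) :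
    A.totalMul h A.totalOne f = f := by
  funext X Z
  rw [totalMul_apply, Finset.sum_eq_single Z]
  · rw [totalOne_self, A.one_comp]
  · intro Y _ hY
    rw [totalOne_ne A hY]; simp
  · simp

lemma totalMul_one (A : DGCat O) {n : ℤ} (h : n + 0 = n) (f : A.totalPart n) :
    A.totalMul h f A.totalOne = f := by
  funext X Z
  rw [totalMul_apply, Finset.sum_eq_single X]
  · rw [totalOne_self, A.comp_one]
  · intro Y _ hY
    rw [totalOne_ne A hY.symm]; simp
  · simp

lemma totalMul_assoc (A : DGCat O) {a b c ab bc abc : ℤ} (h₁ : a + b = ab) (h₂ : ab + c = abc)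
    (h₃ : b + c = bc) (h₄ : a + bc = abc) (h : A.totalPart a) (g : A.totalPart b)
    (f : A.totalPart c) :
    A.totalMul h₂ (A.totalMul h₁ h g) f = A.totalMul h₄ h (A.totalMul h₃ g f) := by
  funext X T
  simp only [totalMul_apply, map_sum, LinearMap.sum_apply]
  rw [Finset.sum_comm]
  refine Finset.sum_congr rfl fun Y _ => Finset.sum_congr rfl fun Z _ => ?_
  exact A.assoc h₁ h₂ h₃ h₄ _ _ _

lemma totalMk_eq (A : DGCat O) {a b k k' : ℤ} (h : a + b = k) (h' : a + b = k')
    (g : A.totalPart a) (f : A.totalPart b) :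
    GradedMonoid.mk (A := A.totalPart) k (A.totalMul h g f) =
      GradedMonoid.mk k' (A.totalMul h' g f) := by
  subst h; subst h'; rfl

instance (A : DGCat O) : GradedMonoid.GMul A.totalPart where
  mul g f := A.totalMul rfl g f

instance (A : DGCat O) : GradedMonoid.GOne A.totalPart where
  one := A.totalOne

instance (A : DGCat O) : GradedMonoid.GMonoid A.totalPart where
  one_mul a := by
    change GradedMonoid.mk _ (A.totalMul rfl A.totalOne a.2) = a
    rw [totalMk_eq A rfl (zero_add a.1), totalOne_mul]; rfl
  mul_one a := by
    change GradedMonoid.mk _ (A.totalMul rfl a.2 A.totalOne) = a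
    rw [totalMk_eq A rfl (add_zero a.1), totalMul_one]; rfl
  mul_assoc a b c := by
    change GradedMonoid.mk _ (A.totalMul rfl (A.totalMul rfl a.2 b.2) c.2) =
      GradedMonoid.mk _ (A.totalMul rfl a.2 (A.totalMul rfl b.2 c.2))
    rw [totalMk_eq A rfl (add_assoc a.1 b.1 c.1), totalMul_assoc A rfl _ rfl rfl]

instance (A : DGCat O) : DirectSum.GRing A.totalPart where
  mul_zero g := map_zero (A.totalMul rfl g)
  zero_mul f := by
    change A.totalMul rfl 0 f = 0
    simp
  mul_add g f f' := map_add (A.totalMul rfl g) f f'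
  add_mul g g' f := by
    change A.totalMul rfl (g + g') f = A.totalMul rfl g f + A.totalMul rfl g' f
    simp
  natCast n := n • A.totalOne
  natCast_zero := zero_smul _ _
  natCast_succ n := by rw [add_smul, one_smul]; rfl
  intCast n := n • A.totalOne
  intCast_ofNat n := natCast_zsmul _ _
  intCast_negSucc_ofNat n := by rw [Int.negSucc_eq, neg_smul, ← natCast_zsmul]; norm_num

instance (A : DGCat O) : DirectSum.GAlgebra ℂ A.totalPart where
  toFun := (LinearMap.toSpanSingleton ℂ (A.totalPart 0) A.totalOne : ℂ →+ A.totalPart 0)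
  map_one := one_smul ℂ A.totalOne
  map_mul r s := by
    change GradedMonoid.mk _ ((r * s) • A.totalOne) =
      GradedMonoid.mk _ (A.totalMul rfl (r • A.totalOne) (s • A.totalOne))
    rw [totalMk_eq A rfl (zero_add 0), map_smul, map_smul, LinearMap.smul_apply, totalOne_mul,
      smul_smul, mul_comm]
  commutes r x := by
    change GradedMonoid.mk _ (A.totalMul rfl (r • A.totalOne) x.2) =
      GradedMonoid.mk _ (A.totalMul rfl x.2 (r • A.totalOne))
    rw [totalMk_eq A rfl (zero_add x.1), totalMk_eq A rfl (add_zero x.1), map_smul, map_smul,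
      LinearMap.smul_apply, totalOne_mul, totalMul_one]
  smul_def r x := by
    change GradedMonoid.mk _ (r • x.2) = GradedMonoid.mk _ (A.totalMul rfl (r • A.totalOne) x.2)
    rw [totalMk_eq A rfl (zero_add x.1), map_smul, LinearMap.smul_apply, totalOne_mul]

/-- The total endomorphism algebra `⨁_n ⨁_{X, Y} hom^n(X, Y)` of a finite set of objects, a
`ℤ`-graded `ℂ`-algebra. -/
abbrev TotalEnd (A : DGCat O) : Type := ⨁ n : ℤ, A.totalPart n

end

end DGCat

/-! ### `A_∞`-categories over `ℂ` -/

/-- Composable strings `(a_d, …, a_1)` of homogeneous morphisms `X = X_0 → X_1 → ⋯ → X_d = Y` in a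
family of graded spaces; the leftmost morphism is applied last. -/
inductive AStr {O : Type} (M : O → O → ℤ → Type) (X : O) : O → Type
  | nil : AStr M X X
  | cons {Y Z : O} (n : ℤ) (a : M Y Z n) (s : AStr M X Y) : AStr M X Z

namespace AStr

variable {O : Type} {M : O → O → ℤ → Type}

/-- The length `d` of a string. -/
def len {X : O} : ∀ {Y : O}, AStr M X Y → ℕ
  | _, nil => 0
  | _, cons _ _ s => s.len + 1

/-- The total degree `|a_1| + ⋯ + |a_d|`. -/
def deg {X : O} : ∀ {Y : O}, AStr M X Y → ℤ
  | _, nil => 0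
  | _, cons n _ s => n + s.deg

/-- Concatenation of strings. -/
def append {X Y : O} : ∀ {Z : O}, AStr M Y Z → AStr M X Y → AStr M X Z
  | _, nil, t => t
  | _, cons n a s, t => cons n a (s.append t)

/-- All ways to write a string as a concatenation of two (possibly empty) strings. -/
def splits {X : O} : ∀ {Z : O}, AStr M X Z → List (Σ Y : O, AStr M Y Z × AStr M X Y)
  | _, nil => [⟨X, nil, nil⟩]
  | Z, cons n a s =>
      ⟨Z, nil, cons n a s⟩ :: s.splits.map fun t => ⟨t.1, cons n a t.2.1, t.2.2⟩

lemma len_append {X Y Z : O} (s : AStr M Y Z) (t : AStr M X Y) :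
    (s.append t).len = s.len + t.len := by
  induction s with
  | nil => simp [append, len]
  | cons n a s ih => simp [append, len, ih]; omega

lemma deg_append {X Y Z : O} (s : AStr M Y Z) (t : AStr M X Y) :
    (s.append t).deg = s.deg + t.deg := by
  induction s with
  | nil => simp [append, deg]
  | cons n a s ih => simp [append, deg, ih]; ring

lemma len_of_mem_splits {X Z : O} (s : AStr M X Z) :
    ∀ t ∈ s.splits, t.2.1.len + t.2.2.len = s.len := by
  induction s with
  | nil => simp [splits, len]
  | cons n a s ih =>
    intro t ht
    simp only [splits, List.mem_cons, List.mem_map] at ht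
    rcases ht with rfl | ⟨t', ht', rfl⟩
    · simp [len]
    · have := ih t' ht'
      simp [len]; omega

end AStr

/-- A family of operations `F(a_d, …, a_1)` on composable strings of homogeneous morphisms, with
values in a family of graded spaces; `F s k` is the degree `k` component of the value. The value on
the empty string vanishes, the operation with `d` inputs is multilinear and has degree `c - d`. -/
structure IsMultilinearOp {O : Type} {M N : O → O → ℤ → Type}
    [∀ X Y n, AddCommGroup (M X Y n)] [∀ X Y n, Module ℂ (M X Y n)]
    [∀ X Y n, AddCommGroup (N X Y n)] [∀ X Y n, Module ℂ (N X Y n)] (c : ℤ)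
    (F : ∀ {X Y : O}, AStr M X Y → ∀ k : ℤ, N X Y k) : Prop where
  map_nil : ∀ (X : O) (k : ℤ), F (AStr.nil : AStr M X X) k = 0
  degree : ∀ {X Y : O} (s : AStr M X Y) (k : ℤ), k ≠ s.deg + c - s.len → F s k = 0
  map_add : ∀ {X Y Z W : O} (u : AStr M Z W) (n : ℤ) (a b : M Y Z n) (v : AStr M X Y) (k : ℤ),
    F (u.append (.cons n (a + b) v)) k =
      F (u.append (.cons n a v)) k + F (u.append (.cons n b v)) k
  map_smul : ∀ {X Y Z W : O} (u : AStr M Z W) (n : ℤ) (r : ℂ) (a : M Y Z n) (v : AStr M X Y)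
    (k : ℤ), F (u.append (.cons n (r • a) v)) k = r • F (u.append (.cons n a v)) k

/-- For operations `μ` on `M` of degree `2 - m` and `F` from `M` to `N`, the degree `k` component of
`∑_{m, n} (-1)^{|a_1| + ⋯ + |a_n| - n} F(a_d, …, a_{n+m+1}, μ(a_{n+m}, …, a_{n+1}), a_n, …, a_1)`. -/
def insertionSum {O : Type} {M N : O → O → ℤ → Type}
    [∀ X Y n, AddCommGroup (N X Y n)] [∀ X Y n, Module ℂ (N X Y n)]
    (μ : ∀ {X Y : O}, AStr M X Y → ∀ k : ℤ, M X Y k)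
    (F : ∀ {X Y : O}, AStr M X Y → ∀ k : ℤ, N X Y k)
    {X Y : O} (s : AStr M X Y) (k : ℤ) : N X Y k :=
  (s.splits.map fun t => (t.2.2.splits.map fun t' =>
    sgn (t'.2.2.deg - t'.2.2.len) •
      F (t.2.1.append (.cons (t'.2.1.deg + 2 - t'.2.1.len)
        (μ t'.2.1 (t'.2.1.deg + 2 - t'.2.1.len)) t'.2.2)) k).sum).sum

/-- A (non-curved, `ℤ`-graded) `A_∞`-category over `ℂ` with set of objects `O`. The operation
`μ (a_d, …, a_1)` has degree `2 - d`, and the `A_∞`-associativity equations are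
`∑_{m, n} (-1)^{|a_1| + ⋯ + |a_n| - n} μ(a_d, …, μ(a_{n+m}, …, a_{n+1}), a_n, …, a_1) = 0`. -/
structure AInfCat (O : Type) where
  hom : O → O → ℤ → Type
  [addCommGroup : ∀ X Y n, AddCommGroup (hom X Y n)]
  [module : ∀ X Y n, Module ℂ (hom X Y n)]
  μ : ∀ {X Y : O}, AStr hom X Y → ∀ k : ℤ, hom X Y k
  multilinear : IsMultilinearOp 2 μ
  relation : ∀ {X Y : O} (s : AStr hom X Y) (k : ℤ), insertionSum μ μ s k = 0

namespace AInfCat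

attribute [instance] AInfCat.addCommGroup AInfCat.module

variable {O : Type}

/-- The differential `μ^1`, from degree `n` to degree `k`; it is zero unless `k = n + 1`. -/
def d (A : AInfCat O) {X Y : O} (n k : ℤ) : A.hom X Y n →ₗ[ℂ] A.hom X Y k where
  toFun a := A.μ (.cons n a .nil) k
  map_add' a b := A.multilinear.map_add .nil n a b .nil k
  map_smul' r a := A.multilinear.map_smul .nil n r a .nil k

/-- The operation `μ^2(b, a)`, with values in degree `k`; it is zero unless `k = m + n`. -/
def m₂ (A : AInfCat O) {X Y Z : O} {m n : ℤ} (b : A.hom Y Z m) (a : A.hom X Y n) (k : ℤ) :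
    A.hom X Z k :=
  A.μ (.cons m b (.cons n a .nil)) k

/-- Cocycles of degree `n`. -/
def Z (A : AInfCat O) (X Y : O) (n : ℤ) : Submodule ℂ (A.hom X Y n) :=
  LinearMap.ker (A.d n (n + 1))

/-- Coboundaries of degree `n`. -/
def B (A : AInfCat O) (X Y : O) (n : ℤ) : Submodule ℂ (A.hom X Y n) :=
  LinearMap.range (A.d (n - 1) n : A.hom X Y (n - 1) →ₗ[ℂ] A.hom X Y n)

/-- The cohomology `H^n(hom(X, Y))` with respect to `μ^1`. -/
abbrev H (A : AInfCat O) (X Y : O) (n : ℤ) : Type :=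
  A.Z X Y n ⧸ (A.B X Y n).submoduleOf (A.Z X Y n)

lemma μ_insert_zero (A : AInfCat O) {X Y Z W : O} (u : AStr A.hom Z W) (n : ℤ)
    (v : AStr A.hom X Y) (k : ℤ) : A.μ (u.append (.cons n (0 : A.hom Y Z n) v)) k = 0 := by
  have := A.multilinear.map_smul u n 0 0 v k
  simpa using this

lemma m₂_mem_Z (A : AInfCat O) {X Y W : O} {m n : ℤ} {b : A.hom Y W m} {a : A.hom X Y n}
    (hb : b ∈ A.Z Y W m) (ha : a ∈ A.Z X Y n) (k : ℤ) : A.m₂ b a k ∈ A.Z X W k := by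
  by_cases hk : k = m + n
  · have h := A.relation (.cons m b (.cons n a .nil)) (k + 1)
    have hb' : A.μ (.cons m b .nil) (m + 1) = 0 := hb
    have ha' : A.μ (.cons n a .nil) (n + 1) = 0 := ha
    have e1 := A.μ_insert_zero (Y := Y) (Z := W) .nil (m + 1) (.cons n a .nil) (k + 1)
    have e2 := A.μ_insert_zero (X := X) (Y := X) (Z := Y) (.cons m b .nil) (n + 1) .nil (k + 1)
    have e3 := fun (j : ℤ) => A.μ_insert_zero (Y := W) (Z := W) .nil j
      (.cons m b (.cons n a .nil)) (k + 1)
    have e4 := fun (j : ℤ) => A.μ_insert_zero (Y := Y) (Z := Y) (.cons m b .nil) j (.cons n a .nil) (k + 1)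
    have e5 := fun (j : ℤ) => A.μ_insert_zero (X := X) (Y := X) (Z := X) (.cons m b (.cons n a .nil)) j .nil (k + 1)
    simp only [AStr.append] at e1 e2 e3 e4 e5
    have r1 : m + 0 + 2 - ((0 + 1 : ℕ) : ℤ) = m + 1 := by push_cast; ring
    have r2 : n + 0 + 2 - ((0 + 1 : ℕ) : ℤ) = n + 1 := by push_cast; ring
    have r3 : m + (n + 0) + 2 - ((0 + 1 + 1 : ℕ) : ℤ) = k := by push_cast; rw [hk]; ring
    simp only [insertionSum, AStr.splits, List.map_cons, List.map_nil, List.sum_cons, List.sum_nil,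
      AStr.append, A.multilinear.map_nil, e3, e4, e5] at h
    dsimp only [AStr.deg, AStr.len] at h
    rw [r1, r2, r3, hb', ha', e1, e2] at h
    change A.μ (.cons k (A.μ (.cons m b (.cons n a .nil)) k) .nil) (k + 1) = 0
    simpa [sgn] using h
  · have : A.m₂ b a k = 0 := A.multilinear.degree _ _ (by
      simp only [AStr.deg, AStr.len]; push_cast; omega)
    rw [this]; exact zero_mem _

/-- An isomorphism of graded linear categories, identical on objects, from the cohomology
category `H(C)` of an `A_∞`-category to a graded linear category `A`. Composition in `H(C)` is
`[b] ∘ [a] = (-1)^{|a|} [μ^2(b, a)]`. -/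
structure CohomologyIso (C : AInfCat O) (A : DGCat O) where
  equiv : ∀ (X Y : O) (n : ℤ), C.H X Y n ≃ₗ[ℂ] A.hom X Y n
  map_comp : ∀ {X Y W : O} {m n k : ℤ} (h : m + n = k) (b : C.Z Y W m) (a : C.Z X Y n),
    equiv X W k (sgn n • Submodule.Quotient.mk ⟨C.m₂ b.1 a.1 k, C.m₂_mem_Z b.2 a.2 k⟩) =
      A.comp h (equiv Y W m (Submodule.Quotient.mk b)) (equiv X Y n (Submodule.Quotient.mk a))

end AInfCat

section Functors

variable {O : Type}

/-- For a family of operations `F` of degrees `1 - d`: all strings `(F(s_r), …, F(s_1))` obtained by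
writing the concatenation of `u` and `s` as a concatenation `s_r ⋯ s_1` of nonempty strings, where
`u` (nonempty) is an initial segment of `s_r`. -/
def blocksAux {M N : O → O → ℤ → Type} (F : ∀ {X Y : O}, AStr M X Y → ∀ k : ℤ, N X Y k) {X : O} :
    ∀ {Y Z : O}, AStr M Y Z → AStr M X Y → List (AStr N X Z)
  | _, _, u, .nil => [.cons (u.deg + 1 - u.len) (F u (u.deg + 1 - u.len)) .nil]
  | _, _, u, .cons n a s =>
      blocksAux F (u.append (.cons n a .nil)) s ++
        (blocksAux F (.cons n a .nil) s).map
          (AStr.cons (u.deg + 1 - u.len) (F u (u.deg + 1 - u.len)))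

/-- All strings `(F(s_r), …, F(s_1))` obtained by writing the string `s` as a concatenation
`s_r ⋯ s_1` of nonempty strings. -/
def blocks {M N : O → O → ℤ → Type} (F : ∀ {X Y : O}, AStr M X Y → ∀ k : ℤ, N X Y k) {X : O} :
    ∀ {Y : O}, AStr M X Y → List (AStr N X Y)
  | _, .nil => [.nil]
  | _, .cons n a s => blocksAux F (.cons n a .nil) s

/-- An `A_∞`-functor which is the identity on objects: multilinear maps `F(a_d, …, a_1)` of degree
`1 - d`, `d ≥ 1`, with
`∑ μ(F(a_d, …), …, F(…, a_1)) = ∑ (-1)^{|a_1| + ⋯ + |a_n| - n} F(a_d, …, μ(…), a_n, …, a_1)`. -/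
structure AInfFunctor (A B : AInfCat O) where
  F : ∀ {X Y : O}, AStr A.hom X Y → ∀ k : ℤ, B.hom X Y k
  multilinear : IsMultilinearOp 1 F
  relation : ∀ {X Y : O} (s : AStr A.hom X Y) (k : ℤ),
    ((blocks F s).map fun t => B.μ t k).sum = insertionSum A.μ F s k

/-- The first order part `F^1` of an `A_∞`-functor. -/
def AInfFunctor.F₁ {A B : AInfCat O} (G : AInfFunctor A B) {X Y : O} {n : ℤ} (a : A.hom X Y n) :
    B.hom X Y n :=
  G.F (.cons n a .nil) n

/-- `F^1` induces isomorphisms on cohomology. -/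
def AInfFunctor.IsQuasiIso {A B : AInfCat O} (G : AInfFunctor A B) : Prop :=
  ∀ (X Y : O) (n : ℤ),
    (∀ a ∈ A.Z X Y n, G.F₁ a ∈ B.B X Y n → a ∈ A.B X Y n) ∧
    (∀ b ∈ B.Z X Y n, ∃ a ∈ A.Z X Y n, G.F₁ a - b ∈ B.B X Y n)

/-- Quasi-isomorphism of `A_∞`-categories with a fixed set of objects: the equivalence relation
generated by the existence of an `A_∞`-quasi-isomorphism. -/
def QuasiIsomorphic : AInfCat O → AInfCat O → Prop :=
  Relation.EqvGen fun A B => ∃ G : AInfFunctor A B, G.IsQuasiIso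

end Functors

/-! #### Dg categories as `A_∞`-categories -/

namespace DGCat

variable {O : Type}

/-- The `A_∞`-operations of a dg category: `μ^1(a) = (-1)^{|a|} d a`,
`μ^2(b, a) = (-1)^{|a|} b ∘ a` and `μ^d = 0` for `d ≥ 3`. -/
def mu (A : DGCat O) {X : O} : ∀ {Y : O}, AStr A.hom X Y → ∀ k : ℤ, A.hom X Y k
  | _, .nil, _ => 0
  | _, .cons n a .nil, k => if h : n + 1 = k then sgn n • A.d h a else 0
  | _, .cons m b (.cons n a .nil), k => if h : m + n = k then sgn n • A.comp h b a else 0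
  | _, .cons _ _ (.cons _ _ (.cons _ _ _)), _ => 0

lemma mu_of_len (A : DGCat O) {X Y : O} (s : AStr A.hom X Y) (k : ℤ) (h : 3 ≤ s.len) :
    A.mu s k = 0 := by
  match s, h with
  | .cons _ _ (.cons _ _ (.cons _ _ _)), _ => rfl

lemma mu_one (A : DGCat O) {X Y : O} {n k : ℤ} (a : A.hom X Y n) (h : n + 1 = k) :
    A.mu (.cons n a .nil) k = sgn n • A.d h a := dif_pos h

lemma mu_two (A : DGCat O) {X Y Z : O} {m n k : ℤ} (b : A.hom Y Z m) (a : A.hom X Y n)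
    (h : m + n = k) :
    A.mu (.cons m b (.cons n a .nil)) k = sgn n • A.comp h b a := dif_pos h

lemma mu_multilinear (A : DGCat O) : IsMultilinearOp 2 A.mu where
  map_nil _ _ := rfl
  degree s k h := by
    match s, h with
    | .nil, _ => rfl
    | .cons n a .nil, h =>
      refine dif_neg ?_
      simp only [AStr.deg, AStr.len] at h; push_cast at h; omega
    | .cons m b (.cons n a .nil), h =>
      refine dif_neg ?_
      simp only [AStr.deg, AStr.len] at h; push_cast at h; omega
    | .cons _ _ (.cons _ _ (.cons _ _ _)), _ => rfl
  map_add u n a b v k := by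
    cases u with
    | nil =>
      cases v with
      | nil => simp only [AStr.append, mu]; split_ifs <;> simp
      | cons _ _ v =>
        cases v with
        | nil => simp only [AStr.append, mu]; split_ifs <;> simp
        | cons _ _ _ => simp [AStr.append, mu]
    | cons _ _ u =>
      cases u with
      | nil =>
        cases v with
        | nil => simp only [AStr.append, mu]; split_ifs <;> simp
        | cons _ _ _ => simp [AStr.append, mu]
      | cons _ _ u =>
        rw [mu_of_len, mu_of_len, mu_of_len, add_zero] <;>
          (rw [AStr.len_append]; simp [AStr.len]; omega)
  map_smul u n r a v k := by
    cases u with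
    | nil =>
      cases v with
      | nil => simp only [AStr.append, mu]; split_ifs <;> simp [smul_smul, mul_comm]
      | cons _ _ v =>
        cases v with
        | nil => simp only [AStr.append, mu]; split_ifs <;> simp [smul_smul, mul_comm]
        | cons _ _ _ => simp [AStr.append, mu]
    | cons _ _ u =>
      cases u with
      | nil =>
        cases v with
        | nil => simp only [AStr.append, mu]; split_ifs <;> simp [smul_smul, mul_comm]
        | cons _ _ _ => simp [AStr.append, mu]
      | cons _ _ u =>
        rw [mu_of_len, mu_of_len, smul_zero] <;>
          (rw [AStr.len_append]; simp [AStr.len]; omega)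

lemma mu_insert_zero (A : DGCat O) {X Y Z W : O} (u : AStr A.hom Z W) (n : ℤ)
    (v : AStr A.hom X Y) (k : ℤ) : A.mu (u.append (.cons n (0 : A.hom Y Z n) v)) k = 0 := by
  have := A.mu_multilinear.map_smul u n 0 0 v k
  simpa using this

lemma mu_relation_one (A : DGCat O) {X Y : O} (n : ℤ) (a : A.hom X Y n) (k : ℤ) :
    insertionSum A.mu A.mu (.cons n a .nil) k = 0 := by
  have e3 := fun (j : ℤ) => A.mu_insert_zero (Y := Y) (Z := Y) .nil j (.cons n a .nil) k
  have e4 := fun (j : ℤ) => A.mu_insert_zero (X := X) (Y := X) (Z := X) (.cons n a .nil) j .nil k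
  simp only [AStr.append] at e3 e4
  simp only [insertionSum, AStr.splits, List.map_cons, List.map_nil, List.sum_cons, List.sum_nil,
    AStr.append, A.mu_multilinear.map_nil, e3, e4]
  dsimp only [AStr.deg, AStr.len]
  rw [show n + 0 + 2 - ((0 + 1 : ℕ) : ℤ) = n + 1 by push_cast; ring, mu_one A a rfl]
  by_cases hk : n + 1 + 1 = k
  · rw [mu_one A _ hk]
    simp [A.d_d]
  · rw [A.mu_multilinear.degree _ _ (by
      simp only [AStr.deg, AStr.len]; push_cast; omega)]
    simp

lemma mu_relation_two (A : DGCat O) {X Y W : O} (m n : ℤ) (b : A.hom Y W m) (a : A.hom X Y n)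
    (k : ℤ) : insertionSum A.mu A.mu (.cons m b (.cons n a .nil)) k = 0 := by
  have e3 := fun (j : ℤ) => A.mu_insert_zero (Y := W) (Z := W) .nil j
    (.cons m b (.cons n a .nil)) k
  have e4 := fun (j : ℤ) => A.mu_insert_zero (Y := Y) (Z := Y) (.cons m b .nil) j
    (.cons n a .nil) k
  have e5 := fun (j : ℤ) => A.mu_insert_zero (X := X) (Y := X) (Z := X)
    (.cons m b (.cons n a .nil)) j .nil k
  simp only [AStr.append] at e3 e4 e5
  simp only [insertionSum, AStr.splits, List.map_cons, List.map_nil, List.sum_cons, List.sum_nil,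
    AStr.append, A.mu_multilinear.map_nil, e3, e4, e5]
  dsimp only [AStr.deg, AStr.len]
  rw [show m + 0 + 2 - ((0 + 1 : ℕ) : ℤ) = m + 1 by push_cast; ring,
    show n + 0 + 2 - ((0 + 1 : ℕ) : ℤ) = n + 1 by push_cast; ring,
    show m + (n + 0) + 2 - ((0 + 1 + 1 : ℕ) : ℤ) = m + n by push_cast; ring,
    mu_one A b rfl, mu_one A a rfl, mu_two A b a rfl]
  by_cases hk : m + n + 1 = k
  · rw [mu_one A _ hk, mu_two A _ _ (by omega : m + 1 + n = k),
      mu_two A _ _ (by omega : m + (n + 1) = k)]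
    have h := A.leibniz rfl hk rfl rfl (by omega : m + 1 + n = k) (by omega : m + (n + 1) = k) b a
    simp only [map_smul, LinearMap.smul_apply, smul_smul, smul_zero, add_zero, zero_add, h]
    have hn := sgn_mul_self n
    have hm := sgn_mul_self m
    rw [show sgn (0 - ((0 : ℕ) : ℤ)) = 1 by simp [sgn],
      show sgn (n - ((1 : ℕ) : ℤ)) = - sgn n by
        rw [show n - ((1 : ℕ) : ℤ) = n + -1 by push_cast; ring, sgn_add, sgn_neg, sgn_one]; ring,
      sgn_add, sgn_add, sgn_one]
    match_scalars
    · ring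
    · linear_combination (sgn n * sgn n) * hm
  · have z1 : ∀ x : A.hom X W (m + n), A.mu (.cons _ x .nil) k = 0 := fun x => dif_neg hk
    have z2 : ∀ (x : A.hom Y W (m + 1)), A.mu (.cons _ x (.cons n a .nil)) k = 0 :=
      fun x => dif_neg (by omega)
    have z3 : ∀ (x : A.hom X Y (n + 1)), A.mu (.cons m b (.cons _ x .nil)) k = 0 :=
      fun x => dif_neg (by omega)
    rw [z1, z2, z3]
    simp

lemma mu_relation_three (A : DGCat O) {X Y Z W : O} (l m n : ℤ) (c : A.hom Z W l)
    (b : A.hom Y Z m) (a : A.hom X Y n) (k : ℤ) :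
    insertionSum A.mu A.mu (.cons l c (.cons m b (.cons n a .nil))) k = 0 := by
  have z : ∀ {X₀ X₁ X₂ X₃ : O} {i j r : ℤ} (x : A.hom X₂ X₃ i) (y : A.hom X₁ X₂ j)
      (w : A.hom X₀ X₁ r) (s : AStr A.hom X X₀) (k : ℤ),
      A.mu (.cons i x (.cons j y (.cons r w s))) k = 0 := fun _ _ _ _ _ => rfl
  have e3 := fun (j : ℤ) => A.mu_insert_zero (X := X) (Y := X) (Z := W) .nil j .nil k
  simp only [AStr.append] at e3
  simp only [insertionSum, AStr.splits, List.map_cons, List.map_nil, List.sum_cons, List.sum_nil,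
    AStr.append, z, e3, smul_zero, add_zero, zero_add]
  dsimp only [AStr.deg, AStr.len]
  rw [show l + (m + 0) + 2 - ((0 + 1 + 1 : ℕ) : ℤ) = l + m by push_cast; ring,
    show m + (n + 0) + 2 - ((0 + 1 + 1 : ℕ) : ℤ) = m + n by push_cast; ring,
    mu_two A c b rfl, mu_two A b a rfl]
  by_cases hk : l + m + n = k
  · rw [mu_two A _ _ hk, mu_two A _ _ (by omega : l + (m + n) = k)]
    have h := A.assoc rfl hk rfl (by omega : l + (m + n) = k) c b a
    simp only [map_smul, LinearMap.smul_apply, h, smul_smul]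
    have hn := sgn_mul_self n
    rw [show sgn (0 - ((0 : ℕ) : ℤ)) = 1 by simp [sgn],
      show sgn (n + 0 - ((0 + 1 : ℕ) : ℤ)) = - sgn n by
        rw [show n + 0 - ((0 + 1 : ℕ) : ℤ) = n + -1 by push_cast; ring, sgn_add, sgn_neg,
          sgn_one]; ring, sgn_add]
    match_scalars
    ring
  · have z2 : ∀ (x : A.hom Y W (l + m)), A.mu (.cons _ x (.cons n a .nil)) k = 0 :=
      fun x => dif_neg hk
    have z3 : ∀ (x : A.hom X Z (m + n)), A.mu (.cons l c (.cons _ x .nil)) k = 0 :=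
      fun x => dif_neg (by omega)
    rw [z2, z3]
    simp

lemma mu_relation (A : DGCat O) {X Y : O} (s : AStr A.hom X Y) (k : ℤ) :
    insertionSum A.mu A.mu s k = 0 := by
  by_cases hs : 4 ≤ s.len
  · refine List.sum_eq_zero fun x hx => ?_
    obtain ⟨t, ht, rfl⟩ := List.mem_map.1 hx
    refine List.sum_eq_zero fun y hy => ?_
    obtain ⟨t', ht', rfl⟩ := List.mem_map.1 hy
    have h1 := AStr.len_of_mem_splits s t ht
    have h2 := AStr.len_of_mem_splits t.2.2 t' ht'
    by_cases h : 3 ≤ t'.2.1.len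
    · beta_reduce
      rw [A.mu_of_len t'.2.1 _ h, A.mu_insert_zero, smul_zero]
    · beta_reduce
      rw [A.mu_of_len, smul_zero]
      rw [AStr.len_append]
      simp only [AStr.len]
      omega
  · match s, hs with
    | .nil, _ =>
      have e := A.mu_insert_zero (X := X) (Y := X) (Z := X) .nil (0 + 2 - ((0 : ℕ) : ℤ)) .nil k
      simp only [insertionSum, AStr.splits, List.map_cons, List.map_nil, List.sum_cons,
        List.sum_nil, AStr.append, A.mu_multilinear.map_nil, AStr.deg, AStr.len] at e ⊢
      rw [e]; simp
    | .cons n a .nil, _ => exact A.mu_relation_one n a k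
    | .cons m b (.cons n a .nil), _ => exact A.mu_relation_two m n b a k
    | .cons l c (.cons m b (.cons n a .nil)), _ => exact A.mu_relation_three l m n c b a k
    | .cons _ _ (.cons _ _ (.cons _ _ (.cons _ _ _))), hs =>
      exact absurd (by simp [AStr.len]) hs

/-- A dg category as an `A_∞`-category. -/
def toAInf (A : DGCat O) : AInfCat O where
  hom := A.hom
  μ := A.mu
  multilinear := A.mu_multilinear
  relation := A.mu_relation

/-- A graded linear category `A` (a dg category without differential) is intrinsically formal if
every `A_∞`-category with cohomology category isomorphic to `A` is quasi-isomorphic to `A`. -/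
def IntrinsicallyFormal (A : DGCat O) : Prop :=
  ∀ C : AInfCat O, Nonempty (C.CohomologyIso A) → QuasiIsomorphic C A.toAInf

end DGCat

/-! ### Graded matrix factorisations -/

section MatrixFactorisations

open MvPolynomial Matrix

variable {L : Type} [AddCommGroup L]

/-- An `L`-graded matrix factorisation of `W ∈ S = ℂ[x, y]`, where `x` and `y` have degrees `wt 0`
and `wt 1` and `W` has degree `c`: a sequence of maps `d i : K^i → K^{i+1}` of graded free
`S`-modules `K^i = ⨁_a S(deg i a)`, all of the same finite rank, with `d (i+1) ∘ d i = W` and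
`K[2] = K(c)`. Here `S(l)_j = S_{l+j}`, so that maps `S(l) → S(l')` of graded modules are
multiplications by elements of `S_{l' - l}`. -/
structure GradedMF (wt : Fin 2 → L) (W : MvPolynomial (Fin 2) ℂ) (c : L) where
  rk : ℕ
  deg : ℤ → Fin rk → L
  d : ℤ → Matrix (Fin rk) (Fin rk) (MvPolynomial (Fin 2) ℂ)
  deg_add_two : ∀ i a, deg (i + 2) a = deg i a + c
  d_add_two : ∀ i, d (i + 2) = d i
  homogeneous : ∀ i b a, IsWeightedHomogeneous wt (d i b a) (deg (i + 1) b - deg i a)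
  d_mul_d : ∀ i, d (i + 1) * d i = W • (1 : Matrix (Fin rk) (Fin rk) (MvPolynomial (Fin 2) ℂ))

namespace GradedMF

variable {wt : Fin 2 → L} {W : MvPolynomial (Fin 2) ℂ} {c : L}

/-- The twist `K(l)` of the internal grading. -/
def twist (K : GradedMF wt W c) (l : L) : GradedMF wt W c where
  rk := K.rk
  deg i a := K.deg i a + l
  d := K.d
  deg_add_two i a := by rw [K.deg_add_two]; abel
  d_add_two := K.d_add_two
  homogeneous i b a := by
    rw [add_sub_add_right_eq_sub]; exact K.homogeneous i b a
  d_mul_d := K.d_mul_d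

/-- The cohomological shift `K[s]`, with differential multiplied by `(-1)^s`. -/
def shift (K : GradedMF wt W c) (s : ℤ) : GradedMF wt W c where
  rk := K.rk
  deg i a := K.deg (i + s) a
  d i := sgn s • K.d (i + s)
  deg_add_two i a := by rw [← K.deg_add_two, add_right_comm]
  d_add_two i := by rw [← K.d_add_two (i + s), add_right_comm]
  homogeneous i b a := by
    rw [add_right_comm]
    exact (weightedHomogeneousSubmodule ℂ wt _).smul_mem _ (K.homogeneous (i + s) b a)
  d_mul_d i := by
    rw [smul_mul_smul_comm, sgn_mul_self, one_smul, add_right_comm]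
    exact K.d_mul_d (i + s)

/-- The matrix factorisation `⋯ → K^{-2} → K^{-1} → K^0 → ⋯` with `K^{-2} = ⨁_a S(e a)`,
`K^{-1} = ⨁_b S(o b)`, and with differentials `A : K^{-2} → K^{-1}` and
`B : K^{-1} → K^0 = K^{-2}(c)`, continued two-periodically. -/
def ofPair {r : ℕ} (e o : Fin r → L) (A B : Matrix (Fin r) (Fin r) (MvPolynomial (Fin 2) ℂ))
    (hA : ∀ b a, IsWeightedHomogeneous wt (A b a) (o b - e a))
    (hB : ∀ a b, IsWeightedHomogeneous wt (B a b) (e a + c - o b))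
    (hAB : A * B = W • (1 : Matrix (Fin r) (Fin r) (MvPolynomial (Fin 2) ℂ)))
    (hBA : B * A = W • (1 : Matrix (Fin r) (Fin r) (MvPolynomial (Fin 2) ℂ))) :
    GradedMF wt W c where
  rk := r
  deg i a := (if Even i then e a else o a) + ((i + 2) / 2) • c
  d i := if Even i then A else B
  deg_add_two i a := by
    rw [show (i + 2 + 2) / 2 = (i + 2) / 2 + 1 by omega, add_smul, one_smul]
    simp only [Int.even_add, even_two, iff_true]
    abel
  d_add_two i := by simp only [Int.even_add, even_two, iff_true]
  homogeneous i b a := by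
    rcases Int.even_or_odd i with h | h
    · have h' : ¬ Even (i + 1) := by simpa [Int.even_add_one] using h
      rw [if_pos h, if_pos h, if_neg h']
      have e1 : (i + 1 + 2) / 2 = (i + 2) / 2 := by obtain ⟨k, rfl⟩ := h; omega
      rw [e1, add_sub_add_right_eq_sub]
      exact hA b a
    · have h0 : ¬ Even i := Int.not_even_iff_odd.2 h
      have h' : Even (i + 1) := h.add_one
      rw [if_neg h0, if_neg h0, if_pos h']
      have e1 : (i + 1 + 2) / 2 = (i + 2) / 2 + 1 := by obtain ⟨k, rfl⟩ := h; omega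
      rw [e1, add_smul, one_smul]
      convert hB b a using 1
      abel
  d_mul_d i := by
    rcases Int.even_or_odd i with h | h
    · have h' : ¬ Even (i + 1) := by simpa [Int.even_add_one] using h
      rw [if_pos h, if_neg h', hBA]
    · have h0 : ¬ Even i := Int.not_even_iff_odd.2 h
      have h' : Even (i + 1) := h.add_one
      rw [if_neg h0, if_pos h', hAB]

/-- Morphisms `K → K'` of degree `n`: families of maps of graded modules `K^i → K'^{i+n}`,
compatible with the two-periodicity. -/
def homSub (K K' : GradedMF wt W c) (n : ℤ) :
    Submodule ℂ (ℤ → Matrix (Fin K'.rk) (Fin K.rk) (MvPolynomial (Fin 2) ℂ)) where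
  carrier := {f | (∀ i b a, IsWeightedHomogeneous wt (f i b a) (K'.deg (i + n) b - K.deg i a)) ∧
    ∀ i, f (i + 2) = f i}
  add_mem' hf hg := ⟨fun i b a => (hf.1 i b a).add (hg.1 i b a), fun i =>
    congrArg₂ (· + ·) (hf.2 i) (hg.2 i)⟩
  zero_mem' := ⟨fun _ _ _ => isWeightedHomogeneous_zero _ _ _, fun _ => rfl⟩
  smul_mem' r _ hf := ⟨fun i b a =>
    (weightedHomogeneousSubmodule ℂ wt _).smul_mem r (hf.1 i b a), fun i =>
    congrArg (r • ·) (hf.2 i)⟩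

lemma homogeneous_mul {k l m : ℕ} {p : Fin k → L} {q : Fin l → L} {r : Fin m → L}
    {M : Matrix (Fin k) (Fin l) (MvPolynomial (Fin 2) ℂ)}
    {N : Matrix (Fin l) (Fin m) (MvPolynomial (Fin 2) ℂ)}
    (hM : ∀ b a, IsWeightedHomogeneous wt (M b a) (p b - q a))
    (hN : ∀ b a, IsWeightedHomogeneous wt (N b a) (q b - r a)) (b : Fin k) (a : Fin m) :
    IsWeightedHomogeneous wt ((M * N) b a) (p b - r a) := by
  rw [Matrix.mul_apply]
  refine IsWeightedHomogeneous.sum _ _ _ fun j _ => ?_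
  have := (hM b j).mul (hN j a)
  rwa [sub_add_sub_cancel] at this

/-- The differential on morphisms, `(δf)^i = d ∘ f^i - (-1)^n f^{i+1} ∘ d`. -/
def homD (K K' : GradedMF wt W c) {n k : ℤ} (h : n + 1 = k) :
    homSub K K' n →ₗ[ℂ] homSub K K' k where
  toFun f := ⟨fun i => K'.d (i + n) * f.1 i - sgn n • (f.1 (i + 1) * K.d i), by
    refine ⟨fun i b a => ?_, fun i => ?_⟩
    · refine IsWeightedHomogeneous.sub ?_ ?_
      · refine homogeneous_mul (p := K'.deg (i + k)) (q := K'.deg (i + n)) (r := K.deg i)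
          (fun b a => ?_) (f.2.1 i) b a
        rw [← h, ← add_assoc]; exact K'.homogeneous _ b a
      · refine (weightedHomogeneousSubmodule ℂ wt _).smul_mem _ ?_
        refine homogeneous_mul (p := K'.deg (i + k)) (q := K.deg (i + 1)) (r := K.deg i)
          (fun b a => ?_) (K.homogeneous i) b a
        rw [← h, add_comm n 1, ← add_assoc]; exact f.2.1 (i + 1) b a
    · beta_reduce
      rw [add_right_comm i 2 n, add_right_comm i 2 1, K'.d_add_two, K.d_add_two, f.2.2, f.2.2]⟩
  map_add' f g := by
    ext1; funext i
    change K'.d (i + n) * (f.1 i + g.1 i) - sgn n • ((f.1 (i + 1) + g.1 (i + 1)) * K.d i) =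
      (K'.d (i + n) * f.1 i - sgn n • (f.1 (i + 1) * K.d i)) +
        (K'.d (i + n) * g.1 i - sgn n • (g.1 (i + 1) * K.d i))
    rw [Matrix.mul_add, Matrix.add_mul, smul_add]; abel
  map_smul' r f := by
    ext1; funext i
    change K'.d (i + n) * (r • f.1 i) - sgn n • ((r • f.1 (i + 1)) * K.d i) =
      r • (K'.d (i + n) * f.1 i - sgn n • (f.1 (i + 1) * K.d i))
    rw [Matrix.mul_smul, Matrix.smul_mul, smul_sub, smul_comm r]

lemma homComp_mem {K K' K'' : GradedMF wt W c} {m n k : ℤ} (h : m + n = k)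
    {g : ℤ → Matrix (Fin K''.rk) (Fin K'.rk) (MvPolynomial (Fin 2) ℂ)} (hg : g ∈ homSub K' K'' m)
    {f : ℤ → Matrix (Fin K'.rk) (Fin K.rk) (MvPolynomial (Fin 2) ℂ)} (hf : f ∈ homSub K K' n) :
    (fun i => g (i + n) * f i) ∈ homSub K K'' k := by
  refine ⟨fun i b a => ?_, fun i => ?_⟩
  · refine homogeneous_mul (p := K''.deg (i + k)) (q := K'.deg (i + n)) (r := K.deg i)
      (fun b a => ?_) (hf.1 i) b a
    rw [← h, add_comm m n, ← add_assoc]; exact hg.1 _ b a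
  · beta_reduce
    rw [add_right_comm i 2 n, hg.2, hf.2]

/-- Composition of morphisms, `(g ∘ f)^i = g^{i+n} ∘ f^i` for `f` of degree `n`. -/
def homComp (K K' K'' : GradedMF wt W c) {m n k : ℤ} (h : m + n = k) :
    homSub K' K'' m →ₗ[ℂ] homSub K K' n →ₗ[ℂ] homSub K K'' k :=
  LinearMap.mk₂ ℂ
    (fun g f => (⟨fun i => g.1 (i + n) * f.1 i, homComp_mem h g.2 f.2⟩ : homSub K K'' k))
    (fun g g' f => Subtype.ext (funext fun i => Matrix.add_mul (g.1 (i + n)) (g'.1 (i + n)) (f.1 i)))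
    (fun r g f => Subtype.ext (funext fun i => Matrix.smul_mul r (g.1 (i + n)) (f.1 i)))
    (fun g f f' => Subtype.ext (funext fun i => Matrix.mul_add (g.1 (i + n)) (f.1 i) (f'.1 i)))
    (fun r g f => Subtype.ext (funext fun i => Matrix.mul_smul (g.1 (i + n)) r (f.1 i)))

lemma homD_apply (K K' : GradedMF wt W c) {n k : ℤ} (h : n + 1 = k) (f : homSub K K' n) (i : ℤ) :
    (homD K K' h f).1 i = K'.d (i + n) * f.1 i - sgn n • (f.1 (i + 1) * K.d i) := rfl

lemma homComp_apply (K K' K'' : GradedMF wt W c) {m n k : ℤ} (h : m + n = k)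
    (g : homSub K' K'' m) (f : homSub K K' n) (i : ℤ) :
    (homComp K K' K'' h g f).1 i = g.1 (i + n) * f.1 i := rfl

end GradedMF

open GradedMF in
/-- The dg category of `L`-graded matrix factorisations of `W`. -/
def mfCat (wt : Fin 2 → L) (W : MvPolynomial (Fin 2) ℂ) (c : L) : DGCat (GradedMF wt W c) where
  hom K K' n := homSub K K' n
  d h := homD _ _ h
  comp h := homComp _ _ _ h
  one K := ⟨fun _ => 1, fun i b a => by
    change IsWeightedHomogeneous wt ((1 : Matrix (Fin K.rk) (Fin K.rk) _) b a) _
    rcases eq_or_ne b a with rfl | hba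
    · rw [Matrix.one_apply_eq, add_zero, sub_self]
      exact isWeightedHomogeneous_one _ _
    · rw [Matrix.one_apply_ne hba]
      exact isWeightedHomogeneous_zero _ _ _, fun _ => rfl⟩
  d_d {K K' n k l} h h' f := by
    subst h; subst h'
    ext1; funext i
    rw [homD_apply, homD_apply, homD_apply, ← add_assoc i n 1, sgn_add, sgn_one,
      show i + 1 + n = i + n + 1 by ring]
    have e1 := K'.d_mul_d (i + n)
    have e2 := K.d_mul_d i
    have e3 := f.2.2 i
    rw [show i + 1 + 1 = i + 2 by ring, e3, Matrix.mul_sub, Matrix.sub_mul, smul_sub, ← Matrix.mul_assoc, e1,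
      Matrix.smul_mul, Matrix.smul_mul, Matrix.mul_smul, Matrix.mul_assoc (f.1 i), e2,
      smul_smul, Matrix.mul_assoc]
    have : sgn n * -1 * sgn n = -1 := by linear_combination - sgn_mul_self n
    rw [this]
    simp
    abel
  leibniz {K K' K'' m n k m' n' l} h hl hm hn h₁ h₂ g f := by
    subst h; subst hm; subst hn; subst hl
    ext1; funext i
    change _ = (homComp K K' K'' h₁ (homD K' K'' rfl g) f).1 i +
      sgn m • (homComp K K' K'' h₂ g (homD K K' rfl f)).1 i
    simp only [homD_apply, homComp_apply]
    rw [show i + (m + n) = i + n + m by ring, show i + (n + 1) = i + n + 1 by ring,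
      show i + 1 + n = i + n + 1 by ring]
    simp only [Matrix.sub_mul, Matrix.mul_sub, smul_sub, Matrix.smul_mul, Matrix.mul_smul, smul_smul,
      Matrix.mul_assoc, sgn_add]
    abel
  assoc {K K' K'' K''' a b c ab bc abc} h₁ h₂ h₃ h₄ h g f := by
    subst h₁; subst h₃
    ext1; funext i
    simp only [homComp_apply]
    rw [show i + (b + c) = i + c + b by ring, Matrix.mul_assoc]
  one_comp h f := by
    ext1; funext i
    exact Matrix.one_mul _
  comp_one h f := by
    ext1; funext i
    change f.1 (i + 0) * 1 = f.1 i
    rw [add_zero, Matrix.mul_one]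

end MatrixFactorisations

/-! ### The loop polynomial and its basic matrix factorisations -/

/-- The data of a loop polynomial `x^p y + y^q x` with `p, q ≥ 2`, a common divisor `ℓ` of `p - 1`
and `q - 1`, and a primitive `ℓ`-th root of unity `η`. -/
structure LoopDatum where
  p : ℕ
  q : ℕ
  l : ℕ
  η : ℂ
  hp : 2 ≤ p
  hq : 2 ≤ q
  hlp : l ∣ p - 1
  hlq : l ∣ q - 1
  hη : IsPrimitiveRoot η l

namespace LoopDatum

open MvPolynomial Matrix

variable (D : LoopDatum)

/-- The number `(p - 1) / ℓ`. -/
def m : ℕ := (D.p - 1) / D.l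

/-- The number `(q - 1) / ℓ`. -/
def n : ℕ := (D.q - 1) / D.l

lemma l_mul_m : D.l * D.m = D.p - 1 := Nat.mul_div_cancel' D.hlp

lemma l_mul_n : D.l * D.n = D.q - 1 := Nat.mul_div_cancel' D.hlq

lemma p_eq : D.p = D.l * D.m + 1 := by have := D.l_mul_m; have := D.hp; omega

lemma q_eq : D.q = D.l * D.n + 1 := by have := D.l_mul_n; have := D.hq; omega

lemma l_pos : 0 < D.l := by
  rcases Nat.eq_zero_or_pos D.l with h | h
  · have := D.l_mul_m; have := D.hp; rw [h] at *; omega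
  · exact h

lemma n_pos : 0 < D.n := by
  rcases Nat.eq_zero_or_pos D.n with h | h
  · have := D.l_mul_n; have := D.hq; rw [h] at *; omega
  · exact h

/-- The grading group `L`, generated by `x⃗` and `y⃗` with the relation
`((p - 1) / ℓ) x⃗ = ((q - 1) / ℓ) y⃗`. -/
abbrev L : Type := (ℤ × ℤ) ⧸ AddSubgroup.zmultiples ((D.m : ℤ), -(D.n : ℤ))

/-- The degree `x⃗` of `x`. -/
def xv : D.L := QuotientAddGroup.mk (1, 0)

/-- The degree `y⃗` of `y`. -/
def yv : D.L := QuotientAddGroup.mk (0, 1)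

/-- The degree `c⃗ = p x⃗ + y⃗` of the loop polynomial. -/
def cv : D.L := (D.p : ℤ) • D.xv + D.yv

/-- The degrees of the variables `x = X 0` and `y = X 1`. -/
def wt : Fin 2 → D.L := ![D.xv, D.yv]

lemma rel : (D.m : ℤ) • D.xv = (D.n : ℤ) • D.yv := by
  have h : ((D.m : ℤ) • ((1 : ℤ), (0 : ℤ)) - (D.n : ℤ) • ((0 : ℤ), (1 : ℤ))) ∈
      AddSubgroup.zmultiples ((D.m : ℤ), -(D.n : ℤ)) := by
    have e : ((D.m : ℤ) • ((1 : ℤ), (0 : ℤ)) - (D.n : ℤ) • ((0 : ℤ), (1 : ℤ))) =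
      ((D.m : ℤ), -(D.n : ℤ)) := by ext <;> simp
    rw [e]
    exact AddSubgroup.mem_zmultiples _
  have h2 := (QuotientAddGroup.eq_zero_iff _).2 h
  rw [← sub_eq_zero]
  exact h2

/-- The loop polynomial `x^p y + y^q x`. -/
def W : MvPolynomial (Fin 2) ℂ := X 0 ^ D.p * X 1 + X 1 ^ D.q * X 0

/-- The number `e^{πi/ℓ} η^r`. -/
def root (r : ℕ) : ℂ := Complex.exp (Real.pi * Complex.I / D.l) * D.η ^ r

/-- The factor `w_r = x^{(p-1)/ℓ} - e^{πi/ℓ} η^r y^{(q-1)/ℓ}` of the loop polynomial. -/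
def w (r : ℕ) : MvPolynomial (Fin 2) ℂ := X 0 ^ D.m - C (D.root r) * X 1 ^ D.n

lemma prod_sub_root {R : Type} [CommRing R] [IsDomain R] (f : ℂ →+* R) (hf : Function.Injective f)
    (a b : R) : ∏ r ∈ Finset.Icc 1 D.l, (a - f (D.root r) * b) = a ^ D.l + b ^ D.l := by
  have hη : IsPrimitiveRoot (f D.η) D.l := D.hη.map_of_injective hf
  have h := hη.pow_sub_pow_eq_prod_sub_mul a
    (f (Complex.exp (Real.pi * Complex.I / D.l)) * b) D.l_pos
  have hl : (D.l : ℂ) ≠ 0 := Nat.cast_ne_zero.2 D.l_pos.ne'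
  have hexp : f (Complex.exp (Real.pi * Complex.I / D.l)) ^ D.l = -1 := by
    rw [← map_pow, ← Complex.exp_nat_mul, mul_div_cancel₀ _ hl, Complex.exp_pi_mul_I]
    simp
  rw [mul_pow, hexp, neg_one_mul, sub_neg_eq_add] at h
  rw [h]
  refine Finset.prod_bij (fun r _ => f D.η ^ r) ?_ ?_ ?_ ?_
  · intro r _
    rw [Polynomial.mem_nthRootsFinset D.l_pos, ← pow_mul, mul_comm, pow_mul, hη.pow_eq_one, one_pow]
  · intro r hr s hs hrs
    rw [Finset.mem_Icc] at hr hs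
    have h1 : f D.η ^ (r - 1) = f D.η ^ (s - 1) := by
      have hne : f D.η ≠ 0 := hη.ne_zero D.l_pos.ne'
      have e1 : r = (r - 1) + 1 := by omega
      have e2 : s = (s - 1) + 1 := by omega
      rw [e1, e2, pow_succ, pow_succ] at hrs
      exact mul_right_cancel₀ hne hrs
    have := hη.pow_inj (by omega) (by omega) h1
    omega
  · intro ζ hζ
    rw [Polynomial.mem_nthRootsFinset D.l_pos] at hζ
    have : NeZero D.l := ⟨D.l_pos.ne'⟩
    obtain ⟨r, hr, rfl⟩ := hη.eq_pow_of_pow_eq_one hζ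
    rcases Nat.eq_zero_or_pos r with rfl | hr0
    · exact ⟨D.l, Finset.mem_Icc.2 ⟨D.l_pos, le_rfl⟩, by rw [hη.pow_eq_one, pow_zero]⟩
    · exact ⟨r, Finset.mem_Icc.2 ⟨hr0, hr.le⟩, rfl⟩
  · intro r _
    unfold root
    rw [map_mul, map_pow]; ring

lemma prod_w : ∏ r ∈ Finset.Icc 1 D.l, D.w r = X 0 ^ (D.p - 1) + X 1 ^ (D.q - 1) := by
  have := D.prod_sub_root (C : ℂ →+* MvPolynomial (Fin 2) ℂ) (C_injective _ _) (X 0 ^ D.m)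
    (X 1 ^ D.n)
  rw [← pow_mul, ← pow_mul, mul_comm D.m, mul_comm D.n, D.l_mul_m, D.l_mul_n] at this
  exact this

/-- The loop polynomial is `x y w_1 ⋯ w_ℓ`. -/
lemma W_eq : D.W = X 0 * X 1 * ∏ r ∈ Finset.Icc 1 D.l, D.w r := by
  rw [prod_w, W]
  have e1 : D.p = D.p - 1 + 1 := by have := D.hp; omega
  have e2 : D.q = D.q - 1 + 1 := by have := D.hq; omega
  conv_lhs => rw [e1, e2]
  ring

lemma homogeneous_X0 (a : ℕ) : IsWeightedHomogeneous D.wt (X 0 ^ a : MvPolynomial (Fin 2) ℂ)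
    ((a : ℤ) • D.xv) := by
  rw [natCast_zsmul]
  exact (isWeightedHomogeneous_X ℂ D.wt 0).pow a

lemma homogeneous_X1 (a : ℕ) : IsWeightedHomogeneous D.wt (X 1 ^ a : MvPolynomial (Fin 2) ℂ)
    ((a : ℤ) • D.yv) := by
  rw [natCast_zsmul]
  exact (isWeightedHomogeneous_X ℂ D.wt 1).pow a

lemma homogeneous_w (r : ℕ) : IsWeightedHomogeneous D.wt (D.w r) ((D.m : ℤ) • D.xv) := by
  refine (D.homogeneous_X0 D.m).sub ?_
  rw [D.rel]
  exact (D.homogeneous_X1 D.n).C_mul _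

lemma homogeneous_prod_w (s : Finset ℕ) : IsWeightedHomogeneous D.wt (∏ r ∈ s, D.w r)
    ((s.card * D.m : ℤ) • D.xv) := by
  have := IsWeightedHomogeneous.prod s D.w (fun _ => (D.m : ℤ) • D.xv) (w := D.wt)
    (fun r _ => D.homogeneous_w r)
  rw [Finset.sum_const, ← natCast_zsmul, smul_smul] at this
  exact this

/-- The rank one matrix factorisation `⋯ → S(-c⃗) → S(-l) → S → ⋯` with maps given by `g` and `f`,
where `f` has degree `l` and `f g` is the loop polynomial. -/
def rankOne (f g : MvPolynomial (Fin 2) ℂ) (l : D.L) (hf : IsWeightedHomogeneous D.wt f l)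
    (hg : IsWeightedHomogeneous D.wt g (D.cv - l)) (h : f * g = D.W) :
    GradedMF D.wt D.W D.cv :=
  GradedMF.ofPair (r := 1) (fun _ => -D.cv) (fun _ => -l) (Matrix.of fun _ _ => g)
    (Matrix.of fun _ _ => f)
    (fun _ _ => by rwa [sub_neg_eq_add, neg_add_eq_sub])
    (fun _ _ => by rwa [sub_neg_eq_add, neg_add_cancel, zero_add])
    (by
      refine Matrix.ext fun i j => ?_
      rw [Matrix.mul_apply, Subsingleton.elim j i, Matrix.smul_apply, Matrix.one_apply_eq, ← h]
      simp [mul_comm])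
    (by
      refine Matrix.ext fun i j => ?_
      rw [Matrix.mul_apply, Subsingleton.elim j i, Matrix.smul_apply, Matrix.one_apply_eq, ← h]
      simp)

/-- The matrix factorisation `K_x`, with maps `y w_1 ⋯ w_ℓ` and `x`. -/
def Kx : GradedMF D.wt D.W D.cv :=
  D.rankOne (X 0) (X 1 * ∏ r ∈ Finset.Icc 1 D.l, D.w r) D.xv
    (by simpa using D.homogeneous_X0 1)
    (by
      have h := (D.homogeneous_X1 1).mul (D.homogeneous_prod_w (Finset.Icc 1 D.l))
      rw [pow_one] at h
      convert h using 1
      rw [cv, Nat.card_Icc]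
      match_scalars
      · have := D.p_eq
        push_cast [this]; ring
      · norm_num)
    (by rw [D.W_eq]; ring)

/-- The matrix factorisation `K_y`, with maps `x w_1 ⋯ w_ℓ` and `y`. -/
def Ky : GradedMF D.wt D.W D.cv :=
  D.rankOne (X 1) (X 0 * ∏ r ∈ Finset.Icc 1 D.l, D.w r) D.yv
    (by simpa using D.homogeneous_X1 1)
    (by
      have h := (D.homogeneous_X0 1).mul (D.homogeneous_prod_w (Finset.Icc 1 D.l))
      rw [pow_one] at h
      convert h using 1
      rw [cv, Nat.card_Icc]
      match_scalars
      · have := D.p_eq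
        push_cast [this]; ring
      · norm_num)
    (by rw [D.W_eq]; ring)

/-- The matrix factorisation `K_{w_r}`, with maps `(x^p y + y^q x) / w_r` and `w_r`. -/
def Kw (r : ℕ) (hr : r ∈ Finset.Icc 1 D.l) : GradedMF D.wt D.W D.cv :=
  D.rankOne (D.w r) (X 0 * X 1 * ∏ s ∈ (Finset.Icc 1 D.l).erase r, D.w s) ((D.m : ℤ) • D.xv)
    (D.homogeneous_w r)
    (by
      have h := ((D.homogeneous_X0 1).mul (D.homogeneous_X1 1)).mul
        (D.homogeneous_prod_w ((Finset.Icc 1 D.l).erase r))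
      rw [pow_one, pow_one] at h
      convert h using 1
      rw [cv, Finset.card_erase_of_mem hr, Nat.card_Icc]
      have hl := D.l_pos
      match_scalars
      · have := D.p_eq
        rw [Nat.add_sub_cancel]
        push_cast [this, Nat.cast_sub hl]; ring
      · norm_num)
    (by rw [D.W_eq, ← Finset.mul_prod_erase _ _ hr]; ring)

end LoopDatum

/-- The `(k+2) × (k+2)`-matrix with diagonal `(u₀, u, …, u, δ)`, lower subdiagonal
`(-β, …, -β, -β')`, upper right entry `γ`, and zeros elsewhere. -/
def cyclicMatrix {R : Type} [Ring R] (k : ℕ) (u₀ u δ β β' γ : R) :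
    Matrix (Fin (k + 2)) (Fin (k + 2)) R := fun b a =>
  if a.val = k + 1 then
    (if b.val = 0 then γ else if b.val = k + 1 then δ else 0)
  else if b.val = a.val then (if a.val = 0 then u₀ else u)
  else if b.val = a.val + 1 then (if b.val = k + 1 then -β' else -β)
  else 0

lemma cyclicMatrix_det {R : Type} [CommRing R] (k : ℕ) (u₀ u δ β β' γ : R) :
    (cyclicMatrix k u₀ u δ β β' γ).det = u₀ * u ^ k * δ + γ * β ^ k * β' := by
  rw [Matrix.det_succ_row_zero, Fin.sum_univ_succ, Fin.sum_univ_castSucc]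
  have h0 : cyclicMatrix k u₀ u δ β β' γ 0 0 = u₀ := by simp [cyclicMatrix]
  have h1 : cyclicMatrix k u₀ u δ β β' γ 0 (Fin.last k).succ = γ := by
    simp [cyclicMatrix]
  have h2 : ∀ t : Fin k, cyclicMatrix k u₀ u δ β β' γ 0 t.castSucc.succ = 0 := by
    intro t
    have := t.2
    simp only [cyclicMatrix, Fin.val_succ, Fin.val_castSucc, Fin.val_zero]
    split_ifs <;> first | rfl | contradiction | omega
  have d0 : ((cyclicMatrix k u₀ u δ β β' γ).submatrix Fin.succ (Fin.succAbove 0)).det =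
      u ^ k * δ := by
    rw [Matrix.det_of_isLowerTriangular, Fin.prod_univ_castSucc]
    · congr 1
      · rw [Finset.prod_eq_pow_card (b := u), Finset.card_univ, Fintype.card_fin]
        intro t _
        have := t.2
        simp only [cyclicMatrix, Matrix.submatrix_apply, Fin.succAbove_zero, Fin.val_succ,
          Fin.val_castSucc]
        split_ifs <;> first | rfl | contradiction | omega
      · simp [cyclicMatrix]
    · intro b a hba
      have hba' : b < a := hba
      rw [Fin.lt_def] at hba'
      have := a.2
      simp only [cyclicMatrix, Matrix.submatrix_apply, Fin.succAbove_zero, Fin.val_succ]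
      split_ifs <;> first | rfl | contradiction | omega
  have d1 : ((cyclicMatrix k u₀ u δ β β' γ).submatrix Fin.succ
      (Fin.succAbove (Fin.last k).succ)).det = (-β) ^ k * -β' := by
    rw [Fin.succ_last, Fin.succAbove_last, Matrix.det_of_isUpperTriangular, Fin.prod_univ_castSucc]
    · congr 1
      · rw [Finset.prod_eq_pow_card (b := -β), Finset.card_univ, Fintype.card_fin]
        intro t _
        have := t.2
        simp only [cyclicMatrix, Matrix.submatrix_apply, Fin.val_succ, Fin.val_castSucc]
        split_ifs <;> first | rfl | contradiction | omega
      · simp [cyclicMatrix]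
    · intro b a hba
      have hba' : a < b := hba
      rw [Fin.lt_def] at hba'
      have := a.2
      have := b.2
      simp only [cyclicMatrix, Matrix.submatrix_apply, Fin.val_succ, Fin.val_castSucc]
      split_ifs <;> first | rfl | contradiction | omega
  rw [h0, h1, d0, d1]
  simp only [h2, mul_zero, zero_mul, Finset.sum_const_zero, zero_add, Fin.val_zero, pow_zero,
    one_mul, Fin.val_succ, Fin.val_last]
  have hs : ((-1 : R) ^ k) * (-1) ^ k = 1 := by rw [← mul_pow]; simp
  rw [neg_pow β]
  linear_combination (γ * β ^ k * β') * hs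

section
open MvPolynomial

lemma det_homogeneous {L : Type} [AddCommGroup L] {wt : Fin 2 → L} {r : ℕ} {e o : Fin r → L}
    {A : Matrix (Fin r) (Fin r) (MvPolynomial (Fin 2) ℂ)}
    (hA : ∀ b a, IsWeightedHomogeneous wt (A b a) (o b - e a)) :
    IsWeightedHomogeneous wt A.det (∑ b, o b - ∑ a, e a) := by
  rw [Matrix.det_apply]
  refine IsWeightedHomogeneous.sum _ _ _ fun σ _ => ?_
  have h : IsWeightedHomogeneous wt (∏ i, A (σ i) i) (∑ b, o b - ∑ a, e a) := by
    have := IsWeightedHomogeneous.prod Finset.univ (fun i => A (σ i) i)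
      (fun i => o (σ i) - e i) (w := wt) (fun i _ => hA (σ i) i)
    rwa [Finset.sum_sub_distrib, Equiv.sum_comp σ o] at this
  rcases Int.units_eq_one_or (Equiv.Perm.sign σ) with hs | hs
  · rw [hs, one_smul]; exact h
  · rw [hs, Units.neg_smul, one_smul]; exact h.neg

lemma adjugate_homogeneous {L : Type} [AddCommGroup L] {wt : Fin 2 → L} {r : ℕ} {e o : Fin r → L}
    {A : Matrix (Fin r) (Fin r) (MvPolynomial (Fin 2) ℂ)}
    (hA : ∀ b a, IsWeightedHomogeneous wt (A b a) (o b - e a)) (a b : Fin r) :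
    IsWeightedHomogeneous wt (A.adjugate a b) (e a + (∑ b, o b - ∑ a, e a) - o b) := by
  rw [Matrix.adjugate_apply]
  have h := det_homogeneous (wt := wt) (e := e) (o := Function.update o b (e a))
    (A := A.updateRow b (Pi.single a 1)) (fun b' a' => by
      rcases eq_or_ne b' b with rfl | hb
      · rw [Matrix.updateRow_self, Function.update_self]
        rcases eq_or_ne a' a with rfl | ha
        · rw [Pi.single_eq_same, sub_self]; exact isWeightedHomogeneous_one _ _
        · rw [Pi.single_eq_of_ne ha]; exact isWeightedHomogeneous_zero _ _ _
      · rw [Matrix.updateRow_ne hb, Function.update_of_ne hb]; exact hA b' a')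
  convert h using 1
  rw [Finset.sum_update_of_mem (Finset.mem_univ b), ← Finset.add_sum_erase _ o (Finset.mem_univ b),
    Finset.sdiff_singleton_eq_erase]
  abel

end

namespace LoopDatum

open MvPolynomial Matrix

variable (D : LoopDatum)

/-- The number `k = ⌊(j - 1) ℓ / (q - 1)⌋`. -/
def kk (j : ℕ) : ℕ := (j - 1) * D.l / (D.q - 1)

/-- The matrix of the differential `K^{-2} → K^{-1}` of `K_0^{i,j}`. -/
def zeroMatrix (i j : ℕ) :
    Matrix (Fin (D.kk j + 2)) (Fin (D.kk j + 2)) (MvPolynomial (Fin 2) ℂ) :=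
  cyclicMatrix (D.kk j) (X 1 ^ (j - D.kk j * D.n)) (X 1 ^ D.n) (X 0 * X 1 ^ (D.q - j))
    (X 0 ^ D.m) (X 0 ^ (i - (D.l - 1) * D.m)) (X 0 ^ (D.p - i + D.m * (D.l - 1 - D.kk j)) * X 1)

/-- The degrees of the summands of `K^{-2}` for `K_0^{i,j}`:
`S(c⃗ - ((p-1)/ℓ) x⃗)` for all but the last, and `S((i+1) x⃗ + (j+1) y⃗ - c⃗)` for the last. -/
def zeroEven (i j : ℕ) (a : Fin (D.kk j + 2)) : D.L :=
  if a.val = D.kk j + 1 then ((i : ℤ) + 1) • D.xv + ((j : ℤ) + 1) • D.yv - D.cv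
  else D.cv - (D.m : ℤ) • D.xv

/-- The degrees of the summands of `K^{-1}` for `K_0^{i,j}`:
`S(c⃗ - (k+1) ((p-1)/ℓ) x⃗ + j y⃗)`, then `k` copies of `S(c⃗)`, then `S((i+1) x⃗ + y⃗)`. -/
def zeroOdd (i j : ℕ) (b : Fin (D.kk j + 2)) : D.L :=
  if b.val = 0 then D.cv - (((D.kk j : ℤ) + 1) * D.m) • D.xv + (j : ℤ) • D.yv
  else if b.val = D.kk j + 1 then ((i : ℤ) + 1) • D.xv + D.yv
  else D.cv

lemma kk_bounds {j : ℕ} (hj : j ∈ Finset.Icc 1 (D.q - 1)) :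
    D.kk j * D.n + 1 ≤ j ∧ j ≤ (D.kk j + 1) * D.n ∧ D.kk j + 1 ≤ D.l := by
  rw [Finset.mem_Icc, ← D.l_mul_n] at hj
  have hk : D.kk j = (j - 1) / D.n := by
    unfold kk
    rw [← D.l_mul_n, mul_comm, Nat.mul_div_mul_left _ _ D.l_pos]
  have h1 := Nat.div_mul_le_self (j - 1) D.n
  have h2 := Nat.lt_div_mul_add (a := j - 1) D.n_pos
  have h3 : (j - 1) / D.n < D.l := by
    rw [Nat.div_lt_iff_lt_mul D.n_pos]; omega
  rw [← hk] at h1 h2 h3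
  refine ⟨by omega, ?_, h3⟩
  rw [add_mul, one_mul]; omega

/-- Bounds on the indices, without truncated subtraction. -/
lemma index_bounds {i j : ℕ} (hi : i ∈ Finset.Icc (D.p - D.m) (D.p - 1))
    (hj : j ∈ Finset.Icc 1 (D.q - 1)) : ∃ s t : ℕ, D.l = D.kk j + 1 + s ∧
      i = (D.kk j + s) * D.m + 1 + t ∧ t + 1 ≤ D.m ∧ D.p = (D.kk j + 1 + s) * D.m + 1 ∧
      D.q = (D.kk j + 1 + s) * D.n + 1 := by
  obtain ⟨h1, h2, h3⟩ := D.kk_bounds hj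
  obtain ⟨s, hs⟩ := Nat.exists_eq_add_of_le h3
  have hp := D.p_eq
  have hq := D.q_eq
  rw [hs] at hp hq
  rw [Finset.mem_Icc] at hi
  have e : (D.kk j + 1 + s) * D.m = (D.kk j + s) * D.m + D.m := by ring
  refine ⟨s, i - ((D.kk j + s) * D.m + 1), hs, ?_, ?_, hp, hq⟩
  · omega
  · omega

lemma zeroMatrix_homogeneous {i j : ℕ} (hi : i ∈ Finset.Icc (D.p - D.m) (D.p - 1))
    (hj : j ∈ Finset.Icc 1 (D.q - 1)) (b a : Fin (D.kk j + 2)) :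
    IsWeightedHomogeneous D.wt (D.zeroMatrix i j b a) (D.zeroOdd i j b - D.zeroEven i j a) := by
  obtain ⟨s, t, hs, hit, ht, hp, hq⟩ := D.index_bounds hi hj
  obtain ⟨h1, h2, h3⟩ := D.kk_bounds hj
  have hj' := Finset.mem_Icc.1 hj
  have rel := D.rel
  have hpz : (D.p : ℤ) = (D.kk j + 1 + s) * D.m + 1 := by rw [hp]; push_cast; ring
  have hqz : (D.q : ℤ) = (D.kk j + 1 + s) * D.n + 1 := by rw [hq]; push_cast; ring
  have hiz : (i : ℤ) = (D.kk j + s) * D.m + 1 + t := by rw [hit]; push_cast; ring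
  have z := isWeightedHomogeneous_zero ℂ D.wt (D.zeroOdd i j b - D.zeroEven i j a)
  have hX0 := D.homogeneous_X0
  have hX1 := D.homogeneous_X1
  have hb := b.2
  have ha := a.2
  have e2 : (D.l - 1) * D.m = (D.kk j + s) * D.m := by rw [hs]; congr 1; omega
  have e3 : D.m * (D.l - 1 - D.kk j) = D.m * s := by rw [hs]; congr 1; omega
  have e4 : (D.kk j + 1 + s) * D.m = (D.kk j + s) * D.m + D.m := by ring
  have x1 : ((j - D.kk j * D.n : ℕ) : ℤ) = j - D.kk j * D.n := by
    rw [Nat.cast_sub (by omega)]; push_cast; ring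
  have x2 : ((D.q - j : ℕ) : ℤ) = D.q - j := Nat.cast_sub (by omega)
  have x3 : ((i - (D.l - 1) * D.m : ℕ) : ℤ) = t + 1 := by
    rw [show i - (D.l - 1) * D.m = t + 1 by omega]; push_cast; ring
  have x4 : ((D.p - i + D.m * (D.l - 1 - D.kk j) : ℕ) : ℤ) = D.m - t + D.m * s := by
    rw [show D.p - i + D.m * (D.l - 1 - D.kk j) = (D.m - t) + D.m * s by omega]
    push_cast [Nat.cast_sub (show t ≤ D.m by omega)]; ring
  have g1 := hX1 (j - D.kk j * D.n)
  have g2 := hX1 D.n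
  have g3 := (hX0 1).mul (hX1 (D.q - j))
  have g4 := hX0 D.m
  have g5 := hX0 (i - (D.l - 1) * D.m)
  have g6 := (hX0 (D.p - i + D.m * (D.l - 1 - D.kk j))).mul (hX1 1)
  rw [x1] at g1
  rw [x2, pow_one] at g3
  rw [x3] at g5
  rw [x4, pow_one] at g6
  clear x1 x2 x3 x4 e2 e3 e4 hX0 hX1
  simp only [zeroMatrix, cyclicMatrix, zeroOdd, zeroEven, cv] at z ⊢
  generalize D.kk j = k at *
  split_ifs at z ⊢ <;> first
    | exact z
    | omega
    | skip
  · convert g6 using 1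
    rw [hpz, hiz]
    module
  · convert g3 using 1
    rw [hpz, hqz, ← sub_eq_zero, ← smul_zero ((k : ℤ) + 1 + s), ← sub_eq_zero.2 rel]
    module
  · convert g1 using 1
    rw [← sub_eq_zero, ← smul_zero (-(k : ℤ)), ← sub_eq_zero.2 rel]
    module
  · convert g2 using 1
    rw [← rel]
    module
  · refine Eq.subst (motive := IsWeightedHomogeneous D.wt _) ?_ g5.neg
    rw [hpz, hiz]
    module
  · refine Eq.subst (motive := IsWeightedHomogeneous D.wt _) ?_ g4.neg
    module

lemma zeroMatrix_det {i j : ℕ} (hi : i ∈ Finset.Icc (D.p - D.m) (D.p - 1))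
    (hj : j ∈ Finset.Icc 1 (D.q - 1)) : (D.zeroMatrix i j).det = D.W := by
  obtain ⟨s, t, hs, hit, ht, hp, hq⟩ := D.index_bounds hi hj
  obtain ⟨h1, h2, h3⟩ := D.kk_bounds hj
  have hj' := Finset.mem_Icc.1 hj
  rw [zeroMatrix, cyclicMatrix_det, W]
  have e1 : D.n * D.kk j = D.kk j * D.n := mul_comm _ _
  have e2 : (D.l - 1) * D.m = (D.kk j + s) * D.m := by rw [hs]; congr 1; omega
  have e3 : D.m * (D.l - 1 - D.kk j) = D.m * s := by rw [hs]; congr 1; omega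
  have e4 : (D.kk j + 1 + s) * D.m = (D.kk j + s) * D.m + D.m := by ring
  have e5 : (D.kk j + s) * D.m = D.m * D.kk j + D.m * s := by ring
  have f1 : (X 1 : MvPolynomial (Fin 2) ℂ) ^ D.q =
      X 1 ^ (j - D.kk j * D.n) * (X 1 ^ D.n) ^ D.kk j * X 1 ^ (D.q - j) := by
    rw [← pow_mul, ← pow_add, ← pow_add]; congr 1; omega
  have f2 : (X 0 : MvPolynomial (Fin 2) ℂ) ^ D.p =
      X 0 ^ (D.p - i + D.m * (D.l - 1 - D.kk j)) * (X 0 ^ D.m) ^ D.kk j *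
        X 0 ^ (i - (D.l - 1) * D.m) := by
    rw [← pow_mul, ← pow_add, ← pow_add]; congr 1; omega
  rw [f1, f2]
  ring

lemma zero_degree_sum (i j : ℕ) :
    ∑ b, D.zeroOdd i j b - ∑ a, D.zeroEven i j a = D.cv := by
  have h1 : ∑ b, D.zeroOdd i j b = D.cv - (((D.kk j : ℤ) + 1) * D.m) • D.xv + (j : ℤ) • D.yv +
      ((D.kk j : ℤ) • D.cv + (((i : ℤ) + 1) • D.xv + D.yv)) := by
    rw [Fin.sum_univ_succ, Fin.sum_univ_castSucc]
    congr 1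
    congr 1
    · rw [Finset.sum_congr rfl (g := fun _ => D.cv), Finset.sum_const, Finset.card_univ,
        Fintype.card_fin, natCast_zsmul]
      intro t _
      have := t.2
      simp [zeroOdd]; omega
    · simp [zeroOdd]
  have h2 : ∑ a, D.zeroEven i j a = ((D.kk j : ℤ) + 1) • (D.cv - (D.m : ℤ) • D.xv) +
      (((i : ℤ) + 1) • D.xv + ((j : ℤ) + 1) • D.yv - D.cv) := by
    rw [Fin.sum_univ_castSucc]
    congr 1
    · rw [Finset.sum_congr rfl (g := fun _ => D.cv - (D.m : ℤ) • D.xv), Finset.sum_const,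
        Finset.card_univ, Fintype.card_fin, ← natCast_zsmul]
      · push_cast; rfl
      · intro t _
        have := t.2
        simp [zeroEven]; omega
    · simp [zeroEven]
  rw [h1, h2]
  module

/-- The matrix factorisation `K_0^{i,j}`, for `p - (p-1)/ℓ ≤ i ≤ p - 1` and `1 ≤ j ≤ q - 1`; its
differential `K^{-1} → K^0` is the adjugate of the differential `K^{-2} → K^{-1}`. -/
def Kzero (i j : ℕ) (hi : i ∈ Finset.Icc (D.p - D.m) (D.p - 1))
    (hj : j ∈ Finset.Icc 1 (D.q - 1)) : GradedMF D.wt D.W D.cv :=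
  GradedMF.ofPair (D.zeroEven i j) (D.zeroOdd i j) (D.zeroMatrix i j) (D.zeroMatrix i j).adjugate
    (D.zeroMatrix_homogeneous hi hj)
    (fun a b => by
      have := adjugate_homogeneous (D.zeroMatrix_homogeneous hi hj) a b
      rwa [D.zero_degree_sum] at this)
    (by rw [Matrix.mul_adjugate, D.zeroMatrix_det hi hj])
    (by rw [Matrix.adjugate_mul, D.zeroMatrix_det hi hj])

/-- Labels for the objects of the category `ℬ`. -/
inductive Obj : Type
  /-- the object `K_0^{i,j}` -/
  | zero (i : Finset.Icc (D.p - D.m) (D.p - 1)) (j : Finset.Icc 1 (D.q - 1)) : Obj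
  /-- the object `K_x^i[3]` -/
  | x (i : Finset.Icc (D.p - D.m) (D.p - 1)) : Obj
  /-- the object `K_y^j[3]` -/
  | y (j : Finset.Icc (D.q - D.n) (D.q - 1)) : Obj
  /-- the object `K_{w_r}[3]` -/
  | w (r : Finset.Icc 1 D.l) : Obj

/-- The objects of `ℬ`, where `K_x^i = K_x((i + 1 - p) x⃗)` and `K_y^j = K_y((j + 1 - q) y⃗)`. -/
def obj : D.Obj → GradedMF D.wt D.W D.cv
  | .zero i j => D.Kzero i j i.2 j.2
  | .x i => (D.Kx.twist (((i : ℤ) + 1 - D.p) • D.xv)).shift 3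
  | .y j => (D.Ky.twist (((j : ℤ) + 1 - D.q) • D.yv)).shift 3
  | .w r => (D.Kw r r.2).shift 3

/-- The full subcategory `ℬ` of the dg category of `L`-graded matrix factorisations. -/
def B : DGCat D.Obj := (mfCat D.wt D.W D.cv).full D.obj

def objEquiv : D.Obj ≃ (Finset.Icc (D.p - D.m) (D.p - 1) × Finset.Icc 1 (D.q - 1)) ⊕
    (Finset.Icc (D.p - D.m) (D.p - 1)) ⊕ (Finset.Icc (D.q - D.n) (D.q - 1)) ⊕
    (Finset.Icc 1 D.l) where
  toFun
    | .zero i j => .inl (i, j)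
    | .x i => .inr (.inl i)
    | .y j => .inr (.inr (.inl j))
    | .w r => .inr (.inr (.inr r))
  invFun
    | .inl (i, j) => .zero i j
    | .inr (.inl i) => .x i
    | .inr (.inr (.inl j)) => .y j
    | .inr (.inr (.inr r)) => .w r
  left_inv o := by cases o <;> rfl
  right_inv o := by rcases o with ⟨i, j⟩ | i | j | r <;> rfl

instance : Fintype D.Obj := Fintype.ofEquiv _ D.objEquiv.symm

end LoopDatum

/-! ### The quiver with relations -/

/-- Generators of the path algebra of a quiver: an idempotent for each vertex, and the arrows. -/
inductive PathGen (V : Type) [Quiver.{0} V] : Type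
  | idem (v : V) : PathGen V
  | arrow {u v : V} (α : u ⟶ v) : PathGen V

/-- The relations of the path algebra of a quiver with finitely many vertices. A product `α * β`
stands for the path which runs through `β` first. -/
inductive PathRel (V : Type) [Quiver.{0} V] [Fintype V] :
    FreeAlgebra ℂ (PathGen V) → FreeAlgebra ℂ (PathGen V) → Prop
  | idem_mul_self (v : V) : PathRel V
      (FreeAlgebra.ι ℂ (.idem v) * FreeAlgebra.ι ℂ (.idem v)) (FreeAlgebra.ι ℂ (.idem v))
  | idem_mul_idem (u v : V) (h : u ≠ v) : PathRel V
      (FreeAlgebra.ι ℂ (.idem u) * FreeAlgebra.ι ℂ (.idem v)) 0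
  | sum_idem : PathRel V (∑ v : V, FreeAlgebra.ι ℂ (.idem v)) 1
  | idem_mul_arrow {u v : V} (α : u ⟶ v) : PathRel V
      (FreeAlgebra.ι ℂ (.idem v) * FreeAlgebra.ι ℂ (.arrow α)) (FreeAlgebra.ι ℂ (.arrow α))
  | arrow_mul_idem {u v : V} (α : u ⟶ v) : PathRel V
      (FreeAlgebra.ι ℂ (.arrow α) * FreeAlgebra.ι ℂ (.idem u)) (FreeAlgebra.ι ℂ (.arrow α))

/-- The path algebra over `ℂ` of a quiver with finitely many vertices. -/
abbrev PathAlgebra (V : Type) [Quiver.{0} V] [Fintype V] : Type := RingQuot (PathRel V)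

/-- The trivial path at a vertex. -/
def PathAlgebra.idem {V : Type} [Quiver.{0} V] [Fintype V] (v : V) : PathAlgebra V :=
  RingQuot.mkAlgHom ℂ (PathRel V) (FreeAlgebra.ι ℂ (.idem v))

/-- The path of length one given by an arrow. -/
def PathAlgebra.arrow {V : Type} [Quiver.{0} V] [Fintype V] {u v : V} (α : u ⟶ v) :
    PathAlgebra V :=
  RingQuot.mkAlgHom ℂ (PathRel V) (FreeAlgebra.ι ℂ (.arrow α))

namespace LoopDatum

variable (D : LoopDatum)

/-- The arrows of the quiver. In the grid of the objects `K_0^{i,j}`, the arrows `x` increase `i`,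
the arrows `xnext` (also called `x`) lead from the last value `i = p - 1` to the first value
`i = p - (p-1)/ℓ` and increase `j` by `(q-1)/ℓ`, and the arrows `y` increase `j`. -/
inductive Arrow : D.Obj → D.Obj → Type
  | x (i i' : Finset.Icc (D.p - D.m) (D.p - 1)) (j : Finset.Icc 1 (D.q - 1))
      (h : (i' : ℕ) = i + 1) : Arrow (.zero i j) (.zero i' j)
  | xnext (i i' : Finset.Icc (D.p - D.m) (D.p - 1)) (j j' : Finset.Icc 1 (D.q - 1))
      (hi : (i : ℕ) = D.p - 1) (hi' : (i' : ℕ) = D.p - D.m) (hj : (j' : ℕ) = j + D.n) :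
      Arrow (.zero i j) (.zero i' j')
  | y (i : Finset.Icc (D.p - D.m) (D.p - 1)) (j j' : Finset.Icc 1 (D.q - 1))
      (h : (j' : ℕ) = j + 1) : Arrow (.zero i j) (.zero i j')
  | a (i : Finset.Icc (D.p - D.m) (D.p - 1)) (j : Finset.Icc 1 (D.q - 1))
      (j' : Finset.Icc (D.q - D.n) (D.q - 1)) (hi : (i : ℕ) = D.p - 1) (hj : (j' : ℕ) = j) :
      Arrow (.zero i j) (.y j')
  | b (i : Finset.Icc (D.p - D.m) (D.p - 1)) (j : Finset.Icc 1 (D.q - 1))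
      (hj : (j : ℕ) = D.q - 1) : Arrow (.zero i j) (.x i)
  | c (i : Finset.Icc (D.p - D.m) (D.p - 1)) (j : Finset.Icc 1 (D.q - 1))
      (r : Finset.Icc 1 D.l) (hi : (i : ℕ) = D.p - 1) (hj : (j : ℕ) = D.q - 1) :
      Arrow (.zero i j) (.w r)

instance : Quiver.{0} D.Obj where
  Hom u v := D.Arrow u v

/-- The sum of all arrows labelled `x`, in the path algebra. -/
def xSum : PathAlgebra D.Obj :=
  (∑ i, ∑ i', ∑ j, if h : _ then PathAlgebra.arrow (V := D.Obj) (Arrow.x i i' j h) else 0) +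
  ∑ i, ∑ i', ∑ j, ∑ j', if h : _ ∧ _ ∧ _ then
    PathAlgebra.arrow (V := D.Obj) (Arrow.xnext i i' j j' h.1 h.2.1 h.2.2) else 0

/-- The sum of all arrows labelled `y`. -/
def ySum : PathAlgebra D.Obj :=
  ∑ i, ∑ j, ∑ j', if h : _ then PathAlgebra.arrow (V := D.Obj) (Arrow.y i j j' h) else 0

/-- The sum of all arrows labelled `a`. -/
def aSum : PathAlgebra D.Obj :=
  ∑ i, ∑ j, ∑ j', if h : _ ∧ _ then
    PathAlgebra.arrow (V := D.Obj) (Arrow.a i j j' h.1 h.2) else 0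

/-- The sum of all arrows labelled `b`. -/
def bSum : PathAlgebra D.Obj :=
  ∑ i, ∑ j, if h : _ then PathAlgebra.arrow (V := D.Obj) (Arrow.b i j h) else 0

/-- The sum of all arrows labelled `c_r` (there is exactly one). -/
def cSum (r : Finset.Icc 1 D.l) : PathAlgebra D.Obj :=
  ∑ i, ∑ j, if h : _ ∧ _ then
    PathAlgebra.arrow (V := D.Obj) (Arrow.c i j r h.1 h.2) else 0

/-- The relations `x y = y x`, `a y = 0`, `b x = 0` and
`c_r (x^{(p-1)/ℓ} - e^{πi/ℓ} η^r y^{(q-1)/ℓ}) = 0`, for all paths of this shape: as the products of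
non-composable arrows vanish, multiplying by trivial paths from both sides separates the paths with
different ends. -/
inductive QuiverRel : PathAlgebra D.Obj → PathAlgebra D.Obj → Prop
  | xy : QuiverRel (D.xSum * D.ySum) (D.ySum * D.xSum)
  | ay : QuiverRel (D.aSum * D.ySum) 0
  | bx : QuiverRel (D.bSum * D.xSum) 0
  | c (r : Finset.Icc 1 D.l) :
      QuiverRel (D.cSum r * (D.xSum ^ D.m - D.root r • D.ySum ^ D.n)) 0

/-- The path algebra of the quiver, modulo the relations. -/
abbrev QuiverAlgebra : Type := RingQuot D.QuiverRel

/-- The image of the trivial path at a vertex. -/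
def idem (v : D.Obj) : D.QuiverAlgebra :=
  RingQuot.mkAlgHom ℂ D.QuiverRel (PathAlgebra.idem v)

/-- The image of an arrow. -/
def arrow {u v : D.Obj} (α : D.Arrow u v) : D.QuiverAlgebra :=
  RingQuot.mkAlgHom ℂ D.QuiverRel (PathAlgebra.arrow (V := D.Obj) α)

end LoopDatum

/-- The maximal symmetry group `{(s, t) ∈ (ℂ^*)^2 : s^p t = t^q s}` of the loop polynomial
`x^p y + y^q x`. -/
def loopSymmetryGroup (p q : ℕ) : Subgroup (ℂˣ × ℂˣ) where
  carrier := {g | g.1 ^ p * g.2 = g.2 ^ q * g.1}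
  mul_mem' {g h} hg hh := by
    change (g.1 * h.1) ^ p * (g.2 * h.2) = (g.2 * h.2) ^ q * (g.1 * h.1)
    have e1 : g.1 ^ p * g.2 = g.2 ^ q * g.1 := hg
    have e2 : h.1 ^ p * h.2 = h.2 ^ q * h.1 := hh
    rw [mul_pow, mul_pow, mul_mul_mul_comm, e1, e2, mul_mul_mul_comm]
  one_mem' := by simp
  inv_mem' {g} hg := by
    change g.1⁻¹ ^ p * g.2⁻¹ = g.2⁻¹ ^ q * g.1⁻¹
    have e1 : g.1 ^ p * g.2 = g.2 ^ q * g.1 := hg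
    rw [inv_pow, inv_pow, ← mul_inv, ← mul_inv, e1]

end

noncomputable section

/-! ### Strict functors and formality of `A_∞`-categories concentrated in degree zero -/

namespace AStr

section

variable {O : Type} {M : O → O → ℤ → Type}

/-! Four arguments are combined: on subgroups, on morphisms of matrix factorisations, on the path
algebra, and on `A_∞`-structures.

Subgroups. The symmetry group is `{s^(p-1) = t^(q-1)}`. With `g = gcd(p-1, q-1)`, `P = (p-1)/g` and
`Q = (q-1)/g`, the character `χ = s^P t^(-Q)` maps it onto the group of `g`-th roots of unity. The
kernel of `χ` is the one-parameter group `(u^Q, u^P)`, which is divisible and hence lies in every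
subgroup of finite index. So `Γ` is the preimage of the group of roots of unity of order `N = g/ℓ`.
Therefore `ℓ` divides `g`, and the characters trivial on `Γ` are the powers of `χ^N`
(`relIndex_data`, `exists_loopDatum`).

Morphisms. `K_0^{i,j}` is the stabilisation of `S/I` for a monomial ideal `I`: the last row of the
adjugate lists the monomials of a staircase (`adjugate_last`), and the remaining data form its
Hilbert–Burch resolution (`Kzero_resolution`). A closed morphism to `K_0^{i,j}` is exact as soon as
one row has entries in `I` (`mem_B_of_row`). All inner corners of the staircase have the same degree
in `L`, so `(S/I)_d = 0` unless both `d` and the corner degree minus `d` are degrees of monomials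
(`exists_row_of_ineffective`); this is a matter of linear inequalities (`ineffective_of`). What
survives is `Hom^0` between two objects `K_0`, which is the graded piece of `S` in the difference of
their degrees. For a target of rank one with factor `f`, a homogeneous polynomial is divisible by
`f` once it vanishes at one chosen point of `f = 0` (`factor_dvd`), since the `Γ`-orbit of that
point is dense in the zero set. Closedness and exactness then become linear algebra over `ℂ` for the
matrices evaluated at this point (`eval_closed`, `mem_B_of_eval`). The result is that `Hom^0` from
`K_0` to a rank one object is at most a line, that the rank one objects have endomorphisms `ℂ` and
are mutually orthogonal, and that they have no morphisms to any `K_0`.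

Algebra. Each class is recorded by a polynomial (`chi`), and composition becomes multiplication
followed by evaluation at the point of the target (`chi_comp`). The total endomorphism algebra thus
consists of matrices of polynomials (`toPoly`), where the arrows labelled `x`, `y` become the
variables and `a`, `b`, `c_r` become `1`. The relations hold because each factor vanishes at its
point. Conversely, the relations reduce every path to a monomial in `x`, `y` followed by at most one
further arrow (`hasCorners`). The grid contains every intermediate vertex that a monomial needs
(`exists_arrow_x`, `exists_arrow_y`), so nothing vanishes by leaving it. Comparing polynomials gives
bijectivity.

Formality. The cohomology lies in degree zero, so an `A_∞`-category `C` with this cohomology is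
connected to it by the strict functors `C ← τ_{≤0} C → H^0` (`quasiIsomorphic_of_concentrated`). -/

lemma sum_splits_left {V : Type} [AddCommMonoid V] {X Y : O} (s : AStr M X Y)
    (G : (Σ Z : O, AStr M Z Y × AStr M X Z) → V) (hG : ∀ t, t.2.1.len ≠ 0 → G t = 0) :
    (s.splits.map G).sum = G ⟨Y, nil, s⟩ := by
  cases s with
  | nil => simp [splits]
  | cons n a s =>
    simp only [splits, List.map_cons, List.sum_cons, List.map_map]
    rw [List.sum_eq_zero, add_zero]
    intro x hx
    obtain ⟨t, _, rfl⟩ := List.mem_map.1 hx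
    exact hG _ (by simp [len])

/-- Together with `sum_splits_left` this collapses the double sum over insertions when the outer
operation accepts only strings of length one. -/
lemma sum_splits_right {V : Type} [AddCommMonoid V] {X Y : O} (s : AStr M X Y)
    (G : (Σ Z : O, AStr M Z Y × AStr M X Z) → V) (hG : ∀ t, t.2.2.len ≠ 0 → G t = 0) :
    (s.splits.map G).sum = G ⟨X, s, nil⟩ := by
  induction s with
  | nil => simp [splits]
  | cons n a s ih =>
    simp only [splits, List.map_cons, List.sum_cons, List.map_map]
    rw [hG _ (by simp [len]), zero_add]
    exact ih (fun t => G ⟨t.1, cons n a t.2.1, t.2.2⟩) fun t ht => hG _ ht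

end

variable {O : Type} {M N : O → O → ℤ → Type}
  [∀ X Y n, AddCommGroup (M X Y n)] [∀ X Y n, Module ℂ (M X Y n)]
  [∀ X Y n, AddCommGroup (N X Y n)] [∀ X Y n, Module ℂ (N X Y n)]

/-- The image of a string under a family of linear maps. -/
def map (φ : ∀ X Y n, M X Y n →ₗ[ℂ] N X Y n) {X : O} : ∀ {Y : O}, AStr M X Y → AStr N X Y
  | _, nil => nil
  | _, cons n a s => cons n (φ _ _ n a) (s.map φ)

variable (φ : ∀ X Y n, M X Y n →ₗ[ℂ] N X Y n)

lemma len_map {X Y : O} (s : AStr M X Y) : (s.map φ).len = s.len := by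
  induction s with
  | nil => rfl
  | cons n a s ih => simp [map, len, ih]

lemma deg_map {X Y : O} (s : AStr M X Y) : (s.map φ).deg = s.deg := by
  induction s with
  | nil => rfl
  | cons n a s ih => simp [map, deg, ih]

lemma map_append {X Y Z : O} (s : AStr M Y Z) (t : AStr M X Y) :
    (s.append t).map φ = (s.map φ).append (t.map φ) := by
  induction s with
  | nil => rfl
  | cons n a s ih => simp [map, append, ih]

lemma splits_map {X Y : O} (s : AStr M X Y) :
    (s.map φ).splits = s.splits.map fun t => ⟨t.1, t.2.1.map φ, t.2.2.map φ⟩ := by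
  induction s with
  | nil => rfl
  | cons n a s ih =>
    simp only [map, splits, ih, List.map_cons, List.map_map]
    rfl

/-- The operations of a strict functor: a linear map on strings of length one, and zero on all
other strings. -/
def strictOp {X : O} : ∀ {Y : O}, AStr M X Y → ∀ k : ℤ, N X Y k
  | _, .nil, _ => 0
  | _, .cons n a .nil, k => if h : n = k then φ _ _ k (h ▸ a) else 0
  | _, .cons _ _ (.cons _ _ _), _ => 0

lemma strictOp_of_len {X Y : O} (s : AStr M X Y) (h : s.len ≠ 1) (k : ℤ) :
    strictOp φ s k = 0 := by
  match s, h with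
  | .nil, _ => rfl
  | .cons n a .nil, h => exact absurd rfl h
  | .cons _ _ (.cons _ _ _), _ => rfl

lemma strictOp_single {X Y : O} (n : ℤ) (a : M X Y n) :
    strictOp φ (.cons n a .nil) n = φ _ _ n a := dif_pos rfl

lemma strictOp_ne {X Y : O} {n k : ℤ} (h : n ≠ k) (a : M X Y n) :
    strictOp φ (.cons n a .nil) k = 0 := dif_neg h

lemma strictOp_multilinear : IsMultilinearOp 1 (strictOp φ) where
  map_nil _ _ := rfl
  degree s k h := by
    match s, h with
    | .nil, _ => rfl
    | .cons n a .nil, h =>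
      refine strictOp_ne φ ?_ a
      simp only [deg, len] at h; push_cast at h; omega
    | .cons _ _ (.cons _ _ _), _ => rfl
  map_add u n a b v k := by
    by_cases h : (u.append (.cons n (a + b) v)).len = 1
    · have h' : u.len = 0 ∧ v.len = 0 := by rw [len_append] at h; simp [len] at h; omega
      cases u with
      | cons _ _ _ => exact absurd h'.1 (Nat.succ_ne_zero _)
      | nil =>
      cases v with
      | cons _ _ _ => exact absurd h'.2 (Nat.succ_ne_zero _)
      | nil =>
        simp only [append]
        by_cases hk : n = k
        · subst hk; simp only [strictOp_single, _root_.map_add]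
        · simp only [strictOp_ne φ hk, add_zero]
    · rw [strictOp_of_len φ _ h, strictOp_of_len, strictOp_of_len, add_zero] <;>
      · rw [len_append] at h ⊢; simpa [len] using h
  map_smul u n r a v k := by
    by_cases h : (u.append (.cons n (r • a) v)).len = 1
    · have h' : u.len = 0 ∧ v.len = 0 := by rw [len_append] at h; simp [len] at h; omega
      cases u with
      | cons _ _ _ => exact absurd h'.1 (Nat.succ_ne_zero _)
      | nil =>
      cases v with
      | cons _ _ _ => exact absurd h'.2 (Nat.succ_ne_zero _)
      | nil =>
        simp only [append]
        by_cases hk : n = k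
        · subst hk; simp only [strictOp_single, _root_.map_smul]
        · simp only [strictOp_ne φ hk, smul_zero]
    · rw [strictOp_of_len φ _ h, strictOp_of_len, smul_zero]
      rw [len_append] at h ⊢; simpa [len] using h

/-- A block of length at least two has value zero, and `hG` abstracts the fact that a multilinear
operation kills strings with a zero entry. Only the decomposition into single letters survives. -/
lemma sum_blocksAux_strictOp {V : Type} [AddCommMonoid V] {X Y Z : O} (s : AStr M X Y)
    (u : AStr M Y Z) (hu : u.len ≠ 0) (G : AStr N X Z → V)
    (hG : ∀ {X' Y' : O} (u : AStr N Y' Z) (n : ℤ) (v : AStr N X X'),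
      G (u.append (.cons n (0 : N X' Y' n) v)) = 0) :
    ((blocksAux (strictOp φ) u s).map G).sum =
      G (.cons (u.deg + 1 - u.len) (strictOp φ u (u.deg + 1 - u.len)) (s.map φ)) := by
  induction s generalizing Z with
  | nil => simp [blocksAux, map]
  | cons n a s ih =>
    rw [blocksAux, List.map_append, List.sum_append, List.map_map]
    have hl : (u.append (.cons n a .nil)).len = u.len + 1 := by simp [len_append, len]
    have h0 := fun k => hG .nil k (s.map φ)
    simp only [append] at h0
    -- In the first summand the leading block has absorbed another letter, so its value is zero.
    rw [ih _ (by omega) G hG, strictOp_of_len φ (u.append (.cons n a .nil)) (by omega), h0,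
      zero_add]
    have := ih (.cons n a .nil) (by simp [len])
      (fun t => G (.cons (u.deg + 1 - u.len) (strictOp φ u (u.deg + 1 - u.len)) t))
      (fun u' n' v' => hG (.cons (u.deg + 1 - u.len) (strictOp φ u (u.deg + 1 - u.len)) u') n' v')
    refine this.trans ?_
    -- The label of a one-letter block is `n + 0 + 1 - 1`, which is `n` only up to a proof; the
    -- index is generalised to move the value along.
    have e : ∀ k : ℤ, k = n → (AStr.cons k (strictOp φ (.cons n a .nil) k) (s.map φ)) =
        AStr.cons n (φ _ _ n a) (s.map φ) := by
      rintro k rfl; rw [strictOp_single]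
    rw [e _ (by simp [deg, len])]
    rfl

lemma sum_blocks_strictOp {V : Type} [AddCommMonoid V] {X Y : O} (s : AStr M X Y)
    (G : AStr N X Y → V)
    (hG : ∀ {X' Y' : O} (u : AStr N Y' Y) (n : ℤ) (v : AStr N X X'),
      G (u.append (.cons n (0 : N X' Y' n) v)) = 0) :
    ((blocks (strictOp φ) s).map G).sum = G (s.map φ) := by
  cases s with
  | nil => simp [blocks, map]
  | cons n a s =>
    rw [blocks, sum_blocksAux_strictOp φ s _ (by simp [len]) G hG]
    have e : ∀ k : ℤ, k = n → (AStr.cons k (strictOp φ (.cons n a .nil) k) (s.map φ)) =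
        AStr.cons n (φ _ _ n a) (s.map φ) := by
      rintro k rfl; rw [strictOp_single]
    rw [e _ (by simp [deg, len])]
    rfl

/-- Inserting `μ` leaves a string of length one only if `μ` consumes all inputs; the sign of that
term is `(-1)^0`. -/
lemma insertionSum_strictOp (μ : ∀ {X Y : O}, AStr M X Y → ∀ k : ℤ, M X Y k)
    (hμ : IsMultilinearOp 2 μ) {X Y : O} (s : AStr M X Y) (k : ℤ) :
    insertionSum μ (strictOp φ) s k = φ X Y k (μ s k) := by
  unfold insertionSum
  rw [sum_splits_left s, sum_splits_right s]
  · by_cases hk : s.deg + 2 - s.len = k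
    · subst hk
      simp only [append, strictOp_single]
      simp [deg, len, sgn]
    · simp only [append]
      rw [strictOp_ne φ hk, hμ.degree s k (Ne.symm hk)]
      simp
  · intro t ht
    beta_reduce
    rw [strictOp_of_len, smul_zero]
    rw [len_append]; simp [len]; omega
  · intro t ht
    refine List.sum_eq_zero fun x hx => ?_
    obtain ⟨t', _, rfl⟩ := List.mem_map.1 hx
    beta_reduce
    rw [strictOp_of_len, smul_zero]
    rw [len_append]; simp [len]; omega

/-- This transports the `A_∞`-relations along maps that commute with the operations; it is used for
the subspaces in `AInfCat.sub`. -/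
lemma map_insertionSum (μ : ∀ {X Y : O}, AStr M X Y → ∀ k : ℤ, M X Y k)
    (ν : ∀ {X Y : O}, AStr N X Y → ∀ k : ℤ, N X Y k)
    (h : ∀ {X Y : O} (s : AStr M X Y) (k : ℤ), φ X Y k (μ s k) = ν (s.map φ) k)
    {X Y : O} (s : AStr M X Y) (k : ℤ) :
    φ X Y k (insertionSum μ μ s k) = insertionSum ν ν (s.map φ) k := by
  unfold insertionSum
  rw [map_list_sum, splits_map, List.map_map, List.map_map]
  congr 1
  refine List.map_congr_left fun t _ => ?_
  simp only [Function.comp_apply]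
  rw [map_list_sum, splits_map, List.map_map, List.map_map]
  congr 1
  refine List.map_congr_left fun t' _ => ?_
  simp only [Function.comp_apply, map_smul, h, map_append, deg_map, len_map]
  rw [map, h, deg_map, len_map]

end AStr

/-! ### Strict functors, truncation, and the zigzag to cohomology -/

namespace AInfCat

variable {O : Type}

/-- The strict functor given by linear maps which commute with all operations. -/
def strictFunctor {A B : AInfCat O} (φ : ∀ X Y n, A.hom X Y n →ₗ[ℂ] B.hom X Y n)
    (h : ∀ {X Y : O} (s : AStr A.hom X Y) (k : ℤ), φ X Y k (A.μ s k) = B.μ (s.map φ) k) :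
    AInfFunctor A B where
  F := AStr.strictOp φ
  multilinear := AStr.strictOp_multilinear φ
  relation s k := by
    rw [AStr.insertionSum_strictOp φ A.μ A.multilinear, h]
    exact AStr.sum_blocks_strictOp φ s (fun t => B.μ t k) fun u n v => B.μ_insert_zero u n v k

lemma strictFunctor_F₁ {A B : AInfCat O} (φ : ∀ X Y n, A.hom X Y n →ₗ[ℂ] B.hom X Y n)
    (h : ∀ {X Y : O} (s : AStr A.hom X Y) (k : ℤ), φ X Y k (A.μ s k) = B.μ (s.map φ) k)
    {X Y : O} {n : ℤ} (a : A.hom X Y n) : (strictFunctor φ h).F₁ a = φ X Y n a :=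
  AStr.strictOp_single φ n a

/-- The subcategory given by subspaces which are closed under all operations. -/
abbrev sub (C : AInfCat O) (V : ∀ X Y n, Submodule ℂ (C.hom X Y n))
    (hV : ∀ {X Y : O} (s : AStr (fun X Y n => V X Y n) X Y) (k : ℤ),
      C.μ (s.map fun X Y n => (V X Y n).subtype) k ∈ V X Y k) : AInfCat O where
  hom X Y n := V X Y n
  μ s k := ⟨C.μ (s.map fun X Y n => (V X Y n).subtype) k, hV s k⟩
  multilinear :=
    { map_nil := fun X k => Subtype.ext (C.multilinear.map_nil X k)
      degree := fun s k h => Subtype.ext (C.multilinear.degree _ k (by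
        rwa [AStr.deg_map, AStr.len_map]))
      map_add := fun u n a b v k => Subtype.ext (by
        simp only [AStr.map_append, AStr.map, map_add, Submodule.coe_add]
        exact C.multilinear.map_add _ n _ _ _ k)
      map_smul := fun u n r a v k => Subtype.ext (by
        simp only [AStr.map_append, AStr.map, map_smul, Submodule.coe_smul]
        exact C.multilinear.map_smul _ n r _ _ k) }
  relation s k := Subtype.ext (by
    have := AStr.map_insertionSum (fun X Y n => (V X Y n).subtype)
      (fun {X Y} s k => (⟨C.μ (s.map fun X Y n => (V X Y n).subtype) k, hV s k⟩ : V X Y k))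
      C.μ (fun _ _ => rfl) s k
    rw [C.relation] at this
    exact this)

/-- This is the `A_∞`-relation for one input. No condition on `k` is needed, because the component
of `μ^1` in a wrong degree is zero. -/
lemma d_d (C : AInfCat O) {X Y : O} (n : ℤ) (a : C.hom X Y n) (k l : ℤ) :
    C.d k l (C.d n k a) = 0 := by
  by_cases hk : k = n + 1
  · subst hk
    have h := C.relation (.cons n a .nil) l
    have e3 := fun (j : ℤ) => C.μ_insert_zero (Y := Y) (Z := Y) .nil j (.cons n a .nil) l
    have e4 := fun (j : ℤ) => C.μ_insert_zero (X := X) (Y := X) (Z := X) (.cons n a .nil) j .nil l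
    simp only [AStr.append] at e3 e4
    simp only [insertionSum, AStr.splits, List.map_cons, List.map_nil, List.sum_cons,
      List.sum_nil, AStr.append, C.multilinear.map_nil, e3, e4] at h
    dsimp only [AStr.deg, AStr.len] at h
    rw [show n + 0 + 2 - ((0 + 1 : ℕ) : ℤ) = n + 1 by push_cast; ring] at h
    change C.μ (.cons (n + 1) (C.μ (.cons n a .nil) (n + 1)) .nil) l = 0
    simpa [sgn] using h
  · have : C.d n k a = 0 := C.multilinear.degree _ _ (by
      simp only [AStr.deg, AStr.len]; push_cast; omega)
    rw [this, map_zero]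

/-- The subspaces of the truncation in degrees at most zero. -/
def truncSub (C : AInfCat O) (X Y : O) (n : ℤ) : Submodule ℂ (C.hom X Y n) where
  carrier := {a | (0 < n → a = 0) ∧ (n = 0 → a ∈ C.Z X Y n)}
  add_mem' ha hb := ⟨fun h => by rw [ha.1 h, hb.1 h, add_zero],
    fun h => add_mem (ha.2 h) (hb.2 h)⟩
  zero_mem' := ⟨fun _ => rfl, fun _ => zero_mem _⟩
  smul_mem' r _ ha := ⟨fun h => by rw [ha.1 h, smul_zero],
    fun h => Submodule.smul_mem _ r (ha.2 h)⟩

/-- An entry of positive degree in the truncation is zero. Hence either the string has a zero entry,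
or all degrees are at most zero and so is their sum. -/
lemma truncSub_deg (C : AInfCat O) {X Y : O} (s : AStr (fun X Y n => C.truncSub X Y n) X Y) :
    s.deg ≤ 0 ∨ ∃ (Z W : O) (u : AStr C.hom W Y) (n : ℤ) (v : AStr C.hom X Z),
      s.map (fun X Y n => (C.truncSub X Y n).subtype) =
        u.append (.cons n (0 : C.hom Z W n) v) := by
  induction s with
  | nil => exact Or.inl le_rfl
  | @cons Y Z n a s ih =>
    rcases ih with ih | ⟨Z', W, u, n', v, h⟩
    · by_cases hn : 0 < n
      · refine Or.inr ⟨Y, Z, .nil, n, s.map fun X Y n => (C.truncSub X Y n).subtype, ?_⟩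
        rw [AStr.map]
        simp only [Submodule.subtype_apply, a.2.1 hn]
        rfl
      · left
        simp only [AStr.deg]; omega
    · exact Or.inr ⟨Z', W, .cons n a.1 u, n', v, by rw [AStr.map, h]; rfl⟩

/-- Since `μ^d` has degree `2 - d`, inputs of total degree at most zero give a negative degree when
`d ≥ 3`. For `d = 2` the value in degree zero comes from two cocycles or from a zero entry; for `d =
1` the cocycle condition in degree zero and `d ∘ d = 0` suffice. -/
lemma truncSub_closed (C : AInfCat O) {X Y : O}
    (s : AStr (fun X Y n => C.truncSub X Y n) X Y) (k : ℤ) :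
    C.μ (s.map fun X Y n => (C.truncSub X Y n).subtype) k ∈ C.truncSub X Y k := by
  rcases C.truncSub_deg s with hs | ⟨Z, W, u, n, v, h⟩
  swap
  · rw [h, C.μ_insert_zero]; exact zero_mem _
  by_cases hk : k = s.deg + 2 - s.len
  swap
  · rw [C.multilinear.degree _ k (by rwa [AStr.deg_map, AStr.len_map])]; exact zero_mem _
  match s, hs, hk with
  | .nil, _, _ => rw [AStr.map, C.multilinear.map_nil]; exact zero_mem _
  | .cons n a .nil, hs, hk =>
    simp only [AStr.deg, AStr.len] at hs hk
    push_cast at hk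
    change C.d n k a.1 ∈ _
    refine ⟨fun h => ?_, fun h => C.d_d n a.1 k (k + 1)⟩
    obtain rfl : n = 0 := by omega
    obtain rfl : k = 0 + 1 := by omega
    exact a.2.2 rfl
  | .cons m b (.cons n a .nil), hs, hk =>
    simp only [AStr.deg, AStr.len] at hs hk
    push_cast at hk
    refine ⟨fun h => by omega, fun h => ?_⟩
    by_cases hn : n = 0
    · exact C.m₂_mem_Z (b.2.2 (by omega)) (a.2.2 hn) k
    · rcases lt_or_gt_of_ne hn with hn | hn
      · have hb : b.1 = 0 := b.2.1 (by omega)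
        have e := C.μ_insert_zero (W := Y) .nil m (.cons n a.1 .nil) k
        simp only [AStr.append] at e
        simp only [AStr.map, Submodule.subtype_apply, hb]
        rw [e]
        exact zero_mem _
      · have ha : a.1 = 0 := a.2.1 hn
        have e := C.μ_insert_zero (X := X) (.cons m b.1 .nil) n .nil k
        simp only [AStr.map, Submodule.subtype_apply, ha]
        simp only [AStr.append] at e
        rw [e]
        exact zero_mem _
  | .cons _ _ (.cons _ _ (.cons _ _ s)), hs, hk =>
    simp only [AStr.len] at hk
    push_cast at hk
    refine ⟨fun h => by omega, fun h => by omega⟩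

/-- The truncation of an `A_∞`-category in degrees at most zero. -/
abbrev trunc (C : AInfCat O) : AInfCat O := C.sub C.truncSub C.truncSub_closed

/-- The inclusion of the truncation. -/
def truncIncl (C : AInfCat O) : AInfFunctor C.trunc C :=
  strictFunctor (fun X Y n => (C.truncSub X Y n).subtype) fun _ _ => rfl

lemma truncIncl_F₁ (C : AInfCat O) {X Y : O} {n : ℤ} (a : C.truncSub X Y n) :
    C.truncIncl.F₁ a = a.1 :=
  AStr.strictOp_single (M := fun X Y n => C.truncSub X Y n)
    (fun X Y n => (C.truncSub X Y n).subtype) n a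

lemma trunc_mem_Z {C : AInfCat O} {X Y : O} {n : ℤ} {a : C.truncSub X Y n} :
    a ∈ C.trunc.Z X Y n ↔ a.1 ∈ C.Z X Y n :=
  ⟨fun h => congrArg Subtype.val h, fun h => Subtype.ext h⟩

lemma trunc_mem_B {C : AInfCat O} {X Y : O} {n : ℤ} {a : C.truncSub X Y n}
    (h : a.1 ∈ C.B X Y n) : a ∈ C.trunc.B X Y n := by
  by_cases hn : 0 < n
  · have : a = 0 := Subtype.ext (a.2.1 hn)
    rw [this]; exact zero_mem _
  · obtain ⟨b, hb⟩ := h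
    exact ⟨⟨b, fun _ => by omega, fun _ => by omega⟩, Subtype.ext (by exact hb)⟩

/-- The truncation discards only the cohomology in positive degrees, which the hypothesis makes
zero. -/
lemma truncIncl_isQuasiIso {C : AInfCat O}
    (h : ∀ X Y n, 0 < n → ∀ a ∈ C.Z X Y n, a ∈ C.B X Y n) : C.truncIncl.IsQuasiIso := by
  intro X Y n
  refine ⟨fun a _ hb => trunc_mem_B ?_, fun b hb => ?_⟩
  · exact (truncIncl_F₁ C a) ▸ hb
  · by_cases hn : 0 < n
    · refine ⟨0, zero_mem _, ?_⟩
      have e : C.truncIncl.F₁ (0 : C.truncSub X Y n) - b = -b := by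
        rw [truncIncl_F₁, Submodule.coe_zero, zero_sub]
      exact e.symm ▸ neg_mem (h X Y n hn b hb)
    · refine ⟨⟨b, fun _ => by omega, fun _ => hb⟩, trunc_mem_Z.2 hb, ?_⟩
      rw [truncIncl_F₁, sub_self]
      exact zero_mem _

section projection

variable {C : AInfCat O} {A : DGCat O} (e : C.CohomologyIso A)

open Classical in
/-- The projection from the truncation to the cohomology in degree zero. -/
def truncProjMap (X Y : O) (n : ℤ) : C.truncSub X Y n →ₗ[ℂ] A.hom X Y n :=
  if h : n = 0 then
    (e.equiv X Y n).toLinearMap ∘ₗ Submodule.mkQ _ ∘ₗ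
      (C.truncSub X Y n).subtype.codRestrict (C.Z X Y n) fun a => a.2.2 h
  else 0

lemma truncProjMap_zero (X Y : O) (a : C.truncSub X Y 0) :
    truncProjMap e X Y 0 a = e.equiv X Y 0 (Submodule.Quotient.mk ⟨a.1, a.2.2 rfl⟩) := by
  unfold truncProjMap
  rw [dif_pos rfl]; rfl

/-- Only values in degree zero matter. There `μ^1` produces coboundaries, `μ^2` of cocycles is the
composition of classes, and `d ≥ 3` inputs would need total degree `d - 2 > 0`, which forces a zero
entry. -/
lemma truncProjMap_comm (hA : ∀ X Y n, n ≠ 0 → Subsingleton (A.hom X Y n)) {X Y : O}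
    (s : AStr (fun X Y n => C.truncSub X Y n) X Y) (k : ℤ) :
    truncProjMap e X Y k (C.trunc.μ s k) = A.mu (s.map (truncProjMap e)) k := by
  by_cases hk : k = 0
  swap
  · have := hA X Y k hk
    exact Subsingleton.elim _ _
  subst hk
  by_cases hd : (0 : ℤ) = s.deg + 2 - s.len
  swap
  · rw [C.trunc.multilinear.degree s 0 hd, map_zero,
      A.mu_multilinear.degree _ 0 (by rwa [AStr.deg_map, AStr.len_map])]
  have key : ∀ {X Y : O} (n : ℤ) (a : C.truncSub X Y n), n ≠ 0 →
      truncProjMap e X Y n a = 0 := fun {X Y} n a hn => by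
    have := hA X Y n hn
    exact Subsingleton.elim _ _
  match s, hd with
  | .nil, _ =>
    exact (congrArg _ (C.trunc.multilinear.map_nil X 0)).trans (map_zero _)
  | .cons n a .nil, hd =>
    simp only [AStr.deg, AStr.len] at hd
    push_cast at hd
    obtain rfl : n = 0 - 1 := by omega
    have e2 := A.mu_insert_zero (X := X) (Y := X) .nil (0 - 1) .nil 0 (Z := Y)
    simp only [AStr.map, key _ a (by omega)]
    refine Eq.trans ?_ e2.symm
    rw [truncProjMap_zero]
    have : (Submodule.Quotient.mk ⟨(C.trunc.μ (.cons (0 - 1) a .nil) 0).1,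
        (C.trunc.μ (.cons (0 - 1) a .nil) 0).2.2 rfl⟩ : C.H X Y 0) = 0 :=
      (Submodule.Quotient.mk_eq_zero _).2 ⟨a.1, rfl⟩
    exact (congrArg _ this).trans (map_zero _)
  | .cons m b (.cons n a .nil), hd =>
    simp only [AStr.deg, AStr.len] at hd
    push_cast at hd
    by_cases hn : n = 0
    · subst hn
      obtain rfl : m = 0 := by omega
      have h := e.map_comp (add_zero 0) ⟨b.1, b.2.2 rfl⟩ ⟨a.1, a.2.2 rfl⟩
      rw [sgn_zero, one_smul] at h
      rw [truncProjMap_zero]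
      refine h.trans ?_
      rw [AStr.map, AStr.map, AStr.map, A.mu_two _ _ (add_zero 0), sgn_zero, one_smul,
        truncProjMap_zero, truncProjMap_zero]
    · have hm : m ≠ 0 := by omega
      have e2 := A.mu_insert_zero (X := X) .nil m
        (.cons n (truncProjMap e _ _ n a) .nil) 0 (Z := Y)
      simp only [AStr.map, key _ b hm]
      refine Eq.trans ?_ e2.symm
      rcases lt_or_gt_of_ne hn with hn | hn
      · have hb : b = 0 := Subtype.ext (b.2.1 (by omega))
        have e3 := C.trunc.μ_insert_zero (W := Y) .nil m (.cons n a .nil) 0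
        subst hb
        exact (congrArg _ e3).trans (map_zero _)
      · have ha : a = 0 := Subtype.ext (a.2.1 hn)
        have e3 := C.trunc.μ_insert_zero (X := X) (.cons m b .nil) n .nil 0
        subst ha
        exact (congrArg _ e3).trans (map_zero _)
  | .cons _ b (.cons _ a (.cons _ c s)), hd =>
    refine Eq.trans ?_ (A.mu_of_len _ _ (by
      rw [AStr.len_map]; simp only [AStr.len]; omega)).symm
    rcases C.truncSub_deg (.cons _ b (.cons _ a (.cons _ c s))) with hs | ⟨Z, W, u, n, v, h⟩
    · simp only [AStr.deg, AStr.len] at hd hs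
      push_cast at hd
      omega
    · have h0 : C.trunc.μ (.cons _ b (.cons _ a (.cons _ c s))) 0 = 0 := Subtype.ext (by
        change C.μ (AStr.map _ _) 0 = 0
        refine (congrArg (C.μ · 0) h).trans ?_
        exact C.μ_insert_zero u n v 0)
      exact (congrArg _ h0).trans (map_zero _)

/-- The projection from the truncation to the cohomology in degree zero, as a strict functor. -/
def truncProj (hA : ∀ X Y n, n ≠ 0 → Subsingleton (A.hom X Y n)) :
    AInfFunctor C.trunc A.toAInf :=
  strictFunctor (A := C.trunc) (B := A.toAInf) (truncProjMap e) (truncProjMap_comm e hA)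

lemma truncProj_F₁ (hA : ∀ X Y n, n ≠ 0 → Subsingleton (A.hom X Y n)) {X Y : O} {n : ℤ}
    (a : C.truncSub X Y n) : (truncProj e hA).F₁ a = truncProjMap e X Y n a :=
  strictFunctor_F₁ (A := C.trunc) (B := A.toAInf) _ _ a

/-- Both legs of `C ← τ_{≤0} C → A` are strict and are quasi-isomorphisms: the left one because
positive cohomology vanishes, the right one because negative cohomology does and `e` identifies
degree zero. -/
theorem quasiIsomorphic_of_concentrated (e : C.CohomologyIso A)
    (hA : ∀ X Y n, n ≠ 0 → Subsingleton (A.hom X Y n)) : QuasiIsomorphic C A.toAInf := by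
  have hC : ∀ X Y n, n ≠ 0 → ∀ a ∈ C.Z X Y n, a ∈ C.B X Y n := by
    intro X Y n hn a ha
    have := hA X Y n hn
    have h0 : (Submodule.Quotient.mk ⟨a, ha⟩ : C.H X Y n) = 0 :=
      (e.equiv X Y n).injective (Subsingleton.elim _ _)
    exact (Submodule.Quotient.mk_eq_zero ((C.B X Y n).submoduleOf (C.Z X Y n))).1 h0
  refine Relation.EqvGen.trans _ C.trunc _ (.symm _ _ (.rel _ _ ⟨C.truncIncl, ?_⟩))
    (.rel _ _ ⟨truncProj e hA, ?_⟩)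
  · exact truncIncl_isQuasiIso fun X Y n hn => hC X Y n hn.ne'
  · intro X Y n
    by_cases hn : n = 0
    swap
    · have := hA X Y n hn
      refine ⟨fun a ha _ => trunc_mem_B (hC X Y n hn _ (trunc_mem_Z.1 ha)), fun b _ => ?_⟩
      refine ⟨0, zero_mem _, ?_⟩
      have hs : ∀ x : A.hom X Y n, x ∈ A.toAInf.B X Y n := fun x => by
        rw [Subsingleton.elim x 0]; exact zero_mem _
      exact hs _
    subst hn
    refine ⟨fun a ha hb => trunc_mem_B ?_, fun b _ => ?_⟩
    · have hb' : truncProjMap e X Y 0 a ∈ A.toAInf.B X Y 0 := truncProj_F₁ e hA a ▸ hb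
      obtain ⟨c, hc⟩ := hb'
      have := hA X Y (0 - 1) (by omega)
      have hc0 : c = 0 := Subsingleton.elim (α := A.hom X Y (0 - 1)) _ _
      rw [hc0, map_zero, truncProjMap_zero] at hc
      have h0 := (e.equiv X Y 0).injective (hc.symm.trans (map_zero _).symm)
      exact (Submodule.Quotient.mk_eq_zero ((C.B X Y 0).submoduleOf (C.Z X Y 0))).1 h0
    · obtain ⟨x, hx⟩ := (e.equiv X Y 0).surjective b
      obtain ⟨⟨a, ha⟩, rfl⟩ := Submodule.Quotient.mk_surjective _ x
      refine ⟨⟨a, fun h => absurd h (lt_irrefl _), fun _ => ha⟩, trunc_mem_Z.2 ha, ?_⟩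
      have e1 : (truncProj e hA).F₁
          (⟨a, fun h => absurd h (lt_irrefl _), fun _ => ha⟩ : C.truncSub X Y 0) = b := by
        rw [truncProj_F₁, truncProjMap_zero]; exact hx
      have e2 : (truncProj e hA).F₁
          (⟨a, fun h => absurd h (lt_irrefl _), fun _ => ha⟩ : C.truncSub X Y 0) - b = 0 :=
        sub_eq_zero.2 e1
      exact e2 ▸ zero_mem _

end projection

end AInfCat

namespace DGCat

variable {O : Type}

/-- A graded linear category concentrated in degree zero is intrinsically formal. -/
theorem intrinsicallyFormal_of_concentrated (A : DGCat O)
    (hA : ∀ X Y n, n ≠ 0 → Subsingleton (A.hom X Y n)) : A.IntrinsicallyFormal :=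
  fun _ ⟨e⟩ => AInfCat.quasiIsomorphic_of_concentrated e hA

lemma toAInf_Z (A : DGCat O) (X Y : O) (n : ℤ) : A.toAInf.Z X Y n = A.Z X Y n := by
  ext a
  have h : A.toAInf.d n (n + 1) a = sgn n • A.d rfl a := A.mu_one a rfl
  have hs : sgn n ≠ 0 := fun h => by simpa [h] using sgn_mul_self n
  change A.toAInf.d n (n + 1) a = 0 ↔ A.d rfl a = 0
  rw [h]
  exact smul_eq_zero_iff_right hs

lemma toAInf_B (A : DGCat O) (X Y : O) (n : ℤ) : A.toAInf.B X Y n = A.B X Y n := by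
  have h : ∀ a : A.hom X Y (n - 1), A.toAInf.d (n - 1) n a = sgn (n - 1) • A.d (sub_add_cancel n 1) a :=
    fun a => A.mu_one (X := X) (Y := Y) a (sub_add_cancel n 1)
  ext a
  constructor
  · rintro ⟨b, rfl⟩
    exact (h b).symm ▸ Submodule.smul_mem _ _ ⟨b, rfl⟩
  · rintro ⟨b, rfl⟩
    refine ⟨sgn (n - 1) • b, ?_⟩
    refine (map_smul (A.toAInf.d (X := X) (Y := Y) (n - 1) n) (sgn (n - 1)) b).trans ?_
    refine (congrArg _ (h b)).trans ?_
    change sgn (n - 1) • sgn (n - 1) • A.d (sub_add_cancel n 1) b = _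
    rw [smul_smul, sgn_mul_self, one_smul]

lemma sgn_smul_mu_two (A : DGCat O) {X Y Z : O} {m n k : ℤ} (h : m + n = k) (b : A.hom Y Z m)
    (a : A.hom X Y n) : sgn n • A.mu (.cons m b (.cons n a .nil)) k = A.comp h b a := by
  rw [A.mu_two _ _ h, smul_smul, sgn_mul_self, one_smul]

/-- The cohomology of a dg category agrees with that of the associated `A_∞`-category. -/
def toAInfCohomologyIso (A : DGCat O) : A.toAInf.CohomologyIso A.cohomology where
  equiv X Y n := Submodule.Quotient.equiv _ _ (LinearEquiv.ofEq _ _ (A.toAInf_Z X Y n)) (by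
    rw [toAInf_B]
    ext ⟨a, ha⟩
    simp only [Submodule.mem_map, Submodule.submoduleOf, Submodule.mem_comap,
      Submodule.subtype_apply]
    constructor
    · rintro ⟨b, hb, h⟩
      have h' : b.1 = a := congrArg Subtype.val h
      exact h' ▸ hb
    · intro h
      exact ⟨⟨a, (A.toAInf_Z X Y n).symm ▸ ha⟩, h, rfl⟩)
  map_comp {X Y W m n k} h b a := by
    refine congrArg (Submodule.Quotient.mk (p := (A.B X W k).submoduleOf (A.Z X W k)))
      (a₁ := LinearEquiv.ofEq _ _ (A.toAInf_Z X W k)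
        (sgn n • ⟨A.toAInf.m₂ b.1 a.1 k, A.toAInf.m₂_mem_Z b.2 a.2 k⟩))
      (a₂ := ⟨A.comp h b.1 a.1, comp_mem_Z h (A.toAInf_Z Y W m ▸ b.2)
        (A.toAInf_Z X Y n ▸ a.2)⟩) (Subtype.ext ?_)
    exact A.sgn_smul_mu_two h b.1 a.1

end DGCat

/-! ### Subgroups of finite index of the symmetry group -/

/-- The character `(s, t) ↦ s^a t^b`. -/
def torusCharacter (a b : ℤ) : ℂˣ × ℂˣ →* ℂˣ where
  toFun g := g.1 ^ a * g.2 ^ b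
  map_one' := by simp
  map_mul' g h := by simp only [Prod.fst_mul, Prod.snd_mul, mul_zpow]; exact mul_mul_mul_comm _ _ _ _

lemma mem_loopSymmetryGroup {p q : ℕ} (hp : 1 ≤ p) (hq : 1 ≤ q) (g : ℂˣ × ℂˣ) :
    g ∈ loopSymmetryGroup p q ↔ g.1 ^ (p - 1) = g.2 ^ (q - 1) := by
  obtain ⟨p, rfl⟩ := Nat.exists_eq_add_of_le' hp
  obtain ⟨q, rfl⟩ := Nat.exists_eq_add_of_le' hq
  change g.1 ^ (p + 1) * g.2 = g.2 ^ (q + 1) * g.1 ↔ _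
  rw [pow_succ, pow_succ, mul_assoc, mul_assoc, mul_comm g.2 g.1, Nat.add_sub_cancel,
    Nat.add_sub_cancel]
  exact mul_left_inj _

lemma exists_pow_eq_unit {n : ℕ} (hn : n ≠ 0) (u : ℂˣ) : ∃ v : ℂˣ, v ^ n = u := by
  obtain ⟨z, hz⟩ := IsAlgClosed.exists_pow_nat_eq (u : ℂ) (Nat.pos_of_ne_zero hn)
  have hz0 : z ≠ 0 := by
    rintro rfl
    rw [zero_pow hn] at hz
    exact u.ne_zero hz.symm
  exact ⟨Units.mk0 z hz0, Units.ext (by simpa using hz)⟩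

section

variable {P Q g ℓ : ℕ} (hP : 0 < P) (hg : 0 < g) (hPQ : Nat.Coprime P Q)
  {Γ : Subgroup (ℂˣ × ℂˣ)} (hΓ : Γ ≤ loopSymmetryGroup (P * g + 1) (Q * g + 1)) (hℓ : ℓ ≠ 0)
  (hidx : Γ.relIndex (loopSymmetryGroup (P * g + 1) (Q * g + 1)) = ℓ)

include hPQ in
-- By Bézout `1 = P α + Q β`, the parameter is `u = s^β t^α`; the relation `s^P = t^Q` turns `u^Q`
-- into `s` and `u^P` into `t`.
lemma exists_param {s t : ℂˣ} (h : s ^ P = t ^ Q) : ∃ u : ℂˣ, s = u ^ Q ∧ t = u ^ P := by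
  have hb := Nat.gcd_eq_gcd_ab P Q
  rw [hPQ.gcd_eq_one] at hb
  have h' : s ^ (P : ℤ) = t ^ (Q : ℤ) := by exact_mod_cast h
  refine ⟨s ^ (P.gcdB Q) * t ^ (P.gcdA Q), ?_, ?_⟩
  · rw [mul_pow, ← zpow_natCast, ← zpow_natCast, ← zpow_mul, ← zpow_mul,
      mul_comm (P.gcdA Q), zpow_mul t, ← h', ← zpow_mul, ← zpow_add]
    conv_lhs => rw [← zpow_one s]
    congr 1
    push_cast at hb
    linarith
  · rw [mul_pow, ← zpow_natCast, ← zpow_natCast, ← zpow_mul, ← zpow_mul,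
      mul_comm (P.gcdB Q), zpow_mul s, h', ← zpow_mul, ← zpow_add]
    conv_lhs => rw [← zpow_one t]
    congr 1
    push_cast at hb
    linarith

include hℓ hidx in
-- The one-parameter group is divisible: `v = u^ℓ`, and the `ℓ`-th power of an element of an abelian
-- group lies in any subgroup of index `ℓ`.
lemma param_mem (v : ℂˣ) : (v ^ Q, v ^ P) ∈ Γ := by
  obtain ⟨u, rfl⟩ := exists_pow_eq_unit hℓ v
  have hu : (u ^ Q, u ^ P) ∈ loopSymmetryGroup (P * g + 1) (Q * g + 1) := by
    rw [mem_loopSymmetryGroup (by omega) (by omega)]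
    simp only [Nat.add_sub_cancel]
    rw [← pow_mul, ← pow_mul]; congr 1; ring
  have := (Γ.subgroupOf (loopSymmetryGroup (P * g + 1) (Q * g + 1))).pow_index_mem ⟨_, hu⟩
  change _ ^ (Γ.relIndex (loopSymmetryGroup (P * g + 1) (Q * g + 1))) ∈ _ at this
  rw [hidx, Subgroup.mem_subgroupOf] at this
  convert this using 1
  ext <;> simp [← pow_mul, mul_comm]

include hP hg hPQ hΓ hℓ hidx in
-- `N` is the order of the image of `Γ` under `χ`. As `Γ` contains `ker χ`, the index of `Γ` can be
-- computed after applying `χ`, inside the cyclic group of `g`-th roots of unity.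
lemma relIndex_data : ∃ N : ℕ, g = ℓ * N ∧ ∀ a b : ℤ, (∀ γ ∈ Γ, γ.1 ^ a * γ.2 ^ b = 1) ↔
    ∃ s : ℤ, a = s * (P * N) ∧ b = -(s * (Q * N)) := by
  set χ := torusCharacter P (-Q) with hχ
  set G := loopSymmetryGroup (P * g + 1) (Q * g + 1) with hG
  have hχa : ∀ γ : ℂˣ × ℂˣ, χ γ = γ.1 ^ P * (γ.2 ^ Q)⁻¹ := fun γ => by
    change γ.1 ^ (P : ℤ) * γ.2 ^ (-(Q : ℤ)) = _
    rw [zpow_neg, zpow_natCast, zpow_natCast]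
  have hker : χ.ker ≤ Γ := by
    rintro ⟨s, t⟩ h
    rw [MonoidHom.mem_ker, hχa, mul_inv_eq_one] at h
    obtain ⟨u, rfl, rfl⟩ := exists_param hPQ h
    exact param_mem hℓ hidx u
  have hmap : G.map χ = rootsOfUnity g ℂ := by
    ext z
    rw [mem_rootsOfUnity, Subgroup.mem_map]
    constructor
    · rintro ⟨γ, hγ, rfl⟩
      rw [hG, mem_loopSymmetryGroup (by omega) (by omega)] at hγ
      simp only [Nat.add_sub_cancel] at hγ
      rw [hχa, mul_pow, inv_pow, ← pow_mul, ← pow_mul, hγ, mul_inv_cancel]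
    · intro hz
      obtain ⟨s, hs⟩ := exists_pow_eq_unit hP.ne' z
      refine ⟨(s, 1), ?_, by rw [hχa]; simp [hs]⟩
      rw [hG, mem_loopSymmetryGroup (by omega) (by omega)]
      simp only [Nat.add_sub_cancel]
      rw [pow_mul, hs, hz, one_pow]
  have hg' : NeZero g := ⟨hg.ne'⟩
  have hcard : Nat.card (rootsOfUnity g ℂ) = g := Complex.card_rootsOfUnity g
  have hrel : (Γ.map χ).relIndex (G.map χ) = ℓ := by
    rw [Subgroup.relIndex_map_map, sup_eq_left.2 hker, sup_eq_left.2 (hker.trans hΓ), hidx]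
  set H := Γ.map χ with hH
  have hHle : H ≤ G.map χ := Subgroup.map_mono hΓ
  have hHcard : Nat.card H * ℓ = g := by
    have := Subgroup.relIndex_mul_relIndex ⊥ H (G.map χ) bot_le hHle
    rw [hrel, hmap, Subgroup.relIndex_bot_left, Subgroup.relIndex_bot_left, hcard] at this
    exact this
  have hHfin : Finite H := Nat.finite_of_card_ne_zero (by
    rintro h0; rw [h0, zero_mul] at hHcard; omega)
  refine ⟨Nat.card H, by rw [← hHcard, mul_comm], fun a b => ⟨fun h => ?_, ?_⟩⟩
  -- Testing the character on the one-parameter group at `u = 2`, which is not a root of unity,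
  -- forces `Q a + P b = 0`, so the character is a power `χ^c`.
  · have h2 : (Units.mk0 (2 : ℂ) two_ne_zero) ^ ((Q : ℤ) * a + P * b) = 1 := by
      have := h _ (param_mem hℓ hidx (Units.mk0 (2 : ℂ) two_ne_zero))
      rw [← this, zpow_add, zpow_mul, zpow_mul, zpow_natCast, zpow_natCast]
    have h3 : ((2 : ℝ)) ^ ((Q : ℤ) * a + P * b) = 1 := by
      have := congrArg (fun u : ℂˣ => (u : ℂ)) h2
      simp only [Units.val_zpow_eq_zpow_val, Units.val_mk0, Units.val_one] at this
      have h' := congrArg (‖·‖) this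
      simpa [norm_zpow] using h'
    have h4 : (Q : ℤ) * a + P * b = 0 := by
      refine (zpow_right_injective₀ (a := (2 : ℝ)) (by norm_num) (by norm_num)) ?_
      simpa using h3
    have h5 : (P : ℤ) ∣ a := by
      have : IsCoprime (P : ℤ) (Q : ℤ) := Nat.isCoprime_iff_coprime.2 hPQ
      refine this.dvd_of_dvd_mul_left ⟨-b, by linarith⟩
    obtain ⟨c, rfl⟩ := h5
    have hb : b = -(Q * c) := by
      have : (P : ℤ) * (Q * c + b) = 0 := by linarith
      rcases mul_eq_zero.1 this with h | h
      · omega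
      · omega
    subst hb
    -- On a generator of the cyclic image the power `c` is trivial, so `N` divides `c`.
    have hcyc : IsCyclic H := isCyclic_subgroup_units H
    obtain ⟨z, hz⟩ := hcyc.exists_ofOrder_eq_natCard
    obtain ⟨γ, hγ, hγz⟩ := z.2
    have h6 : z ^ c = 1 := by
      ext
      have := h γ hγ
      rw [zpow_mul, zpow_neg, zpow_mul, ← inv_zpow, ← mul_zpow, zpow_natCast, zpow_natCast,
        ← hχa, hγz] at this
      simpa using congrArg (fun u : ℂˣ => (u : ℂ)) this
    obtain ⟨s, rfl⟩ := (orderOf_dvd_iff_zpow_eq_one).2 h6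
    rw [hz]
    exact ⟨s, by ring, by ring⟩
  · rintro ⟨s, rfl, rfl⟩ γ hγ
    have h1 : χ γ ^ Nat.card H = 1 := by
      have := pow_card_eq_one' (x := (⟨χ γ, Subgroup.mem_map_of_mem χ hγ⟩ : H))
      exact congrArg Subtype.val this
    have h2 : (χ γ ^ Nat.card H) ^ s = 1 := by rw [h1, one_zpow]
    rw [← h2, hχa, ← zpow_natCast (γ.1 ^ P * _), ← zpow_mul, mul_zpow, inv_zpow,
      ← zpow_natCast γ.1, ← zpow_natCast γ.2, ← zpow_mul, ← zpow_mul, ← zpow_neg]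
    congr 2 <;> ring

end

/-! ### The grading group and the loop datum attached to a subgroup -/

namespace LoopDatum

lemma smul_add_smul (D : LoopDatum) (a b : ℤ) :
    a • D.xv + b • D.yv = QuotientAddGroup.mk (a, b) := by
  have : (a, b) = a • ((1 : ℤ), (0 : ℤ)) + b • ((0 : ℤ), (1 : ℤ)) := by ext <;> simp
  rw [this]; rfl

lemma smul_add_smul_eq_zero (D : LoopDatum) (a b : ℤ) :
    a • D.xv + b • D.yv = 0 ↔ ∃ s : ℤ, a = s * D.m ∧ b = -(s * D.n) := by
  rw [smul_add_smul, QuotientAddGroup.eq_zero_iff, AddSubgroup.mem_zmultiples_iff]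
  constructor
  · rintro ⟨s, h⟩
    simp only [Prod.smul_mk, Prod.mk.injEq, smul_eq_mul] at h
    exact ⟨s, h.1.symm, by rw [← h.2]; ring⟩
  · rintro ⟨s, rfl, rfl⟩
    exact ⟨s, by simp⟩

/-- The count is `m (q-1) + m + n + ℓ`, and `p q - 1 = ℓ (m q + n)` follows from `p = ℓ m + 1` and
`q = ℓ n + 1`. -/
lemma card_obj (D : LoopDatum) : Fintype.card D.Obj = (D.p * D.q - 1) / D.l + D.l := by
  rw [Fintype.card_congr D.objEquiv]
  simp only [Fintype.card_sum, Fintype.card_prod, Fintype.card_coe, Nat.card_Icc]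
  have hl := D.l_pos
  have hp := D.p_eq
  have hq := D.q_eq
  have hm : D.m ≤ D.l * D.m := Nat.le_mul_of_pos_left _ hl
  have hn : D.n ≤ D.l * D.n := Nat.le_mul_of_pos_left _ hl
  have e : (D.p * D.q - 1) / D.l = D.m * D.q + D.n := by
    have : D.p * D.q - 1 = D.l * (D.m * D.q + D.n) := by
      rw [hp, Nat.add_mul]
      have : D.l * D.m * D.q + 1 * D.q = D.l * (D.m * D.q + D.n) + 1 := by
        rw [mul_add, ← mul_assoc]; omega
      omega
    rw [this, Nat.mul_div_cancel_left _ hl]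
  rw [e, show D.p - 1 + 1 - (D.p - D.m) = D.m by omega, show D.q - 1 + 1 - 1 = D.q - 1 by omega,
    show D.q - 1 + 1 - (D.q - D.n) = D.n by omega, show D.l + 1 - 1 = D.l by omega]
  have : D.m * D.q = D.m * (D.q - 1) + D.m := by
    rw [← Nat.mul_succ]; congr 1; omega
  omega

end LoopDatum

/-- A subgroup of finite index of the symmetry group gives rise to a loop datum. -/
theorem exists_loopDatum (p q ℓ : ℕ) (hp : 2 ≤ p) (hq : 2 ≤ q) (Γ : Subgroup (ℂˣ × ℂˣ))
    (hΓ : Γ ≤ loopSymmetryGroup p q) (hℓ : ℓ ≠ 0)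
    (hidx : Γ.relIndex (loopSymmetryGroup p q) = ℓ) (η : ℂ) (hη : IsPrimitiveRoot η ℓ) :
    ∃ D : LoopDatum, D.p = p ∧ D.q = q ∧ D.l = ℓ ∧ D.η = η ∧
      ∀ a b : ℤ, a • D.xv + b • D.yv = 0 ↔ ∀ g ∈ Γ, g.1 ^ a * g.2 ^ b = 1 := by
  obtain ⟨p, rfl⟩ := Nat.exists_eq_add_of_le' (show 1 ≤ p by omega)
  obtain ⟨q, rfl⟩ := Nat.exists_eq_add_of_le' (show 1 ≤ q by omega)
  have hg : 0 < Nat.gcd p q := Nat.gcd_pos_of_pos_left _ (by omega)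
  obtain ⟨P, Q, hPQ, hP, hQ⟩ := Nat.exists_coprime p q
  set g := Nat.gcd p q
  have hP0 : 0 < P := Nat.pos_of_ne_zero (by rintro rfl; omega)
  rw [hP, hQ] at hΓ hidx
  obtain ⟨N, hN, h⟩ := relIndex_data hP0 hg hPQ hΓ hℓ hidx
  -- Here `p` and `q` stand for the original exponents minus one, so that `m = P N` and `n = Q N`.
  have e1 : p = ℓ * (P * N) := by rw [hP, hN]; ring
  have e2 : q = ℓ * (Q * N) := by rw [hQ, hN]; ring
  refine ⟨⟨p + 1, q + 1, ℓ, η, hp, hq, ⟨P * N, e1⟩, ⟨Q * N, e2⟩, hη⟩, rfl, rfl, rfl, rfl, ?_⟩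
  intro a b
  rw [h, LoopDatum.smul_add_smul_eq_zero]
  have e3 : p / ℓ = P * N := by rw [e1, Nat.mul_div_cancel_left _ (Nat.pos_of_ne_zero hℓ)]
  have e4 : q / ℓ = Q * N := by rw [e2, Nat.mul_div_cancel_left _ (Nat.pos_of_ne_zero hℓ)]
  simp only [LoopDatum.m, LoopDatum.n, Nat.add_sub_cancel, e3, e4]
  push_cast
  rfl

/-! ### Homogeneous linear systems -/

section

open MvPolynomial Matrix

variable {L : Type} [AddCommGroup L] {wt : Fin 2 → L}

/-- All monomials of `f` have degree `d`, and degrees cancel in the group `L`; so a product of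
monomials has degree `d + e` exactly when the second one has degree `e`. -/
lemma weightedHomogeneousComponent_mul {f : MvPolynomial (Fin 2) ℂ} {d : L}
    (hf : IsWeightedHomogeneous wt f d) (e : L) (h : MvPolynomial (Fin 2) ℂ) :
    weightedHomogeneousComponent wt (d + e) (f * h) =
      f * weightedHomogeneousComponent wt e h := by
  classical
  ext n
  rw [coeff_weightedHomogeneousComponent, coeff_mul, coeff_mul]
  by_cases hn : Finsupp.weight wt n = d + e
  · rw [if_pos hn]
    refine Finset.sum_congr rfl fun x hx => ?_
    rw [Finset.HasAntidiagonal.mem_antidiagonal] at hx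
    by_cases h1 : coeff x.1 f = 0
    · rw [h1, zero_mul, zero_mul]
    · rw [coeff_weightedHomogeneousComponent, if_pos]
      rw [← hx, map_add, hf h1] at hn
      exact add_left_cancel hn
  · rw [if_neg hn]
    refine (Finset.sum_eq_zero fun x hx => ?_).symm
    rw [Finset.HasAntidiagonal.mem_antidiagonal] at hx
    by_cases h1 : coeff x.1 f = 0
    · rw [h1, zero_mul]
    · rw [coeff_weightedHomogeneousComponent, if_neg, mul_zero]
      intro h2
      exact hn (by rw [← hx, map_add, hf h1, h2])

/-- A homogeneous linear system which has a solution has a homogeneous solution. -/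
lemma exists_homogeneous_solution {α β : Type} [Fintype α]
    {M : Matrix β α (MvPolynomial (Fin 2) ℂ)} {o : β → L} {e : α → L}
    (hM : ∀ b a, IsWeightedHomogeneous wt (M b a) (o b - e a)) {v : β → MvPolynomial (Fin 2) ℂ}
    {τ : L} (hv : ∀ b, IsWeightedHomogeneous wt (v b) (o b - τ))
    {w : α → MvPolynomial (Fin 2) ℂ} (hw : ∀ b, ∑ a, M b a * w a = v b) :
    ∃ w' : α → MvPolynomial (Fin 2) ℂ, (∀ a, IsWeightedHomogeneous wt (w' a) (e a - τ)) ∧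
      (∀ b, ∑ a, M b a * w' a = v b) ∧ ∀ a, w a = 0 → w' a = 0 := by
  refine ⟨fun a => weightedHomogeneousComponent wt (e a - τ) (w a),
    fun a => weightedHomogeneousComponent_isWeightedHomogeneous _ _, fun b => ?_, fun a ha => ?_⟩
  · rw [← (hv b).weightedHomogeneousComponent_same, ← hw b, map_sum]
    refine Finset.sum_congr rfl fun a _ => ?_
    rw [← weightedHomogeneousComponent_mul (hM b a), sub_add_sub_cancel]
  · beta_reduce
    rw [ha, map_zero]

/-- A homogeneous divisor of a homogeneous polynomial has a homogeneous cofactor. -/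
lemma exists_homogeneous_cofactor {f h : MvPolynomial (Fin 2) ℂ} {d e : L}
    (hf : IsWeightedHomogeneous wt f d) (hh : IsWeightedHomogeneous wt h (d + e)) (hfh : f ∣ h) :
    ∃ u, IsWeightedHomogeneous wt u e ∧ h = f * u := by
  obtain ⟨u, rfl⟩ := hfh
  refine ⟨weightedHomogeneousComponent wt e u,
    weightedHomogeneousComponent_isWeightedHomogeneous _ _, ?_⟩
  rw [← weightedHomogeneousComponent_mul hf, hh.weightedHomogeneousComponent_same]

end

/-! ### Morphisms of matrix factorisations -/

namespace GradedMF

open MvPolynomial Matrix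

variable {L : Type} [AddCommGroup L] {wt : Fin 2 → L} {W : MvPolynomial (Fin 2) ℂ} {c : L}
  {K K' : GradedMF wt W c}

lemma deg_add_mul (K : GradedMF wt W c) (i r : ℤ) (a : Fin K.rk) :
    K.deg (i + 2 * r) a = K.deg i a + r • c := by
  induction r using Int.induction_on with
  | zero => simp
  | succ r ih => rw [mul_add, ← add_assoc, mul_one, K.deg_add_two, ih, add_smul, one_smul]; abel
  | pred r ih =>
    have := K.deg_add_two (i + 2 * (-(r : ℤ) - 1)) a
    rw [show i + 2 * (-(r : ℤ) - 1) + 2 = i + 2 * -(r : ℤ) by ring, ih] at this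
    rw [← sub_eq_iff_eq_add.2 this, sub_smul, one_smul]; abel

lemma periodic_add_mul {V : Type} {f : ℤ → V} (hf : ∀ i, f (i + 2) = f i) (i r : ℤ) :
    f (i + 2 * r) = f i := by
  induction r using Int.induction_on with
  | zero => simp
  | succ r ih => rw [mul_add, ← add_assoc, mul_one, hf, ih]
  | pred r ih =>
    rw [← hf, ← ih]; congr 1; ring

lemma d_add_mul (K : GradedMF wt W c) (i r : ℤ) : K.d (i + 2 * r) = K.d i :=
  periodic_add_mul K.d_add_two i r

/-- Morphisms with prescribed components in two consecutive degrees. -/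
lemma exists_hom {n i j : ℤ} (h : i + n = j)
    {F G : Matrix (Fin K'.rk) (Fin K.rk) (MvPolynomial (Fin 2) ℂ)}
    (hF : ∀ b a, IsWeightedHomogeneous wt (F b a) (K'.deg j b - K.deg i a))
    (hG : ∀ b a, IsWeightedHomogeneous wt (G b a) (K'.deg (j + 1) b - K.deg (i + 1) a)) :
    ∃ f : homSub K K' n, f.1 i = F ∧ f.1 (i + 1) = G := by
  subst h
  refine ⟨⟨fun k => if Even (k - i) then F else G, fun k b a => ?_, fun k => ?_⟩, ?_, ?_⟩
  · beta_reduce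
    rcases Int.even_or_odd (k - i) with hk | hk
    · rw [if_pos hk]
      obtain ⟨r, hr⟩ := hk
      obtain rfl : k = i + 2 * r := by omega
      rw [K.deg_add_mul, show i + 2 * r + n = i + n + 2 * r by ring, K'.deg_add_mul,
        add_sub_add_right_eq_sub]
      exact hF b a
    · rw [if_neg (Int.not_even_iff_odd.2 hk)]
      obtain ⟨r, hr⟩ := hk
      obtain rfl : k = i + 1 + 2 * r := by omega
      rw [K.deg_add_mul, show i + 1 + 2 * r + n = i + n + 1 + 2 * r by ring, K'.deg_add_mul,
        add_sub_add_right_eq_sub]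
      exact hG b a
  · beta_reduce
    rw [show k + 2 - i = k - i + 2 by ring]
    simp only [Int.even_add, even_two, iff_true]
  · simp
  · simp

variable (hW : W ≠ 0)
include hW

/-- Multiplying once more by the preceding differential turns `M d` into `W M`, and `W` is not a
zero divisor. -/
lemma eq_zero_of_mul_d {k : ℕ} {i : ℤ}
    {M : Matrix (Fin k) (Fin K.rk) (MvPolynomial (Fin 2) ℂ)} (h : M * K.d i = 0) : M = 0 := by
  have h1 : M * K.d (i - 1 + 1) * K.d (i - 1) = 0 := by
    rw [sub_add_cancel, h, Matrix.zero_mul]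
  rw [Matrix.mul_assoc, K.d_mul_d, Matrix.mul_smul, Matrix.mul_one] at h1
  exact (smul_eq_zero.1 h1).resolve_left hW

/-- A closed morphism is determined by any of its components. -/
lemma eq_zero_of_closed {n k : ℤ} (h : n + 1 = k) {f : homSub K K' n} (hf : homD K K' h f = 0)
    {j : ℤ} (hj : f.1 j = 0) : f = 0 := by
  have key : f.1 (j + 1) = 0 := by
    have h1 := congrArg (fun g : homSub K K' k => g.1 j) hf
    simp only [homD_apply, hj, Matrix.mul_zero, zero_sub] at h1
    have h2 : sgn n • (f.1 (j + 1) * K.d j) = 0 := neg_eq_zero.1 h1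
    have hs : sgn n ≠ 0 := fun h => by simpa [h] using sgn_mul_self n
    exact eq_zero_of_mul_d hW ((smul_eq_zero.1 h2).resolve_left hs)
  ext1
  funext i
  change f.1 i = 0
  rcases Int.even_or_odd (i - j) with ⟨r, hr⟩ | ⟨r, hr⟩
  · obtain rfl : i = j + 2 * r := by omega
    rw [periodic_add_mul f.2.2, hj]
  · obtain rfl : i = j + 1 + 2 * r := by omega
    rw [periodic_add_mul f.2.2, key]

/-- The differential of `f` is closed, so it vanishes once one of its components does. -/
lemma mem_Z_of_comp {n : ℤ} {f : homSub K K' n} (j : ℤ)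
    (hj : K'.d (j + n) * f.1 j = sgn n • (f.1 (j + 1) * K.d j)) :
    f ∈ (mfCat wt W c).Z K K' n := by
  refine eq_zero_of_closed hW (rfl : n + 1 + 1 = n + 1 + 1) (f := homD K K' rfl f)
    ((mfCat wt W c).d_d rfl rfl f) (j := j) ?_
  rw [homD_apply, hj, sub_self]

/-- The difference of `f` and the differential of `g` is closed, hence zero as soon as one component
is; exactness needs checking in one degree only. -/
lemma mem_B_of_comp {n m : ℤ} (hm : m + 1 = n) {f : homSub K K' n}
    (hf : f ∈ (mfCat wt W c).Z K K' n) (g : homSub K K' m) (j : ℤ)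
    (hj : f.1 j = K'.d (j + m) * g.1 j - sgn m • (g.1 (j + 1) * K.d j)) :
    f ∈ (mfCat wt W c).B K K' n := by
  refine (DGCat.mem_B hm).2 ⟨g, ?_⟩
  have h1 : f - homD K K' hm g = 0 := by
    refine eq_zero_of_closed hW (rfl : n + 1 = n + 1) ?_ (j := j) ?_
    · rw [map_sub]
      have e1 : homD K K' rfl f = 0 := hf
      have e2 : homD K K' (rfl : n + 1 = n + 1) (homD K K' hm g) = 0 :=
        (mfCat wt W c).d_d hm rfl g
      rw [e1, e2, sub_zero]
    · change f.1 j - (homD K K' hm g).1 j = 0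
      rw [homD_apply, hj, sub_self]
  exact (sub_eq_zero.1 h1).symm

omit hW in
lemma closed_comp {n : ℤ} {f : homSub K K' n} (hf : f ∈ (mfCat wt W c).Z K K' n) (j : ℤ) :
    K'.d (j + n) * f.1 j = sgn n • (f.1 (j + 1) * K.d j) := by
  have h : homD K K' rfl f = 0 := hf
  have h1 := congrArg (fun g : homSub K K' (n + 1) => g.1 j) h
  exact sub_eq_zero.1 h1

omit hW in
lemma sgn_ne_zero (n : ℤ) : sgn n ≠ 0 := fun h => by simpa [h] using sgn_mul_self n

/-! #### Targets which resolve a quotient of `S` -/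

section Quotient

-- The hypothesis `hK` says that every syzygy of row `e` of `K'^{-1} → K'^0` comes from the columns
-- of `K'^{-2} → K'^{-1}` other than column `e`. So `K'` is the stabilisation of `S/I`, with `I`
-- generated by the entries of that row.
variable {e : Fin K'.rk}
  (hK : ∀ v : Fin K'.rk → MvPolynomial (Fin 2) ℂ, ∑ b, K'.d (-1) e b * v b = 0 →
    ∃ w : Fin K'.rk → MvPolynomial (Fin 2) ℂ,
      w e = 0 ∧ ∀ b, ∑ a, K'.d (-2) b a * w a = v b)
include hK

/-- If the row `e` of `K'^{-1} → K'^0` is a resolution of length two of `S / I`, then a closed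
morphism to `K'` is exact if the relevant row has entries in `I`. -/
lemma mem_B_of_row {n : ℤ} {f : homSub K K' n} (hf : f ∈ (mfCat wt W c).Z K K' n)
    (hrow : ∀ a, ∃ u : Fin K'.rk → MvPolynomial (Fin 2) ℂ,
      f.1 (-n) e a = ∑ b, K'.d (-1) e b * u b) :
    f ∈ (mfCat wt W c).B K K' n := by
  have hdeg : ∀ b, IsWeightedHomogeneous wt (K'.d (-1) e b) (K'.deg 0 e - K'.deg (-1) b) :=
    fun b => by simpa using K'.homogeneous (-1) e b
  have hf0 : ∀ a, IsWeightedHomogeneous wt (f.1 (-n) e a) (K'.deg 0 e - K.deg (-n) a) :=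
    fun a => by simpa using f.2.1 (-n) e a
  have h1 : ∀ a, ∃ u : Fin K'.rk → MvPolynomial (Fin 2) ℂ,
      (∀ b, IsWeightedHomogeneous wt (u b) (K'.deg (-1) b - K.deg (-n) a)) ∧
      ∑ b, K'.d (-1) e b * u b = f.1 (-n) e a := by
    intro a
    obtain ⟨u, hu⟩ := hrow a
    obtain ⟨u', h1, h2, _⟩ := exists_homogeneous_solution (β := Unit) (M := fun _ b => K'.d (-1) e b)
      (o := fun _ => K'.deg 0 e) (e := fun b => K'.deg (-1) b) (fun _ => hdeg)
      (v := fun _ => f.1 (-n) e a) (τ := K.deg (-n) a) (fun _ => hf0 a) (w := u) fun _ => hu.symm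
    exact ⟨u', h1, h2 ()⟩
  choose u hu1 hu2 using h1
  -- A homotopy with only one parity of components: it changes row `e` of `f` in degree `-n` by
  -- exactly the chosen element of `I`, so that row of `f1` becomes zero.
  obtain ⟨g, hg1, hg2⟩ := exists_hom (K := K) (K' := K') (n := n - 1)
    (show -n + (n - 1) = -1 by ring) (F := Matrix.of fun b a => u a b) (G := 0)
    (fun b a => hu1 a b) (fun b a => isWeightedHomogeneous_zero _ _ _)
  set f1 := f - homD K K' (sub_add_cancel n 1) g with hf1
  have hgB : homD K K' (sub_add_cancel n 1) g ∈ (mfCat wt W c).B K K' n := ⟨g, rfl⟩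
  have hgZ : homD K K' (sub_add_cancel n 1) g ∈ (mfCat wt W c).Z K K' n :=
    (mfCat wt W c).d_d (sub_add_cancel n 1) rfl g
  have hf1Z : f1 ∈ (mfCat wt W c).Z K K' n := sub_mem hf hgZ
  have hrow0 : ∀ a, f1.1 (-n) e a = 0 := by
    intro a
    have : f1.1 (-n) = f.1 (-n) - (K'.d (-n + (n - 1)) * g.1 (-n) -
      sgn (n - 1) • (g.1 (-n + 1) * K.d (-n))) := rfl
    rw [this, hg1, hg2, Matrix.zero_mul, smul_zero, sub_zero, show -n + (n - 1) = -1 by ring,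
      Matrix.sub_apply, Matrix.mul_apply, ← hu2 a]
    exact sub_self _
  -- With row `e` in degree `-n` gone, closedness says that the columns of the preceding component
  -- are syzygies; by `hK` they are boundaries, which gives a second homotopy.
  have h2 : ∀ a, ∃ w : Fin K'.rk → MvPolynomial (Fin 2) ℂ,
      (∀ b, IsWeightedHomogeneous wt (w b) (K'.deg (-2) b - K.deg (-n - 1) a)) ∧
      ∀ b, ∑ a', K'.d (-2) b a' * w a' = f1.1 (-n - 1) b a := by
    intro a
    have hc := congrFun (congrFun (closed_comp hf1Z (-n - 1)) e) a
    rw [show -n - 1 + n = -1 by ring, sub_add_cancel, Matrix.smul_apply, Matrix.mul_apply,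
      Matrix.mul_apply, Finset.sum_eq_zero (fun b _ => by rw [hrow0, zero_mul]) (s := Finset.univ)
        (f := fun b => f1.1 (-n) e b * K.d (-n - 1) b a), smul_zero] at hc
    obtain ⟨w, _, hw⟩ := hK (fun b => f1.1 (-n - 1) b a) hc
    obtain ⟨w', h1, h2, _⟩ := exists_homogeneous_solution (M := K'.d (-2))
      (o := fun b => K'.deg (-1) b) (e := fun b => K'.deg (-2) b) (K'.homogeneous (-2))
      (v := fun b => f1.1 (-n - 1) b a) (τ := K.deg (-n - 1) a)
      (fun b => by simpa [show -n - 1 + n = -1 by ring] using f1.2.1 (-n - 1) b a) hw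
    exact ⟨w', h1, h2⟩
  choose w hw1 hw2 using h2
  obtain ⟨g', hg1', hg2'⟩ := exists_hom (K := K) (K' := K') (n := n - 1)
    (show -n - 1 + (n - 1) = -2 by ring) (F := Matrix.of fun b a => w a b) (G := 0)
    (fun b a => hw1 a b) (fun b a => isWeightedHomogeneous_zero _ _ _)
  have hfB : f1 ∈ (mfCat wt W c).B K K' n := by
    refine mem_B_of_comp hW (sub_add_cancel n 1) hf1Z g' (-n - 1) ?_
    rw [hg2', hg1', Matrix.zero_mul, smul_zero, sub_zero, show -n - 1 + (n - 1) = -2 by ring]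
    refine Matrix.ext fun b a => ?_
    rw [Matrix.mul_apply, ← hw2 a]
    rfl
  have : f = f1 + homD K K' (sub_add_cancel n 1) g := by rw [hf1, sub_add_cancel]
  rw [this]
  exact add_mem hfB hgB

/-- Construction of closed morphisms of degree zero with a prescribed row. -/
lemma exists_closed_of_row {v : Fin K.rk → MvPolynomial (Fin 2) ℂ}
    (hv : ∀ a, IsWeightedHomogeneous wt (v a) (K'.deg (-2) e - K.deg (-2) a))
    (hrow : ∀ a, ∃ u : Fin K'.rk → MvPolynomial (Fin 2) ℂ,
      ∑ b, v b * K.d (-1) b a = ∑ b, K'.d (-1) e b * u b) :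
    ∃ f ∈ (mfCat wt W c).Z K K' 0, ∀ a, f.1 (-2) e a = v a := by
  have hdeg : ∀ b, IsWeightedHomogeneous wt (K'.d (-1) e b) (K'.deg 0 e - K'.deg (-1) b) :=
    fun b => by simpa using K'.homogeneous (-1) e b
  have hd0 : ∀ (K : GradedMF wt W c) b, K.deg 0 b = K.deg (-2) b + c := fun K b => by
    rw [← K.deg_add_two]; rfl
  have h1 : ∀ a, ∃ u : Fin K'.rk → MvPolynomial (Fin 2) ℂ,
      (∀ b, IsWeightedHomogeneous wt (u b) (K'.deg (-1) b - K.deg (-1) a)) ∧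
      ∑ b, K'.d (-1) e b * u b = ∑ b, v b * K.d (-1) b a := by
    intro a
    obtain ⟨u, hu⟩ := hrow a
    obtain ⟨u', h1, h2, _⟩ := exists_homogeneous_solution (β := Unit) (M := fun _ b => K'.d (-1) e b)
      (o := fun _ => K'.deg 0 e) (e := fun b => K'.deg (-1) b) (fun _ => hdeg)
      (v := fun _ => ∑ b, v b * K.d (-1) b a) (τ := K.deg (-1) a) (fun _ => by
        refine IsWeightedHomogeneous.sum _ _ _ fun b _ => ?_
        have := (hv b).mul (K.homogeneous (-1) b a)
        convert this using 1
        rw [show (-1 + 1 : ℤ) = 0 by norm_num, hd0, hd0]; abel) (w := u) fun _ => hu.symm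
    exact ⟨u', h1, h2 ()⟩
  choose u hu1 hu2 using h1
  set G : Matrix (Fin K'.rk) (Fin K.rk) (MvPolynomial (Fin 2) ℂ) := Matrix.of fun b a => u a b
  have hG : ∀ a, (K'.d (-1) * G) e a = ∑ b, v b * K.d (-1) b a := fun a => by
    rw [Matrix.mul_apply, ← hu2]; rfl
  have hKd : K.d (-1) * K.d (-2) = W • 1 := K.d_mul_d (-2)
  have hKd' : K'.d (-1) * K'.d (-2) = W • 1 := K'.d_mul_d (-2)
  have h2 : ∀ a, ∃ w : Fin K'.rk → MvPolynomial (Fin 2) ℂ,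
      (∀ b, IsWeightedHomogeneous wt (w b) (K'.deg (-2) b - K.deg (-2) a)) ∧ w e = 0 ∧
      ∀ b, ∑ a', K'.d (-2) b a' * w a' = (G * K.d (-2)) b a - K'.d (-2) b e * v a := by
    intro a
    -- Both terms of the difference give `W v a` when paired with row `e`, so their difference is a
    -- syzygy.
    have hc : ∑ b, K'.d (-1) e b * ((G * K.d (-2)) b a - K'.d (-2) b e * v a) = 0 := by
      have e1 : ∑ b, K'.d (-1) e b * (G * K.d (-2)) b a = W * v a := by
        rw [← Matrix.mul_apply, ← Matrix.mul_assoc, Matrix.mul_apply]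
        simp only [hG]
        have : ∑ x, (∑ b, v b * K.d (-1) b x) * K.d (-2) x a =
            ∑ b, v b * (K.d (-1) * K.d (-2)) b a := by
          simp only [Matrix.mul_apply, Finset.sum_mul, Finset.mul_sum]
          rw [Finset.sum_comm]
          simp only [mul_assoc]
        rw [this, hKd, Finset.sum_eq_single a]
        · simp [mul_comm]
        · intro b _ hb
          simp [Matrix.one_apply_ne hb]
        · simp
      have e2 : ∑ b, K'.d (-1) e b * (K'.d (-2) b e * v a) = W * v a := by
        simp only [← mul_assoc]
        rw [← Finset.sum_mul, ← Matrix.mul_apply, hKd']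
        simp
      simp only [mul_sub, Finset.sum_sub_distrib]
      rw [e1, e2, sub_self]
    obtain ⟨w, hwe, hw⟩ := hK (fun b => (G * K.d (-2)) b a - K'.d (-2) b e * v a) hc
    obtain ⟨w', h1, h2, h3⟩ := exists_homogeneous_solution (M := K'.d (-2))
      (o := fun b => K'.deg (-1) b) (e := fun b => K'.deg (-2) b) (K'.homogeneous (-2))
      (v := fun b => (G * K.d (-2)) b a - K'.d (-2) b e * v a) (τ := K.deg (-2) a)
      (fun b => by
        refine IsWeightedHomogeneous.sub ?_ ?_
        · exact homogeneous_mul (p := K'.deg (-1)) (q := K.deg (-1)) (r := K.deg (-2))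
            (fun b a => hu1 a b) (K.homogeneous (-2)) b a
        · have := (K'.homogeneous (-2) b e).mul (hv a)
          rwa [sub_add_sub_cancel] at this) hw
    exact ⟨w', h1, h3 e hwe, h2⟩
  choose w hw1 hw2 hw3 using h2
  -- Since `w` has zero entry at `e`, inserting `v` as row `e` does not disturb the equation solved
  -- by `w`.
  obtain ⟨f, hf1, hf2⟩ := exists_hom (K := K) (K' := K') (n := 0)
    (show (-2 : ℤ) + 0 = -2 by ring) (F := Matrix.of fun b a => if b = e then v a else w a b)
    (G := G)
    (fun b a => by
      simp only [Matrix.of_apply]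
      split_ifs with hb
      · rw [hb]; exact hv a
      · exact hw1 a b)
    (fun b a => hu1 a b)
  refine ⟨f, mem_Z_of_comp hW (-2) ?_, fun a => by rw [hf1]; simp⟩
  rw [sgn_zero, one_smul, hf2, hf1, add_zero]
  refine Matrix.ext fun b a => ?_
  have h3 := hw3 a b
  rw [eq_sub_iff_add_eq] at h3
  rw [← h3, Matrix.mul_apply]
  have : ∀ a', K'.d (-2) b a' * (Matrix.of fun b a => if b = e then v a else w a b) a' a =
      K'.d (-2) b a' * w a a' + if a' = e then K'.d (-2) b a' * v a else 0 := by
    intro a'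
    simp only [Matrix.of_apply]
    split_ifs with ha
    · rw [ha, hw2]; ring
    · ring
  simp only [this, Finset.sum_add_distrib, Finset.sum_ite_eq', Finset.mem_univ, if_true]

end Quotient

/-! #### Targets of rank one -/

section RankOne

-- Here the target has rank one, and `hP` says that the evaluation at `P` detects divisibility of
-- homogeneous polynomials by the entry of `K'^{-2} → K'^{-1}`.
variable {e : Fin K'.rk} (he : ∀ b, b = e) {P : Fin 2 → ℂ}
  (hP : ∀ (d : L) (h : MvPolynomial (Fin 2) ℂ), IsWeightedHomogeneous wt h d → eval P h = 0 →
    K'.d (-2) e e ∣ h)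
  (hP0 : eval P (K'.d (-2) e e) = 0)

include he hP in
-- The scalars `s` are the values at `P` of one half of a homotopy; `hs` allows them to be lifted to
-- homogeneous polynomials `t`. The remainder vanishes at `P`, so it is a multiple of the entry of
-- the differential, and the cofactors form the other half.
lemma mem_B_of_eval {n : ℤ} {f : homSub K K' n} (hf : f ∈ (mfCat wt W c).Z K K' n)
    (s : Fin K.rk → ℂ) (hs : ∀ a, s a ≠ 0 → ∃ h : MvPolynomial (Fin 2) ℂ,
      IsWeightedHomogeneous wt h (K'.deg (-1) e - K.deg (-n) a) ∧ eval P h ≠ 0)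
    (h : ∀ b, eval P (f.1 (-n - 1) e b) = ∑ a, s a * eval P (K.d (-n - 1) a b)) :
    f ∈ (mfCat wt W c).B K K' n := by
  have h1 : ∀ a, ∃ t : MvPolynomial (Fin 2) ℂ,
      IsWeightedHomogeneous wt t (K'.deg (-1) e - K.deg (-n) a) ∧ eval P t = s a := by
    intro a
    by_cases ha : s a = 0
    · exact ⟨0, isWeightedHomogeneous_zero _ _ _, by rw [ha, map_zero]⟩
    · obtain ⟨t, ht, ht0⟩ := hs a ha
      exact ⟨C (s a / eval P t) * t, ht.C_mul _, by rw [map_mul, eval_C, div_mul_cancel₀ _ ht0]⟩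
  choose t ht1 ht2 using h1
  have hK1 : ∀ a b, IsWeightedHomogeneous wt (K.d (-n - 1) a b)
      (K.deg (-n) a - K.deg (-n - 1) b) := fun a b => by
    simpa using K.homogeneous (-n - 1) a b
  have h2 : ∀ b, ∃ u, IsWeightedHomogeneous wt u (K'.deg (-2) e - K.deg (-n - 1) b) ∧
      f.1 (-n - 1) e b - ∑ a, t a * K.d (-n - 1) a b = K'.d (-2) e e * u := by
    intro b
    have hh : IsWeightedHomogeneous wt (f.1 (-n - 1) e b - ∑ a, t a * K.d (-n - 1) a b)
        (K'.deg (-1) e - K.deg (-n - 1) b) := by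
      refine IsWeightedHomogeneous.sub ?_ (IsWeightedHomogeneous.sum _ _ _ fun a _ => ?_)
      · simpa [show -n - 1 + n = -1 by ring] using f.2.1 (-n - 1) e b
      · have := (ht1 a).mul (hK1 a b)
        rwa [sub_add_sub_cancel] at this
    refine exists_homogeneous_cofactor (K'.homogeneous (-2) e e) ?_ (hP _ _ hh ?_)
    · convert hh using 1
      rw [show (-2 + 1 : ℤ) = -1 by norm_num]; abel
    · simp only [map_sub, map_sum, map_mul, ht2, h, sub_self]
  choose u hu1 hu2 using h2
  obtain ⟨g, hg1, hg2⟩ := exists_hom (K := K) (K' := K') (n := n - 1)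
    (show -n - 1 + (n - 1) = -2 by ring) (F := Matrix.of fun b a => u a)
    (G := Matrix.of fun b a => -sgn (n - 1) • t a)
    (fun b a => by rw [he b]; exact hu1 a)
    (fun b a => by
      rw [he b, sub_add_cancel]
      exact (weightedHomogeneousSubmodule ℂ wt _).smul_mem _ (ht1 a))
  refine mem_B_of_comp hW (sub_add_cancel n 1) hf g (-n - 1) ?_
  rw [hg1, hg2, show -n - 1 + (n - 1) = -2 by ring]
  refine Matrix.ext fun b a => ?_
  rw [he b, Matrix.sub_apply, Matrix.smul_apply, Matrix.mul_apply, Matrix.mul_apply,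
    Finset.sum_eq_single e (fun b' _ hb' => absurd (he b') hb') (by simp)]
  simp only [Matrix.of_apply, smul_mul_assoc]
  rw [← Finset.smul_sum, smul_smul, mul_neg, sgn_mul_self, neg_one_smul, ← hu2 a]
  ring

omit hW in
include he hP0 in
-- In the component `-n - 2` of the closedness equation, the side multiplied by the differential of
-- the target vanishes at `P`.
lemma eval_closed {n : ℤ} {f : homSub K K' n} (hf : f ∈ (mfCat wt W c).Z K K' n)
    (b : Fin K.rk) : ∑ a, eval P (f.1 (-n - 1) e a) * eval P (K.d (-n - 2) a b) = 0 := by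
  have hc := congrFun (congrFun (closed_comp hf (-n - 2)) e) b
  rw [show -n - 2 + n = -2 by ring, show -n - 2 + 1 = -n - 1 by ring, Matrix.smul_apply,
    Matrix.mul_apply, Matrix.mul_apply,
    Finset.sum_eq_single e (fun b' _ hb' => absurd (he b') hb') (by simp)] at hc
  have h1 := congrArg (eval P) hc
  rw [map_mul, hP0, zero_mul, smul_eq_C_mul, map_mul, eval_C] at h1
  have h2 := (mul_eq_zero.1 h1.symm).resolve_left (sgn_ne_zero n)
  simpa only [map_sum, map_mul] using h2

include he hP in
-- The composite of the row with the differential of the source vanishes at `P`, so it is divisible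
-- by the entry of the target differential; the quotients give the neighbouring component.
lemma exists_closed_of_eval {v : Fin K.rk → MvPolynomial (Fin 2) ℂ}
    (hv : ∀ a, IsWeightedHomogeneous wt (v a) (K'.deg (-1) e - K.deg (-1) a))
    (h : ∀ b, ∑ a, eval P (v a) * eval P (K.d (-2) a b) = 0) :
    ∃ f ∈ (mfCat wt W c).Z K K' 0, ∀ a, f.1 (-1) e a = v a := by
  have h2 : ∀ b, ∃ u, IsWeightedHomogeneous wt u (K'.deg (-2) e - K.deg (-2) b) ∧
      ∑ a, v a * K.d (-2) a b = K'.d (-2) e e * u := by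
    intro b
    have hh : IsWeightedHomogeneous wt (∑ a, v a * K.d (-2) a b)
        (K'.deg (-1) e - K.deg (-2) b) := by
      refine IsWeightedHomogeneous.sum _ _ _ fun a _ => ?_
      have := (hv a).mul (K.homogeneous (-2) a b)
      rwa [show (-2 + 1 : ℤ) = -1 by norm_num, sub_add_sub_cancel] at this
    refine exists_homogeneous_cofactor (K'.homogeneous (-2) e e) ?_ (hP _ _ hh ?_)
    · convert hh using 1
      rw [show (-2 + 1 : ℤ) = -1 by norm_num]; abel
    · simp only [map_sum, map_mul, h]
  choose u hu1 hu2 using h2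
  obtain ⟨f, hf1, hf2⟩ := exists_hom (K := K) (K' := K') (n := 0)
    (show (-2 : ℤ) + 0 = -2 by ring) (F := Matrix.of fun b a => u a)
    (G := Matrix.of fun b a => v a)
    (fun b a => by rw [he b]; exact hu1 a) (fun b a => by rw [he b]; exact hv a)
  refine ⟨f, mem_Z_of_comp hW (-2) ?_, fun a => ?_⟩
  · rw [hf1, hf2, sgn_zero, one_smul, add_zero]
    refine Matrix.ext fun b a => ?_
    rw [he b, Matrix.mul_apply, Matrix.mul_apply,
      Finset.sum_eq_single e (fun b' _ hb' => absurd (he b') hb') (by simp)]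
    simp only [Matrix.of_apply]
    exact (hu2 a).symm
  · have : f.1 (-1) = f.1 (-2 + 1) := rfl
    rw [this, hf2]; rfl

omit hW in
include he hP0 in
-- Of the two terms of a boundary, one carries the factor vanishing at `P`; the hypothesis makes the
-- component `K^0 → K'^{-1}` of the homotopy vanish at `P`.
lemma eval_exact {f : homSub K K' 0} (hf : f ∈ (mfCat wt W c).B K K' 0)
    (h : ∀ a (t : MvPolynomial (Fin 2) ℂ),
      IsWeightedHomogeneous wt t (K'.deg (-1) e - K.deg 0 a) → eval P t = 0) (b : Fin K.rk) :
    eval P (f.1 (-1) e b) = 0 := by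
  obtain ⟨g, hg⟩ : ∃ g : homSub K K' (-1), homD K K' (show (-1 : ℤ) + 1 = 0 by norm_num) g = f :=
    (DGCat.mem_B (show (-1 : ℤ) + 1 = 0 by norm_num)).1 hf
  rw [← hg]
  rw [homD_apply, show (-1 + -1 : ℤ) = -2 by norm_num, show (-1 + 1 : ℤ) = 0 by norm_num,
    Matrix.sub_apply, Matrix.smul_apply, Matrix.mul_apply, Matrix.mul_apply,
    Finset.sum_eq_single e (fun b' _ hb' => absurd (he b') hb') (by simp), map_sub, map_mul, hP0,
    zero_mul, zero_sub, smul_eq_C_mul, map_mul, map_sum, Finset.sum_eq_zero, mul_zero, neg_zero]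
  intro a _
  rw [map_mul, h a _ (by simpa using g.2.1 0 e a), zero_mul]

end RankOne

end GradedMF

/-! ### Effective degrees -/

namespace LoopDatum

open MvPolynomial Matrix

variable (D : LoopDatum)

lemma m_pos : 0 < D.m := by
  rcases Nat.eq_zero_or_pos D.m with h | h
  · have := D.l_mul_m; have := D.hp; rw [h] at *; omega
  · exact h

lemma W_ne_zero : D.W ≠ 0 := by
  intro h
  have h1 := congrArg (eval (fun _ => (1 : ℂ))) h
  simp only [W, map_add, map_mul, map_pow, eval_X, one_pow, map_zero] at h1
  norm_num at h1

lemma cv_eq : D.cv = D.xv + (D.q : ℤ) • D.yv := by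
  have h : (D.p : ℤ) = D.l * D.m + 1 := by exact_mod_cast D.p_eq
  have h' : (D.q : ℤ) = D.l * D.n + 1 := by exact_mod_cast D.q_eq
  rw [cv, h, h']
  linear_combination (norm := module) (D.l : ℤ) • D.rel

lemma weight_eq (s : Fin 2 →₀ ℕ) :
    Finsupp.weight D.wt s = (s 0 : ℤ) • D.xv + (s 1 : ℤ) • D.yv := by
  rw [Finsupp.weight_apply, Finsupp.sum_fintype _ _ (by simp), Fin.sum_univ_two, natCast_zsmul,
    natCast_zsmul]
  rfl

/-- A degree in which `S` vanishes. -/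
def Ineffective (d : D.L) : Prop := ∀ a b : ℕ, (a : ℤ) • D.xv + (b : ℤ) • D.yv ≠ d

variable {D}

lemma Ineffective.eq_zero {d : D.L} (hd : D.Ineffective d) {h : MvPolynomial (Fin 2) ℂ}
    (hh : IsWeightedHomogeneous D.wt h d) : h = 0 := by
  ext s
  by_contra hs
  exact hd _ _ ((D.weight_eq s).symm.trans (hh hs))

/-- All later vanishing statements reduce to these inequalities. Exponent pairs of a given degree
are `(A + σ m, B - σ n)`; none is nonnegative if `A < m, B < 0` or `A < 0, B < n`. The listed cases
reach this after rewriting `γ c⃗`, as `γ ≤ 0`, by one of the two expressions for `c⃗`. -/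
lemma ineffective_of {d : D.L} (α β γ : ℤ) (hd : d = α • D.xv + β • D.yv + γ • D.cv)
    (h : γ ≤ 0 ∧ ((α < D.m ∧ β < 0) ∨ (α < 0 ∧ β < D.n) ∨ (γ ≤ -1 ∧
      ((α ≤ D.m ∧ β < D.q) ∨ (α < D.p ∧ β ≤ D.n) ∨ (α ≤ 0 ∧ β < D.n + D.q))))) :
    D.Ineffective d := by
  intro a b hab
  have hm : (0 : ℤ) < D.m := by exact_mod_cast D.m_pos
  have hn : (0 : ℤ) < D.n := by exact_mod_cast D.n_pos
  have hp : (D.p : ℤ) = D.l * D.m + 1 := by exact_mod_cast D.p_eq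
  have hq : (D.q : ℤ) = D.l * D.n + 1 := by exact_mod_cast D.q_eq
  have hl : (0 : ℤ) < D.l := by exact_mod_cast D.l_pos
  have h0 : ((a : ℤ) - α - γ) • D.xv + ((b : ℤ) - β - γ * D.q) • D.yv = 0 := by
    rw [hd, D.cv_eq] at hab
    linear_combination (norm := module) hab
  obtain ⟨s, hs, hs'⟩ := (D.smul_add_smul_eq_zero _ _).1 h0
  have ha : (0 : ℤ) ≤ a := Int.natCast_nonneg a
  have hb : (0 : ℤ) ≤ b := Int.natCast_nonneg b
  have core : ∀ A B σ : ℤ, (a : ℤ) = A + σ * D.m → (b : ℤ) = B - σ * D.n →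
      (A < D.m ∧ B < 0) ∨ (A < 0 ∧ B < D.n) → False := by
    intro A B σ h1 h2 h3
    rcases lt_or_ge σ 0 with h4 | h4
    · have : σ * D.m ≤ -1 * D.m := mul_le_mul_of_nonneg_right (by omega) hm.le
      rcases h3 with h3 | h3 <;> omega
    · rcases h4.eq_or_lt with h4 | h4
      · subst h4; omega
      · have : 1 * D.n ≤ σ * D.n := mul_le_mul_of_nonneg_right (by omega) hn.le
        have : 1 * D.m ≤ σ * D.m := mul_le_mul_of_nonneg_right (by omega) hm.le
        rcases h3 with h3 | h3 <;> omega
  have g0 : γ * D.q ≤ 0 := mul_nonpos_of_nonpos_of_nonneg h.1 (by positivity)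
  have g1 : γ ≤ -1 → γ * D.q ≤ -1 * D.q := fun h => mul_le_mul_of_nonneg_right h (by positivity)
  have g2 : γ ≤ -1 → γ * D.p ≤ -1 * D.p := fun h => mul_le_mul_of_nonneg_right h (by positivity)
  obtain ⟨hγ, h | h | ⟨h', h | h | h⟩⟩ := h
  · exact core (α + γ) (β + γ * D.q) s (by omega) (by omega) (Or.inl ⟨by omega, by omega⟩)
  · exact core (α + γ) (β + γ * D.q) s (by omega) (by omega) (Or.inr ⟨by omega, by omega⟩)
  · have := g1 h'
    exact core (α + γ) (β + γ * D.q) s (by omega) (by omega) (Or.inl ⟨by omega, by omega⟩)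
  · have := g2 h'
    -- This case uses `c⃗ = p x⃗ + y⃗` instead of `c⃗ = x⃗ + q y⃗`; the two representatives differ
    -- by `ℓ` times the relation, hence the shift of `s` by `γ ℓ`.
    refine core (α + γ * D.p) (β + γ) (s - γ * D.l) ?_ ?_ (Or.inr ⟨by omega, by omega⟩)
    · rw [hp]; linear_combination hs
    · rw [hq] at hs'; linear_combination hs'
  · have := g1 h'
    exact core (α + γ) (β + γ * D.q) s (by omega) (by omega) (Or.inr ⟨by omega, by omega⟩)

end LoopDatum

/-! ### Staircases -/

section Staircase

open MvPolynomial

/-- The Hilbert–Burch resolution of a monomial ideal of `ℂ[x, y]`, exactness in the middle. -/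
lemma staircase_syzygy (N : ℕ) (A B : ℕ → ℕ) (hA : Antitone A) (hB : Monotone B)
    (v : ℕ → MvPolynomial (Fin 2) ℂ)
    (h : ∑ s ∈ Finset.range (N + 1), X 0 ^ A s * X 1 ^ B s * v s = 0) :
    ∃ w : ℕ → MvPolynomial (Fin 2) ℂ, w N = 0 ∧ v 0 = X 1 ^ (B 1 - B 0) * w 0 ∧
      ∀ s < N, v (s + 1) = X 1 ^ (B (s + 2) - B (s + 1)) * w (s + 1) -
        X 0 ^ (A s - A (s + 1)) * w s := by
  have hx0 : ∀ n, (X 0 : MvPolynomial (Fin 2) ℂ) ^ n ≠ 0 := fun n => pow_ne_zero _ (X_ne_zero 0)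
  have hx1 : ∀ n, (X 1 : MvPolynomial (Fin 2) ℂ) ^ n ≠ 0 := fun n => pow_ne_zero _ (X_ne_zero 1)
  -- The first generator is split off. Every other generator has at least `B 1` factors `y`, so
  -- `y^(B 1 - B 0)` divides `v 0`, being prime to `x`.
  induction N generalizing A B v with
  | zero =>
    refine ⟨0, rfl, ?_, fun s hs => by omega⟩
    simp only [zero_add, Finset.range_one, Finset.sum_singleton] at h
    rw [(mul_eq_zero.1 h).resolve_left (mul_ne_zero (hx0 _) (hx1 _))]
    simp
  | succ N ih =>
    rw [Finset.sum_range_succ'] at h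
    have h1 : ∑ s ∈ Finset.range (N + 1), X 0 ^ A (s + 1) * X 1 ^ (B (s + 1) - B 0) * v (s + 1) +
        X 0 ^ A 0 * v 0 = 0 := by
      refine (mul_eq_zero.1 (?_ : (X 1 : MvPolynomial (Fin 2) ℂ) ^ B 0 * _ = 0)).resolve_left (hx1 (B 0))
      rw [← h, mul_add, Finset.mul_sum]
      congr 1
      · refine Finset.sum_congr rfl fun s _ => ?_
        rw [← pow_sub_mul_pow (X 1 : MvPolynomial (Fin 2) ℂ) (hB (Nat.zero_le (s + 1)))]
        ring
      · ring
    have h2 : (X 1 : MvPolynomial (Fin 2) ℂ) ^ (B 1 - B 0) ∣ X 0 ^ A 0 * v 0 := by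
      rw [← dvd_add_right (Finset.dvd_sum fun s _ => ?_), h1]
      · exact dvd_zero _
      · exact Dvd.dvd.mul_right (Dvd.dvd.mul_left (pow_dvd_pow _
          (Nat.sub_le_sub_right (hB (by omega)) _)) _) _
    have hprime : Prime (X 1 : MvPolynomial (Fin 2) ℂ) := X_prime
    have h3 : (X 1 : MvPolynomial (Fin 2) ℂ) ^ (B 1 - B 0) ∣ v 0 := by
      refine hprime.pow_dvd_of_dvd_mul_left _ (fun h4 => ?_) h2
      have := hprime.dvd_of_dvd_pow h4
      rw [X_dvd_X] at this
      simp at this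
    obtain ⟨w0, hw0⟩ := h3
    -- Subtracting the first Hilbert–Burch relation `w0` times moves `v 0` into the coefficient of
    -- the second generator and leaves a syzygy of the shorter staircase.
    obtain ⟨w, hw1, hw2, hw3⟩ := ih (fun s => A (s + 1)) (fun s => B (s + 1))
      (fun a b hab => hA (by omega)) (fun a b hab => hB (by omega))
      (fun s => if s = 0 then v 1 + X 0 ^ (A 0 - A 1) * w0 else v (s + 1)) (by
        rw [Finset.sum_range_succ'] at h ⊢
        rw [← h]
        simp only [Nat.add_eq_zero_iff, one_ne_zero, and_false, if_false, if_true, zero_add]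
        rw [add_assoc]
        congr 1
        rw [hw0, ← pow_sub_mul_pow (X 0 : MvPolynomial (Fin 2) ℂ) (hA (Nat.zero_le 1)),
          ← pow_sub_mul_pow (X 1 : MvPolynomial (Fin 2) ℂ) (hB (Nat.zero_le 1))]
        ring)
    refine ⟨fun s => if s = 0 then w0 else w (s - 1), by simpa using hw1, by simpa using hw0,
      fun s hs => ?_⟩
    rcases s with _ | s
    · simp only [zero_add, if_true] at hw2
      simp only [zero_add, one_ne_zero, if_false, if_true, Nat.sub_self]
      rw [← hw2]; ring
    · simpa using hw3 s (by omega)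

/-- A monomial outside of a staircase ideal lies below one of the inner corners. -/
lemma staircase_corner (N : ℕ) (A B : ℕ → ℕ) (hA : A N = 0) (hB : B 0 = 0) (a b : ℕ)
    (h : ∀ s ≤ N, A s ≤ a → ¬ B s ≤ b) : ∃ s < N, a < A s ∧ b < B (s + 1) := by
  classical
  -- The corner lies just before the first step whose `x`-exponent is at most `a`; that step is not
  -- step `0`, where the condition on `y` would hold trivially.
  have hex : ∃ s, s ≤ N ∧ A s ≤ a := ⟨N, le_rfl, by omega⟩
  obtain ⟨h1, h2⟩ := Nat.find_spec hex
  have h3 := fun s hs => Nat.find_min (m := s) hex hs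
  have h4 := h _ h1 h2
  rcases hs : Nat.find hex with _ | s
  · rw [hs] at h4; omega
  · rw [hs] at h1 h3 h4
    refine ⟨s, by omega, ?_, by omega⟩
    have := h3 s (by omega)
    by_contra h5
    exact this ⟨by omega, by omega⟩

end Staircase

/-! ### The matrix factorisations `K_0^{i,j}` -/

section Cyclic

variable {R : Type} [CommRing R] (k : ℕ) (u₀ u δ β β' γ : R)

/-- The vector is indexed by `ℕ`, so that the two nonzero entries of a column can be written at `a`
and `a + 1` without bounds. -/
lemma sum_mul_cyclicMatrix (V : ℕ → R) (a : Fin (k + 2)) (ha : a.val ≠ k + 1) :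
    ∑ b : Fin (k + 2), V b * cyclicMatrix k u₀ u δ β β' γ b a =
      V a * (if a.val = 0 then u₀ else u) - V (a + 1) * (if a.val = k then β' else β) := by
  have h1 := a.2
  rw [Fintype.sum_eq_add a ⟨a.val + 1, by omega⟩ (by simp [Fin.ext_iff])]
  · simp only [cyclicMatrix, ha, if_false, if_true]
    rw [if_neg (by omega : ¬ a.val + 1 = a.val)]
    by_cases h : a.val = k
    · simp [h]; ring
    · simp [h]; ring
  · rintro b ⟨hb1, hb2⟩
    rw [Ne, Fin.ext_iff] at hb1 hb2
    simp only at hb2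
    simp [cyclicMatrix, ha, hb1, hb2]

lemma sum_mul_cyclicMatrix_last (V : ℕ → R) (a : Fin (k + 2)) (ha : a.val = k + 1) :
    ∑ b : Fin (k + 2), V b * cyclicMatrix k u₀ u δ β β' γ b a = V 0 * γ + V (k + 1) * δ := by
  rw [Fintype.sum_eq_add 0 (Fin.last (k + 1)) (by simp [Fin.ext_iff])]
  · simp [cyclicMatrix, ha]
  · rintro b ⟨hb1, hb2⟩
    rw [Ne, Fin.ext_iff] at hb1 hb2
    simp only [Fin.val_zero, Fin.val_last] at hb1 hb2
    simp [cyclicMatrix, ha, hb1, hb2]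

/-- The condition on `w` removes the last column; what remains is bidiagonal, the Hilbert–Burch
matrix of a staircase. -/
lemma sum_cyclicMatrix_mul_zero (w : ℕ → R) (hw : w (k + 1) = 0) :
    ∑ a : Fin (k + 2), cyclicMatrix k u₀ u δ β β' γ 0 a * w a = u₀ * w 0 := by
  rw [Fintype.sum_eq_single 0]
  · simp [cyclicMatrix]
  · intro a ha
    rw [Ne, Fin.ext_iff] at ha
    simp only [Fin.val_zero] at ha
    by_cases h : a.val = k + 1
    · rw [h, hw, mul_zero]
    · simp [cyclicMatrix, h, Ne.symm ha]

lemma sum_cyclicMatrix_mul_succ (w : ℕ → R) (hw : w (k + 1) = 0) (s : ℕ) (hs : s < k + 1)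
    (b : Fin (k + 2)) (hb : b.val = s + 1) :
    ∑ a : Fin (k + 2), cyclicMatrix k u₀ u δ β β' γ b a * w a =
      u * w (s + 1) - (if s = k then β' else β) * w s := by
  rw [Fintype.sum_eq_add b ⟨s, by omega⟩ (by simp [Fin.ext_iff, hb])]
  · simp only [cyclicMatrix, hb]
    by_cases h : s = k
    · subst h; simp [hw]
    · simp [h, show ¬ s = k + 1 by omega]; ring
  · rintro a ⟨ha1, ha2⟩
    rw [Ne, Fin.ext_iff] at ha1 ha2
    simp only at ha2
    by_cases h : a.val = k + 1
    · rw [h, hw, mul_zero]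
    · simp [cyclicMatrix, h, Ne.symm ha1, show ¬ b.val = a.val + 1 by omega]

end Cyclic

namespace LoopDatum

open MvPolynomial Matrix

variable (D : LoopDatum)

/-- The exponents of `x` in the last row of the adjugate matrix of `K_0^{i,j}`. -/
def stairA (i j s : ℕ) : ℕ :=
  if s ≤ D.kk j then (i - (D.l - 1) * D.m) + (D.kk j - s) * D.m else 0

/-- The exponents of `y` in the last row of the adjugate matrix of `K_0^{i,j}`. -/
def stairB (j s : ℕ) : ℕ := if s = 0 then 0 else j - (D.kk j + 1 - s) * D.n

lemma stairA_antitone (i j : ℕ) : Antitone (D.stairA i j) := by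
  intro s s' h
  unfold stairA
  split_ifs
  · gcongr
  · omega
  · exact Nat.zero_le _
  · exact le_rfl

lemma stairB_monotone (j : ℕ) : Monotone (D.stairB j) := by
  intro s s' h
  unfold stairB
  split_ifs
  · exact le_rfl
  · exact Nat.zero_le _
  · omega
  · gcongr

variable {D} {i j : ℕ} (hi : i ∈ Finset.Icc (D.p - D.m) (D.p - 1))
  (hj : j ∈ Finset.Icc 1 (D.q - 1))

/-- The steps in `x` of the staircase are the exponents on the lower subdiagonal of the matrix;
`stairB_sub` is the counterpart for `y` and the diagonal. -/
lemma stairA_sub (s : ℕ) (hs : s ≤ D.kk j) : D.stairA i j s - D.stairA i j (s + 1) =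
    if s = D.kk j then i - (D.l - 1) * D.m else D.m := by
  unfold stairA
  rw [if_pos hs]
  by_cases h : s = D.kk j
  · rw [if_neg (by omega), if_pos h, h]; simp
  · rw [if_pos (by omega), if_neg h, show D.kk j - s = D.kk j - (s + 1) + 1 by omega, add_mul]
    omega

include hj in
lemma stairB_sub (s : ℕ) (hs : s ≤ D.kk j) : D.stairB j (s + 1) - D.stairB j s =
    if s = 0 then j - D.kk j * D.n else D.n := by
  obtain ⟨h1, -, -⟩ := D.kk_bounds hj
  unfold stairB
  rw [if_neg (Nat.succ_ne_zero s)]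
  by_cases h : s = 0
  · subst h; simp
  · rw [if_neg h, if_neg h, show D.kk j + 1 - s = D.kk j + 1 - (s + 1) + 1 by omega, add_mul]
    have : (D.kk j + 1 - (s + 1) + 1) * D.n ≤ D.kk j * D.n := Nat.mul_le_mul_right _ (by omega)
    rw [add_mul] at this
    omega

include hi hj in
-- All bounds on the indices over `ℤ`, where products such as `kk * n` are atoms, so that the
-- hypotheses of `ineffective_of` become linear.
lemma index_bounds_int : (D.p : ℤ) - D.m ≤ i ∧ (i : ℤ) ≤ D.p - 1 ∧ 1 ≤ (j : ℤ) ∧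
    (j : ℤ) ≤ D.q - 1 ∧ (D.kk j : ℤ) * D.n + 1 ≤ j ∧ (j : ℤ) ≤ D.kk j * D.n + D.n ∧
    (D.p : ℤ) = D.l * D.m + 1 ∧ (D.q : ℤ) = D.l * D.n + 1 ∧ 0 < (D.m : ℤ) ∧ 0 < (D.n : ℤ) ∧
    (D.m : ℤ) < D.p ∧ (D.n : ℤ) < D.q ∧ (D.kk j : ℤ) + 1 ≤ D.l ∧ 0 ≤ (D.kk j : ℤ) := by
  rw [Finset.mem_Icc] at hi
  obtain ⟨h1, h2, h3⟩ := D.kk_bounds hj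
  rw [Finset.mem_Icc] at hj
  have hp := D.p_eq
  have hq := D.q_eq
  have hm := D.m_pos
  have hn := D.n_pos
  have hl := D.l_pos
  have h4 : 1 * D.m ≤ D.l * D.m := Nat.mul_le_mul_right _ hl
  have h5 : 1 * D.n ≤ D.l * D.n := Nat.mul_le_mul_right _ hl
  rw [add_mul] at h2
  have hp' : (D.p : ℤ) = D.l * D.m + 1 := by exact_mod_cast hp
  have hq' : (D.q : ℤ) = D.l * D.n + 1 := by exact_mod_cast hq
  have h1' : (D.kk j : ℤ) * D.n + 1 ≤ j := by exact_mod_cast h1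
  have h2' : (j : ℤ) ≤ D.kk j * D.n + 1 * D.n := by exact_mod_cast h2
  refine ⟨by omega, by omega, by omega, by omega, h1', by omega, hp', hq', by omega, by omega,
    by omega, by omega, by omega, by omega⟩

include hi in
lemma stairA_int (s : ℕ) (hs : s ≤ D.kk j) :
    (D.stairA i j s : ℤ) = i - D.p + D.m + 1 + (D.kk j - s) * D.m := by
  rw [Finset.mem_Icc] at hi
  have hp := D.p_eq
  obtain ⟨l, hl⟩ := Nat.exists_eq_add_of_le' D.l_pos
  have e : D.l * D.m = l * D.m + D.m := by rw [hl]; ring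
  unfold stairA
  rw [if_pos hs, hl, Nat.add_sub_cancel]
  rw [e] at hp
  push_cast [Nat.cast_sub hs, Nat.cast_sub (show l * D.m ≤ i by omega), hp]
  ring

include hj in
lemma stairB_int (s : ℕ) (hs : s ≤ D.kk j) :
    (D.stairB j (s + 1) : ℤ) = j - (D.kk j - s) * D.n := by
  obtain ⟨h1, -, -⟩ := D.kk_bounds hj
  have : (D.kk j - s) * D.n ≤ D.kk j * D.n := Nat.mul_le_mul_right _ (by omega)
  unfold stairB
  rw [if_neg (Nat.succ_ne_zero s), show D.kk j + 1 - (s + 1) = D.kk j - s by omega,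
    Nat.cast_sub (by omega)]
  push_cast [Nat.cast_sub hs]
  ring

lemma stairA_last : D.stairA i j (D.kk j + 1) = 0 := by simp [stairA]

lemma stairB_last : D.stairB j (D.kk j + 1) = j := by simp [stairB]

lemma stairB_zero : D.stairB j 0 = 0 := by simp [stairB]

include hj in
lemma sum_mul_zeroMatrix (V : ℕ → MvPolynomial (Fin 2) ℂ) (a : Fin (D.kk j + 2))
    (ha : a.val ≠ D.kk j + 1) : ∑ b : Fin (D.kk j + 2), V b * D.zeroMatrix i j b a =
      V a * X 1 ^ (D.stairB j (a + 1) - D.stairB j a) -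
        V (a + 1) * X 0 ^ (D.stairA i j a - D.stairA i j (a + 1)) := by
  have := a.2
  rw [zeroMatrix, sum_mul_cyclicMatrix _ _ _ _ _ _ _ _ _ ha, stairB_sub hj _ (by omega),
    stairA_sub _ (by omega)]
  split_ifs <;> rfl

include hi hj in
lemma sum_mul_zeroMatrix_last (V : ℕ → MvPolynomial (Fin 2) ℂ) :
    ∑ b : Fin (D.kk j + 2), V b * D.zeroMatrix i j b (Fin.last _) =
      V 0 * (X 0 ^ (D.p - D.stairA i j 0) * X 1) + V (D.kk j + 1) * (X 0 * X 1 ^ (D.q - j)) := by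
  rw [zeroMatrix, sum_mul_cyclicMatrix_last _ _ _ _ _ _ _ _ _ (Fin.val_last _)]
  obtain ⟨s, t, hs, hit, ht, hp, hq⟩ := D.index_bounds hi hj
  have e2 : (D.l - 1) * D.m = (D.kk j + s) * D.m := by rw [hs]; congr 1; omega
  have e3 : D.m * (D.l - 1 - D.kk j) = s * D.m := by rw [hs, mul_comm]; congr 1; omega
  have e4 : (D.kk j + 1 + s) * D.m = (D.kk j + s) * D.m + D.m := by ring
  have e5 : (D.kk j + s) * D.m = D.kk j * D.m + s * D.m := by ring
  congr 4
  simp only [stairA, Nat.zero_le, if_true, Nat.sub_zero]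
  omega

include hi hj in
-- The row `ε` of staircase monomials satisfies `ε M = (0, …, 0, W)`: neighbouring monomials cancel
-- in the bidiagonal columns, and the last column gives `x^p y + y^q x`. Multiplying by the adjugate
-- and cancelling `W = det M` identifies `ε` with its last row.
lemma adjugate_last (b : Fin (D.kk j + 2)) : (D.zeroMatrix i j).adjugate (Fin.last _) b =
    X 0 ^ D.stairA i j b * X 1 ^ D.stairB j b := by
  have hb := index_bounds_int hi hj
  set ε : Fin (D.kk j + 2) → MvPolynomial (Fin 2) ℂ :=
    fun b => X 0 ^ D.stairA i j b * X 1 ^ D.stairB j b with hε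
  have h1 : ε ᵥ* D.zeroMatrix i j = Pi.single (Fin.last _) D.W := by
    funext a
    change ∑ b : Fin (D.kk j + 2), X 0 ^ D.stairA i j b * X 1 ^ D.stairB j b *
      D.zeroMatrix i j b a = _
    by_cases ha : a.val = D.kk j + 1
    · obtain rfl : a = Fin.last _ := Fin.ext ha
      rw [sum_mul_zeroMatrix_last hi hj (fun b => X 0 ^ D.stairA i j b * X 1 ^ D.stairB j b),
        Pi.single_eq_same, stairA_last, stairB_last, stairB_zero, W]
      have hA : D.stairA i j 0 ≤ D.p := by
        have h3 := stairA_int hi (j := j) 0 (Nat.zero_le _)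
        have h4 : ((D.kk j : ℤ) + 1) * D.m ≤ D.l * D.m :=
          mul_le_mul_of_nonneg_right (by omega) (by omega)
        have h5 : ((D.kk j : ℤ) - (0 : ℕ)) * D.m = (D.kk j + 1) * D.m - D.m := by push_cast; ring
        omega
      rw [← pow_mul_pow_sub (X 0 : MvPolynomial (Fin 2) ℂ) hA,
        ← pow_mul_pow_sub (X 1 : MvPolynomial (Fin 2) ℂ) (show j ≤ D.q by omega)]
      ring
    · have ha' := a.2
      rw [sum_mul_zeroMatrix hj (fun b => X 0 ^ D.stairA i j b * X 1 ^ D.stairB j b) a ha,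
        Pi.single_eq_of_ne (fun h => ha (by rw [h]; rfl)),
        ← pow_mul_pow_sub (X 0 : MvPolynomial (Fin 2) ℂ)
          (D.stairA_antitone i j (Nat.le_succ a.val)),
        ← pow_mul_pow_sub (X 1 : MvPolynomial (Fin 2) ℂ) (D.stairB_monotone j (Nat.le_succ a.val))]
      ring
  have h2 : (ε ᵥ* D.zeroMatrix i j) ᵥ* (D.zeroMatrix i j).adjugate = D.W • ε := by
    rw [Matrix.vecMul_vecMul, Matrix.mul_adjugate, D.zeroMatrix_det hi hj, Matrix.vecMul_smul,
      Matrix.vecMul_one]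
  rw [h1] at h2
  have h3 := congrFun h2 b
  rw [Matrix.single_vecMul] at h3
  have hW : D.W ≠ 0 := D.W_ne_zero
  exact mul_left_cancel₀ hW h3

end LoopDatum

namespace LoopDatum

open MvPolynomial Matrix

variable {D : LoopDatum}

/-! ### Degrees of the summands -/

lemma Kzero_deg_even {i j : ℕ} (hi : i ∈ Finset.Icc (D.p - D.m) (D.p - 1))
    (hj : j ∈ Finset.Icc 1 (D.q - 1)) (r : ℤ) (a : Fin (D.kk j + 2)) :
    (D.Kzero i j hi hj).deg (2 * r) a = D.zeroEven i j a + (r + 1) • D.cv := by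
  have h := (D.Kzero i j hi hj).deg_add_mul 0 r a
  rw [zero_add] at h
  have h0 : (D.Kzero i j hi hj).deg 0 a = D.zeroEven i j a + D.cv := by
    simp [Kzero, GradedMF.ofPair]
  rw [h, h0]; module

lemma Kzero_deg_odd {i j : ℕ} (hi : i ∈ Finset.Icc (D.p - D.m) (D.p - 1))
    (hj : j ∈ Finset.Icc 1 (D.q - 1)) (r : ℤ) (a : Fin (D.kk j + 2)) :
    (D.Kzero i j hi hj).deg (2 * r - 1) a = D.zeroOdd i j a + r • D.cv := by
  have h := (D.Kzero i j hi hj).deg_add_mul (-1) r a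
  rw [neg_add_eq_sub] at h
  rw [h]
  congr 1
  simp [Kzero, GradedMF.ofPair]

lemma Kzero_d_even {i j : ℕ} (hi : i ∈ Finset.Icc (D.p - D.m) (D.p - 1))
    (hj : j ∈ Finset.Icc 1 (D.q - 1)) (r : ℤ) :
    (D.Kzero i j hi hj).d (2 * r) = D.zeroMatrix i j := by
  have h := (D.Kzero i j hi hj).d_add_mul 0 r
  rw [zero_add] at h
  rw [h]
  simp [Kzero, GradedMF.ofPair]

lemma Kzero_d_odd {i j : ℕ} (hi : i ∈ Finset.Icc (D.p - D.m) (D.p - 1))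
    (hj : j ∈ Finset.Icc 1 (D.q - 1)) (r : ℤ) :
    (D.Kzero i j hi hj).d (2 * r - 1) = (D.zeroMatrix i j).adjugate := by
  have h := (D.Kzero i j hi hj).d_add_mul (-1) r
  rw [neg_add_eq_sub] at h
  rw [h]
  simp [Kzero, GradedMF.ofPair]

/-! ### The objects of rank one: factors, degrees and differentials -/

variable (D) in
/-- The labels of the objects of rank one. -/
inductive Line : Type
  | x (i : Finset.Icc (D.p - D.m) (D.p - 1)) : Line
  | y (j : Finset.Icc (D.q - D.n) (D.q - 1)) : Line
  | w (r : Finset.Icc 1 D.l) : Line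

namespace Line

/-- The object with a given label. -/
def obj : D.Line → D.Obj
  | x i => .x i
  | y j => .y j
  | w r => .w r

/-- The factor of the loop polynomial. -/
def factor : D.Line → MvPolynomial (Fin 2) ℂ
  | x _ => X 0
  | y _ => X 1
  | w r => D.w r

/-- The complementary factor of the loop polynomial. -/
def cofactor : D.Line → MvPolynomial (Fin 2) ℂ
  | x _ => X 1 * ∏ r ∈ Finset.Icc 1 D.l, D.w r
  | y _ => X 0 * ∏ r ∈ Finset.Icc 1 D.l, D.w r
  | w r => X 0 * X 1 * ∏ s ∈ (Finset.Icc 1 D.l).erase r, D.w s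

/-- The degree of the factor. -/
def len : D.Line → D.L
  | x _ => D.xv
  | y _ => D.yv
  | w _ => (D.m : ℤ) • D.xv

/-- The twist of the matrix factorisation. -/
def tw : D.Line → D.L
  | x i => ((i : ℤ) + 1 - D.p) • D.xv
  | y j => ((j : ℤ) + 1 - D.q) • D.yv
  | w _ => 0

/-- The unique index. -/
def idx : ∀ Y : D.Line, Fin (D.obj Y.obj).rk
  | x _ => (0 : Fin 1)
  | y _ => (0 : Fin 1)
  | w _ => (0 : Fin 1)

lemma eq_idx (Y : D.Line) (a : Fin (D.obj Y.obj).rk) : a = Y.idx := by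
  cases Y <;> exact Subsingleton.elim (α := Fin 1) _ _

lemma factor_mul_cofactor (Y : D.Line) : Y.factor * Y.cofactor = D.W := by
  rw [D.W_eq]
  cases Y with
  | x i => simp only [factor, cofactor]; ring
  | y i => simp only [factor, cofactor]; ring
  | w r => simp only [factor, cofactor]; rw [← Finset.mul_prod_erase _ _ r.2]; ring

lemma deg_neg_one (Y : D.Line) (a) : (D.obj Y.obj).deg (-1) a = D.cv + Y.tw := by
  cases Y <;>
  · simp [LoopDatum.obj, obj, tw, GradedMF.shift, GradedMF.twist, Kx, Ky, Kw, rankOne,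
      GradedMF.ofPair, show (2 : ℤ) + 2 = 4 by norm_num, show (4 : ℤ) / 2 = 2 by norm_num]
    module

lemma deg_neg_two (Y : D.Line) (a) : (D.obj Y.obj).deg (-2) a = -Y.len + D.cv + Y.tw := by
  cases Y <;>
  simp [LoopDatum.obj, obj, tw, len, GradedMF.shift, GradedMF.twist, Kx, Ky, Kw, rankOne,
    GradedMF.ofPair, show ¬ Even (1 : ℤ) by decide]

lemma d_neg_one (Y : D.Line) (a b) : (D.obj Y.obj).d (-1) a b = -Y.cofactor := by
  cases Y <;>
  · simp [LoopDatum.obj, obj, cofactor, GradedMF.shift, GradedMF.twist, Kx, Ky, Kw, rankOne,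
      GradedMF.ofPair, show sgn 3 = -1 by simp [sgn]; norm_num]
    exact neg_one_smul ℂ _

/-- The shift by `3` exchanges the parities and contributes the sign `(-1)^3`; so the factor sits in
even degrees and the cofactor in odd ones. -/
lemma d_neg_two (Y : D.Line) (a b) : (D.obj Y.obj).d (-2) a b = -Y.factor := by
  cases Y <;>
  · simp [LoopDatum.obj, obj, factor, GradedMF.shift, GradedMF.twist, Kx, Ky, Kw, rankOne,
      GradedMF.ofPair, show sgn 3 = -1 by simp [sgn]; norm_num, show ¬ Even (1 : ℤ) by decide]
    exact neg_one_smul ℂ _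

lemma deg_odd (Y : D.Line) (r : ℤ) (a) :
    (D.obj Y.obj).deg (2 * r - 1) a = (r + 1) • D.cv + Y.tw := by
  have h := (D.obj Y.obj).deg_add_mul (-1) r a
  rw [neg_add_eq_sub, deg_neg_one] at h
  rw [h]; module

lemma deg_even (Y : D.Line) (r : ℤ) (a) :
    (D.obj Y.obj).deg (2 * r) a = -Y.len + (r + 2) • D.cv + Y.tw := by
  have h := (D.obj Y.obj).deg_add_mul (-2) (r + 1) a
  rw [show -2 + 2 * (r + 1) = 2 * r by ring, deg_neg_two] at h
  rw [h]; module

lemma d_odd (Y : D.Line) (r : ℤ) (a b) : (D.obj Y.obj).d (2 * r - 1) a b = -Y.cofactor := by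
  have h := (D.obj Y.obj).d_add_mul (-1) r
  rw [neg_add_eq_sub] at h
  rw [h, d_neg_one]

lemma d_even (Y : D.Line) (r : ℤ) (a b) : (D.obj Y.obj).d (2 * r) a b = -Y.factor := by
  have h := (D.obj Y.obj).d_add_mul (-2) (r + 1)
  rw [show -2 + 2 * (r + 1) = 2 * r by ring] at h
  rw [h, d_neg_two]

end Line

/-! ### The ideal of a staircase -/

section Zero

variable {i j : ℕ} (hi : i ∈ Finset.Icc (D.p - D.m) (D.p - 1)) (hj : j ∈ Finset.Icc 1 (D.q - 1))

variable (D) in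
/-- The degree of the last summand of `K_0^{i,j}` in cohomological degree zero. -/
def topDeg (i j : ℕ) : D.L := ((i : ℤ) + 1) • D.xv + ((j : ℤ) + 1) • D.yv

variable (D) in
/-- The degree of the corners of the staircase. -/
def socleDeg (i j : ℕ) : D.L := ((i : ℤ) - D.p + D.m) • D.xv + ((j : ℤ) - 1) • D.yv

lemma zeroEven_last (i j : ℕ) (a : Fin (D.kk j + 2)) (ha : a.val = D.kk j + 1) :
    D.zeroEven i j a = D.topDeg i j - D.cv := by
  rw [zeroEven, if_pos ha, topDeg]

include hi hj in
-- A monomial outside the ideal divides one of the monomials `x^(A_b - 1) y^(B_(b+1) - 1)` at the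
-- inner corners. By `m x⃗ = n y⃗` all these have degree `socleDeg`, so the quotient would be a
-- monomial of degree `socleDeg - d`.
lemma exists_row_of_ineffective {h : MvPolynomial (Fin 2) ℂ} {d : D.L}
    (hh : IsWeightedHomogeneous D.wt h d)
    (hd : D.Ineffective d ∨ D.Ineffective (D.socleDeg i j - d)) :
    ∃ u : Fin (D.kk j + 2) → MvPolynomial (Fin 2) ℂ,
      h = ∑ b, (D.zeroMatrix i j).adjugate (Fin.last _) b * u b := by
  rcases hd with hd | hd
  · exact ⟨0, by simp [hd.eq_zero hh]⟩
  have key : h ∈ Ideal.span (Set.range fun b => (D.zeroMatrix i j).adjugate (Fin.last _) b) := by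
    rw [h.as_sum]
    refine Ideal.sum_mem _ fun s hs => ?_
    by_cases hex : ∃ b ≤ D.kk j + 1, D.stairA i j b ≤ s 0 ∧ D.stairB j b ≤ s 1
    · obtain ⟨b, hb, h0, h1⟩ := hex
      have h2 : (D.zeroMatrix i j).adjugate (Fin.last _) ⟨b, by omega⟩ ∣
          monomial s (coeff s h) := by
        rw [adjugate_last hi hj, monomial_eq, Finsupp.prod_fintype _ _ (by simp),
          Fin.prod_univ_two]
        exact Dvd.dvd.mul_left (mul_dvd_mul (pow_dvd_pow _ h0) (pow_dvd_pow _ h1)) _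
      exact Ideal.mem_of_dvd _ h2 (Ideal.subset_span ⟨_, rfl⟩)
    · exfalso
      push Not at hex
      obtain ⟨b, hb, h0, h1⟩ := staircase_corner (D.kk j + 1) (D.stairA i j) (D.stairB j)
        stairA_last stairB_zero (s 0) (s 1) fun b hb h => not_le.2 (hex b hb h)
      have hw : d = (s 0 : ℤ) • D.xv + (s 1 : ℤ) • D.yv :=
        (hh (mem_support_iff.1 hs)).symm.trans (D.weight_eq s)
      -- The cofactor of the monomial in its corner is a monomial of the forbidden degree; `(k - b)`
      -- times the relation moves the corner to the standard representative.
      refine hd (D.stairA i j b - 1 - s 0) (D.stairB j (b + 1) - 1 - s 1) ?_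
      have e0 : ((D.stairA i j b - 1 - s 0 : ℕ) : ℤ) = D.stairA i j b - 1 - s 0 := by omega
      have e1 : ((D.stairB j (b + 1) - 1 - s 1 : ℕ) : ℤ) = D.stairB j (b + 1) - 1 - s 1 := by omega
      rw [e0, e1, stairA_int hi b (by omega), stairB_int hj b (by omega), hw, socleDeg]
      linear_combination (norm := module) ((D.kk j : ℤ) - b) • D.rel
  obtain ⟨u, hu⟩ := Ideal.mem_span_range_iff_exists_fun.1 key
  exact ⟨u, by rw [← hu]; exact Finset.sum_congr rfl fun b _ => mul_comm _ _⟩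

include hi hj in
/-- The rank `k + 2` matrix factorisation resolves the quotient of `S` by a monomial ideal. -/
lemma Kzero_resolution (v : Fin (D.kk j + 2) → MvPolynomial (Fin 2) ℂ)
    (hv : ∑ b, (D.zeroMatrix i j).adjugate (Fin.last _) b * v b = 0) :
    ∃ w : Fin (D.kk j + 2) → MvPolynomial (Fin 2) ℂ, w (Fin.last _) = 0 ∧
      ∀ b, ∑ a, D.zeroMatrix i j b a * w a = v b := by
  obtain ⟨w, h1, h2, h3⟩ := staircase_syzygy (D.kk j + 1) (D.stairA i j) (D.stairB j)
    (D.stairA_antitone i j) (D.stairB_monotone j)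
    (fun s => if h : s < D.kk j + 2 then v ⟨s, h⟩ else 0) (by
      rw [Finset.sum_range, ← hv]
      refine Finset.sum_congr rfl fun b _ => ?_
      rw [adjugate_last hi hj, dif_pos b.2])
  refine ⟨fun a => w a, h1, fun b => ?_⟩
  rcases hb : b.val with _ | s
  · obtain rfl : b = 0 := Fin.ext hb
    have h4 : D.stairB j (0 + 1) - D.stairB j 0 = _ := stairB_sub hj 0 (Nat.zero_le _)
    rw [if_pos rfl, zero_add] at h4
    rw [zeroMatrix, sum_cyclicMatrix_mul_zero _ _ _ _ _ _ _ w h1, ← h4, ← h2,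
      dif_pos (Nat.succ_pos _)]
    rfl
  · have hs := b.2
    have h4 := h3 s (by omega)
    rw [dif_pos (by omega)] at h4
    have hb' : (⟨s + 1, by omega⟩ : Fin (D.kk j + 2)) = b := Fin.ext hb.symm
    rw [hb'] at h4
    rw [zeroMatrix, sum_cyclicMatrix_mul_succ _ _ _ _ _ _ _ w h1 s (by omega) b hb, h4,
      stairA_sub s (by omega)]
    congr 1
    · by_cases hs' : s = D.kk j
      · rw [hs', h1, mul_zero, mul_zero]
      · have h5 : D.stairB j (s + 1 + 1) - D.stairB j (s + 1) = _ := stairB_sub hj (s + 1) (by omega)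
        rw [if_neg (Nat.succ_ne_zero s)] at h5
        rw [h5]
    · split_ifs <;> rfl

/-! ### Degrees of entries of morphisms to `K_0^{i,j}` -/

variable {i' j' : ℕ} (hi' : i' ∈ Finset.Icc (D.p - D.m) (D.p - 1))
  (hj' : j' ∈ Finset.Icc 1 (D.q - 1))

include hi hj hi' hj'

/-- This and the next three lemmas treat all entries of the last row of a morphism to `K_0^{i',j'}`:
each entry vanishes or lies in the staircase ideal for degree reasons, except the one in the last
column when `r = 0` in the even case. -/
lemma topDeg_sub_odd_ineffective (r : ℤ) (hr : 1 ≤ r) (a : Fin (D.kk j + 2)) :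
    D.Ineffective (D.topDeg i' j' - (D.Kzero i j hi hj).deg (2 * r - 1) a) := by
  have h1 := index_bounds_int hi hj
  have h2 := index_bounds_int hi' hj'
  rw [Kzero_deg_odd, zeroOdd]
  split_ifs
  · refine ineffective_of ((i' : ℤ) - D.p + 1) ((j' : ℤ) - j + D.kk j * D.n + D.n) (-r) ?_ (by omega)
    rw [topDeg, cv]
    linear_combination (norm := module) ((D.kk j : ℤ) + 1) • D.rel
  · refine ineffective_of ((i' : ℤ) - i) j' (-r) ?_ (by omega)
    rw [topDeg]; module
  · refine ineffective_of ((i' : ℤ) - D.p + 1) j' (-r) ?_ (by omega)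
    rw [topDeg, cv]; module

lemma socleDeg_sub_odd_ineffective (r : ℤ) (hr : r ≤ 0) (a : Fin (D.kk j + 2)) :
    D.Ineffective (D.socleDeg i' j' -
      (D.topDeg i' j' - (D.Kzero i j hi hj).deg (2 * r - 1) a)) := by
  have h1 := index_bounds_int hi hj
  have h2 := index_bounds_int hi' hj'
  rw [Kzero_deg_odd, zeroOdd]
  split_ifs
  · refine ineffective_of ((D.m : ℤ) - 1) (-1 + j - D.kk j * D.n - D.n) r ?_ (by omega)
    rw [topDeg, socleDeg, cv]
    linear_combination (norm := module) -((D.kk j : ℤ) + 1) • D.rel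
  · refine ineffective_of ((i : ℤ) - D.p + D.m) (-1) r ?_ (by omega)
    rw [topDeg, socleDeg]; module
  · refine ineffective_of ((D.m : ℤ) - 1) (-1) r ?_ (by omega)
    rw [topDeg, socleDeg, cv]; module

lemma topDeg_sub_even_ineffective (r : ℤ) (a : Fin (D.kk j + 2))
    (hr : 1 ≤ r ∨ (0 ≤ r ∧ a.val ≠ D.kk j + 1)) :
    D.Ineffective (D.topDeg i' j' - (D.Kzero i j hi hj).deg (2 * r) a) := by
  have h1 := index_bounds_int hi hj
  have h2 := index_bounds_int hi' hj'
  rw [Kzero_deg_even, zeroEven]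
  split_ifs
  · refine ineffective_of ((i' : ℤ) - i) ((j' : ℤ) - j) (-r) ?_ (by omega)
    rw [topDeg]; module
  · refine ineffective_of ((i' : ℤ) - D.p + D.m + 1) j' (-(r + 1)) ?_ (by omega)
    rw [topDeg, cv]; module

lemma socleDeg_sub_even_ineffective (r : ℤ) (hr : r ≤ -1) (a : Fin (D.kk j + 2)) :
    D.Ineffective (D.socleDeg i' j' - (D.topDeg i' j' - (D.Kzero i j hi hj).deg (2 * r) a)) := by
  have h1 := index_bounds_int hi hj
  have h2 := index_bounds_int hi' hj'
  rw [Kzero_deg_even, zeroEven]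
  split_ifs
  · refine ineffective_of ((i : ℤ) - D.p + D.m) ((j : ℤ) - 1) r ?_ (by omega)
    rw [topDeg, socleDeg]; module
  · refine ineffective_of (-1) (-1) (r + 1) ?_ (by omega)
    rw [topDeg, socleDeg, cv]; module

omit hi hj

/-- For sources of rank one there is no exceptional entry, so all their morphisms to `K_0^{i',j'}`
are exact. -/
lemma topDeg_sub_line_ineffective (X : D.Line) (n : ℤ) (a) :
    D.Ineffective (D.topDeg i' j' - (D.obj X.obj).deg n a) ∨
      D.Ineffective (D.socleDeg i' j' - (D.topDeg i' j' - (D.obj X.obj).deg n a)) := by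
  have h2 := index_bounds_int hi' hj'
  rcases Int.even_or_odd n with ⟨r, hr⟩ | ⟨r, hr⟩
  · obtain rfl : n = 2 * r := by omega
    rw [X.deg_even]
    rcases le_or_gt 0 r with hr | hr
    · left
      rcases X with ⟨i, hi⟩ | ⟨j, hj⟩ | t
      · rw [Finset.mem_Icc] at hi
        refine ineffective_of ((i' : ℤ) - D.p + 1 + D.p - i) j' (-(r + 1)) ?_ (by omega)
        simp only [Line.len, Line.tw]; rw [topDeg, cv]; module
      · rw [Finset.mem_Icc] at hj
        refine ineffective_of ((i' : ℤ) - D.p + 1) (j' + D.q - j) (-(r + 1)) ?_ (by omega)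
        simp only [Line.len, Line.tw]; rw [topDeg, cv]; module
      · refine ineffective_of ((i' : ℤ) - D.p + 1 + D.m) j' (-(r + 1)) ?_ (by omega)
        simp only [Line.len, Line.tw]; rw [topDeg, cv]; module
    · right
      rcases X with ⟨i, hi⟩ | ⟨j, hj⟩ | t
      · rw [Finset.mem_Icc] at hi
        refine ineffective_of (D.m - 1 - (D.p - i)) (-1) (r + 1) ?_ (by omega)
        simp only [Line.len, Line.tw]; rw [topDeg, socleDeg, cv]; module
      · rw [Finset.mem_Icc] at hj
        refine ineffective_of (D.m - 1) (-1 - (D.q - j)) (r + 1) ?_ (by omega)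
        simp only [Line.len, Line.tw]; rw [topDeg, socleDeg, cv]; module
      · refine ineffective_of (-1) (-1) (r + 1) ?_ (by omega)
        simp only [Line.len, Line.tw]; rw [topDeg, socleDeg, cv]; module
  · obtain ⟨r, rfl⟩ : ∃ s, n = 2 * s - 1 := ⟨r + 1, by omega⟩
    rw [X.deg_odd]
    rcases le_or_gt 1 r with hr | hr
    · left
      rcases X with ⟨i, hi⟩ | ⟨j, hj⟩ | t
      · rw [Finset.mem_Icc] at hi
        refine ineffective_of ((i' : ℤ) - i) j' (-r) ?_ (by omega)
        simp only [Line.tw]; rw [topDeg, cv]; module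
      · rw [Finset.mem_Icc] at hj
        refine ineffective_of ((i' : ℤ) - D.p + 1) (j' + D.q - 1 - j) (-r) ?_ (by omega)
        simp only [Line.tw]; rw [topDeg, cv]; module
      · refine ineffective_of ((i' : ℤ) - D.p + 1) j' (-r) ?_ (by omega)
        simp only [Line.tw]; rw [topDeg, cv]; module
    · right
      rcases X with ⟨i, hi⟩ | ⟨j, hj⟩ | t
      · rw [Finset.mem_Icc] at hi
        refine ineffective_of (D.m - 1 + i + 1 - D.p) (-1) r ?_ (by omega)
        simp only [Line.tw]; rw [topDeg, socleDeg, cv]; module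
      · rw [Finset.mem_Icc] at hj
        refine ineffective_of (D.m - 1) (-1 + j + 1 - D.q) r ?_ (by omega)
        simp only [Line.tw]; rw [topDeg, socleDeg, cv]; module
      · refine ineffective_of (D.m - 1) (-1) r ?_ (by omega)
        simp only [Line.tw]; rw [topDeg, socleDeg, cv]; module

end Zero

end LoopDatum

/-! ### Morphisms to `K_0^{i,j}` -/

namespace LoopDatum

open MvPolynomial Matrix

variable {D : LoopDatum} {i j : ℕ} (hi : i ∈ Finset.Icc (D.p - D.m) (D.p - 1))
  (hj : j ∈ Finset.Icc 1 (D.q - 1)) {i' j' : ℕ} (hi' : i' ∈ Finset.Icc (D.p - D.m) (D.p - 1))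
  (hj' : j' ∈ Finset.Icc 1 (D.q - 1))

/-- The last index. -/
def top : Fin (D.Kzero i j hi hj).rk := Fin.last (D.kk j + 1)

lemma Kzero_d_neg_one : (D.Kzero i j hi hj).d (-1) = (D.zeroMatrix i j).adjugate :=
  Kzero_d_odd hi hj 0

lemma Kzero_d_neg_two : (D.Kzero i j hi hj).d (-2) = D.zeroMatrix i j := by
  have h := Kzero_d_even hi hj (-1)
  rwa [show (2 * -1 : ℤ) = -2 by norm_num] at h

lemma Kzero_deg_top (r : ℤ) :
    (D.Kzero i j hi hj).deg (2 * r) (top hi hj) = D.topDeg i j + r • D.cv := by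
  have h := Kzero_deg_even hi hj r (Fin.last (D.kk j + 1))
  rw [zeroEven_last i j _ (Fin.val_last _)] at h
  refine h.trans ?_
  module

lemma Kzero_deg_zero_top : (D.Kzero i j hi hj).deg 0 (top hi hj) = D.topDeg i j := by
  have h := Kzero_deg_top hi hj 0
  rwa [mul_zero, zero_smul, add_zero] at h

/-- A closed morphism to `K_0^{i,j}` is exact if its last row in cohomological degree zero consists
of elements of suitable degrees. -/
lemma Kzero_mem_B {K : GradedMF D.wt D.W D.cv} {n : ℤ}
    {f : GradedMF.homSub K (D.Kzero i' j' hi' hj') n}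
    (hf : f ∈ (mfCat D.wt D.W D.cv).Z K (D.Kzero i' j' hi' hj') n)
    (h : ∀ a, f.1 (-n) (top hi' hj') a = 0 ∨ D.Ineffective (D.topDeg i' j' - K.deg (-n) a) ∨
      D.Ineffective (D.socleDeg i' j' - (D.topDeg i' j' - K.deg (-n) a))) :
    f ∈ (mfCat D.wt D.W D.cv).B K (D.Kzero i' j' hi' hj') n := by
  refine GradedMF.mem_B_of_row D.W_ne_zero (e := top hi' hj') ?_ hf fun a => ?_
  · rw [Kzero_d_neg_one, Kzero_d_neg_two]
    exact Kzero_resolution hi' hj'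
  · rw [Kzero_d_neg_one]
    rcases h a with h | h
    · exact ⟨0, by simp [h]⟩
    · refine exists_row_of_ineffective hi' hj' ?_ h
      have := f.2.1 (-n) (top hi' hj') a
      rwa [neg_add_cancel, Kzero_deg_zero_top] at this

lemma line_zero_mem_B (X : D.Line) {n : ℤ}
    {f : GradedMF.homSub (D.obj X.obj) (D.Kzero i' j' hi' hj') n}
    (hf : f ∈ (mfCat D.wt D.W D.cv).Z (D.obj X.obj) (D.Kzero i' j' hi' hj') n) :
    f ∈ (mfCat D.wt D.W D.cv).B (D.obj X.obj) (D.Kzero i' j' hi' hj') n :=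
  Kzero_mem_B hi' hj' hf fun a => Or.inr (topDeg_sub_line_ineffective hi' hj' X (-n) a)

lemma zero_zero_row (f : GradedMF.homSub (D.Kzero i j hi hj) (D.Kzero i' j' hi' hj') 0)
    (a : Fin (D.Kzero i j hi hj).rk) (ha : a ≠ top hi hj) : f.1 0 (top hi' hj') a = 0 := by
  have h := f.2.1 0 (top hi' hj') a
  rw [add_zero, Kzero_deg_zero_top] at h
  refine Ineffective.eq_zero ?_ h
  refine topDeg_sub_even_ineffective hi hj hi' hj' 0 a (Or.inr ⟨le_rfl, fun h => ha (Fin.ext ?_)⟩)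
  exact h

/-- The exceptional entry, the one between the last summands in degree zero, is the only obstruction
to exactness. -/
lemma zero_zero_mem_B {n : ℤ}
    {f : GradedMF.homSub (D.Kzero i j hi hj) (D.Kzero i' j' hi' hj') n}
    (hf : f ∈ (mfCat D.wt D.W D.cv).Z (D.Kzero i j hi hj) (D.Kzero i' j' hi' hj') n)
    (h : n = 0 → f.1 0 (top hi' hj') (top hi hj) = 0) :
    f ∈ (mfCat D.wt D.W D.cv).B (D.Kzero i j hi hj) (D.Kzero i' j' hi' hj') n := by
  refine Kzero_mem_B hi' hj' hf fun a => ?_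
  rcases Int.even_or_odd (-n) with ⟨r, hr⟩ | ⟨r, hr⟩
  · have hr' : -n = 2 * r := by omega
    rcases lt_trichotomy r 0 with h0 | h0 | h0
    · rw [hr']
      exact Or.inr (Or.inr (socleDeg_sub_even_ineffective hi hj hi' hj' r (by omega) a))
    · left
      obtain rfl : n = 0 := by omega
      by_cases ha : a = top hi hj
      · rw [ha]; exact h rfl
      · exact zero_zero_row hi hj hi' hj' f a ha
    · rw [hr']
      exact Or.inr (Or.inl (topDeg_sub_even_ineffective hi hj hi' hj' r a (Or.inl (by omega))))
  · obtain ⟨s, hs⟩ : ∃ s, -n = 2 * s - 1 := ⟨r + 1, by omega⟩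
    rw [hs]
    rcases le_or_gt 1 s with h0 | h0
    · exact Or.inr (Or.inl (topDeg_sub_odd_ineffective hi hj hi' hj' s h0 a))
    · exact Or.inr (Or.inr (socleDeg_sub_odd_ineffective hi hj hi' hj' s (by omega) a))

include hi hj hi' hj' in
-- Used for homotopies of degree `-1`: their components from the last summand of `K^0` vanish.
lemma zeroOdd_sub_topDeg_ineffective (b : Fin (D.kk j' + 2)) :
    D.Ineffective (D.zeroOdd i' j' b - D.topDeg i j) := by
  have h1 := index_bounds_int hi hj
  have h2 := index_bounds_int hi' hj'
  rw [zeroOdd]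
  split_ifs
  · refine ineffective_of ((D.p : ℤ) - 1 - i) ((j' : ℤ) - j - D.kk j' * D.n - D.n) 0 ?_ (by omega)
    rw [topDeg, cv]
    linear_combination (norm := module) -((D.kk j' : ℤ) + 1) • D.rel
  · refine ineffective_of ((i' : ℤ) - i) (-j) 0 ?_ (by omega)
    rw [topDeg]; module
  · refine ineffective_of ((D.p : ℤ) - 1 - i) (-j) 0 ?_ (by omega)
    rw [topDeg, cv]; module

/-- Both terms of a boundary contribute zero to this entry, since the relevant entries of the
homotopy have degrees without monomials. The entry is therefore an invariant of the cohomology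
class. -/
lemma zero_zero_exact {f : GradedMF.homSub (D.Kzero i j hi hj) (D.Kzero i' j' hi' hj') 0}
    (hf : f ∈ (mfCat D.wt D.W D.cv).B (D.Kzero i j hi hj) (D.Kzero i' j' hi' hj') 0) :
    f.1 0 (top hi' hj') (top hi hj) = 0 := by
  obtain ⟨g, hg⟩ : ∃ g : GradedMF.homSub (D.Kzero i j hi hj) (D.Kzero i' j' hi' hj') (-1),
      GradedMF.homD _ _ (show (-1 : ℤ) + 1 = 0 by norm_num) g = f :=
    (DGCat.mem_B (show (-1 : ℤ) + 1 = 0 by norm_num)).1 hf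
  have e1 : ∀ b, g.1 0 b (top hi hj) = 0 := by
    intro b
    have h := g.2.1 0 b (top hi hj)
    rw [zero_add, Kzero_deg_zero_top] at h
    refine Ineffective.eq_zero ?_ h
    have h3 := Kzero_deg_odd hi' hj' 0 b
    rw [mul_zero, zero_sub, zero_smul, add_zero] at h3
    rw [h3]
    exact zeroOdd_sub_topDeg_ineffective hi hj hi' hj' b
  have e2 : ∀ a, g.1 1 (top hi' hj') a = 0 := by
    intro a
    have h := g.2.1 1 (top hi' hj') a
    rw [show (1 + -1 : ℤ) = 0 by norm_num, Kzero_deg_zero_top] at h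
    exact (topDeg_sub_odd_ineffective hi hj hi' hj' 1 le_rfl a).eq_zero h
  rw [← hg, GradedMF.homD_apply, Matrix.sub_apply, Matrix.smul_apply, Matrix.mul_apply,
    Matrix.mul_apply, zero_add, zero_add]
  simp [e1, e2]

/-- The row with the single entry `h` extends to a closed morphism, because `h` times the generators
of the source ideal lies in the target ideal by degree. -/
lemma exists_zero_zero {h : MvPolynomial (Fin 2) ℂ}
    (hh : IsWeightedHomogeneous D.wt h (D.topDeg i' j' - D.topDeg i j)) :
    ∃ f ∈ (mfCat D.wt D.W D.cv).Z (D.Kzero i j hi hj) (D.Kzero i' j' hi' hj') 0,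
      f.1 0 (top hi' hj') (top hi hj) = h := by
  obtain ⟨f, hf, hfv⟩ := GradedMF.exists_closed_of_row D.W_ne_zero (K := D.Kzero i j hi hj)
    (K' := D.Kzero i' j' hi' hj') (e := top hi' hj') (by
      rw [Kzero_d_neg_one, Kzero_d_neg_two]
      exact Kzero_resolution hi' hj') (v := Pi.single (top hi hj) h) (fun a => by
      have h1 := Kzero_deg_top hi' hj' (-1)
      by_cases ha : a = top hi hj
      · subst ha
        have h2 := Kzero_deg_top hi hj (-1)
        rw [Pi.single_eq_same]
        convert hh using 1
        refine (congrArg₂ (· - ·) h1 h2).trans ?_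
        abel
      · rw [Pi.single_eq_of_ne ha]; exact isWeightedHomogeneous_zero _ _ _)
    (fun a => by
      rw [Kzero_d_neg_one]
      refine exists_row_of_ineffective hi' hj' (d := D.topDeg i' j' -
        (D.Kzero i j hi hj).deg (2 * 0 - 1) a) ?_
        (Or.inr (socleDeg_sub_odd_ineffective hi hj hi' hj' 0 le_rfl a))
      rw [Finset.sum_eq_single (top hi hj) (fun b _ hb => by rw [Pi.single_eq_of_ne hb, zero_mul])
        (by simp), Pi.single_eq_same]
      have h1 := (D.Kzero i j hi hj).homogeneous (-1) (top hi hj) a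
      rw [neg_add_cancel, Kzero_deg_zero_top] at h1
      have h2 := hh.mul h1
      rwa [sub_add_sub_cancel] at h2)
  refine ⟨f, hf, ?_⟩
  have h0 : f.1 0 = f.1 (-2) := by
    have h := f.2.2 (-2)
    rwa [show (-2 + 2 : ℤ) = 0 by norm_num] at h
  rw [h0, hfv, Pi.single_eq_same]

end LoopDatum

/-! ### Points on the factors of the loop polynomial -/

namespace LoopDatum

open MvPolynomial Matrix

variable {D : LoopDatum}

lemma exists_pow_eq_root (D : LoopDatum) (r : ℕ) : ∃ ξ : ℂ, ξ ^ D.m = D.root r :=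
  IsAlgClosed.exists_pow_nat_eq _ D.m_pos

lemma root_ne_zero (D : LoopDatum) (r : ℕ) : D.root r ≠ 0 :=
  mul_ne_zero (Complex.exp_ne_zero _) (pow_ne_zero _ (D.hη.ne_zero D.l_pos.ne'))

lemma root_injOn (D : LoopDatum) {r s : ℕ} (hr : r ∈ Finset.Icc 1 D.l)
    (hs : s ∈ Finset.Icc 1 D.l) (h : D.root r = D.root s) : r = s := by
  have h1 := mul_left_cancel₀ (Complex.exp_ne_zero _) h
  rw [Finset.mem_Icc] at hr hs
  obtain ⟨r, rfl⟩ := Nat.exists_eq_add_of_le' hr.1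
  obtain ⟨s, rfl⟩ := Nat.exists_eq_add_of_le' hs.1
  rw [pow_succ, pow_succ] at h1
  rw [D.hη.pow_inj (by omega) (by omega) (mul_right_cancel₀ (D.hη.ne_zero D.l_pos.ne') h1)]

/-- A chosen `m`-th root of `root r`. -/
def rootPow (D : LoopDatum) (r : ℕ) : ℂ := (D.exists_pow_eq_root r).choose

lemma rootPow_pow (D : LoopDatum) (r : ℕ) : D.rootPow r ^ D.m = D.root r :=
  (D.exists_pow_eq_root r).choose_spec

lemma rootPow_ne_zero (D : LoopDatum) (r : ℕ) : D.rootPow r ≠ 0 := fun h => by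
  have := D.rootPow_pow r
  rw [h, zero_pow D.m_pos.ne'] at this
  exact D.root_ne_zero r this.symm

lemma monomial_eq_mul (s : Fin 2 →₀ ℕ) (c : ℂ) :
    monomial s c = C c * (X 0 ^ s 0 * X 1 ^ s 1) := by
  rw [monomial_eq, Finsupp.prod_fintype _ _ (by simp), Fin.prod_univ_two]

/-- Monomials of the same degree. -/
lemma weight_eq_weight {s t : Fin 2 →₀ ℕ}
    (h : Finsupp.weight D.wt s = Finsupp.weight D.wt t) :
    ∃ k : ℤ, (s 0 : ℤ) = t 0 + k * D.m ∧ (s 1 : ℤ) = t 1 - k * D.n := by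
  rw [D.weight_eq, D.weight_eq] at h
  obtain ⟨k, h1, h2⟩ := (D.smul_add_smul_eq_zero (s 0 - t 0) (s 1 - t 1)).1 (by
    linear_combination (norm := module) h)
  exact ⟨k, by omega, by omega⟩

/-- If `f` divides the combinations of any two monomials of equal degree which vanish at `P`, and
the monomials which vanish at `P`, then it divides all homogeneous polynomials which vanish
at `P`. -/
lemma dvd_of_eval_eq_zero {f : MvPolynomial (Fin 2) ℂ} {P : Fin 2 → ℂ}
    (h0 : ∀ a b : ℕ, P 0 ^ a * P 1 ^ b = 0 → f ∣ X 0 ^ a * X 1 ^ b)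
    (h1 : ∀ a b k : ℕ, f ∣ C (P 0 ^ (a + k * D.m) * P 1 ^ b) * (X 0 ^ a * X 1 ^ (b + k * D.n)) -
      C (P 0 ^ a * P 1 ^ (b + k * D.n)) * (X 0 ^ (a + k * D.m) * X 1 ^ b))
    {d : D.L} {h : MvPolynomial (Fin 2) ℂ} (hh : IsWeightedHomogeneous D.wt h d)
    (hP : eval P h = 0) : f ∣ h := by
  -- Two monomials of equal degree differ by trading `x^(k m)` for `y^(k n)`; the sign of `k`
  -- decides which of them plays which role in `h1`.
  have h2 : ∀ s t : Fin 2 →₀ ℕ, Finsupp.weight D.wt s = Finsupp.weight D.wt t →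
      f ∣ C (P 0 ^ t 0 * P 1 ^ t 1) * (X 0 ^ s 0 * X 1 ^ s 1) -
        C (P 0 ^ s 0 * P 1 ^ s 1) * (X 0 ^ t 0 * X 1 ^ t 1) := by
    intro s t hst
    obtain ⟨k, hk0, hk1⟩ := weight_eq_weight hst
    rcases le_or_gt 0 k with hk | hk
    · obtain ⟨k, rfl⟩ := Int.eq_ofNat_of_zero_le hk
      have e0 : s 0 = t 0 + k * D.m := by exact_mod_cast hk0
      have e1 : t 1 = s 1 + k * D.n := by
        have : (t 1 : ℤ) = s 1 + k * D.n := by omega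
        exact_mod_cast this
      rw [e0, e1, ← dvd_neg, neg_sub]
      exact h1 (t 0) (s 1) k
    · obtain ⟨k', hk'⟩ := Int.eq_ofNat_of_zero_le (neg_nonneg.2 hk.le)
      obtain rfl : k = -(k' : ℤ) := by omega
      have e0 : t 0 = s 0 + k' * D.m := by
        have : (t 0 : ℤ) = s 0 + k' * D.m := by rw [hk0]; ring
        exact_mod_cast this
      have e1 : s 1 = t 1 + k' * D.n := by
        have : (s 1 : ℤ) = t 1 + k' * D.n := by rw [hk1]; ring
        exact_mod_cast this
      rw [e0, e1]
      exact h1 (s 0) (t 1) k'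
  by_cases hex : ∃ t ∈ h.support, P 0 ^ t 0 * P 1 ^ t 1 ≠ 0
  · obtain ⟨t, ht, hPt⟩ := hex
    -- Fix a monomial `t` that does not vanish at `P`. As `h` vanishes at `P`, the multiple of `h`
    -- by that value is a combination of binomials, each divisible by `f`.
    have e1 : C (P 0 ^ t 0 * P 1 ^ t 1) * h = ∑ s ∈ h.support, C (coeff s h) *
        (C (P 0 ^ t 0 * P 1 ^ t 1) * (X 0 ^ s 0 * X 1 ^ s 1) -
          C (P 0 ^ s 0 * P 1 ^ s 1) * (X 0 ^ t 0 * X 1 ^ t 1)) := by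
      have e2 : ∑ s ∈ h.support, C (coeff s h) * (C (P 0 ^ s 0 * P 1 ^ s 1) *
          ((X 0 : MvPolynomial (Fin 2) ℂ) ^ t 0 * X 1 ^ t 1)) = 0 := by
        have e3 : eval P h = ∑ s ∈ h.support, coeff s h * (P 0 ^ s 0 * P 1 ^ s 1) := by
          rw [eval_eq']
          exact Finset.sum_congr rfl fun s _ => by rw [Fin.prod_univ_two]
        rw [Finset.sum_congr rfl fun s _ => by rw [← mul_assoc, ← C_mul], ← Finset.sum_mul,
          ← map_sum, ← e3, hP, C_0, zero_mul]
      simp only [mul_sub, Finset.sum_sub_distrib]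
      rw [e2, sub_zero]
      conv_lhs => rw [h.as_sum, Finset.mul_sum]
      refine Finset.sum_congr rfl fun s _ => ?_
      rw [monomial_eq_mul]; ring
    have e4 : f ∣ C (P 0 ^ t 0 * P 1 ^ t 1) * h := by
      rw [e1]
      refine Finset.dvd_sum fun s hs => Dvd.dvd.mul_left (h2 s t ?_) _
      rw [hh (mem_support_iff.1 hs), hh (mem_support_iff.1 ht)]
    have e5 : h = C (P 0 ^ t 0 * P 1 ^ t 1)⁻¹ * (C (P 0 ^ t 0 * P 1 ^ t 1) * h) := by
      rw [← mul_assoc, ← C_mul, inv_mul_cancel₀ hPt, C_1, one_mul]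
    rw [e5]
    exact Dvd.dvd.mul_left e4 _
  · push Not at hex
    rw [h.as_sum]
    refine Finset.dvd_sum fun s hs => ?_
    rw [monomial_eq_mul]
    exact Dvd.dvd.mul_left (h0 _ _ (hex s hs)) _

namespace Line

/-- A point on the zero locus of the factor. -/
def pt : D.Line → Fin 2 → ℂ
  | x _ => ![0, 1]
  | y _ => ![1, 0]
  | w r => ![D.rootPow r, 1]

lemma eval_factor (Y : D.Line) : eval Y.pt Y.factor = 0 := by
  cases Y <;> simp [pt, factor, LoopDatum.w, rootPow_pow]

lemma eval_W (Y : D.Line) : eval Y.pt D.W = 0 := by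
  rw [← Y.factor_mul_cofactor, map_mul, eval_factor, zero_mul]

/-- Modulo the factor, a monomial that vanishes at the point is zero, and monomials of equal degree
become proportional in the ratio of their values; for `w_r` this is the divisibility of `x^(k m) -
λ^k y^(k n)` by `x^m - λ y^n`. -/
lemma factor_dvd (Y : D.Line) {d : D.L} {h : MvPolynomial (Fin 2) ℂ}
    (hh : IsWeightedHomogeneous D.wt h d) (hP : eval Y.pt h = 0) : Y.factor ∣ h := by
  have hm := D.m_pos
  have hn := D.n_pos
  refine dvd_of_eval_eq_zero (P := Y.pt) ?_ ?_ hh hP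
  · rintro a b hab
    cases Y with
    | x i =>
      simp only [pt, cons_val_zero, cons_val_one, one_pow, mul_one] at hab
      exact Dvd.dvd.mul_right (dvd_pow_self _ (fun h => by simp [h] at hab)) _
    | y i =>
      simp only [pt, cons_val_zero, cons_val_one, one_pow, one_mul] at hab
      exact Dvd.dvd.mul_left (dvd_pow_self _ (fun h => by simp [h] at hab)) _
    | w r =>
      simp only [pt, cons_val_zero, cons_val_one, one_pow, mul_one] at hab
      exact absurd hab (pow_ne_zero _ (D.rootPow_ne_zero r))
  · intro a b k
    rcases Nat.eq_zero_or_pos k with rfl | hk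
    · simp
    have hkm : k * D.m ≠ 0 := (Nat.mul_pos hk hm).ne'
    have hkn : k * D.n ≠ 0 := (Nat.mul_pos hk hn).ne'
    cases Y with
    | x i =>
      simp only [pt, cons_val_zero, cons_val_one, one_pow, mul_one, factor]
      rw [zero_pow (by omega), C_0, zero_mul, zero_sub, dvd_neg]
      exact Dvd.dvd.mul_left (Dvd.dvd.mul_right (dvd_pow_self _ (by omega)) _) _
    | y i =>
      simp only [pt, cons_val_zero, cons_val_one, one_pow, one_mul, factor]
      rw [zero_pow (n := b + k * D.n) (by omega), C_0, zero_mul, sub_zero]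
      exact Dvd.dvd.mul_left (Dvd.dvd.mul_left (dvd_pow_self _ (by omega)) _) _
    | w r =>
      simp only [pt, cons_val_zero, cons_val_one, one_pow, mul_one, factor]
      have h1 := sub_dvd_pow_sub_pow (X 0 ^ D.m : MvPolynomial (Fin 2) ℂ)
        (C (D.root r) * X 1 ^ D.n) k
      rw [← dvd_neg, neg_sub]
      refine (h1.mul_left (C (D.rootPow r ^ a) * (X 0 ^ a * X 1 ^ b))).trans (dvd_of_eq ?_)
      rw [← D.rootPow_pow r]
      simp only [C_mul, C_pow, pow_add, pow_mul', mul_pow]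
      ring

/-- Different factors have no common zero outside the origin. This lemma and the next express that
the loop polynomial is reduced. -/
lemma eval_factor_ne_zero {X Y : D.Line} (h : X.factor ≠ Y.factor) :
    eval Y.pt X.factor ≠ 0 := by
  have hm := D.m_pos.ne'
  have hn := D.n_pos.ne'
  rcases X with i | j | r <;> rcases Y with i' | j' | r'
  · exact absurd rfl h
  · simp [pt, factor]
  · simp [pt, factor, rootPow_ne_zero]
  · simp [pt, factor]
  · exact absurd rfl h
  · simp [pt, factor]
  · simp [pt, factor, LoopDatum.w, hm, root_ne_zero]
  · simp [pt, factor, LoopDatum.w, hn]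
  · simp only [pt, factor, LoopDatum.w, map_sub, map_pow, eval_X, map_mul, eval_C, cons_val_zero,
      cons_val_one, one_pow, mul_one, rootPow_pow]
    refine sub_ne_zero.2 fun h' => h ?_
    simp only [factor, D.root_injOn r'.2 r.2 h']

lemma eval_cofactor_ne_zero (Y : D.Line) : eval Y.pt Y.cofactor ≠ 0 := by
  have hm := D.m_pos.ne'
  have hn := D.n_pos.ne'
  cases Y with
  | x i =>
    simp [pt, cofactor, LoopDatum.w, hm, Finset.prod_eq_zero_iff, root_ne_zero]
  | y j =>
    simp [pt, cofactor, LoopDatum.w, hn]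
  | w r =>
    simp only [pt, cofactor, LoopDatum.w, map_sub, map_pow, eval_X, map_mul, eval_C, cons_val_zero,
      cons_val_one, one_pow, mul_one, rootPow_pow, map_prod]
    refine mul_ne_zero (D.rootPow_ne_zero r) (Finset.prod_ne_zero_iff.2 fun s hs => ?_)
    rw [Finset.mem_erase] at hs
    exact sub_ne_zero.2 fun h => hs.1 (D.root_injOn hs.2 r.2 h.symm)

/-- There is a homogeneous polynomial of degree `d` which does not vanish at the chosen point. -/
def Allowed (Y : D.Line) (d : D.L) : Prop :=
  ∃ h : MvPolynomial (Fin 2) ℂ, IsWeightedHomogeneous D.wt h d ∧ eval Y.pt h ≠ 0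

lemma allowed_iff (Y : D.Line) (d : D.L) : Y.Allowed d ↔
    ∃ a b : ℕ, Y.pt 0 ^ a * Y.pt 1 ^ b ≠ 0 ∧ (a : ℤ) • D.xv + (b : ℤ) • D.yv = d := by
  constructor
  · rintro ⟨h, hh, hP⟩
    rw [eval_eq'] at hP
    obtain ⟨s, hs, hs'⟩ := Finset.exists_ne_zero_of_sum_ne_zero hP
    refine ⟨s 0, s 1, ?_, ?_⟩
    · rw [Fin.prod_univ_two] at hs'
      exact right_ne_zero_of_mul hs'
    · rw [← D.weight_eq]; exact hh (mem_support_iff.1 hs)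
  · rintro ⟨a, b, h1, h2⟩
    refine ⟨X 0 ^ a * X 1 ^ b, ?_, by simpa using h1⟩
    rw [← h2]
    exact (D.homogeneous_X0 a).mul (D.homogeneous_X1 b)

lemma Allowed.effective {Y : D.Line} {d : D.L} (h : Y.Allowed d) : ¬ D.Ineffective d := by
  obtain ⟨a, b, -, h⟩ := (Y.allowed_iff d).1 h
  exact fun hd => hd a b h

lemma allowed_x {i} {d : D.L} : (x i : D.Line).Allowed d ↔ ∃ b : ℕ, (b : ℤ) • D.yv = d := by
  rw [allowed_iff]
  constructor
  · rintro ⟨a, b, h1, h2⟩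
    have ha : a = 0 := by
      by_contra ha
      simp [pt, ha] at h1
    exact ⟨b, by rw [← h2, ha]; simp⟩
  · rintro ⟨b, rfl⟩
    exact ⟨0, b, by simp [pt], by simp⟩

lemma allowed_y {j} {d : D.L} : (y j : D.Line).Allowed d ↔ ∃ a : ℕ, (a : ℤ) • D.xv = d := by
  rw [allowed_iff]
  constructor
  · rintro ⟨a, b, h1, h2⟩
    have hb : b = 0 := by
      by_contra hb
      simp [pt, hb] at h1
    exact ⟨a, by rw [← h2, hb]; simp⟩
  · rintro ⟨a, rfl⟩
    exact ⟨a, 0, by simp [pt], by simp⟩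

lemma allowed_w {r} {d : D.L} : (w r : D.Line).Allowed d ↔
    ∃ a b : ℕ, (a : ℤ) • D.xv + (b : ℤ) • D.yv = d := by
  rw [allowed_iff]
  refine exists_congr fun a => exists_congr fun b => and_iff_right ?_
  simp [pt, D.rootPow_ne_zero r]

/-- At the point `(0, 1)` only powers of `y` survive. If `d + b y⃗ = b' y⃗`, then `d` is allowed
when `b ≤ b'`; otherwise `-d - y⃗` is a nonnegative multiple of `y⃗`, which `hd` excludes.
`Allowed.sub_y` is the mirror image. -/
lemma Allowed.sub_x {i} {d : D.L} (b : ℕ) (h : (x i : D.Line).Allowed (d + (b : ℤ) • D.yv))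
    (hd : D.Ineffective (-d - D.yv)) : (x i : D.Line).Allowed d := by
  obtain ⟨b', h⟩ := allowed_x.1 h
  rcases le_or_gt b b' with hb | hb
  · refine allowed_x.2 ⟨b' - b, ?_⟩
    rw [Nat.cast_sub hb]
    linear_combination (norm := module) h
  · refine absurd ?_ (hd 0 (b - 1 - b'))
    rw [Nat.cast_sub (by omega), Nat.cast_sub (by omega)]
    push_cast
    linear_combination (norm := module) -h

lemma Allowed.sub_y {j} {d : D.L} (a : ℕ) (h : (y j : D.Line).Allowed (d + (a : ℤ) • D.xv))
    (hd : D.Ineffective (-d - D.xv)) : (y j : D.Line).Allowed d := by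
  obtain ⟨a', h⟩ := allowed_y.1 h
  rcases le_or_gt a a' with ha | ha
  · refine allowed_y.2 ⟨a' - a, ?_⟩
    rw [Nat.cast_sub ha]
    linear_combination (norm := module) h
  · refine absurd ?_ (hd (a - 1 - a') 0)
    rw [Nat.cast_sub (by omega), Nat.cast_sub (by omega)]
    push_cast
    linear_combination (norm := module) -h

end Line

end LoopDatum

/-! ### Morphisms from `K_0^{i,j}` to matrix factorisations of rank one -/

namespace LoopDatum

open MvPolynomial Matrix

variable {D : LoopDatum}

lemma rel' (D : LoopDatum) : ((D.p : ℤ) - 1) • D.xv = ((D.q : ℤ) - 1) • D.yv := by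
  have h := D.cv_eq
  rw [cv] at h
  linear_combination (norm := module) h

section Evaluation

variable {i j : ℕ} (hi : i ∈ Finset.Icc (D.p - D.m) (D.p - 1)) (hj : j ∈ Finset.Icc 1 (D.q - 1))

include hi in
-- Because these exponents are positive, the corresponding matrix entries vanish at the points on
-- the coordinate axes.
lemma stairA_lt (s : ℕ) (hs : s ≤ D.kk j) : 0 < D.stairA i j s - D.stairA i j (s + 1) := by
  rw [stairA_sub s hs]
  rw [Finset.mem_Icc] at hi
  have hp := D.p_eq
  have hm := D.m_pos
  obtain ⟨l, hl⟩ := Nat.exists_eq_add_of_le' D.l_pos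
  have e : D.l * D.m = l * D.m + D.m := by rw [hl]; ring
  have e' : (D.l - 1) * D.m = l * D.m := by rw [hl, Nat.add_sub_cancel]
  split_ifs <;> omega

include hj in
lemma stairB_lt (s : ℕ) (hs : s ≤ D.kk j) : 0 < D.stairB j (s + 1) - D.stairB j s := by
  rw [stairB_sub hj s hs]
  obtain ⟨h1, -, -⟩ := D.kk_bounds hj
  have hn := D.n_pos
  split_ifs <;> omega

include hj in
lemma eval_mul_zeroMatrix (P : Fin 2 → ℂ) (V : ℕ → ℂ) (a : Fin (D.kk j + 2))
    (ha : a.val ≠ D.kk j + 1) : ∑ b : Fin (D.kk j + 2), V b * eval P (D.zeroMatrix i j b a) =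
      V a * P 1 ^ (D.stairB j (a + 1) - D.stairB j a) -
        V (a + 1) * P 0 ^ (D.stairA i j a - D.stairA i j (a + 1)) := by
  have h := congrArg (eval P) (sum_mul_zeroMatrix hj (i := i) (fun s => C (V s)) a ha)
  simpa only [map_sum, map_mul, map_sub, map_pow, eval_C, eval_X] using h

include hi hj in
/-- A row vector which annihilates the value of the adjugate matrix at a zero of the loop
polynomial is a multiple of the value of the matrix, if all but one entry are. -/
lemma eq_mul_zeroMatrix {P : Fin 2 → ℂ} (hP : eval P D.W = 0)
    (hε : ∃ c, eval P ((D.zeroMatrix i j).adjugate (Fin.last _) c) ≠ 0)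
    {v : Fin (D.kk j + 2) → ℂ}
    (hv : ∀ b, ∑ a, v a * eval P ((D.zeroMatrix i j).adjugate a b) = 0) {V : ℕ → ℂ}
    (hV : ∀ a : Fin (D.kk j + 2), a.val ≠ D.kk j + 1 →
      V a * P 1 ^ (D.stairB j (a + 1) - D.stairB j a) -
        V (a + 1) * P 0 ^ (D.stairA i j a - D.stairA i j (a + 1)) = v a) (b : Fin (D.kk j + 2)) :
    v b = ∑ a : Fin (D.kk j + 2), V a * eval P (D.zeroMatrix i j a b) := by
  have h1 : ∀ b : Fin (D.kk j + 2), b.val ≠ D.kk j + 1 →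
      v b - ∑ a : Fin (D.kk j + 2), V a * eval P (D.zeroMatrix i j a b) = 0 := fun b hb => by
    rw [eval_mul_zeroMatrix hj P V b hb, hV b hb, sub_self]
  -- The difference of the two rows is supported in the last entry and is annihilated by the
  -- adjugate, whose last row is nonzero at `P`; hence that entry is zero as well.
  by_cases hb : b.val = D.kk j + 1
  · obtain ⟨c, hc⟩ := hε
    have h2 : ∑ b, (v b - ∑ a : Fin (D.kk j + 2), V a * eval P (D.zeroMatrix i j a b)) *
        eval P ((D.zeroMatrix i j).adjugate b c) = 0 := by
      simp only [sub_mul, Finset.sum_sub_distrib, hv, zero_sub, neg_eq_zero, Finset.sum_mul]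
      rw [Finset.sum_comm]
      refine Finset.sum_eq_zero fun a _ => ?_
      have h3 := congrFun (congrFun (Matrix.mul_adjugate (D.zeroMatrix i j)) a) c
      rw [D.zeroMatrix_det hi hj, Matrix.mul_apply, Matrix.smul_apply, smul_eq_mul] at h3
      have h4 := congrArg (eval P) h3
      rw [map_mul, hP, zero_mul, map_sum] at h4
      simp only [mul_assoc, ← Finset.mul_sum]
      simp only [map_mul] at h4
      rw [h4, mul_zero]
    rw [Finset.sum_eq_single b (fun b' _ hb' => by
      rw [h1 b' (fun h => hb' (Fin.ext (h.trans hb.symm))), zero_mul]) (by simp)] at h2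
    obtain rfl : b = Fin.last _ := Fin.ext hb
    exact sub_eq_zero.1 ((mul_eq_zero.1 h2).resolve_right hc)
  · exact sub_eq_zero.1 (h1 b hb)

end Evaluation

namespace Line

variable (Y : D.Line) {i j : ℕ} (hi : i ∈ Finset.Icc (D.p - D.m) (D.p - 1))
  (hj : j ∈ Finset.Icc 1 (D.q - 1))

/-- The index of a corner of the staircase which does not vanish at the chosen point. -/
def base (j : ℕ) : D.Line → ℕ
  | x _ => D.kk j + 1
  | y _ => 0
  | w _ => D.kk j + 1

lemma base_lt (j : ℕ) : Y.base j < D.kk j + 2 := by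
  cases Y <;> simp [base]

/-- The values of the corners of the staircase at the chosen point. -/
def corner (i j s : ℕ) : ℂ := Y.pt 0 ^ D.stairA i j s * Y.pt 1 ^ D.stairB j s

lemma corner_base (i j : ℕ) : Y.corner i j (Y.base j) = 1 := by
  cases Y <;> simp [corner, base, pt, stairA_last, stairB_zero]

include hi hj in
lemma eval_adjugate (b : Fin (D.kk j + 2)) :
    eval Y.pt ((D.zeroMatrix i j).adjugate (Fin.last _) b) = Y.corner i j b := by
  rw [adjugate_last hi hj, map_mul, map_pow, map_pow, eval_X, eval_X, corner]

include hi hj in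
lemma exists_eval_adjugate_ne_zero :
    ∃ b, eval Y.pt ((D.zeroMatrix i j).adjugate (Fin.last _) b) ≠ 0 :=
  ⟨⟨Y.base j, Y.base_lt j⟩, by rw [Y.eval_adjugate hi hj, corner_base]; exact one_ne_zero⟩

include hi hj in
-- The first `k + 1` columns give a two-term recursion that determines `V` from its value at the
-- base index; the vector of corner values is the solution with value `1` there.
lemma eq_corner {V : ℕ → ℂ} (hV : ∀ s ≤ D.kk j,
    V s * Y.pt 1 ^ (D.stairB j (s + 1) - D.stairB j s) =
      V (s + 1) * Y.pt 0 ^ (D.stairA i j s - D.stairA i j (s + 1))) (s : ℕ)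
    (hs : s ≤ D.kk j + 1) : V s = V (Y.base j) * Y.corner i j s := by
  rcases Y with t | t | t
  · simp only [pt, cons_val_zero, cons_val_one, one_pow, mul_one, base, corner] at hV ⊢
    rcases hs.eq_or_lt with rfl | hs
    · simp [stairA_last]
    · have h1 := stairA_lt hi (j := j) s (by omega)
      rw [hV s (by omega), zero_pow (by omega), zero_pow (by omega)]; simp
  · simp only [pt, cons_val_zero, cons_val_one, one_pow, mul_one, one_mul, base, corner] at hV ⊢
    rcases s with _ | s
    · simp [stairB_zero]
    · have h1 := stairB_lt hj s (by omega)
      rw [← hV s (by omega), zero_pow (by omega), zero_pow (by omega), mul_zero, mul_zero]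
  · simp only [pt, cons_val_zero, cons_val_one, one_pow, mul_one, base, corner] at hV ⊢
    obtain ⟨d, hd⟩ := Nat.exists_eq_add_of_le hs
    induction d generalizing s with
    | zero => rw [show s = D.kk j + 1 by omega]; simp [stairA_last]
    | succ d ih =>
      rw [hV s (by omega), ih (s + 1) (by omega) (by omega), mul_assoc, mul_comm (_ ^ _),
        pow_sub_mul_pow _ (D.stairA_antitone i j (Nat.le_succ s))]

include hi hj in
-- In odd degrees every row satisfying the closedness condition is a combination of rows of the
-- matrix, with coefficients that occur in the available degrees. The equations for all columns but
-- the last are solved explicitly; the last one is automatic by `eq_mul_zeroMatrix`.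
lemma exists_solution_odd (r : ℤ) {v : Fin (D.kk j + 2) → ℂ}
    (hv : ∀ b, v b ≠ 0 → Y.Allowed (D.cv + Y.tw - (D.zeroEven i j b + r • D.cv)))
    (hc : ∀ b, ∑ a, v a * eval Y.pt ((D.zeroMatrix i j).adjugate a b) = 0) :
    ∃ s : Fin (D.kk j + 2) → ℂ,
      (∀ a, s a ≠ 0 → Y.Allowed (D.cv + Y.tw - (D.zeroOdd i j a + r • D.cv))) ∧
      ∀ b, v b = ∑ a, s a * eval Y.pt (D.zeroMatrix i j a b) := by
  have hb := index_bounds_int hi hj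
  have hr' := D.rel'
  have hrel := D.rel
  have hsol := fun V => eq_mul_zeroMatrix hi hj Y.eval_W (Y.exists_eval_adjugate_ne_zero hi hj) hc
    (V := V)
  set V : ℕ → ℂ := fun s => if h : s < D.kk j + 2 then v ⟨s, h⟩ else 0 with hVdef
  have hV : ∀ a : Fin (D.kk j + 2), V a = v a := fun a => dif_pos a.2
  have hVe : ∀ s ≤ D.kk j, V s ≠ 0 →
      Y.Allowed (D.cv + Y.tw - (D.cv - (D.m : ℤ) • D.xv + r • D.cv)) := by
    intro s hs h
    have h1 := hv ⟨s, by omega⟩ (by rwa [← hV])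
    rwa [zeroEven, if_neg (by simp only; omega)] at h1
  rcases Y with ⟨i', hi'⟩ | ⟨j', hj'⟩ | t
  · rw [Finset.mem_Icc] at hi'
    -- At `(0, 1)` the subdiagonal vanishes and the diagonal is `1`, so the coefficients are the
    -- entries of `v`.
    refine ⟨fun a => if a.val = D.kk j + 1 then 0 else V a, fun a ha => ?_, hsol
      (fun s => if s = D.kk j + 1 then 0 else V s) fun a ha => ?_⟩
    · have ha2 := a.2
      have ha' : a.val ≠ D.kk j + 1 := fun h => ha (if_pos h)
      beta_reduce at ha
      rw [if_neg ha'] at ha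
      have h1 := hVe a (by omega) ha
      rcases le_or_gt 1 r with hr | hr
      · refine absurd (ineffective_of ((i' : ℤ) + 1 - D.p + D.m) 0 (-r) ?_ (by omega)) h1.effective
        simp only [tw]; module
      · refine Allowed.sub_x (D.stairB j (a + 1) - D.stairB j a) ?_ ?_
        · convert h1 using 1
          rw [stairB_sub hj a (by omega), zeroOdd]
          split_ifs
          · rw [Nat.cast_sub (by have := D.kk_bounds hj; omega)]
            push_cast
            linear_combination (norm := module) ((D.kk j : ℤ)) • D.rel
          · linear_combination (norm := module) (-1 : ℤ) • D.rel
        · rw [zeroOdd]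
          simp only [tw]
          split_ifs
          · refine ineffective_of ((D.p : ℤ) - 1 - i') (j - 1 - D.kk j * D.n - D.n) r ?_ (by omega)
            linear_combination (norm := module) -((D.kk j : ℤ) + 1) • D.rel
          · refine ineffective_of ((D.p : ℤ) - 1 - i') (-1) r ?_ (by omega)
            module
    · have ha2 := a.2
      simp only [pt, cons_val_zero, cons_val_one, one_pow, mul_one]
      have h1 := stairA_lt hi (j := j) a (by omega)
      rw [if_neg ha, zero_pow (by omega), mul_zero, sub_zero, hV]
  · rw [Finset.mem_Icc] at hj'
    -- At `(1, 0)` the diagonal vanishes and the subdiagonal is `-1`, so the coefficients are the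
    -- negated entries of `v`, shifted by one.
    refine ⟨fun a => if a.val = 0 then 0 else -V (a - 1), fun a ha => ?_, hsol
      (fun s => if s = 0 then 0 else -V (s - 1)) fun a ha => ?_⟩
    · have ha2 := a.2
      have ha' : a.val ≠ 0 := fun h => ha (if_pos h)
      beta_reduce at ha
      rw [if_neg ha'] at ha
      obtain ⟨b, hb'⟩ := Nat.exists_eq_succ_of_ne_zero ha'
      have h1 := hVe (a - 1) (by omega) (by simpa using ha)
      rcases le_or_gt 1 r with hr | hr
      · refine absurd (ineffective_of 0 ((j' : ℤ) + 1 - D.q + D.n) (-r) ?_ (by omega)) h1.effective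
        simp only [tw]
        linear_combination (norm := module) D.rel
      · refine Allowed.sub_y (D.stairA i j b - D.stairA i j (b + 1)) ?_ ?_
        · convert h1 using 1
          rw [stairA_sub b (by omega), zeroOdd]
          simp only [tw]
          rw [if_neg ha']
          by_cases hbk : b = D.kk j
          · rw [if_pos (by omega), if_pos hbk]
            obtain ⟨l, hl⟩ := Nat.exists_eq_add_of_le' D.l_pos
            have e : (D.p : ℤ) = l * D.m + D.m + 1 := by rw [hb.2.2.2.2.2.2.1, hl]; push_cast; ring
            have e2 : l * D.m ≤ i := by
              have : (l : ℤ) * D.m ≤ i := by omega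
              exact_mod_cast this
            rw [hl, Nat.add_sub_cancel, Nat.cast_sub e2, cv]
            push_cast
            rw [e]
            module
          · rw [if_neg (by omega), if_neg hbk]
            module
        · rw [zeroOdd, if_neg ha']
          simp only [tw]
          split_ifs
          · refine ineffective_of ((i : ℤ) - D.p + D.m) (D.q - 1 - D.n - j') r ?_ (by omega)
            rw [D.cv_eq]
            linear_combination (norm := module) D.rel' - D.rel
          · refine ineffective_of (-1) (D.q - 1 - j') r ?_ (by omega)
            module
    · have ha2 := a.2
      simp only [pt, cons_val_zero, cons_val_one, one_pow, mul_one]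
      have h1 := stairB_lt hj a (by omega)
      rw [zero_pow (by omega), mul_zero, zero_sub, if_neg (Nat.succ_ne_zero _), neg_neg,
        Nat.add_sub_cancel, hV]
  · rcases le_or_gt 1 r with hr | hr
    · have hv0 : ∀ b, v b = 0 := by
        intro b
        by_contra h
        refine (hv b h).effective ?_
        rw [zeroEven]
        simp only [tw]
        split_ifs
        · refine ineffective_of ((D.p : ℤ) - 1 - i) (-j) (-(r - 1)) ?_ (by omega)
          rw [cv]; module
        · refine ineffective_of D.m 0 (-r) ?_ (by omega)
          module
      exact ⟨0, fun a ha => absurd rfl ha, fun b => by simp [hv0]⟩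
    · have hξ := D.rootPow_ne_zero t
      -- At a point with nonzero coordinates the two-term recursion is solved from the starting
      -- value `0`.
      set s : ℕ → ℂ := fun a => Nat.rec 0 (fun a sa => (sa - V a) /
        D.rootPow t ^ (D.stairA i j a - D.stairA i j (a + 1))) a with hs
      refine ⟨fun a => s a, fun a ha => ?_, hsol s fun a ha => ?_⟩
      · have ha' : a.val ≠ 0 := fun h => ha (by beta_reduce; rw [h]; rfl)
        obtain ⟨r', rfl⟩ : ∃ r' : ℕ, r = -(r' : ℤ) := ⟨r.natAbs, by omega⟩
        rw [zeroOdd, if_neg ha']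
        simp only [tw]
        split_ifs
        · refine allowed_w.2 ⟨D.p - 1 - i + r' * D.p, r', ?_⟩
          push_cast [show ((D.p - 1 - i : ℕ) : ℤ) = D.p - 1 - i by omega]
          rw [cv]; module
        · refine allowed_w.2 ⟨r' * D.p, r', ?_⟩
          push_cast
          rw [cv]; module
      · simp only [pt, cons_val_zero, cons_val_one, one_pow, mul_one]
        have e : s (a.val + 1) = (s a.val - V a.val) /
          D.rootPow t ^ (D.stairA i j a - D.stairA i j (a + 1)) := rfl
        rw [e, div_mul_cancel₀ _ (pow_ne_zero _ hξ), hV]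
        ring

include hi hj in
-- In even degrees a closed row is a multiple of the corner vector. For `r > 0` the multiple is zero
-- by degree; for `r < 0` it may be used as a homotopy out of the last summand; `r = 0` is the
-- surviving class.
lemma base_allowed (r : ℤ)
    (hv : Y.Allowed (D.cv + Y.tw - (D.zeroOdd i j ⟨Y.base j, Y.base_lt j⟩ + r • D.cv))) :
    r ≤ 0 ∧ (r ≤ -1 → Y.Allowed (D.cv + Y.tw - (D.topDeg i j + r • D.cv))) := by
  have hb := index_bounds_int hi hj
  rcases Y with ⟨i', hi'⟩ | ⟨j', hj'⟩ | t
  · rw [Finset.mem_Icc] at hi'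
    simp only [base, tw, zeroOdd] at hv ⊢
    rw [if_neg (Nat.succ_ne_zero _), if_pos trivial] at hv
    constructor
    · by_contra hr
      refine hv.effective (ineffective_of ((i' : ℤ) - i) 0 (-r) ?_ (by omega))
      rw [cv]; module
    · intro hr
      refine Allowed.sub_x j ?_ ?_
      · convert hv using 1
        rw [topDeg]; module
      · refine ineffective_of ((i : ℤ) - i') (j - 1) r ?_ (by omega)
        rw [topDeg, cv]; module
  · rw [Finset.mem_Icc] at hj'
    simp only [base, tw, zeroOdd, if_true] at hv ⊢
    constructor
    · by_contra hr
      refine hv.effective (ineffective_of 0 ((j' : ℤ) + 1 - D.q - j + D.kk j * D.n + D.n) (-r) ?_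
        (by omega))
      linear_combination (norm := module) ((D.kk j : ℤ) + 1) • D.rel
    · intro hr
      refine Allowed.sub_y (D.stairA i j 0) ?_ ?_
      · convert hv using 1
        rw [stairA_int hi 0 (Nat.zero_le _), topDeg, cv]
        push_cast
        module
      · refine ineffective_of ((i : ℤ) - D.p + D.m) (D.q - 1 - D.n + j - j') r ?_ (by omega)
        rw [topDeg, D.cv_eq]
        linear_combination (norm := module) D.rel' - D.rel
  · simp only [base, tw, zeroOdd] at hv ⊢
    rw [if_neg (Nat.succ_ne_zero _), if_pos trivial] at hv
    constructor
    · by_contra hr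
      refine hv.effective (ineffective_of ((D.p : ℤ) - 1 - i) 0 (-r) ?_ (by omega))
      rw [cv]; module
    · intro hr
      obtain ⟨r', rfl⟩ : ∃ r' : ℕ, r = -((r' : ℤ) + 1) := ⟨(-r - 1).natAbs, by omega⟩
      refine allowed_w.2 ⟨D.p - 1 - i + r' + 1, D.q - j + r' * D.q, ?_⟩
      push_cast [show ((D.p - 1 - i : ℕ) : ℤ) = D.p - 1 - i by omega,
        show ((D.q - j : ℕ) : ℤ) = D.q - j by omega]
      rw [topDeg, D.cv_eq]
      linear_combination (norm := module) D.rel'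

include hi hj in
-- A homotopy of degree `-1` has no component from `K^0` to degree `-1` of a rank one object; hence
-- boundaries of degree zero vanish at the point.
lemma zeroEven_ineffective (a : Fin (D.kk j + 2)) :
    D.Ineffective (D.cv + Y.tw - (D.zeroEven i j a + D.cv)) := by
  have hb := index_bounds_int hi hj
  rw [zeroEven]
  rcases Y with ⟨i', hi'⟩ | ⟨j', hj'⟩ | t
  · rw [Finset.mem_Icc] at hi'
    simp only [tw]
    split_ifs
    · refine ineffective_of ((i' : ℤ) - i) (-j) 0 ?_ (by omega)
      rw [cv]; module
    · refine ineffective_of ((i' : ℤ) + 1 - D.p + D.m) 0 (-1) ?_ (by omega)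
      module
  · rw [Finset.mem_Icc] at hj'
    simp only [tw]
    split_ifs
    · refine ineffective_of (-((i : ℤ) - D.p + D.m + 1)) (j' - j - (D.q - 1 - D.n)) 0 ?_ (by omega)
      rw [D.cv_eq]
      linear_combination (norm := module) D.rel - D.rel'
    · refine ineffective_of 0 ((j' : ℤ) + 1 - D.q + D.n) (-1) ?_ (by omega)
      linear_combination (norm := module) D.rel
  · simp only [tw]
    split_ifs
    · refine ineffective_of ((D.p : ℤ) - 1 - i) (-j) 0 ?_ (by omega)
      rw [cv]; module
    · refine ineffective_of D.m 0 (-1) ?_ (by omega)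
      module

end Line

end LoopDatum

/-! ### Morphisms to matrix factorisations of rank one -/

namespace LoopDatum

open MvPolynomial Matrix

variable {D : LoopDatum}

namespace Line

variable (X Y : D.Line) {i j : ℕ} (hi : i ∈ Finset.Icc (D.p - D.m) (D.p - 1))
  (hj : j ∈ Finset.Icc 1 (D.q - 1))

lemma d_neg_two_dvd (d : D.L) (h : MvPolynomial (Fin 2) ℂ) (hh : IsWeightedHomogeneous D.wt h d)
    (hP : eval Y.pt h = 0) : (D.obj Y.obj).d (-2) Y.idx Y.idx ∣ h := by
  rw [d_neg_two, neg_dvd]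
  exact Y.factor_dvd hh hP

lemma eval_d_neg_two : eval Y.pt ((D.obj Y.obj).d (-2) Y.idx Y.idx) = 0 := by
  rw [d_neg_two, map_neg, eval_factor, neg_zero]

lemma allowed_entry {K : GradedMF D.wt D.W D.cv} {n : ℤ} (f : GradedMF.homSub K (D.obj Y.obj) n)
    (b : Fin K.rk) (h : eval Y.pt (f.1 (-n - 1) Y.idx b) ≠ 0) :
    Y.Allowed (D.cv + Y.tw - K.deg (-n - 1) b) := by
  refine ⟨_, ?_, h⟩
  have h1 := f.2.1 (-n - 1) Y.idx b
  rwa [show -n - 1 + n = -1 by ring, deg_neg_one] at h1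

/-- The index of a corner which does not vanish at the chosen point. -/
def baseIdx : Fin (D.Kzero i j hi hj).rk := ⟨Y.base j, Y.base_lt j⟩

/-- Closedness puts the evaluated row in the left kernel of the evaluated matrix, which the corner
vector spans. -/
lemma zero_line_row {n r : ℤ} (hn : -n = 2 * r)
    {f : GradedMF.homSub (D.Kzero i j hi hj) (D.obj Y.obj) n}
    (hf : f ∈ (mfCat D.wt D.W D.cv).Z (D.Kzero i j hi hj) (D.obj Y.obj) n)
    (b : Fin (D.kk j + 2)) : eval Y.pt (f.1 (-n - 1) Y.idx b) =
      eval Y.pt (f.1 (-n - 1) Y.idx (Y.baseIdx hi hj)) * Y.corner i j b := by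
  have hc := GradedMF.eval_closed (e := Y.idx) Y.eq_idx Y.eval_d_neg_two hf
  have hd : (D.Kzero i j hi hj).d (-n - 2) = D.zeroMatrix i j := by
    rw [show -n - 2 = 2 * (r - 1) by omega]; exact Kzero_d_even hi hj _
  rw [hd] at hc
  set v : Fin (D.kk j + 2) → ℂ := fun b => eval Y.pt (f.1 (-n - 1) Y.idx b)
  set V : ℕ → ℂ := fun s => if h : s < D.kk j + 2 then v ⟨s, h⟩ else 0
  have hV : ∀ a : Fin (D.kk j + 2), V a = v a := fun a => dif_pos a.2
  have h1 := Y.eq_corner hi hj (V := V) (fun s hs => by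
    have h2 := hc ⟨s, by change s < D.kk j + 2; omega⟩
    have h3 := eval_mul_zeroMatrix hj (i := i) Y.pt V ⟨s, by omega⟩ (by simp only; omega)
    simp only [hV] at h3
    exact sub_eq_zero.1 (h3.symm.trans h2)) b (by omega)
  have h2 : V (Y.base j) = v ⟨Y.base j, Y.base_lt j⟩ := hV ⟨Y.base j, Y.base_lt j⟩
  rw [hV, h2] at h1
  exact h1

lemma zero_line_mem_B {n : ℤ} {f : GradedMF.homSub (D.Kzero i j hi hj) (D.obj Y.obj) n}
    (hf : f ∈ (mfCat D.wt D.W D.cv).Z (D.Kzero i j hi hj) (D.obj Y.obj) n)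
    (h : n = 0 → eval Y.pt (f.1 (-1) Y.idx (Y.baseIdx hi hj)) = 0) :
    f ∈ (mfCat D.wt D.W D.cv).B (D.Kzero i j hi hj) (D.obj Y.obj) n := by
  have hA := Y.allowed_entry f
  rcases Int.even_or_odd (-n) with ⟨r, hr⟩ | ⟨r, hr⟩
  · have hn : -n = 2 * r := by omega
    have hrow := Y.zero_line_row hi hj hn hf
    have hd : (D.Kzero i j hi hj).d (-n - 1) = (D.zeroMatrix i j).adjugate := by
      rw [hn]; exact Kzero_d_odd hi hj _
    have hdeg1 : (D.Kzero i j hi hj).deg (-n - 1) (Y.baseIdx hi hj) =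
        D.zeroOdd i j ⟨Y.base j, Y.base_lt j⟩ + r • D.cv := by
      rw [hn]; exact Kzero_deg_odd hi hj r _
    have hdeg0 : (D.Kzero i j hi hj).deg (-n) (top hi hj) = D.topDeg i j + r • D.cv := by
      rw [hn]; exact Kzero_deg_top hi hj r
    -- The row is a multiple of the last row of the evaluated adjugate, so the homotopy is
    -- concentrated in the last summand.
    refine GradedMF.mem_B_of_eval D.W_ne_zero Y.eq_idx Y.d_neg_two_dvd hf
      (Pi.single (top hi hj) (eval Y.pt (f.1 (-n - 1) Y.idx (Y.baseIdx hi hj)))) ?_ ?_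
    · intro a ha
      have ha' : a = top hi hj := by
        by_contra h'
        exact ha (Pi.single_eq_of_ne h' _)
      subst ha'
      rw [Pi.single_eq_same] at ha
      have h1 := hA _ ha
      rw [hdeg1] at h1
      obtain ⟨h2, h3⟩ := Y.base_allowed hi hj r h1
      rw [hdeg0, deg_neg_one]
      rcases h2.eq_or_lt with h2 | h2
      · obtain rfl : n = 0 := by omega
        exact absurd (by simpa using h rfl) ha
      · exact h3 (by omega)
    · intro b
      rw [Finset.sum_eq_single (top hi hj) (fun a _ ha => by
        rw [Pi.single_eq_of_ne ha, zero_mul]) (by simp), Pi.single_eq_same, hd]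
      exact (hrow b).trans (congrArg _ (Y.eval_adjugate hi hj b).symm)
  · obtain ⟨r, hn⟩ : ∃ s, -n = 2 * s - 1 := ⟨r + 1, by omega⟩
    have hc := GradedMF.eval_closed (e := Y.idx) Y.eq_idx Y.eval_d_neg_two hf
    have hd : (D.Kzero i j hi hj).d (-n - 2) = (D.zeroMatrix i j).adjugate := by
      rw [show -n - 2 = 2 * (r - 1) - 1 by omega]; exact Kzero_d_odd hi hj _
    have hd1 : (D.Kzero i j hi hj).d (-n - 1) = D.zeroMatrix i j := by
      rw [show -n - 1 = 2 * (r - 1) by omega]; exact Kzero_d_even hi hj _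
    have hdeg1 : ∀ b : Fin (D.kk j + 2), (D.Kzero i j hi hj).deg (-n - 1) b =
        D.zeroEven i j b + r • D.cv := fun b => by
      rw [show -n - 1 = 2 * (r - 1) by omega]
      exact (Kzero_deg_even hi hj _ b).trans (by rw [sub_add_cancel])
    have hdeg0 : ∀ b : Fin (D.kk j + 2), (D.Kzero i j hi hj).deg (-n) b =
        D.zeroOdd i j b + r • D.cv := fun b => by
      rw [hn]; exact Kzero_deg_odd hi hj _ b
    rw [hd] at hc
    obtain ⟨s, hs1, hs2⟩ := Y.exists_solution_odd hi hj r
      (v := fun b => eval Y.pt (f.1 (-n - 1) Y.idx b))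
      (fun b hb => by rw [← hdeg1]; exact hA b hb) hc
    refine GradedMF.mem_B_of_eval D.W_ne_zero Y.eq_idx Y.d_neg_two_dvd hf s ?_ ?_
    · intro a ha
      have h1 := hdeg0 a
      rw [h1, deg_neg_one]
      exact hs1 a ha
    · rw [hd1]
      exact hs2

lemma zero_line_exact {f : GradedMF.homSub (D.Kzero i j hi hj) (D.obj Y.obj) 0}
    (hf : f ∈ (mfCat D.wt D.W D.cv).B (D.Kzero i j hi hj) (D.obj Y.obj) 0)
    (b : Fin (D.Kzero i j hi hj).rk) : eval Y.pt (f.1 (-1) Y.idx b) = 0 := by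
  refine GradedMF.eval_exact Y.eq_idx Y.eval_d_neg_two hf (fun a t ht => ?_) b
  have h1 := Kzero_deg_even hi hj 0 a
  rw [mul_zero, zero_add, one_smul] at h1
  rw [deg_neg_one, h1] at ht
  rw [(Y.zeroEven_ineffective hi hj a).eq_zero ht, map_zero]

include hi hj in
lemma sum_corner_mul (b : Fin (D.kk j + 2)) :
    ∑ a : Fin (D.kk j + 2), Y.corner i j a * eval Y.pt (D.zeroMatrix i j a b) = 0 := by
  have h1 := congrFun (congrFun (Matrix.adjugate_mul (D.zeroMatrix i j)) (Fin.last _)) b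
  rw [D.zeroMatrix_det hi hj, Matrix.mul_apply, Matrix.smul_apply, smul_eq_mul] at h1
  have h2 := congrArg (eval Y.pt) h1
  rw [map_mul, eval_W, zero_mul, map_sum] at h2
  rw [← h2]
  refine Finset.sum_congr rfl fun a _ => ?_
  rw [map_mul, Y.eval_adjugate hi hj]

/-- The morphism is given by the constants `Y.corner i j a`. They have degree zero by the hypothesis
and satisfy the closedness condition by `sum_corner_mul`. -/
lemma exists_zero_line (h : ∀ a : Fin (D.kk j + 2), Y.corner i j a ≠ 0 →
      D.cv + Y.tw = D.zeroOdd i j a) :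
    ∃ f ∈ (mfCat D.wt D.W D.cv).Z (D.Kzero i j hi hj) (D.obj Y.obj) 0,
      eval Y.pt (f.1 (-1) Y.idx (Y.baseIdx hi hj)) = 1 := by
  obtain ⟨f, hf, hv⟩ := GradedMF.exists_closed_of_eval D.W_ne_zero Y.eq_idx Y.d_neg_two_dvd
    (K := D.Kzero i j hi hj) (v := fun a : Fin (D.kk j + 2) => C (Y.corner i j a)) (fun a => by
      by_cases ha : Y.corner i j (a : ℕ) = 0
      · rw [ha, C_0]; exact isWeightedHomogeneous_zero _ _ _
      · have h1 := Kzero_deg_odd hi hj 0 a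
        rw [mul_zero, zero_sub, zero_smul, add_zero] at h1
        rw [deg_neg_one, h1, h a ha, sub_self]
        exact isWeightedHomogeneous_C _ _) (fun b => by
      rw [Kzero_d_neg_two]
      simp only [eval_C]
      exact Y.sum_corner_mul hi hj b)
  refine ⟨f, hf, ?_⟩
  rw [hv, eval_C]
  exact Y.corner_base i j

/-! #### Morphisms between matrix factorisations of rank one -/

/-- For different factors the homotopy is the value divided by the factor of the source, which is
invertible at the point of `Y`; its degree has to be attained by a polynomial not vanishing there.
-/
lemma allowed_of_factor_ne (h : X.factor ≠ Y.factor) (r : ℤ)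
    (hd : Y.Allowed (Y.tw - X.tw - r • D.cv + X.len)) : Y.Allowed (Y.tw - X.tw - r • D.cv) := by
  have hm : (0 : ℤ) < D.m := by exact_mod_cast D.m_pos
  have hn : (0 : ℤ) < D.n := by exact_mod_cast D.n_pos
  have hp : (D.p : ℤ) = D.l * D.m + 1 := by exact_mod_cast D.p_eq
  have hq : (D.q : ℤ) = D.l * D.n + 1 := by exact_mod_cast D.q_eq
  have hl : (1 : ℤ) ≤ D.l := by exact_mod_cast D.l_pos
  have h4 : (1 : ℤ) * D.m ≤ D.l * D.m := mul_le_mul_of_nonneg_right hl hm.le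
  have h5 : (1 : ℤ) * D.n ≤ D.l * D.n := mul_le_mul_of_nonneg_right hl hn.le
  have hrel := D.rel
  rcases le_or_gt 1 r with hr | hr
  · refine absurd ?_ hd.effective
    rcases Y with ⟨i', hi'⟩ | ⟨j', hj'⟩ | t <;> rcases X with ⟨i, hi⟩ | ⟨j, hj⟩ | u
    · exact absurd rfl h
    · rw [Finset.mem_Icc] at hi' hj
      refine ineffective_of (-((D.p : ℤ) - 1 - i')) (D.q - j) (-r) ?_ (by omega)
      simp only [tw, len]; module
    · rw [Finset.mem_Icc] at hi'
      refine ineffective_of (D.m - ((D.p : ℤ) - 1 - i')) 0 (-r) ?_ (by omega)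
      simp only [tw, len]; module
    · rw [Finset.mem_Icc] at hi hj'
      refine ineffective_of (D.p - i) (-(D.q - 1 - j')) (-r) ?_ (by omega)
      simp only [tw, len]; module
    · exact absurd rfl h
    · rw [Finset.mem_Icc] at hj'
      refine ineffective_of 0 (D.n - (D.q - 1 - j')) (-r) ?_ (by omega)
      simp only [tw, len]
      linear_combination (norm := module) D.rel
    · rw [Finset.mem_Icc] at hi
      refine ineffective_of (D.p - i) 0 (-r) ?_ (by omega)
      simp only [tw, len]; module
    · rw [Finset.mem_Icc] at hj
      refine ineffective_of 0 (D.q - j) (-r) ?_ (by omega)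
      simp only [tw, len]; module
    · refine ineffective_of D.m 0 (-r) ?_ (by omega)
      simp only [tw, len]; module
  · rcases Y with ⟨i', hi'⟩ | ⟨j', hj'⟩ | t
    · rw [Finset.mem_Icc] at hi'
      rcases X with ⟨i, hi⟩ | ⟨j, hj⟩ | u
      · exact absurd rfl h
      · rw [Finset.mem_Icc] at hj
        refine Allowed.sub_x 1 (by simpa [len] using hd)
          (ineffective_of ((D.p : ℤ) - 1 - i') (-(D.q - j)) r ?_ (by omega))
        simp only [tw]; module
      · refine Allowed.sub_x D.n (by simpa only [len, D.rel] using hd)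
          (ineffective_of ((D.p : ℤ) - 1 - i') (-1) r ?_ (by omega))
        simp only [tw]; module
    · rw [Finset.mem_Icc] at hj'
      rcases X with ⟨i, hi⟩ | ⟨j, hj⟩ | u
      · rw [Finset.mem_Icc] at hi
        refine Allowed.sub_y 1 (by simpa [len] using hd)
          (ineffective_of (-(D.p - i)) ((D.q : ℤ) - 1 - j') r ?_ (by omega))
        simp only [tw]; module
      · exact absurd rfl h
      · refine Allowed.sub_y D.m (by simpa only [len] using hd)
          (ineffective_of (-1) ((D.q : ℤ) - 1 - j') r ?_ (by omega))
        simp only [tw]; module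
    · obtain ⟨r', rfl⟩ : ∃ r' : ℕ, r = -(r' : ℤ) := ⟨r.natAbs, by omega⟩
      rcases X with ⟨i, hi⟩ | ⟨j, hj⟩ | u
      · rw [Finset.mem_Icc] at hi
        refine allowed_w.2 ⟨D.p - 1 - i + r' * D.p, r', ?_⟩
        push_cast [show ((D.p - 1 - i : ℕ) : ℤ) = D.p - 1 - i by omega]
        simp only [tw]; rw [cv]; module
      · rw [Finset.mem_Icc] at hj
        refine allowed_w.2 ⟨r' * D.p, D.q - 1 - j + r', ?_⟩
        push_cast [show ((D.q - 1 - j : ℕ) : ℤ) = D.q - 1 - j by omega]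
        simp only [tw]; rw [cv]; module
      · refine allowed_w.2 ⟨r' * D.p, r', ?_⟩
        push_cast
        simp only [tw]; rw [cv]; module

/-- For equal factors the homotopy divides by the cofactor instead. The exception `r = 0`, `X = Y`
is the identity class. -/
lemma allowed_of_factor_eq (h : X.factor = Y.factor) (r : ℤ)
    (hd : Y.Allowed (Y.tw - X.tw - r • D.cv)) :
    (r = 0 ∧ X = Y) ∨ Y.Allowed (X.len + Y.tw - X.tw - (r + 1) • D.cv) := by
  have hm : (0 : ℤ) < D.m := by exact_mod_cast D.m_pos
  have hn : (0 : ℤ) < D.n := by exact_mod_cast D.n_pos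
  have hp : (D.p : ℤ) = D.l * D.m + 1 := by exact_mod_cast D.p_eq
  have hq : (D.q : ℤ) = D.l * D.n + 1 := by exact_mod_cast D.q_eq
  have hl : (1 : ℤ) ≤ D.l := by exact_mod_cast D.l_pos
  have h4 : (1 : ℤ) * D.m ≤ D.l * D.m := mul_le_mul_of_nonneg_right hl hm.le
  have h5 : (1 : ℤ) * D.n ≤ D.l * D.n := mul_le_mul_of_nonneg_right hl hn.le
  have hne : eval Y.pt X.factor = 0 := by rw [h, eval_factor]
  rcases Y with ⟨i', hi'⟩ | ⟨j', hj'⟩ | t <;> rcases X with ⟨i, hi⟩ | ⟨j, hj⟩ | u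
  · rw [Finset.mem_Icc] at hi hi'
    rcases lt_trichotomy r 0 with hr | rfl | hr
    · right
      refine Allowed.sub_x D.q ?_ (ineffective_of ((i : ℤ) - i' - 1) (-1) (r + 1) ?_ (by omega))
      · convert hd using 1
        simp only [tw, len]; rw [D.cv_eq]; module
      · simp only [tw, len]; module
    · left
      refine ⟨rfl, ?_⟩
      obtain ⟨b, hb⟩ := allowed_x.1 hd
      simp only [tw] at hb
      obtain ⟨s, hs1, hs2⟩ := (D.smul_add_smul_eq_zero ((i' : ℤ) - i) (-b)).1 (by
        linear_combination (norm := module) -hb)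
      -- Both indices lie among `m` consecutive integers, so no multiple of the relation other than
      -- zero relates them.
      have hs : s = 0 := by
        rcases lt_trichotomy s 0 with h0 | h0 | h0
        · have := mul_le_mul_of_nonneg_right (show s ≤ -1 by omega) hm.le
          omega
        · exact h0
        · have := mul_le_mul_of_nonneg_right (show 1 ≤ s by omega) hm.le
          omega
      subst hs
      congr 2
      omega
    · refine absurd ?_ hd.effective
      refine ineffective_of ((i' : ℤ) - i) 0 (-r) ?_ (by omega)
      simp only [tw]; module
  · simp [pt, factor] at hne
  · simp [pt, factor, LoopDatum.w, D.m_pos.ne', root_ne_zero] at hne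
  · simp [pt, factor] at hne
  · rw [Finset.mem_Icc] at hj hj'
    rcases lt_trichotomy r 0 with hr | rfl | hr
    · right
      refine Allowed.sub_y D.p ?_ (ineffective_of (-1) ((j : ℤ) - j' - 1) (r + 1) ?_ (by omega))
      · convert hd using 1
        simp only [tw, len]; rw [cv]; module
      · simp only [tw, len]; module
    · left
      refine ⟨rfl, ?_⟩
      obtain ⟨b, hb⟩ := allowed_y.1 hd
      simp only [tw] at hb
      obtain ⟨s, hs1, hs2⟩ := (D.smul_add_smul_eq_zero (-b) ((j' : ℤ) - j)).1 (by
        linear_combination (norm := module) -hb)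
      have hs : s = 0 := by
        rcases lt_trichotomy s 0 with h0 | h0 | h0
        · have := mul_le_mul_of_nonneg_right (show s ≤ -1 by omega) hn.le
          omega
        · exact h0
        · have := mul_le_mul_of_nonneg_right (show 1 ≤ s by omega) hn.le
          omega
      subst hs
      congr 2
      omega
    · refine absurd ?_ hd.effective
      refine ineffective_of 0 ((j' : ℤ) - j) (-r) ?_ (by omega)
      simp only [tw]; module
  · simp [pt, factor, LoopDatum.w, D.n_pos.ne'] at hne
  · simp [pt, factor, rootPow_ne_zero] at hne
  · simp [pt, factor] at hne
  · rcases lt_trichotomy r 0 with hr | rfl | hr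
    · right
      obtain ⟨r', rfl⟩ : ∃ r' : ℕ, r = -((r' : ℤ) + 1) := ⟨(-r - 1).natAbs, by omega⟩
      refine allowed_w.2 ⟨D.m + r' * D.p, r', ?_⟩
      push_cast
      simp only [tw, len]; rw [cv]; module
    · left
      refine ⟨rfl, ?_⟩
      by_contra h'
      refine eval_factor_ne_zero (X := w u) (Y := w t) (fun h'' => h' ?_) hne
      simp only [factor, LoopDatum.w] at h''
      have h6 := congrArg (eval ![(0 : ℂ), 1]) h''
      simp [D.m_pos.ne'] at h6
      congr 1
      exact Subtype.ext (D.root_injOn u.2 t.2 h6)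
    · refine absurd ?_ hd.effective
      refine ineffective_of 0 0 (-r) ?_ (by omega)
      simp only [tw]; module

/-- If the value is nonzero, closedness makes one of factor and cofactor of `X` vanish at the point
of `Y`. The other does not, as the loop polynomial is reduced, and dividing by it gives the
homotopy. -/
lemma line_line_mem_B {n : ℤ} {f : GradedMF.homSub (D.obj X.obj) (D.obj Y.obj) n}
    (hf : f ∈ (mfCat D.wt D.W D.cv).Z (D.obj X.obj) (D.obj Y.obj) n)
    (h : n = 0 → X = Y → eval Y.pt (f.1 (-1) Y.idx X.idx) = 0) :
    f ∈ (mfCat D.wt D.W D.cv).B (D.obj X.obj) (D.obj Y.obj) n := by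
  have hA := Y.allowed_entry f X.idx
  have hc := GradedMF.eval_closed (e := Y.idx) Y.eq_idx Y.eval_d_neg_two hf X.idx
  rw [Finset.sum_eq_single X.idx (fun a _ ha => absurd (X.eq_idx a) ha) (by simp)] at hc
  have hex : (∃ s : ℂ, (s ≠ 0 → Y.Allowed (D.cv + Y.tw - (D.obj X.obj).deg (-n) X.idx)) ∧
      eval Y.pt (f.1 (-n - 1) Y.idx X.idx) =
        s * eval Y.pt ((D.obj X.obj).d (-n - 1) X.idx X.idx)) → f ∈
      (mfCat D.wt D.W D.cv).B (D.obj X.obj) (D.obj Y.obj) n := by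
    rintro ⟨s, hs1, hs2⟩
    refine GradedMF.mem_B_of_eval D.W_ne_zero Y.eq_idx Y.d_neg_two_dvd hf (fun _ => s) ?_ ?_
    · intro a ha
      rw [X.eq_idx a, deg_neg_one]
      exact hs1 ha
    · intro b
      rw [X.eq_idx b, Finset.sum_eq_single X.idx (fun a _ ha => absurd (X.eq_idx a) ha) (by simp)]
      exact hs2
  apply hex
  by_cases hv : eval Y.pt (f.1 (-n - 1) Y.idx X.idx) = 0
  · exact ⟨0, fun h => absurd rfl h, by rw [hv, zero_mul]⟩
  have hc' := (mul_eq_zero.1 hc).resolve_left hv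
  rcases Int.even_or_odd (-n) with ⟨r, hr⟩ | ⟨r, hr⟩
  · have hn : -n = 2 * r := by omega
    rw [show -n - 2 = 2 * (r - 1) by omega, d_even, map_neg, neg_eq_zero] at hc'
    have hfac : X.factor = Y.factor := by
      by_contra h'
      exact eval_factor_ne_zero h' hc'
    have h1 := hA hv
    have hn1 : -n - 1 = 2 * r - 1 := by omega
    have hcof : eval Y.pt X.cofactor ≠ 0 := by
      have h2 : X.factor * X.cofactor = Y.factor * Y.cofactor := by
        rw [factor_mul_cofactor, factor_mul_cofactor]
      rw [hfac] at h2
      have h3 : Y.factor ≠ 0 := fun h3 => D.W_ne_zero (by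
        rw [← Y.factor_mul_cofactor, h3, zero_mul])
      rw [mul_left_cancel₀ h3 h2]
      exact Y.eval_cofactor_ne_zero
    have h2 : Y.Allowed (Y.tw - X.tw - r • D.cv) := by
      rw [hn1, deg_odd] at h1
      convert h1 using 1
      module
    rcases allowed_of_factor_eq X Y hfac r h2 with ⟨h3, h4⟩ | h3
    · obtain rfl : n = 0 := by omega
      exact absurd (by simpa using h rfl h4) hv
    · refine ⟨eval Y.pt (f.1 (-n - 1) Y.idx X.idx) / -eval Y.pt X.cofactor, fun _ => ?_, ?_⟩
      · rw [hn, deg_even]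
        convert h3 using 1
        module
      · have hd : (D.obj X.obj).d (-n - 1) X.idx X.idx = -X.cofactor := by rw [hn1, d_odd]
        rw [hd, map_neg, div_mul_cancel₀ _ (neg_ne_zero.2 hcof)]
  · obtain ⟨r, hn⟩ : ∃ s, -n = 2 * s - 1 := ⟨r + 1, by omega⟩
    rw [show -n - 2 = 2 * (r - 1) - 1 by omega, d_odd, map_neg, neg_eq_zero] at hc'
    have hfac : X.factor ≠ Y.factor := by
      intro h'
      have h2 : X.factor * X.cofactor = Y.factor * Y.cofactor := by
        rw [factor_mul_cofactor, factor_mul_cofactor]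
      rw [h'] at h2
      have h3 : Y.factor ≠ 0 := fun h3 => D.W_ne_zero (by
        rw [← Y.factor_mul_cofactor, h3, zero_mul])
      rw [mul_left_cancel₀ h3 h2] at hc'
      exact Y.eval_cofactor_ne_zero hc'
    have hn1 : -n - 1 = 2 * (r - 1) := by omega
    have h1 := hA hv
    have h2 : Y.Allowed (Y.tw - X.tw - r • D.cv + X.len) := by
      rw [hn1, deg_even] at h1
      convert h1 using 1
      module
    refine ⟨eval Y.pt (f.1 (-n - 1) Y.idx X.idx) / -eval Y.pt X.factor, fun _ => ?_, ?_⟩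
    · rw [hn, deg_odd]
      convert allowed_of_factor_ne X Y hfac r h2 using 1
      module
    · have hd : (D.obj X.obj).d (-n - 1) X.idx X.idx = -X.factor := by rw [hn1, d_even]
      rw [hd, map_neg, div_mul_cancel₀ _ (neg_ne_zero.2 (eval_factor_ne_zero hfac))]

lemma line_self_exact {f : GradedMF.homSub (D.obj Y.obj) (D.obj Y.obj) 0}
    (hf : f ∈ (mfCat D.wt D.W D.cv).B (D.obj Y.obj) (D.obj Y.obj) 0) :
    eval Y.pt (f.1 (-1) Y.idx Y.idx) = 0 := by
  refine GradedMF.eval_exact Y.eq_idx Y.eval_d_neg_two hf (fun a t ht => ?_) Y.idx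
  have hm : (0 : ℤ) < D.m := by exact_mod_cast D.m_pos
  have hn : (0 : ℤ) < D.n := by exact_mod_cast D.n_pos
  have hp : (2 : ℤ) ≤ D.p := by exact_mod_cast D.hp
  have hq : (2 : ℤ) ≤ D.q := by exact_mod_cast D.hq
  have h1 := Y.deg_even 0 a
  rw [mul_zero] at h1
  rw [deg_neg_one, h1] at ht
  have h2 : D.Ineffective (D.cv + Y.tw - (-Y.len + (0 + 2 : ℤ) • D.cv + Y.tw)) := by
    cases Y with
    | x i =>
      refine ineffective_of 0 (-D.q) 0 ?_ (by omega)
      simp only [len]; rw [D.cv_eq]; module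
    | y j =>
      refine ineffective_of (-D.p) 0 0 ?_ (by omega)
      simp only [len]; rw [cv]; module
    | w r =>
      refine ineffective_of D.m 0 (-1) ?_ (by omega)
      simp only [len]; module
  rw [h2.eq_zero ht, map_zero]

end Line

end LoopDatum

/-! ### The cohomology of morphism spaces -/

namespace LoopDatum

open MvPolynomial Matrix

variable (D : LoopDatum)

/-- The two kinds of objects. -/
inductive View : D.Obj → Type
  | zero (i : Finset.Icc (D.p - D.m) (D.p - 1)) (j : Finset.Icc 1 (D.q - 1)) : View (.zero i j)
  | line (Y : D.Line) : View Y.obj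

/-- The kind of an object. -/
def view : ∀ X : D.Obj, D.View X
  | .zero i j => .zero i j
  | .x i => .line (.x i)
  | .y j => .line (.y j)
  | .w r => .line (.w r)

variable {D}

lemma view_line (Y : D.Line) : D.view Y.obj = .line Y := by cases Y <;> rfl

variable (D) in
/-- The degree attached to an object. -/
def objDeg : D.Obj → D.L
  | .zero i j => (i : ℤ) • D.xv + (j : ℤ) • D.yv
  | .x i => (i : ℤ) • D.xv + ((D.q : ℤ) - 1) • D.yv
  | .y j => ((D.p : ℤ) - 1) • D.xv + (j : ℤ) • D.yv
  | .w _ => ((D.p : ℤ) - 1) • D.xv + ((D.q : ℤ) - 1) • D.yv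

/-- The projection from `S` to the coordinate ring of the chosen point, for a line. -/
def View.rho : ∀ {X : D.Obj}, D.View X →
    (MvPolynomial (Fin 2) ℂ →ₐ[ℂ] MvPolynomial (Fin 2) ℂ)
  | _, .zero _ _ => AlgHom.id ℂ _
  | _, .line Y => (Algebra.ofId ℂ _).comp (aeval Y.pt)

lemma View.rho_line (Y : D.Line) (h : MvPolynomial (Fin 2) ℂ) :
    (View.line Y).rho h = C (eval Y.pt h) := rfl

variable (D) in
/-- The projection from `S` to the coordinate ring of the chosen point, for an object of
rank one. -/
def rho (X : D.Obj) : MvPolynomial (Fin 2) ℂ →ₐ[ℂ] MvPolynomial (Fin 2) ℂ := (D.view X).rho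

/-- The linear functional on matrices given by an entry. -/
def entry {K K' : GradedMF D.wt D.W D.cv} (n i : ℤ) (b : Fin K'.rk) (a : Fin K.rk) :
    GradedMF.homSub K K' n →ₗ[ℂ] MvPolynomial (Fin 2) ℂ where
  toFun f := f.1 i b a
  map_add' _ _ := rfl
  map_smul' _ _ := rfl

open Classical in
/-- The polynomial which represents the class of a morphism. -/
def View.chi : ∀ {X Y : D.Obj}, D.View X → D.View Y →
    (D.B.hom X Y 0 →ₗ[ℂ] MvPolynomial (Fin 2) ℂ)
  | _, _, .zero i j, .zero i' j' => entry 0 0 (top i'.2 j'.2) (top i.2 j.2)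
  | _, _, .zero i j, .line Y => (View.line Y).rho.toLinearMap ∘ₗ
      entry 0 (-1) Y.idx (Y.baseIdx i.2 j.2)
  | _, _, .line _, .zero _ _ => 0
  | _, _, .line X, .line Y => if X = Y then
      (View.line Y).rho.toLinearMap ∘ₗ entry 0 (-1) Y.idx X.idx else 0

variable (D) in
/-- The polynomial which represents the class of a morphism. -/
def chi (X Y : D.Obj) : D.B.hom X Y 0 →ₗ[ℂ] MvPolynomial (Fin 2) ℂ := (D.view X).chi (D.view Y)

lemma objDeg_sub_zero (i i' : Finset.Icc (D.p - D.m) (D.p - 1)) (j j' : Finset.Icc 1 (D.q - 1)) :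
    D.objDeg (.zero i' j') - D.objDeg (.zero i j) = D.topDeg i' j' - D.topDeg i j := by
  rw [objDeg, objDeg, topDeg, topDeg]; module

lemma mem_B_of_ne_zero {X Y : D.Obj} {n : ℤ} (hn : n ≠ 0) {f : D.B.hom X Y n}
    (hf : f ∈ D.B.Z X Y n) : f ∈ D.B.B X Y n := by
  have key : ∀ (vX : D.View X) (vY : D.View Y), f ∈ D.B.B X Y n := by
    intro vX vY
    cases vX with
    | zero i j =>
      cases vY with
      | zero i' j' => exact zero_zero_mem_B i.2 j.2 i'.2 j'.2 hf fun h => absurd h hn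
      | line Y => exact Y.zero_line_mem_B i.2 j.2 hf fun h => absurd h hn
    | line X =>
      cases vY with
      | zero i' j' => exact line_zero_mem_B i'.2 j'.2 X hf
      | line Y => exact X.line_line_mem_B Y hf fun h => absurd h hn
  exact key (D.view X) (D.view Y)

/-- `chi` picks the one entry, or its value at the point, which obstructs exactness; in the pairs of
objects without morphisms it is zero. -/
lemma chi_eq_zero_iff {X Y : D.Obj} {f : D.B.hom X Y 0} (hf : f ∈ D.B.Z X Y 0) :
    D.chi X Y f = 0 ↔ f ∈ D.B.B X Y 0 := by
  have key : ∀ (vX : D.View X) (vY : D.View Y), vX.chi vY f = 0 ↔ f ∈ D.B.B X Y 0 := by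
    intro vX vY
    cases vX with
    | zero i j =>
      cases vY with
      | zero i' j' => exact ⟨fun h => zero_zero_mem_B i.2 j.2 i'.2 j'.2 hf fun _ => h,
          fun h => zero_zero_exact i.2 j.2 i'.2 j'.2 h⟩
      | line Y =>
        refine ⟨fun h => Y.zero_line_mem_B i.2 j.2 hf fun _ => ?_, fun h => ?_⟩
        · exact (map_eq_zero_iff C (C_injective _ _)).1 h
        · exact (congrArg C (Y.zero_line_exact i.2 j.2 h _)).trans C_0
    | line X =>
      cases vY with
      | zero i' j' => exact ⟨fun _ => line_zero_mem_B i'.2 j'.2 X hf, fun _ => rfl⟩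
      | line Y =>
        by_cases hXY : X = Y
        · subst hXY
          rw [View.chi, if_pos rfl]
          refine ⟨fun h => X.line_line_mem_B X hf fun _ _ => ?_, fun h => ?_⟩
          · exact (map_eq_zero_iff C (C_injective _ _)).1 h
          · exact (congrArg C (X.line_self_exact h)).trans C_0
        · rw [View.chi, if_neg hXY]
          exact ⟨fun _ => X.line_line_mem_B Y hf fun _ h => absurd h hXY, fun _ => rfl⟩
  exact key (D.view X) (D.view Y)

lemma chi_one (X : D.Obj) : D.chi X X (D.B.one X) = 1 := by
  have key : ∀ vX : D.View X, vX.chi vX (D.B.one X) = 1 := by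
    intro vX
    cases vX with
    | zero i j => exact Matrix.one_apply_eq (top i.2 j.2)
    | line X =>
      rw [View.chi, if_pos rfl]
      change (View.line X).rho ((1 : Matrix _ _ (MvPolynomial (Fin 2) ℂ)) X.idx X.idx) = 1
      rw [Matrix.one_apply_eq, map_one]
  exact key _

lemma chi_line_ne {X Y : D.Obj} (V : D.Line) (hX : X = V.obj) (h : X ≠ Y) (f : D.B.hom X Y 0) :
    D.chi X Y f = 0 := by
  subst hX
  rw [chi, view_line]
  have key : ∀ vY : D.View Y, (View.line V).chi vY f = 0 := by
    intro vY
    cases vY with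
    | zero i j => rfl
    | line Y => rw [View.chi, if_neg (fun h' => h (by rw [h']))]; rfl
  exact key _

lemma homComp_zero_apply {K K' K'' : GradedMF D.wt D.W D.cv} (g : GradedMF.homSub K' K'' 0)
    (f : GradedMF.homSub K K' 0) (i : ℤ) (b : Fin K''.rk) (a : Fin K.rk) :
    ((mfCat D.wt D.W D.cv).comp (X := K) (Y := K') (Z := K'') (add_zero 0) g f).1 i b a =
      ∑ c, g.1 i b c * f.1 i c a := by
  change (g.1 (i + 0) * f.1 i) b a = _
  rw [add_zero, Matrix.mul_apply]

/-- Closedness in degree `-1`, read in the last row, reads `adj' f^{-1} = f^0 adj`. Evaluated in the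
base column, where the corner value is `1`, it expresses the invariant of `f` through its odd
component. -/
lemma Line.zero_zero_col (Y : D.Line) {i j i' j' : ℕ}
    (hi : i ∈ Finset.Icc (D.p - D.m) (D.p - 1)) (hj : j ∈ Finset.Icc 1 (D.q - 1))
    (hi' : i' ∈ Finset.Icc (D.p - D.m) (D.p - 1)) (hj' : j' ∈ Finset.Icc 1 (D.q - 1))
    {f : GradedMF.homSub (D.Kzero i j hi hj) (D.Kzero i' j' hi' hj') 0}
    (hf : f ∈ (mfCat D.wt D.W D.cv).Z (D.Kzero i j hi hj) (D.Kzero i' j' hi' hj') 0) :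
    ∑ c : Fin (D.kk j' + 2), Y.corner i' j' c * eval Y.pt (f.1 (-1) c (Y.baseIdx hi hj)) =
      eval Y.pt (f.1 0 (top hi' hj') (top hi hj)) := by
  have h := congrFun (congrFun (GradedMF.closed_comp hf (-1)) (top hi' hj')) (Y.baseIdx hi hj)
  rw [sgn_zero, one_smul, add_zero, neg_add_cancel, Matrix.mul_apply, Matrix.mul_apply,
    Kzero_d_neg_one, Kzero_d_neg_one, Finset.sum_eq_single (top hi hj) (fun c _ hc => by
      rw [zero_zero_row hi hj hi' hj' f c hc, zero_mul]) (by simp)] at h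
  have h1 := congrArg (eval Y.pt) h
  rw [map_sum, map_mul] at h1
  refine Eq.trans (Finset.sum_congr rfl fun c _ => ?_) (h1.trans ?_)
  · rw [map_mul]
    exact congrArg (· * _) (Y.eval_adjugate hi' hj' c).symm
  · have h2 := Y.eval_adjugate hi hj ⟨Y.base j, Y.base_lt j⟩
    exact (congrArg (_ * ·) (h2.trans (Y.corner_base i j))).trans (mul_one _)

/-- If one polynomial is zero, its factor is exact and so is the composite. Otherwise the nonzero
cases are: three grid objects, where only the last summands interact; grid to grid to line, which
uses `zero_line_row` and `Line.zero_zero_col`; and cases with an endomorphism of a line, where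
matrices of rank one multiply. -/
lemma chi_comp {X Y Z : D.Obj} {g : D.B.hom Y Z 0} {f : D.B.hom X Y 0} (hg : g ∈ D.B.Z Y Z 0)
    (hf : f ∈ D.B.Z X Y 0) : D.chi X Z (D.B.comp (add_zero 0) g f) =
      D.rho Z (D.chi Y Z g * D.chi X Y f) := by
  have hgf : D.B.comp (add_zero 0) g f ∈ D.B.Z X Z 0 := DGCat.comp_mem_Z _ hg hf
  by_cases hg0 : D.chi Y Z g = 0
  · rw [hg0, zero_mul, map_zero, chi_eq_zero_iff hgf]
    exact DGCat.comp_mem_B_left _ ((chi_eq_zero_iff hg).1 hg0) hf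
  by_cases hf0 : D.chi X Y f = 0
  · rw [hf0, mul_zero, map_zero, chi_eq_zero_iff hgf]
    exact DGCat.comp_mem_B_right _ hg ((chi_eq_zero_iff hf).1 hf0)
  have key : ∀ (vX : D.View X) (vY : D.View Y) (vZ : D.View Z), vY.chi vZ g ≠ 0 →
      vX.chi vY f ≠ 0 → vX.chi vZ (D.B.comp (add_zero 0) g f) =
        vZ.rho (vY.chi vZ g * vX.chi vY f) := by
    intro vX vY vZ hg0 hf0
    cases vX with
    | zero i j =>
      cases vY with
      | zero i' j' =>
        cases vZ with
        | zero i'' j'' =>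
          refine (homComp_zero_apply g f 0 (top i''.2 j''.2) (top i.2 j.2)).trans ?_
          refine Finset.sum_eq_single (top i'.2 j'.2) (fun b _ hb => ?_)
            fun h => absurd (Finset.mem_univ _) h
          rw [zero_zero_row i'.2 j'.2 i''.2 j''.2 g b hb, zero_mul]
        | line Z =>
          change (View.line Z).rho _ = (View.line Z).rho ((View.line Z).rho _ * _)
          rw [View.rho_line, View.rho_line, View.rho_line, map_mul, eval_C]
          congr 1
          refine (congrArg (eval Z.pt) (homComp_zero_apply g f (-1) Z.idx
            (Z.baseIdx i.2 j.2))).trans ?_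
          rw [map_sum]
          refine Eq.trans ?_ (congrArg (_ * ·) (Z.zero_zero_col i.2 j.2 i'.2 j'.2 hf))
          rw [Finset.mul_sum]
          refine Finset.sum_congr rfl fun c _ => ?_
          have h1 := Z.zero_line_row i'.2 j'.2 (n := 0) (r := 0) rfl hg c
          rw [map_mul, ← mul_assoc]
          exact congrArg (· * _) h1
      | line Y =>
        cases vZ with
        | zero i'' j'' => exact absurd rfl hg0
        | line Z =>
          by_cases hYZ : Y = Z
          · subst hYZ
            have hYY : (View.line Y).chi (View.line Y) = (View.line Y).rho.toLinearMap ∘ₗ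
                entry 0 (-1) Y.idx Y.idx := if_pos rfl
            rw [hYY]
            change (View.line Y).rho _ = (View.line Y).rho
              ((View.line Y).rho _ * (View.line Y).rho _)
            rw [View.rho_line, View.rho_line, View.rho_line, View.rho_line, map_mul, eval_C, eval_C]
            congr 1
            refine (congrArg (eval Y.pt) (homComp_zero_apply g f (-1) Y.idx
              (Y.baseIdx i.2 j.2))).trans ?_
            rw [Finset.sum_eq_single Y.idx (fun c _ hc => absurd (Y.eq_idx c) hc) (by simp),
              map_mul]
            rfl
          · exact absurd (by rw [View.chi, if_neg hYZ]; rfl) hg0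
    | line X =>
      cases vY with
      | zero i' j' => exact absurd rfl hf0
      | line Y =>
        cases vZ with
        | zero i'' j'' => exact absurd rfl hg0
        | line Z =>
          by_cases hYZ : Y = Z
          · subst hYZ
            by_cases hXY : X = Y
            · subst hXY
              simp only [View.chi, if_true]
              change (View.line X).rho _ = (View.line X).rho
                ((View.line X).rho _ * (View.line X).rho _)
              rw [View.rho_line, View.rho_line, View.rho_line, View.rho_line, map_mul, eval_C,
                eval_C]
              congr 1
              refine (congrArg (eval X.pt) (homComp_zero_apply g f (-1) X.idx X.idx)).trans ?_
              rw [Finset.sum_eq_single X.idx (fun c _ hc => absurd (X.eq_idx c) hc) (by simp),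
                map_mul]
              rfl
            · exact absurd (by rw [View.chi, if_neg hXY]; rfl) hf0
          · exact absurd (by rw [View.chi, if_neg hYZ]; rfl) hg0
  exact key _ _ _ hg0 hf0

/-- The two degrees differ by that of a monomial which does not vanish at the point, so classes with
values in `ℂ` can be represented by polynomials of the uniform degree `objDeg Y - objDeg K_0`. -/
lemma Line.allowed_objDeg (Y : D.Line) (i : Finset.Icc (D.p - D.m) (D.p - 1))
    (j : Finset.Icc 1 (D.q - 1))
    (h : Y.Allowed (D.cv + Y.tw - D.zeroOdd i j ⟨Y.base j, Y.base_lt j⟩)) :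
    Y.Allowed (D.objDeg Y.obj - D.objDeg (.zero i j)) := by
  have hb := index_bounds_int i.2 j.2
  obtain ⟨s, t, hs, -⟩ := D.index_bounds i.2 j.2
  have hrel := D.rel'
  rcases Y with i' | j' | r
  · simp only [Line.base, Line.tw, zeroOdd] at h
    rw [if_neg (Nat.succ_ne_zero _), if_pos trivial] at h
    obtain ⟨b, hb'⟩ := Line.allowed_x.1 h
    refine Line.allowed_x.2 ⟨b + (D.q - 1 - j), ?_⟩
    push_cast [show ((D.q - 1 - (j : ℕ) : ℕ) : ℤ) = D.q - 1 - (j : ℕ) by omega]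
    simp only [Line.obj, objDeg]
    rw [cv] at hb'
    linear_combination (norm := module) hb'
  · simp only [Line.base, Line.tw, zeroOdd, if_true] at h
    obtain ⟨a, ha⟩ := Line.allowed_y.1 h
    refine Line.allowed_y.2 ⟨a + (D.p - 1 - i) + s * D.m, ?_⟩
    push_cast [show ((D.p - 1 - (i : ℕ) : ℕ) : ℤ) = D.p - 1 - (i : ℕ) by omega]
    simp only [Line.obj, objDeg]
    have hl : (D.l : ℤ) = D.kk j + 1 + s := by exact_mod_cast hs
    have e1 : (D.p : ℤ) = (D.kk j + 1 + s) * D.m + 1 := by rw [hb.2.2.2.2.2.2.1, hl]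
    linear_combination (norm := skip) ha + D.rel'
    rw [e1]
    module
  · simp only [Line.base, Line.tw, zeroOdd] at h
    rw [if_neg (Nat.succ_ne_zero _), if_pos trivial] at h
    obtain ⟨a, b, hb'⟩ := Line.allowed_w.1 h
    refine Line.allowed_w.2 ⟨a, b + (D.q - 1 - j), ?_⟩
    push_cast [show ((D.q - 1 - (j : ℕ) : ℕ) : ℤ) = D.q - 1 - (j : ℕ) by omega]
    simp only [Line.obj, objDeg]
    rw [cv] at hb'
    linear_combination (norm := module) hb'

/-- For a line the value is a scalar, and a homogeneous polynomial with nonzero value at the point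
can be rescaled to attain it. -/
lemma exists_eq_rho_of_zero (i : Finset.Icc (D.p - D.m) (D.p - 1)) (j : Finset.Icc 1 (D.q - 1))
    (Y : D.Obj) (f : D.B.hom (.zero i j) Y 0) :
    ∃ h, IsWeightedHomogeneous D.wt h (D.objDeg Y - D.objDeg (.zero i j)) ∧
      D.chi (.zero i j) Y f = D.rho Y h := by
  have key : ∀ (vY : D.View Y), ∃ h,
      IsWeightedHomogeneous D.wt h (D.objDeg Y - D.objDeg (.zero i j)) ∧
        (View.zero i j).chi vY f = vY.rho h := by
    intro vY
    cases vY with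
    | zero i' j' =>
      refine ⟨f.1 0 (top i'.2 j'.2) (top i.2 j.2), ?_, rfl⟩
      have h1 := f.2.1 0 (top i'.2 j'.2) (top i.2 j.2)
      rw [objDeg_sub_zero, ← Kzero_deg_zero_top i'.2 j'.2, ← Kzero_deg_zero_top i.2 j.2]
      exact h1
    | line Y =>
      change ∃ h, _ ∧ C (eval Y.pt (f.1 (-1) Y.idx (Y.baseIdx i.2 j.2))) = C (eval Y.pt h)
      by_cases h0 : eval Y.pt (f.1 (-1) Y.idx (Y.baseIdx i.2 j.2)) = 0
      · exact ⟨0, isWeightedHomogeneous_zero _ _ _, by rw [h0, map_zero, map_zero, map_zero]⟩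
      · have h1 : Y.Allowed (D.cv + Y.tw - (D.Kzero i j i.2 j.2).deg (-1) (Y.baseIdx i.2 j.2)) :=
          Y.allowed_entry f (Y.baseIdx i.2 j.2) h0
        have h2 := Kzero_deg_odd i.2 j.2 0 ⟨Y.base j, Y.base_lt j⟩
        rw [mul_zero, zero_sub, zero_smul, add_zero] at h2
        obtain ⟨t, ht, ht0⟩ := Y.allowed_objDeg i j (by
          have h3 : (D.Kzero i j i.2 j.2).deg (-1) (Y.baseIdx i.2 j.2) = _ := h2
          rwa [h3] at h1)
        refine ⟨C (eval Y.pt (f.1 (-1) Y.idx (Y.baseIdx i.2 j.2)) / eval Y.pt t) * t,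
          ht.C_mul _, ?_⟩
        rw [map_mul, eval_C, div_mul_cancel₀ _ ht0]
  exact key _

lemma exists_eq_C_of_line (Y : D.Line) (f : D.B.hom Y.obj Y.obj 0) :
    ∃ c, D.chi Y.obj Y.obj f = C c := by
  rw [chi, view_line, View.chi, if_pos rfl]
  exact ⟨_, rfl⟩

lemma exists_chi_zero (i i' : Finset.Icc (D.p - D.m) (D.p - 1)) (j j' : Finset.Icc 1 (D.q - 1))
    {h : MvPolynomial (Fin 2) ℂ}
    (hh : IsWeightedHomogeneous D.wt h (D.objDeg (.zero i' j') - D.objDeg (.zero i j))) :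
    ∃ f ∈ D.B.Z (.zero i j) (.zero i' j') 0, D.chi (.zero i j) (.zero i' j') f = h := by
  rw [objDeg_sub_zero] at hh
  exact exists_zero_zero i.2 j.2 i'.2 j'.2 hh

lemma exists_chi_line (i : Finset.Icc (D.p - D.m) (D.p - 1)) (j : Finset.Icc 1 (D.q - 1))
    (Y : D.Line) (h : ∀ a : Fin (D.kk j + 2), Y.corner i j a ≠ 0 →
      D.cv + Y.tw = D.zeroOdd i j a) :
    ∃ f ∈ D.B.Z (.zero i j) Y.obj 0, D.chi (.zero i j) Y.obj f = 1 := by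
  obtain ⟨f, hf, hf1⟩ := Y.exists_zero_line i.2 j.2 h
  refine ⟨f, hf, ?_⟩
  rw [chi, view_line]
  change C (eval Y.pt (f.1 (-1) Y.idx (Y.baseIdx i.2 j.2))) = 1
  rw [hf1, C_1]

/-- At `(0, 1)` only the last corner is nonzero, and its summand has the degree of the target. -/
lemma exists_chi_x (i : Finset.Icc (D.p - D.m) (D.p - 1)) (j : Finset.Icc 1 (D.q - 1)) :
    ∃ f ∈ D.B.Z (.zero i j) (.x i) 0, D.chi (.zero i j) (.x i) f = 1 := by
  refine exists_chi_line i j (.x i) fun a ha => ?_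
  have h1 : D.stairA i j a = 0 := by
    by_contra h
    exact ha (by simp [Line.corner, Line.pt, h])
  have h2 : a.val = D.kk j + 1 := by
    by_contra h
    have h3 := stairA_lt i.2 (j := (j : ℕ)) a.val (by omega)
    omega
  rw [zeroOdd, if_neg (by omega), if_pos h2, cv]
  simp only [Line.tw]
  module

lemma kk_eq {j : ℕ} (hj : j ∈ Finset.Icc 1 (D.q - 1)) (h : D.q - D.n ≤ j) :
    D.kk j + 1 = D.l := by
  obtain ⟨h1, h2, h3⟩ := D.kk_bounds hj
  refine le_antisymm h3 ?_
  by_contra h4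
  have h5 : (D.kk j + 1 + 1) * D.n ≤ D.l * D.n := Nat.mul_le_mul_right _ (by omega)
  have hq := D.q_eq
  rw [add_mul _ 1] at h5
  omega

/-- At `(1, 0)` only the first corner is nonzero. Its summand has the right degree because `j ≥ q -
n` gives `k + 1 = ℓ`, and `ℓ m x⃗ = (q - 1) y⃗`. -/
lemma exists_chi_y (i : Finset.Icc (D.p - D.m) (D.p - 1)) (j : Finset.Icc 1 (D.q - 1))
    (j' : Finset.Icc (D.q - D.n) (D.q - 1)) (hj : (j' : ℕ) = j) :
    ∃ f ∈ D.B.Z (.zero i j) (.y j') 0, D.chi (.zero i j) (.y j') f = 1 := by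
  refine exists_chi_line i j (.y j') fun a ha => ?_
  have h1 : D.stairB j a = 0 := by
    by_contra h
    exact ha (by simp [Line.corner, Line.pt, h])
  have h2 : a.val = 0 := by
    by_contra h
    obtain ⟨b, hb⟩ := Nat.exists_eq_succ_of_ne_zero h
    have h3 := stairB_lt j.2 b (by omega)
    rw [hb] at h1
    have h4 : D.stairB j (b + 1) = 0 := h1
    omega
  have hb := index_bounds_int i.2 j.2
  have hl : ((D.kk j : ℤ) + 1) = D.l := by
    exact_mod_cast kk_eq j.2 (by rw [← hj]; exact (Finset.mem_Icc.1 j'.2).1)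
  rw [zeroOdd, if_pos h2, hl]
  simp only [Line.tw]
  rw [hj]
  have e : ((D.l : ℤ) * D.m) = D.p - 1 := by rw [hb.2.2.2.2.2.2.1]; ring
  rw [e]
  linear_combination (norm := module) D.rel'

/-- Here all corners are nonzero, and for `i = p - 1`, `j = q - 1` all summands of `K_0^{-1}` have
degree `c⃗`. -/
lemma exists_chi_w (i : Finset.Icc (D.p - D.m) (D.p - 1)) (j : Finset.Icc 1 (D.q - 1))
    (r : Finset.Icc 1 D.l) (hi : (i : ℕ) = D.p - 1) (hj : (j : ℕ) = D.q - 1) :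
    ∃ f ∈ D.B.Z (.zero i j) (.w r) 0, D.chi (.zero i j) (.w r) f = 1 := by
  refine exists_chi_line i j (.w r) fun a ha => ?_
  have hb := index_bounds_int i.2 j.2
  have hn := D.n_pos
  have hl : ((D.kk j : ℤ) + 1) = D.l := by
    exact_mod_cast kk_eq j.2 (by omega)
  rw [zeroOdd, hl]
  simp only [Line.tw]
  have e : ((D.l : ℤ) * D.m) = D.p - 1 := by rw [hb.2.2.2.2.2.2.1]; ring
  have ej : ((j : ℕ) : ℤ) = D.q - 1 := by omega
  have ei : ((i : ℕ) : ℤ) = D.p - 1 := by omega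
  rw [e, ej, ei]
  split_ifs
  · linear_combination (norm := module) D.rel'
  · rw [cv]; module
  · module

end LoopDatum

/-! ### The total endomorphism algebra in terms of polynomials -/

lemma DGCat.of_mul_of {O : Type} [Fintype O] (A : DGCat O) {m n k : ℤ} (h : m + n = k)
    (g : A.totalPart m) (f : A.totalPart n) :
    (DirectSum.of A.totalPart m g * DirectSum.of A.totalPart n f : A.TotalEnd) =
      DirectSum.of A.totalPart k (A.totalMul h g f) := by
  subst h
  exact DirectSum.of_mul_of g f

namespace LoopDatum

open MvPolynomial

variable {D : LoopDatum}

instance subsingleton_H (X Y : D.Obj) (n : ℤ) [NeZero n] :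
    Subsingleton (D.B.cohomology.hom X Y n) := by
  refine ⟨fun f g => ?_⟩
  have key : ∀ f : D.B.H X Y n, f = 0 := by
    intro f
    obtain ⟨f, rfl⟩ := Submodule.Quotient.mk_surjective _ f
    exact (Submodule.Quotient.mk_eq_zero _).2 (mem_B_of_ne_zero (NeZero.ne n) f.2)
  exact (key f).trans (key g).symm

variable (D) in
/-- The polynomial which represents a cohomology class. -/
def Hchi (X Y : D.Obj) : D.B.cohomology.hom X Y 0 →ₗ[ℂ] MvPolynomial (Fin 2) ℂ :=
  Submodule.liftQ _ ((D.chi X Y).comp (D.B.Z X Y 0).subtype)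
    fun f hf => (chi_eq_zero_iff f.2).2 hf

lemma Hchi_mk (X Y : D.Obj) (f : D.B.Z X Y 0) :
    D.Hchi X Y (Submodule.Quotient.mk f : D.B.H X Y 0) = D.chi X Y f.1 := rfl

lemma Hchi_injective (X Y : D.Obj) : Function.Injective (D.Hchi X Y) := by
  refine (injective_iff_map_eq_zero _).2 fun f hf => ?_
  obtain ⟨f, rfl⟩ := Submodule.Quotient.mk_surjective _ (show D.B.H X Y 0 from f)
  exact (Submodule.Quotient.mk_eq_zero _).2 ((chi_eq_zero_iff f.2).1 hf)

lemma Hchi_comp (X Y Z : D.Obj) (g : D.B.cohomology.hom Y Z 0) (f : D.B.cohomology.hom X Y 0) :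
    D.Hchi X Z (D.B.cohomology.comp (add_zero 0) g f) =
      D.rho Z (D.Hchi Y Z g * D.Hchi X Y f) := by
  obtain ⟨f, rfl⟩ := Submodule.Quotient.mk_surjective _ (show D.B.H X Y 0 from f)
  obtain ⟨g, rfl⟩ := Submodule.Quotient.mk_surjective _ (show D.B.H Y Z 0 from g)
  exact chi_comp g.2 f.2

lemma Hchi_one (X : D.Obj) : D.Hchi X X (D.B.cohomology.one X) = 1 := chi_one X

variable (D) in
/-- The matrix of polynomials which represents an element of the total endomorphism algebra. -/
def toPoly : D.B.cohomology.TotalEnd →ₗ[ℂ] (D.Obj → D.Obj → MvPolynomial (Fin 2) ℂ) where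
  toFun F X Y := D.Hchi X Y (F 0 X Y)
  map_add' F G := by
    funext X Y
    exact map_add (D.Hchi X Y) (F 0 X Y) (G 0 X Y)
  map_smul' c F := by
    funext X Y
    exact map_smul (D.Hchi X Y) c (F 0 X Y)

lemma toPoly_of (f : D.B.cohomology.totalPart 0) (X Y : D.Obj) :
    D.toPoly (DirectSum.of _ 0 f) X Y = D.Hchi X Y (f X Y) := by
  change D.Hchi X Y (DirectSum.of D.B.cohomology.totalPart 0 f 0 X Y) = _
  rw [DirectSum.of_eq_same]

lemma eq_of_zero (F : D.B.cohomology.TotalEnd) : F = DirectSum.of _ 0 (F 0) := by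
  refine DFinsupp.ext fun n => ?_
  by_cases hn : n = 0
  · subst hn
    exact (DirectSum.of_eq_same 0 _).symm
  · have : NeZero n := ⟨hn⟩
    funext X Y
    exact Subsingleton.elim _ _

/-- The algebra is concentrated in degree zero, and each class is determined by its polynomial.
Identities can therefore be checked on matrices of polynomials. -/
lemma toPoly_injective : Function.Injective D.toPoly := by
  intro F G h
  rw [eq_of_zero F, eq_of_zero G]
  congr 1
  funext X Y
  exact Hchi_injective X Y (congrFun (congrFun h X) Y)

lemma toPoly_mul (F G : D.B.cohomology.TotalEnd) (X Z : D.Obj) :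
    D.toPoly (F * G) X Z = ∑ Y, D.rho Z (D.toPoly F Y Z * D.toPoly G X Y) := by
  rw [eq_of_zero F, eq_of_zero G, DGCat.of_mul_of _ (add_zero 0), toPoly_of,
    DGCat.totalMul_apply, map_sum]
  refine Finset.sum_congr rfl fun Y _ => ?_
  rw [Hchi_comp, toPoly_of, toPoly_of]

open Classical in
variable (D) in
/-- The matrix with a single entry. -/
def single (X Y : D.Obj) (s : MvPolynomial (Fin 2) ℂ) (X' Y' : D.Obj) : MvPolynomial (Fin 2) ℂ :=
  if X' = X ∧ Y' = Y then s else 0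

lemma single_self (X Y : D.Obj) (s : MvPolynomial (Fin 2) ℂ) : D.single X Y s X Y = s :=
  if_pos ⟨rfl, rfl⟩

lemma toPoly_idem (v : D.Obj) :
    D.toPoly (DirectSum.of _ 0 (D.B.cohomology.totalIdem v)) = D.single v v 1 := by
  classical
  funext X Y
  rw [toPoly_of, DGCat.totalIdem, single]
  by_cases h : v = X ∧ v = Y
  · obtain ⟨rfl, rfl⟩ := h
    rw [dif_pos ⟨rfl, rfl⟩, if_pos ⟨rfl, rfl⟩]
    exact Hchi_one v
  · rw [dif_neg h, map_zero, if_neg fun h' => h ⟨h'.1.symm, h'.2.symm⟩]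

lemma toPoly_one_ne {X Y : D.Obj} (h : X ≠ Y) : D.toPoly 1 X Y = 0 := by
  refine (toPoly_of D.B.cohomology.totalOne X Y).trans ?_
  rw [DGCat.totalOne_ne _ h, map_zero]

lemma toPoly_one_self (X : D.Obj) : D.toPoly 1 X X = 1 := by
  refine (toPoly_of D.B.cohomology.totalOne X X).trans ?_
  rw [DGCat.totalOne_self, Hchi_one]

lemma toPoly_mul_left {F G : D.B.cohomology.TotalEnd} {u v : D.Obj} {s : MvPolynomial (Fin 2) ℂ}
    (hF : D.toPoly F = D.single u v s) (X Z : D.Obj) :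
    D.toPoly (F * G) X Z = D.single X v (D.rho v (s * D.toPoly G X u)) X Z := by
  classical
  rw [toPoly_mul, hF, Finset.sum_eq_single u (fun Y _ hY => by
    rw [single, if_neg (fun h => hY h.1), zero_mul, map_zero]) (by simp)]
  by_cases h : Z = v
  · subst h
    rw [single_self, single_self]
  · rw [single, if_neg (fun h' => h h'.2), single, if_neg (fun h' => h h'.2), zero_mul, map_zero]

lemma rho_line (Y : D.Line) (h : MvPolynomial (Fin 2) ℂ) :
    D.rho Y.obj h = C (eval Y.pt h) := by
  rw [rho, view_line]
  rfl

lemma rho_factor (Y : D.Line) : D.rho Y.obj Y.factor = 0 := by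
  rw [rho_line, Y.eval_factor, C_0]

/-- Entries are already reduced modulo the target; this follows by multiplying with the unit. -/
lemma rho_toPoly (F : D.B.cohomology.TotalEnd) (X Y : D.Obj) :
    D.rho Y (D.toPoly F X Y) = D.toPoly F X Y := by
  conv_rhs => rw [← one_mul F]
  rw [toPoly_mul, Finset.sum_eq_single Y (fun Z _ hZ => by
    rw [toPoly_one_ne hZ, zero_mul, map_zero]) (by simp), toPoly_one_self, one_mul]

lemma toPoly_idem_mul (v X Z : D.Obj) (F : D.B.cohomology.TotalEnd) :
    D.toPoly (DirectSum.of _ 0 (D.B.cohomology.totalIdem v) * F) X Z =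
      D.single X v (D.toPoly F X v) X Z := by
  rw [toPoly_mul_left (toPoly_idem v), one_mul, rho_toPoly]

lemma toPoly_mul_idem (v X Z : D.Obj) (F : D.B.cohomology.TotalEnd) :
    D.toPoly (F * DirectSum.of _ 0 (D.B.cohomology.totalIdem v)) X Z =
      D.single v Z (D.toPoly F v Z) X Z := by
  classical
  rw [toPoly_mul, toPoly_idem, Finset.sum_eq_single v (fun Y _ hY => by
    rw [single, if_neg (fun h => hY h.2), mul_zero, map_zero]) (by simp)]
  by_cases h : X = v
  · subst h
    rw [single_self, single_self, mul_one, rho_toPoly]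
  · rw [single, if_neg (fun h' => h h'.1), single, if_neg (fun h' => h h'.1), mul_zero, map_zero]

lemma exists_toPoly_eq_single_Hchi {X Y : D.Obj} (f : D.B.cohomology.hom X Y 0) :
    ∃ F : D.B.cohomology.totalPart 0,
      D.toPoly (DirectSum.of _ 0 F) = D.single X Y (D.Hchi X Y f) := by
  classical
  refine ⟨Function.update (0 : ∀ X Y, D.B.cohomology.hom X Y 0) X
    (Function.update (0 : ∀ Y, D.B.cohomology.hom X Y 0) Y f), ?_⟩
  funext X' Y'
  refine (toPoly_of _ X' Y').trans ?_
  rw [single]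
  by_cases hX : X' = X
  · subst hX
    rw [Function.update_self]
    by_cases hY : Y' = Y
    · subst hY
      rw [Function.update_self, if_pos ⟨rfl, rfl⟩]
    · rw [Function.update_of_ne hY, if_neg fun h => hY h.2]
      exact map_zero _
  · rw [Function.update_of_ne hX, if_neg fun h => hX h.1]
    exact map_zero _

lemma exists_toPoly_eq_single {X Y : D.Obj} {f : D.B.hom X Y 0} (hf : f ∈ D.B.Z X Y 0) :
    ∃ F : D.B.cohomology.totalPart 0,
      D.toPoly (DirectSum.of _ 0 F) = D.single X Y (D.chi X Y f) :=
  exists_toPoly_eq_single_Hchi (Submodule.Quotient.mk ⟨f, hf⟩ : D.B.H X Y 0)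

lemma exists_toPoly_zero (i : Finset.Icc (D.p - D.m) (D.p - 1)) (j : Finset.Icc 1 (D.q - 1))
    (Y : D.Obj) (F : D.B.cohomology.TotalEnd) :
    ∃ h, IsWeightedHomogeneous D.wt h (D.objDeg Y - D.objDeg (.zero i j)) ∧
      D.toPoly F (.zero i j) Y = D.rho Y h := by
  obtain ⟨f, hf⟩ := Submodule.Quotient.mk_surjective _
    (show D.B.H (.zero i j) Y 0 from F 0 (.zero i j) Y)
  obtain ⟨h, h1, h2⟩ := exists_eq_rho_of_zero i j Y f.1
  refine ⟨h, h1, Eq.trans ?_ h2⟩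
  change D.Hchi _ _ (show D.B.H (.zero i j) Y 0 from F 0 (.zero i j) Y) = _
  rw [← hf, Hchi_mk]

lemma exists_toPoly_line (Y : D.Line) (F : D.B.cohomology.TotalEnd) :
    ∃ c, D.toPoly F Y.obj Y.obj = C c := by
  obtain ⟨f, hf⟩ := Submodule.Quotient.mk_surjective _
    (show D.B.H Y.obj Y.obj 0 from F 0 Y.obj Y.obj)
  obtain ⟨c, hc⟩ := exists_eq_C_of_line Y f.1
  refine ⟨c, Eq.trans ?_ hc⟩
  change D.Hchi _ _ (show D.B.H Y.obj Y.obj 0 from F 0 Y.obj Y.obj) = _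
  rw [← hf, Hchi_mk]

lemma toPoly_line_ne (Y : D.Line) {Z : D.Obj} (h : Y.obj ≠ Z) (F : D.B.cohomology.TotalEnd) :
    D.toPoly F Y.obj Z = 0 := by
  obtain ⟨f, hf⟩ := Submodule.Quotient.mk_surjective _
    (show D.B.H Y.obj Z 0 from F 0 Y.obj Z)
  refine Eq.trans ?_ (chi_line_ne Y rfl h f.1)
  change D.Hchi _ _ (show D.B.H Y.obj Z 0 from F 0 Y.obj Z) = _
  rw [← hf, Hchi_mk]

end LoopDatum

/-! ### Paths in the quiver -/

namespace PathAlgebra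

variable {V : Type} [Quiver.{0} V] [Fintype V]

lemma idem_mul_self (v : V) : idem v * idem v = idem v := by
  rw [idem, ← map_mul]
  exact RingQuot.mkAlgHom_rel ℂ (PathRel.idem_mul_self v)

lemma idem_mul_idem {u v : V} (h : u ≠ v) : idem u * idem v = 0 := by
  rw [idem, idem, ← map_mul, RingQuot.mkAlgHom_rel ℂ (PathRel.idem_mul_idem u v h), map_zero]

lemma sum_idem : ∑ v : V, idem v = 1 := by
  simp only [idem]
  rw [← map_sum, RingQuot.mkAlgHom_rel ℂ PathRel.sum_idem, map_one]

lemma idem_mul_arrow {u v : V} (α : u ⟶ v) : idem v * arrow α = arrow α := by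
  rw [idem, arrow, ← map_mul]
  exact RingQuot.mkAlgHom_rel ℂ (PathRel.idem_mul_arrow α)

lemma arrow_mul_idem {u v : V} (α : u ⟶ v) : arrow α * idem u = arrow α := by
  rw [idem, arrow, ← map_mul]
  exact RingQuot.mkAlgHom_rel ℂ (PathRel.arrow_mul_idem α)

lemma idem_mul_arrow_of_ne {u v w : V} (α : u ⟶ v) (h : w ≠ v) : idem w * arrow α = 0 := by
  rw [← idem_mul_arrow α, ← mul_assoc, idem_mul_idem h, zero_mul]

lemma arrow_mul_idem_of_ne {u v w : V} (α : u ⟶ v) (h : u ≠ w) : arrow α * idem w = 0 := by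
  rw [← arrow_mul_idem α, mul_assoc, idem_mul_idem h, mul_zero]

section
variable {ι : Type} [Fintype ι] {S : PathAlgebra V} {src tgt : ι → V} {P : ι → Prop}
  [∀ t, Decidable (P t)] {α : ∀ t, P t → (src t ⟶ tgt t)}

/-- `inj` says that a label occurs at most once between two given vertices, so trivial paths on both
sides isolate one arrow from the sum over its label. -/
lemma idem_mul_sum_mul_idem (hS : S = ∑ t, if h : P t then arrow (α t h) else 0) (t₀ : ι)
    (h₀ : P t₀) (inj : ∀ t, src t = src t₀ → tgt t = tgt t₀ → t = t₀) :
    idem (tgt t₀) * S * idem (src t₀) = arrow (α t₀ h₀) := by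
  rw [hS, Finset.mul_sum, Finset.sum_mul, Finset.sum_eq_single t₀ (fun t _ ht => ?_) (by simp),
    dif_pos h₀, idem_mul_arrow, arrow_mul_idem]
  by_cases h : P t
  · rw [dif_pos h]
    by_cases h1 : src t = src t₀
    · rw [idem_mul_arrow_of_ne _ (fun h2 => ht (inj t h1 h2.symm)), zero_mul]
    · rw [mul_assoc, arrow_mul_idem_of_ne _ h1, mul_zero]
  · rw [dif_neg h, mul_zero, zero_mul]

lemma idem_mul_sum_mul_idem_eq_zero (hS : S = ∑ t, if h : P t then arrow (α t h) else 0)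
    {X Y : V} (hXY : ∀ t, P t → src t = X → tgt t = Y → False) :
    idem Y * S * idem X = 0 := by
  rw [hS, Finset.mul_sum, Finset.sum_mul]
  refine Finset.sum_eq_zero fun t _ => ?_
  by_cases h : P t
  · rw [dif_pos h]
    by_cases h1 : src t = X
    · rw [idem_mul_arrow_of_ne _ (fun h2 => hXY t h h1 h2.symm), zero_mul]
    · rw [mul_assoc, arrow_mul_idem_of_ne _ h1, mul_zero]
  · rw [dif_neg h, mul_zero, zero_mul]

end

end PathAlgebra

namespace LoopDatum

open MvPolynomial PathAlgebra

variable {D : LoopDatum}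

variable (D) in
/-- The sum of the arrows `x` which increase `i`. -/
def xSumInner : PathAlgebra D.Obj :=
  ∑ i, ∑ i', ∑ j, if h : _ then PathAlgebra.arrow (V := D.Obj) (Arrow.x i i' j h) else 0

variable (D) in
/-- The sum of the arrows `x` which lead to the first value of `i`. -/
def xSumNext : PathAlgebra D.Obj :=
  ∑ i, ∑ i', ∑ j, ∑ j', if h : _ ∧ _ ∧ _ then
    PathAlgebra.arrow (V := D.Obj) (Arrow.xnext i i' j j' h.1 h.2.1 h.2.2) else 0

/-- The values of the index `i` of the objects `K_0^{i,j}`. -/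
abbrev IdxI (D : LoopDatum) := Finset.Icc (D.p - D.m) (D.p - 1)

/-- The values of the index `j` of the objects `K_0^{i,j}`. -/
abbrev IdxJ (D : LoopDatum) := Finset.Icc 1 (D.q - 1)

lemma xSum_eq : D.xSum = D.xSumInner + D.xSumNext := rfl

lemma xSumInner_eq : D.xSumInner = ∑ t : IdxI D × IdxI D × IdxJ D,
    if h : (t.2.1 : ℕ) = t.1 + 1 then
      PathAlgebra.arrow (V := D.Obj) (Arrow.x t.1 t.2.1 t.2.2 h) else 0 := by
  simp only [xSumInner, Fintype.sum_prod_type]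

lemma xSumNext_eq : D.xSumNext = ∑ t : IdxI D × IdxI D × IdxJ D × IdxJ D,
    if h : (t.1 : ℕ) = D.p - 1 ∧ (t.2.1 : ℕ) = D.p - D.m ∧ (t.2.2.2 : ℕ) = t.2.2.1 + D.n then
      PathAlgebra.arrow (V := D.Obj) (Arrow.xnext t.1 t.2.1 t.2.2.1 t.2.2.2 h.1 h.2.1 h.2.2)
      else 0 := by
  simp only [xSumNext, Fintype.sum_prod_type]

lemma ySum_eq : D.ySum = ∑ t : IdxI D × IdxJ D × IdxJ D,
    if h : (t.2.2 : ℕ) = t.2.1 + 1 then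
      PathAlgebra.arrow (V := D.Obj) (Arrow.y t.1 t.2.1 t.2.2 h) else 0 := by
  simp only [ySum, Fintype.sum_prod_type]

lemma aSum_eq : D.aSum = ∑ t : IdxI D × IdxJ D × Finset.Icc (D.q - D.n) (D.q - 1),
    if h : (t.1 : ℕ) = D.p - 1 ∧ (t.2.2 : ℕ) = t.2.1 then
      PathAlgebra.arrow (V := D.Obj) (Arrow.a t.1 t.2.1 t.2.2 h.1 h.2) else 0 := by
  simp only [aSum, Fintype.sum_prod_type]

lemma bSum_eq : D.bSum = ∑ t : IdxI D × IdxJ D,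
    if h : (t.2 : ℕ) = D.q - 1 then
      PathAlgebra.arrow (V := D.Obj) (Arrow.b t.1 t.2 h) else 0 := by
  simp only [bSum, Fintype.sum_prod_type]

lemma cSum_eq (r : Finset.Icc 1 D.l) : D.cSum r = ∑ t : IdxI D × IdxJ D,
    if h : (t.1 : ℕ) = D.p - 1 ∧ (t.2 : ℕ) = D.q - 1 then
      PathAlgebra.arrow (V := D.Obj) (Arrow.c t.1 t.2 r h.1 h.2) else 0 := by
  simp only [cSum, Fintype.sum_prod_type]

/-- The sum of all arrows with the same label as a given one. -/
def Arrow.labelSum : ∀ {u v : D.Obj}, D.Arrow u v → PathAlgebra D.Obj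
  | _, _, .x .. => D.xSum
  | _, _, .xnext .. => D.xSum
  | _, _, .y .. => D.ySum
  | _, _, .a .. => D.aSum
  | _, _, .b .. => D.bSum
  | _, _, .c _ _ r _ _ => D.cSum r

/-- For the label `x` the two families do not overlap: inner arrows keep `j`, while the others raise
it by `n > 0`. -/
lemma idem_mul_labelSum_mul_idem {u v : D.Obj} (α : D.Arrow u v) :
    PathAlgebra.idem v * α.labelSum * PathAlgebra.idem u = PathAlgebra.arrow (V := D.Obj) α := by
  cases α with
  | x i i' j h =>
    rw [Arrow.labelSum, xSum_eq]
    have h1 := idem_mul_sum_mul_idem xSumInner_eq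
      (i, i', j) h (by
        rintro ⟨a, b, c⟩ h1 h2
        simp only [Obj.zero.injEq] at h1 h2
        simp only [Prod.mk.injEq]
        exact ⟨h1.1, h2.1, h1.2⟩)
    have h2 := idem_mul_sum_mul_idem_eq_zero xSumNext_eq
      (X := .zero i j) (Y := .zero i' j) (by
        rintro ⟨a, b, c, d⟩ h0 h1 h2
        simp only [Obj.zero.injEq] at h1 h2
        obtain ⟨rfl, rfl⟩ := h1
        obtain ⟨rfl, rfl⟩ := h2
        have := D.n_pos
        have := h0.2.2
        dsimp only at this
        omega)
    rw [mul_add, add_mul, h2, add_zero]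
    exact h1
  | xnext i i' j j' h3 h4 h5 =>
    rw [Arrow.labelSum, xSum_eq]
    have h1 := idem_mul_sum_mul_idem xSumNext_eq
      (i, i', j, j') ⟨h3, h4, h5⟩ (by
        rintro ⟨a, b, c, d⟩ h1 h2
        simp only [Obj.zero.injEq] at h1 h2
        simp only [Prod.mk.injEq]
        exact ⟨h1.1, h2.1, h1.2, h2.2⟩)
    have h2 := idem_mul_sum_mul_idem_eq_zero xSumInner_eq
      (X := .zero i j) (Y := .zero i' j') (by
        rintro ⟨a, b, c⟩ h0 h1 h2
        simp only [Obj.zero.injEq] at h1 h2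
        obtain ⟨rfl, rfl⟩ := h1
        obtain ⟨rfl, rfl⟩ := h2
        have := D.n_pos
        omega)
    rw [mul_add, add_mul, h2, zero_add]
    exact h1
  | y i j j' h =>
    exact idem_mul_sum_mul_idem ySum_eq
      (i, j, j') h (by
        rintro ⟨a, b, c⟩ h1 h2
        simp only [Obj.zero.injEq] at h1 h2
        simp only [Prod.mk.injEq]
        exact ⟨h1.1, h1.2, h2.2⟩)
  | a i j j' h1 h2 =>
    exact idem_mul_sum_mul_idem aSum_eq
      (i, j, j') ⟨h1, h2⟩ (by
        rintro ⟨a, b, c⟩ h1 h2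
        simp only [Obj.zero.injEq, Obj.y.injEq] at h1 h2
        simp only [Prod.mk.injEq]
        exact ⟨h1.1, h1.2, h2⟩)
  | b i j h =>
    exact idem_mul_sum_mul_idem bSum_eq
      (i, j) h (by
        rintro ⟨a, b⟩ h1 -
        simp only [Obj.zero.injEq] at h1
        simp only [Prod.mk.injEq]
        exact h1)
  | c i j r h1 h2 =>
    exact idem_mul_sum_mul_idem (cSum_eq r)
      (i, j) ⟨h1, h2⟩ (by
        rintro ⟨a, b⟩ h1 -
        simp only [Obj.zero.injEq] at h1
        simp only [Prod.mk.injEq]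
        exact h1)

/-- The objects `K_0^{i,j}`. -/
def Obj.IsZero : D.Obj → Prop
  | .zero _ _ => True
  | _ => False

/-- Going from `i = p - 1` back to `i' = p - m` loses `(m - 1) x⃗`, and raising `j` by `n` gains `n
y⃗ = m x⃗`; so these arrows also have degree `x⃗`. -/
lemma next_degree {i i' j j' : ℕ} (hi : i = D.p - 1) (hi' : i' = D.p - D.m) (hj : j' = j + D.n) :
    (i' : ℤ) • D.xv + (j' : ℤ) • D.yv = (i : ℤ) • D.xv + (j : ℤ) • D.yv + D.xv := by
  have hm := D.m_pos
  have hp := D.p_eq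
  have h1 := Nat.le_mul_of_pos_left D.m D.l_pos
  have e1 : (i : ℤ) = i' + D.m - 1 := by omega
  have e2 : (j' : ℤ) = j + D.n := by omega
  rw [e1, e2]
  linear_combination (norm := module) -D.rel

lemma idem_mul_xSum_mul_idem_eq_zero {X Y : D.Obj}
    (h : ¬ (X.IsZero ∧ Y.IsZero ∧ D.objDeg Y = D.objDeg X + D.xv)) :
    PathAlgebra.idem Y * D.xSum * PathAlgebra.idem X = 0 := by
  rw [xSum_eq]
  rw [mul_add, add_mul, idem_mul_sum_mul_idem_eq_zero xSumNext_eq (by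
        rintro ⟨a, b, c, d⟩ h0 rfl rfl
        exact h ⟨trivial, trivial, next_degree h0.1 h0.2.1 h0.2.2⟩),
    idem_mul_sum_mul_idem_eq_zero xSumInner_eq (by
        rintro ⟨a, b, c⟩ h0 rfl rfl
        refine h ⟨trivial, trivial, ?_⟩
        dsimp only at h0
        simp only [objDeg]
        rw [h0]
        push_cast
        module), add_zero]

lemma idem_mul_ySum_mul_idem_eq_zero {X Y : D.Obj}
    (h : ¬ (X.IsZero ∧ Y.IsZero ∧ D.objDeg Y = D.objDeg X + D.yv)) :
    PathAlgebra.idem Y * D.ySum * PathAlgebra.idem X = 0 :=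
  idem_mul_sum_mul_idem_eq_zero ySum_eq (by
        rintro ⟨a, b, c⟩ h0 rfl rfl
        refine h ⟨trivial, trivial, ?_⟩
        dsimp only at h0
        simp only [objDeg]
        rw [h0]
        push_cast
        module)

/-- The sum of all arrows with the label of the arrows which end in a given object of rank one. -/
def Line.tail : D.Line → PathAlgebra D.Obj
  | x _ => D.bSum
  | y _ => D.aSum
  | w r => D.cSum r

/-- The sums for `a` and `b` run over all lines with the same factor, so the target is determined
only up to equality of factors, which is all that the relations need. -/
lemma Line.idem_mul_tail_mul_idem (Y : D.Line) (U Z : D.Obj) :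
    PathAlgebra.idem Z * Y.tail * PathAlgebra.idem U = 0 ∨ ∃ Z' : D.Line, Z = Z'.obj ∧ Z'.factor = Y.factor := by
  by_cases hZ : ∃ Z' : D.Line, Z = Z'.obj ∧ Z'.factor = Y.factor
  · exact Or.inr hZ
  refine Or.inl ?_
  rcases Y with i | j | r
  · exact idem_mul_sum_mul_idem_eq_zero bSum_eq
      fun t _ _ h => hZ ⟨.x t.1, h.symm, rfl⟩
  · exact idem_mul_sum_mul_idem_eq_zero aSum_eq
      fun t _ _ h => hZ ⟨.y t.2.2, h.symm, rfl⟩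
  · exact idem_mul_sum_mul_idem_eq_zero (cSum_eq r)
      fun t _ _ h => hZ ⟨.w r, h.symm, rfl⟩

/-- The label of an arrow, as a polynomial. -/
def Arrow.label : ∀ {u v : D.Obj}, D.Arrow u v → MvPolynomial (Fin 2) ℂ
  | _, _, .x .. => X 0
  | _, _, .xnext .. => X 0
  | _, _, .y .. => X 1
  | _, _, .a .. => 1
  | _, _, .b .. => 1
  | _, _, .c .. => 1

/-- Each line is reached by one arrow from the grid object of the same degree; morphisms from the
grid to the line can thus be factored through that object. -/
lemma Line.exists_arrow (Y : D.Line) : ∃ (i : _) (j : _) (α : D.Arrow (.zero i j) Y.obj),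
    α.labelSum = Y.tail ∧ α.label = 1 ∧ D.objDeg (.zero i j) = D.objDeg Y.obj := by
  have hp := D.hp
  have hq := D.hq
  have hm := D.m_pos
  have hp1 : D.p - 1 ∈ Finset.Icc (D.p - D.m) (D.p - 1) := Finset.mem_Icc.2 (by omega)
  have hq1 : D.q - 1 ∈ Finset.Icc 1 (D.q - 1) := Finset.mem_Icc.2 (by omega)
  have ep : ((D.p - 1 : ℕ) : ℤ) = D.p - 1 := by omega
  have eq : ((D.q - 1 : ℕ) : ℤ) = D.q - 1 := by omega
  rcases Y with i | j | r
  · refine ⟨i, ⟨_, hq1⟩, Arrow.b i ⟨_, hq1⟩ rfl, rfl, rfl, ?_⟩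
    simp only [Line.obj, objDeg, eq]
  · have hj := Finset.mem_Icc.1 j.2
    have hn := D.q_eq
    have h1 := Nat.le_mul_of_pos_left D.n D.l_pos
    refine ⟨⟨_, hp1⟩, ⟨j, Finset.mem_Icc.2 (by omega)⟩, Arrow.a _ _ j rfl rfl, rfl, rfl, ?_⟩
    simp only [Line.obj, objDeg, ep]
  · refine ⟨⟨_, hp1⟩, ⟨_, hq1⟩, Arrow.c _ _ r rfl rfl, rfl, rfl, ?_⟩
    simp only [Line.obj, objDeg, ep, eq]

lemma Arrow.label_homogeneous {u v : D.Obj} (α : D.Arrow u v) :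
    IsWeightedHomogeneous D.wt α.label (D.objDeg v - D.objDeg u) := by
  have h0 := D.homogeneous_X0 1
  have h1 := D.homogeneous_X1 1
  have h2 : IsWeightedHomogeneous D.wt (1 : MvPolynomial (Fin 2) ℂ) 0 :=
    isWeightedHomogeneous_one ℂ D.wt
  have hp := D.hp
  have hq := D.hq
  rw [pow_one, Nat.cast_one, one_smul] at h0 h1
  cases α with
  | x i i' j h =>
    refine Eq.subst (motive := IsWeightedHomogeneous D.wt _) ?_ h0
    simp only [objDeg, h]
    push_cast
    module
  | xnext i i' j j' hi hi' hj =>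
    refine Eq.subst (motive := IsWeightedHomogeneous D.wt _) ?_ h0
    simp only [objDeg]
    rw [next_degree hi hi' hj]
    module
  | y i j j' h =>
    refine Eq.subst (motive := IsWeightedHomogeneous D.wt _) ?_ h1
    simp only [objDeg, h]
    push_cast
    module
  | a i j j' hi hj =>
    refine Eq.subst (motive := IsWeightedHomogeneous D.wt _) ?_ h2
    simp only [objDeg]
    rw [show ((i : ℕ) : ℤ) = D.p - 1 by omega, hj, sub_self]
  | b i j hj =>
    refine Eq.subst (motive := IsWeightedHomogeneous D.wt _) ?_ h2
    simp only [objDeg]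
    rw [show ((j : ℕ) : ℤ) = D.q - 1 by omega, sub_self]
  | c i j r hi hj =>
    refine Eq.subst (motive := IsWeightedHomogeneous D.wt _) ?_ h2
    simp only [objDeg]
    rw [show ((i : ℕ) : ℤ) = D.p - 1 by omega, show ((j : ℕ) : ℤ) = D.q - 1 by omega, sub_self]

lemma Arrow.exists_chi {u v : D.Obj} (α : D.Arrow u v) :
    ∃ f ∈ D.B.Z u v 0, D.chi u v f = α.label := by
  have h0 := α.label_homogeneous
  cases α with
  | x i i' j h => exact exists_chi_zero i i' j j h0
  | xnext i i' j j' hi hi' hj => exact exists_chi_zero i i' j j' h0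
  | y i j j' h => exact exists_chi_zero i i j j' h0
  | a i j j' hi hj => exact exists_chi_y i j j' hj
  | b i j hj => exact exists_chi_x i j
  | c i j r hi hj => exact exists_chi_w i j r hi hj

end LoopDatum

/-! ### The map from the path algebra to the total endomorphism algebra -/

namespace LoopDatum

open MvPolynomial

variable {D : LoopDatum}

lemma exists_toPoly_arrow {u v : D.Obj} (α : D.Arrow u v) :
    ∃ F : D.B.cohomology.totalPart 0,
      D.toPoly (DirectSum.of _ 0 F) = D.single u v α.label := by
  obtain ⟨f, hf, h⟩ := α.exists_chi
  rw [← h]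
  exact exists_toPoly_eq_single hf

variable (D) in
/-- The images of the generators of the path algebra. -/
def genImage : PathGen D.Obj → D.B.cohomology.totalPart 0
  | .idem v => D.B.cohomology.totalIdem v
  | .arrow α => (exists_toPoly_arrow α).choose

lemma toPoly_genImage_arrow {u v : D.Obj} (α : u ⟶ v) :
    D.toPoly (DirectSum.of _ 0 (D.genImage (.arrow α))) = D.single u v (Arrow.label α) :=
  (exists_toPoly_arrow α).choose_spec

lemma sum_of_totalIdem :
    ∑ v, DirectSum.of D.B.cohomology.totalPart 0 (D.B.cohomology.totalIdem v) = 1 := by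
  rw [← map_sum]
  rfl

variable (D) in
/-- The map from the path algebra to the total endomorphism algebra. -/
def pathMap : PathAlgebra D.Obj →ₐ[ℂ] D.B.cohomology.TotalEnd :=
  RingQuot.liftAlgHom ℂ ⟨FreeAlgebra.lift ℂ fun g => DirectSum.of _ 0 (D.genImage g), by
    classical
    intro a b h
    apply toPoly_injective
    cases h with
    | idem_mul_self v =>
      rw [map_mul, FreeAlgebra.lift_ι_apply]
      funext X Z
      rw [genImage, toPoly_idem_mul, toPoly_idem, single, single, single]
      split_ifs <;> simp_all
    | idem_mul_idem u v h =>
      rw [map_mul, map_zero, map_zero, FreeAlgebra.lift_ι_apply, FreeAlgebra.lift_ι_apply]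
      funext X Z
      rw [genImage, genImage, toPoly_idem_mul, toPoly_idem, single, single]
      split_ifs <;> simp_all
    | sum_idem =>
      rw [map_one, map_sum]
      simp only [FreeAlgebra.lift_ι_apply]
      exact congrArg _ sum_of_totalIdem
    | idem_mul_arrow α =>
      rw [map_mul, FreeAlgebra.lift_ι_apply, FreeAlgebra.lift_ι_apply]
      funext X Z
      rw [genImage, toPoly_idem_mul, toPoly_genImage_arrow, single, single, single]
      split_ifs <;> simp_all
    | arrow_mul_idem α =>
      rw [map_mul, FreeAlgebra.lift_ι_apply, FreeAlgebra.lift_ι_apply]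
      funext X Z
      rw [genImage.eq_1, toPoly_mul_idem, toPoly_genImage_arrow, single, single, single]
      split_ifs <;> simp_all⟩

lemma pathMap_idem (v : D.Obj) :
    D.pathMap (PathAlgebra.idem v) = DirectSum.of _ 0 (D.B.cohomology.totalIdem v) := by
  rw [pathMap, PathAlgebra.idem, RingQuot.liftAlgHom_mkAlgHom_apply, FreeAlgebra.lift_ι_apply]
  rfl

lemma pathMap_arrow {u v : D.Obj} (α : u ⟶ v) :
    D.pathMap (PathAlgebra.arrow α) = DirectSum.of _ 0 (D.genImage (.arrow α)) := by
  rw [pathMap, PathAlgebra.arrow, RingQuot.liftAlgHom_mkAlgHom_apply, FreeAlgebra.lift_ι_apply]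

lemma toPoly_corner (F : D.B.cohomology.TotalEnd) (X Y : D.Obj) :
    D.toPoly (DirectSum.of _ 0 (D.B.cohomology.totalIdem Y) * F *
      DirectSum.of _ 0 (D.B.cohomology.totalIdem X)) X Y = D.toPoly F X Y := by
  rw [toPoly_mul_idem, single_self, toPoly_idem_mul, single_self]

lemma toPoly_pathMap_corner (z : PathAlgebra D.Obj) (X Y : D.Obj) :
    D.toPoly (D.pathMap (PathAlgebra.idem Y * z * PathAlgebra.idem X)) X Y =
      D.toPoly (D.pathMap z) X Y := by
  rw [map_mul D.pathMap, map_mul D.pathMap, pathMap_idem, pathMap_idem, toPoly_corner]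

lemma toPoly_pathMap_labelSum {u v : D.Obj} (α : D.Arrow u v) :
    D.toPoly (D.pathMap α.labelSum) u v = α.label := by
  rw [← toPoly_pathMap_corner, idem_mul_labelSum_mul_idem]
  refine (congrFun (congrFun (congrArg D.toPoly (pathMap_arrow (D := D) α)) u) v).trans ?_
  rw [toPoly_genImage_arrow, single_self]

/-! #### Degrees in the grid -/

/-- The index `i` takes `m` consecutive values, one for each residue modulo `m`, so the relation
identifies no two grid objects. -/
lemma objDeg_zero_injective {i i' : IdxI D} {j j' : IdxJ D}
    (h : D.objDeg (.zero i j) = D.objDeg (.zero i' j')) :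
    (Obj.zero i j : D.Obj) = .zero i' j' := by
  simp only [objDeg] at h
  obtain ⟨s, h1, h2⟩ := (D.smul_add_smul_eq_zero ((i : ℤ) - i') ((j : ℤ) - j')).1 (by
    linear_combination (norm := module) h)
  have hi := Finset.mem_Icc.1 i.2
  have hi' := Finset.mem_Icc.1 i'.2
  have hm := D.m_pos
  have h3 : s = 0 := by
    by_contra hs
    rcases lt_or_gt_of_ne hs with hs | hs
    · have : s * D.m ≤ -1 * D.m := mul_le_mul_of_nonneg_right (by omega) (by omega)
      omega
    · have : 1 * (D.m : ℤ) ≤ s * D.m := mul_le_mul_of_nonneg_right (by omega) (by omega)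
      omega
  subst h3
  rw [zero_mul] at h1 h2
  congr 1 <;> ext <;> omega

/-- A monomial containing `y` and joining two grid objects has its last step `y` inside the grid:
the multiple `s` of the relation is nonnegative, so `j' = j + b + 1 + s n ≥ 2`. -/
lemma exists_arrow_y {i i' : IdxI D} {j j' : IdxJ D} (a b : ℕ)
    (h : D.objDeg (.zero i' j') = D.objDeg (.zero i j) +
      ((a : ℤ) • D.xv + ((b : ℤ) + 1) • D.yv)) :
    ∃ (j'' : _) (α : D.Arrow (.zero i' j'') (.zero i' j')), α.labelSum = D.ySum ∧
      α.label = X 1 ∧ D.objDeg (.zero i' j') = D.objDeg (.zero i' j'') + D.yv := by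
  simp only [objDeg] at h
  obtain ⟨s, h1, h2⟩ := (D.smul_add_smul_eq_zero ((i : ℤ) + a - i') ((j : ℤ) + (b + 1) - j')).1 (by
    linear_combination (norm := module) -h)
  have hi := Finset.mem_Icc.1 i.2
  have hi' := Finset.mem_Icc.1 i'.2
  have hj := Finset.mem_Icc.1 j.2
  have hj' := Finset.mem_Icc.1 j'.2
  have hm := D.m_pos
  have hn := D.n_pos
  have h3 : 0 ≤ s := by
    by_contra hs
    have : s * D.m ≤ -1 * D.m := mul_le_mul_of_nonneg_right (by omega) (by omega)
    omega
  have h4 : 0 ≤ s * D.n := mul_nonneg h3 (by omega)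
  have h5 : (j' : ℕ) = (j' - 1 : ℕ) + 1 := by omega
  refine ⟨⟨j' - 1, Finset.mem_Icc.2 (by omega)⟩, Arrow.y _ _ _ h5, rfl, rfl, ?_⟩
  simp only [objDeg]
  rw [show ((j' : ℕ) : ℤ) = ((j' - 1 : ℕ) : ℤ) + 1 by omega]
  module

/-- The same for `x`. At the first value of `i'` the multiple `s` of the relation is at least `1`,
so `j' > n` and the predecessor exists in the last column. -/
lemma exists_arrow_x {i i' : IdxI D} {j j' : IdxJ D} (a b : ℕ)
    (h : D.objDeg (.zero i' j') = D.objDeg (.zero i j) +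
      (((a : ℤ) + 1) • D.xv + (b : ℤ) • D.yv)) :
    ∃ (i'' : _) (j'' : _) (α : D.Arrow (.zero i'' j'') (.zero i' j')), α.labelSum = D.xSum ∧
      α.label = X 0 ∧ D.objDeg (.zero i' j') = D.objDeg (.zero i'' j'') + D.xv := by
  simp only [objDeg] at h
  obtain ⟨s, h1, h2⟩ := (D.smul_add_smul_eq_zero ((i : ℤ) + (a + 1) - i') ((j : ℤ) + b - j')).1 (by
    linear_combination (norm := module) -h)
  have hp := D.hp
  have hi := Finset.mem_Icc.1 i.2
  have hi' := Finset.mem_Icc.1 i'.2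
  have hj := Finset.mem_Icc.1 j.2
  have hj' := Finset.mem_Icc.1 j'.2
  have hm := D.m_pos
  have hn := D.n_pos
  by_cases h0 : (i' : ℕ) = D.p - D.m
  · have h3 : 1 ≤ s := by
      by_contra hs
      have : s * D.m ≤ 0 * D.m := mul_le_mul_of_nonneg_right (by omega) (by omega)
      omega
    have h4 : 1 * (D.n : ℤ) ≤ s * D.n := mul_le_mul_of_nonneg_right h3 (by omega)
    have h5 : (j' : ℕ) = (j' - D.n : ℕ) + D.n := by omega
    exact ⟨⟨D.p - 1, Finset.mem_Icc.2 (by omega)⟩, ⟨j' - D.n, Finset.mem_Icc.2 (by omega)⟩,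
      Arrow.xnext _ _ _ _ rfl h0 h5, rfl, rfl, next_degree rfl h0 h5⟩
  · have h5 : (i' : ℕ) = (i' - 1 : ℕ) + 1 := by omega
    refine ⟨⟨i' - 1, Finset.mem_Icc.2 (by omega)⟩, j', Arrow.x _ _ _ h5, rfl, rfl, ?_⟩
    simp only [objDeg]
    rw [show ((i' : ℕ) : ℤ) = ((i' - 1 : ℕ) : ℤ) + 1 by omega]
    module

open Classical in
variable (D) in
/-- The matrix which represents multiplication by a homogeneous polynomial of degree `d` in the
grid. -/
def gridEntry (d : D.L) (s : MvPolynomial (Fin 2) ℂ) (X Y : D.Obj) : MvPolynomial (Fin 2) ℂ :=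
  if X.IsZero ∧ Y.IsZero ∧ D.objDeg Y = D.objDeg X + d then s else 0

lemma Obj.IsZero.exists {X : D.Obj} (h : X.IsZero) : ∃ i j, X = .zero i j := by
  cases X with
  | zero i j => exact ⟨i, j, rfl⟩
  | _ => exact h.elim

lemma Obj.exists_line {X : D.Obj} (h : ¬ X.IsZero) : ∃ Y : D.Line, X = Y.obj := by
  cases X with
  | zero i j => exact absurd trivial h
  | x i => exact ⟨.x i, rfl⟩
  | y i => exact ⟨.y i, rfl⟩
  | w i => exact ⟨.w i, rfl⟩

lemma Line.not_isZero (Y : D.Line) : ¬ Y.obj.IsZero := by cases Y <;> exact id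

lemma Obj.IsZero.eq_of_objDeg {X Y : D.Obj} (hX : X.IsZero) (hY : Y.IsZero)
    (h : D.objDeg X = D.objDeg Y) : X = Y := by
  obtain ⟨i, j, rfl⟩ := hX.exists
  obtain ⟨i', j', rfl⟩ := hY.exists
  exact objDeg_zero_injective h

lemma Obj.IsZero.rho {X : D.Obj} (hX : X.IsZero) (h : MvPolynomial (Fin 2) ℂ) :
    D.rho X h = h := by
  obtain ⟨i, j, rfl⟩ := hX.exists
  rfl

/-- `hpred` supplies the intermediate vertex of a composite, and degrees determine it uniquely, so
the sum has one term. Control of `G` on grid sources suffices, since lines have no morphisms to the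
grid. -/
lemma toPoly_mul_grid {F G : D.B.cohomology.TotalEnd} {e d : D.L}
    {t s : MvPolynomial (Fin 2) ℂ} (hF : D.toPoly F = D.gridEntry e t)
    (hG : ∀ X Y, X.IsZero → D.toPoly G X Y = D.gridEntry d s X Y)
    (hpred : ∀ X Z : D.Obj, X.IsZero → Z.IsZero → D.objDeg Z = D.objDeg X + (e + d) →
      ∃ Y : D.Obj, Y.IsZero ∧ D.objDeg Z = D.objDeg Y + e) :
    D.toPoly (F * G) = D.gridEntry (e + d) (t * s) := by
  classical
  funext X Z
  rw [toPoly_mul, hF]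
  by_cases hX : X.IsZero
  · by_cases hZ : Z.IsZero
    · by_cases h : ∃ Y : D.Obj, Y.IsZero ∧ D.objDeg Z = D.objDeg Y + e
      · obtain ⟨Y, hY, hYZ⟩ := h
        rw [Finset.sum_eq_single Y (fun Y' _ hY' => by
          rw [gridEntry, if_neg (fun h => hY' (h.1.eq_of_objDeg hY
            (add_right_cancel (h.2.2.symm.trans hYZ)))), zero_mul, map_zero]) (by simp),
          hZ.rho, hG X Y hX, gridEntry, gridEntry, gridEntry, if_pos ⟨hY, hZ, hYZ⟩]
        have h1 : D.objDeg Y = D.objDeg X + d ↔ D.objDeg Z = D.objDeg X + (e + d) := by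
          rw [hYZ, add_comm e d, ← add_assoc, add_left_inj]
        simp only [hX, hY, hZ, true_and, h1, mul_ite, mul_zero]
      · rw [gridEntry, if_neg fun h' => h (hpred X Z hX hZ h'.2.2)]
        refine Finset.sum_eq_zero fun Y _ => ?_
        rw [gridEntry, if_neg fun h' => h ⟨Y, h'.1, h'.2.2⟩, zero_mul, map_zero]
    · rw [gridEntry, if_neg fun h => hZ h.2.1]
      refine Finset.sum_eq_zero fun Y _ => ?_
      rw [gridEntry, if_neg fun h => hZ h.2.1, zero_mul, map_zero]
  · rw [gridEntry, if_neg fun h => hX h.1]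
    refine Finset.sum_eq_zero fun Y _ => ?_
    by_cases hY : Y.IsZero
    · obtain ⟨V, rfl⟩ := Obj.exists_line hX
      rw [toPoly_line_ne V (fun h => V.not_isZero (h ▸ hY)), mul_zero, map_zero]
    · rw [gridEntry, if_neg fun h => hY h.1, zero_mul, map_zero]

lemma toPoly_xSum : D.toPoly (D.pathMap D.xSum) = D.gridEntry D.xv (X 0) := by
  classical
  funext X Y
  rw [gridEntry]
  split_ifs with h
  · obtain ⟨hX, hY, h⟩ := h
    obtain ⟨i, j, rfl⟩ := hX.exists
    obtain ⟨i', j', rfl⟩ := hY.exists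
    obtain ⟨i'', j'', α, h1, h2, h3⟩ := exists_arrow_x 0 0 (by simpa using h)
    have h4 := objDeg_zero_injective (add_right_cancel (h3.symm.trans h))
    rw [← h4, ← h1, toPoly_pathMap_labelSum, h2]
  · rw [← toPoly_pathMap_corner, idem_mul_xSum_mul_idem_eq_zero h, map_zero, map_zero]
    rfl

lemma toPoly_ySum : D.toPoly (D.pathMap D.ySum) = D.gridEntry D.yv (X 1) := by
  classical
  funext X Y
  rw [gridEntry]
  split_ifs with h
  · obtain ⟨hX, hY, h⟩ := h
    obtain ⟨i, j, rfl⟩ := hX.exists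
    obtain ⟨i', j', rfl⟩ := hY.exists
    obtain ⟨j'', α, h1, h2, h3⟩ := exists_arrow_y 0 0 (by simpa using h)
    have h4 := objDeg_zero_injective (add_right_cancel (h3.symm.trans h))
    rw [← h4, ← h1, toPoly_pathMap_labelSum, h2]
  · rw [← toPoly_pathMap_corner, idem_mul_ySum_mul_idem_eq_zero h, map_zero, map_zero]
    rfl

lemma toPoly_ySum_mul {G : D.B.cohomology.TotalEnd} {s : MvPolynomial (Fin 2) ℂ} (a b : ℕ)
    (hG : ∀ X Y, X.IsZero →
      D.toPoly G X Y = D.gridEntry ((a : ℤ) • D.xv + (b : ℤ) • D.yv) s X Y) :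
    D.toPoly (D.pathMap D.ySum * G) =
      D.gridEntry ((a : ℤ) • D.xv + ((b + 1 : ℕ) : ℤ) • D.yv) (X 1 * s) := by
  have e : (a : ℤ) • D.xv + ((b + 1 : ℕ) : ℤ) • D.yv =
      D.yv + ((a : ℤ) • D.xv + (b : ℤ) • D.yv) := by push_cast; module
  rw [e]
  refine toPoly_mul_grid toPoly_ySum hG fun X Z hX hZ h => ?_
  obtain ⟨i, j, rfl⟩ := hX.exists
  obtain ⟨i', j', rfl⟩ := hZ.exists
  obtain ⟨j'', -, -, -, h'⟩ := exists_arrow_y a b (h.trans (by rw [← e]; push_cast; rfl))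
  exact ⟨.zero _ _, trivial, h'⟩

lemma toPoly_xSum_mul {G : D.B.cohomology.TotalEnd} {s : MvPolynomial (Fin 2) ℂ} (a b : ℕ)
    (hG : ∀ X Y, X.IsZero →
      D.toPoly G X Y = D.gridEntry ((a : ℤ) • D.xv + (b : ℤ) • D.yv) s X Y) :
    D.toPoly (D.pathMap D.xSum * G) =
      D.gridEntry (((a + 1 : ℕ) : ℤ) • D.xv + (b : ℤ) • D.yv) (X 0 * s) := by
  have e : ((a + 1 : ℕ) : ℤ) • D.xv + (b : ℤ) • D.yv =
      D.xv + ((a : ℤ) • D.xv + (b : ℤ) • D.yv) := by push_cast; module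
  rw [e]
  refine toPoly_mul_grid toPoly_xSum hG fun X Z hX hZ h => ?_
  obtain ⟨i, j, rfl⟩ := hX.exists
  obtain ⟨i', j', rfl⟩ := hZ.exists
  obtain ⟨i'', j'', -, -, -, h'⟩ := exists_arrow_x a b (h.trans (by rw [← e]; push_cast; rfl))
  exact ⟨.zero _ _, trivial, h'⟩

/-- The source must lie in the grid, since the unit also contains the identities of the lines; this
is why the formulas for powers valid at all sources require a nonzero exponent. -/
lemma toPoly_one_grid {X Y : D.Obj} (hX : X.IsZero) :
    D.toPoly 1 X Y = D.gridEntry (((0 : ℕ) : ℤ) • D.xv + ((0 : ℕ) : ℤ) • D.yv) 1 X Y := by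
  classical
  rw [gridEntry]
  simp only [Nat.cast_zero, zero_smul, add_zero]
  split_ifs with h
  · rw [← hX.eq_of_objDeg h.2.1 h.2.2.symm, toPoly_one_self]
  · exact toPoly_one_ne fun h' => h (h' ▸ ⟨hX, hX, rfl⟩)

lemma toPoly_ySum_pow (b : ℕ) {X Y : D.Obj} (hX : X.IsZero) :
    D.toPoly (D.pathMap D.ySum ^ b) X Y =
      D.gridEntry (((0 : ℕ) : ℤ) • D.xv + (b : ℤ) • D.yv) (MvPolynomial.X 1 ^ b) X Y := by
  induction b generalizing X Y with
  | zero => rw [pow_zero, pow_zero, toPoly_one_grid hX]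
  | succ b ih =>
    rw [pow_succ', pow_succ', toPoly_ySum_mul 0 b fun X Y hX => ih hX]

lemma toPoly_monomial (a b : ℕ) {X Y : D.Obj} (hX : X.IsZero) :
    D.toPoly (D.pathMap D.xSum ^ a * D.pathMap D.ySum ^ b) X Y =
      D.gridEntry ((a : ℤ) • D.xv + (b : ℤ) • D.yv)
        (MvPolynomial.X 0 ^ a * MvPolynomial.X 1 ^ b) X Y := by
  induction a generalizing X Y with
  | zero => rw [pow_zero, one_mul, pow_zero, one_mul, toPoly_ySum_pow b hX]
  | succ a ih =>
    rw [pow_succ', mul_assoc, toPoly_xSum_mul a b fun X Y hX => ih hX, pow_succ', mul_assoc]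

lemma toPoly_ySum_pow_of_ne_zero {b : ℕ} (hb : b ≠ 0) :
    D.toPoly (D.pathMap D.ySum ^ b) = D.gridEntry ((b : ℤ) • D.yv) (X 1 ^ b) := by
  obtain ⟨b, rfl⟩ := Nat.exists_eq_succ_of_ne_zero hb
  rw [Nat.succ_eq_add_one, pow_succ', toPoly_ySum_mul 0 b fun X Y hX => toPoly_ySum_pow b hX,
    ← pow_succ', Nat.cast_zero, zero_smul, zero_add]

lemma toPoly_xSum_pow_of_ne_zero {a : ℕ} (ha : a ≠ 0) :
    D.toPoly (D.pathMap D.xSum ^ a) = D.gridEntry ((a : ℤ) • D.xv) (X 0 ^ a) := by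
  obtain ⟨a, rfl⟩ := Nat.exists_eq_succ_of_ne_zero ha
  have h := toPoly_xSum_mul (D := D) a 0 fun X Y hX => toPoly_monomial a 0 hX
  simp only [pow_zero, mul_one, Nat.cast_zero, zero_smul, add_zero] at h
  rw [Nat.succ_eq_add_one, pow_succ', h, ← pow_succ']

/-! #### The relations of the quiver -/

/-- Any line reached by the tail has the same factor as `Y`, and the factor is zero at the point of
that line. This proves the relations with `a`, `b` and `c_r` uniformly. -/
lemma pathMap_tail_mul {Y : D.Line} {G : D.B.cohomology.TotalEnd}
    (hG : ∀ X U, D.toPoly G X U = 0 ∨ D.toPoly G X U = Y.factor) :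
    D.pathMap Y.tail * G = 0 := by
  apply toPoly_injective
  rw [map_zero]
  funext X Z
  rw [toPoly_mul]
  refine Finset.sum_eq_zero fun U _ => ?_
  rcases Y.idem_mul_tail_mul_idem U Z with h | ⟨Z', rfl, h⟩
  · rw [← toPoly_pathMap_corner, h, map_zero, map_zero]
    exact (congrArg _ (zero_mul _)).trans (map_zero _)
  · rcases hG X U with h' | h'
    · rw [h', mul_zero, map_zero]
    · rw [h', ← h, map_mul, rho_factor, mul_zero]

lemma gridEntry_eq (d : D.L) (s : MvPolynomial (Fin 2) ℂ) (X Y : D.Obj) :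
    D.gridEntry d s X Y = 0 ∨ D.gridEntry d s X Y = s := by
  rw [gridEntry]
  split_ifs
  · exact Or.inr rfl
  · exact Or.inl rfl

variable (D) in
/-- The map from the path algebra with relations to the total endomorphism algebra. -/
def quiverMap : D.QuiverAlgebra →ₐ[ℂ] D.B.cohomology.TotalEnd :=
  RingQuot.liftAlgHom ℂ ⟨D.pathMap, by
    intro a b h
    cases h with
    | xy =>
      apply toPoly_injective
      have h1 := toPoly_xSum_mul (D := D) 0 1 fun X Y hX => toPoly_monomial 0 1 hX
      have h2 := toPoly_ySum_mul (D := D) 1 0 fun X Y hX => toPoly_monomial 1 0 hX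
      simp only [pow_zero, pow_one, mul_one, one_mul, zero_add] at h1 h2
      rw [map_mul D.pathMap, map_mul D.pathMap, h1, h2, mul_comm]
    | ay =>
      rw [map_mul, map_zero]
      have hn := D.n_pos
      have hq := D.hq
      -- The tail and the factor depend only on the kind of line, so any index serves.
      refine pathMap_tail_mul (Y := .y ⟨D.q - 1, Finset.mem_Icc.2 (by omega)⟩) fun X U => ?_
      rw [toPoly_ySum]
      exact gridEntry_eq _ _ _ _
    | bx =>
      rw [map_mul, map_zero]
      have hm := D.m_pos
      have hp := D.hp
      refine pathMap_tail_mul (Y := .x ⟨D.p - 1, Finset.mem_Icc.2 (by omega)⟩) fun X U => ?_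
      rw [toPoly_xSum]
      exact gridEntry_eq _ _ _ _
    | c r =>
      rw [map_mul, map_zero]
      refine pathMap_tail_mul (Y := .w r) fun X U => ?_
      -- By `m x⃗ = n y⃗` both powers have their entries at the same pairs of grid objects, so the
      -- difference is `w_r` there and zero elsewhere.
      rw [map_sub, map_smul, map_pow, map_pow, map_sub, map_smul,
        toPoly_xSum_pow_of_ne_zero D.m_pos.ne', toPoly_ySum_pow_of_ne_zero D.n_pos.ne', D.rel]
      change D.gridEntry _ _ X U - D.root r • D.gridEntry _ _ X U = 0 ∨
        D.gridEntry _ _ X U - D.root r • D.gridEntry _ _ X U = _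
      rw [gridEntry, gridEntry]
      split_ifs
      · right
        rw [Line.factor, LoopDatum.w, smul_eq_C_mul]
      · left
        rw [smul_zero, sub_zero]⟩

end LoopDatum

/-! ### Bases of the path algebra with relations -/

namespace LoopDatum

open MvPolynomial

variable {D : LoopDatum}

variable (D) in
/-- The projection from the path algebra. -/
def toQuiver : PathAlgebra D.Obj →ₐ[ℂ] D.QuiverAlgebra := RingQuot.mkAlgHom ℂ D.QuiverRel

lemma quiverMap_toQuiver (z : PathAlgebra D.Obj) : D.quiverMap (D.toQuiver z) = D.pathMap z := by
  rw [quiverMap, toQuiver, RingQuot.liftAlgHom_mkAlgHom_apply]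

lemma toQuiver_rel {a b : PathAlgebra D.Obj} (h : D.QuiverRel a b) :
    D.toQuiver a = D.toQuiver b := RingQuot.mkAlgHom_rel ℂ h

lemma toQuiver_commute : Commute (D.toQuiver D.xSum) (D.toQuiver D.ySum) := by
  rw [Commute, SemiconjBy, ← map_mul, ← map_mul, toQuiver_rel .xy]

lemma idem_mul_self (v : D.Obj) : D.idem v * D.idem v = D.idem v := by
  rw [idem, ← map_mul, PathAlgebra.idem_mul_self]

lemma idem_mul_idem {u v : D.Obj} (h : u ≠ v) : D.idem u * D.idem v = 0 := by
  rw [idem, idem, ← map_mul, PathAlgebra.idem_mul_idem h, map_zero]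

lemma sum_idem : ∑ v, D.idem v = 1 := by
  simp only [idem]
  rw [← map_sum, PathAlgebra.sum_idem, map_one]

lemma idem_mul_arrow {u v : D.Obj} (α : D.Arrow u v) : D.idem v * D.arrow α = D.arrow α := by
  rw [idem, arrow, ← map_mul]
  exact congrArg _ (PathAlgebra.idem_mul_arrow (V := D.Obj) α)

lemma arrow_mul_idem {u v : D.Obj} (α : D.Arrow u v) : D.arrow α * D.idem u = D.arrow α := by
  rw [idem, arrow, ← map_mul]
  exact congrArg _ (PathAlgebra.arrow_mul_idem (V := D.Obj) α)

lemma idem_mul_arrow_of_ne {u v w : D.Obj} (α : D.Arrow u v) (h : w ≠ v) :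
    D.idem w * D.arrow α = 0 := by
  rw [← idem_mul_arrow α, ← mul_assoc, idem_mul_idem h, zero_mul]

variable (D) in
/-- Evaluation of polynomials at the sums of the arrows `x` and `y`. -/
def ev : MvPolynomial (Fin 2) ℂ →ₐ[ℂ] D.QuiverAlgebra :=
  AddMonoidAlgebra.lift ℂ D.QuiverAlgebra (Fin 2 →₀ ℕ)
    { toFun := fun s => D.toQuiver D.xSum ^ (s.toAdd 0) * D.toQuiver D.ySum ^ (s.toAdd 1)
      map_one' := by simp
      map_mul' := fun s t => by
        rw [toAdd_mul, Finsupp.add_apply, Finsupp.add_apply, pow_add, pow_add, mul_assoc,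
          mul_assoc, ← mul_assoc (_ ^ _) (_ ^ _) (_ ^ _), ← mul_assoc (_ ^ _) (_ ^ _) (_ ^ _),
          (toQuiver_commute.pow_pow _ _).eq] }

lemma ev_monomial (s : Fin 2 →₀ ℕ) (c : ℂ) : D.ev (monomial s c) =
    c • (D.toQuiver D.xSum ^ (s 0) * D.toQuiver D.ySum ^ (s 1)) :=
  AddMonoidAlgebra.lift_single _ _ _

lemma ev_X0 : D.ev (X 0) = D.toQuiver D.xSum := by
  rw [X, ev_monomial]
  simp

lemma ev_X1 : D.ev (X 1) = D.toQuiver D.ySum := by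
  rw [X, ev_monomial]
  simp

variable (D) in
/-- The sum of all arrows with the label of the arrows which end in an object of rank one, and the
unit for the objects `K_0^{i,j}`. -/
def tailObj : D.Obj → D.QuiverAlgebra
  | .zero _ _ => 1
  | .x _ => D.toQuiver D.bSum
  | .y _ => D.toQuiver D.aSum
  | .w r => D.toQuiver (D.cSum r)

lemma tailObj_line (Y : D.Line) : D.tailObj Y.obj = D.toQuiver Y.tail := by cases Y <;> rfl

lemma Obj.IsZero.tailObj {X : D.Obj} (hX : X.IsZero) : D.tailObj X = 1 := by
  obtain ⟨i, j, rfl⟩ := hX.exists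
  rfl

/-- These are the defining relations, rewritten through `ev`. -/
lemma tailObj_mul_factor (Y : D.Line) : D.tailObj Y.obj * D.ev Y.factor = 0 := by
  cases Y with
  | x i =>
    change D.toQuiver D.bSum * D.ev (X 0) = 0
    rw [ev_X0, ← map_mul, toQuiver_rel .bx, map_zero]
  | y j =>
    change D.toQuiver D.aSum * D.ev (X 1) = 0
    rw [ev_X1, ← map_mul, toQuiver_rel .ay, map_zero]
  | w r =>
    change D.toQuiver (D.cSum r) * D.ev (D.w r) = 0
    rw [LoopDatum.w, ← smul_eq_C_mul, map_sub, map_smul, map_pow, map_pow, ev_X0, ev_X1,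
      ← map_pow, ← map_pow, ← map_smul, ← map_sub, ← map_mul, toQuiver_rel (.c r), map_zero]

lemma Arrow.isZero {u v : D.Obj} (α : D.Arrow u v) : u.IsZero := by cases α <;> trivial

lemma toQuiver_labelSum {u v : D.Obj} (α : D.Arrow u v) :
    D.toQuiver α.labelSum = D.tailObj v * D.ev α.label := by
  cases α with
  | x => exact ev_X0.symm.trans (one_mul _).symm
  | xnext => exact ev_X0.symm.trans (one_mul _).symm
  | y => exact ev_X1.symm.trans (one_mul _).symm
  | a => exact ((congrArg _ (map_one D.ev)).trans (mul_one _)).symm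
  | b => exact ((congrArg _ (map_one D.ev)).trans (mul_one _)).symm
  | c => exact ((congrArg _ (map_one D.ev)).trans (mul_one _)).symm

lemma arrow_eq {u v : D.Obj} (α : D.Arrow u v) :
    D.arrow α = D.idem v * (D.tailObj v * D.ev α.label) * D.idem u := by
  rw [← toQuiver_labelSum, idem, idem, toQuiver, ← map_mul, ← map_mul,
    idem_mul_labelSum_mul_idem]
  rfl

variable (D) in
/-- An element whose product with a trivial path ends in the objects `K_0^{i,j}` of a given
degree. -/
def IsHomogeneousAt (X : D.Obj) (d : D.L) (G : D.QuiverAlgebra) : Prop :=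
  ∀ Y : D.Obj, ¬ (Y.IsZero ∧ D.objDeg Y = D.objDeg X + d) → D.idem Y * G * D.idem X = 0

lemma IsHomogeneousAt.mul {X : D.Obj} {e d : D.L} {F G : D.QuiverAlgebra}
    (hF : ∀ U, D.IsHomogeneousAt U e F) (hG : D.IsHomogeneousAt X d G) :
    D.IsHomogeneousAt X (e + d) (F * G) := by
  intro Y hY
  have h : D.idem Y * (F * G) * D.idem X =
      ∑ U, (D.idem Y * F * D.idem U) * (D.idem U * G * D.idem X) := by
    calc _ = D.idem Y * F * (∑ U, D.idem U) * (G * D.idem X) := by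
          rw [sum_idem, mul_one]; simp only [mul_assoc]
      _ = _ := by
          rw [Finset.mul_sum, Finset.sum_mul]
          refine Finset.sum_congr rfl fun U _ => ?_
          conv_lhs => rw [← idem_mul_self U]
          simp only [mul_assoc]
  rw [h]
  refine Finset.sum_eq_zero fun U _ => ?_
  by_cases hU : U.IsZero ∧ D.objDeg U = D.objDeg X + d
  · rw [hF U Y fun h => hY ⟨h.1, by rw [h.2, hU.2, add_comm e, add_assoc]⟩, zero_mul]
  · rw [hG U hU, mul_zero]

lemma isHomogeneousAt_x (X : D.Obj) : D.IsHomogeneousAt X D.xv (D.toQuiver D.xSum) := by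
  intro Y hY
  rw [idem, idem, toQuiver, ← map_mul, ← map_mul,
    idem_mul_xSum_mul_idem_eq_zero fun h => hY h.2, map_zero]

lemma isHomogeneousAt_y (X : D.Obj) : D.IsHomogeneousAt X D.yv (D.toQuiver D.ySum) := by
  intro Y hY
  rw [idem, idem, toQuiver, ← map_mul, ← map_mul,
    idem_mul_ySum_mul_idem_eq_zero fun h => hY h.2, map_zero]

lemma isHomogeneousAt_one {X : D.Obj} (hX : X.IsZero) : D.IsHomogeneousAt X 0 1 := by
  intro Y hY
  rw [mul_one, idem_mul_idem fun h : Y = X => hY ⟨h ▸ hX, by rw [h, add_zero]⟩]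

lemma isHomogeneousAt_y_pow {X : D.Obj} (hX : X.IsZero) (b : ℕ) :
    D.IsHomogeneousAt X (b • D.yv) (D.toQuiver D.ySum ^ b) := by
  induction b with
  | zero =>
    rw [zero_smul, pow_zero]
    exact isHomogeneousAt_one hX
  | succ b ih =>
    rw [succ_nsmul', pow_succ']
    exact ih.mul isHomogeneousAt_y

lemma isHomogeneousAt_monomial {X : D.Obj} (hX : X.IsZero) (a b : ℕ) :
    D.IsHomogeneousAt X (a • D.xv + b • D.yv) (D.toQuiver D.xSum ^ a * D.toQuiver D.ySum ^ b) := by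
  induction a with
  | zero =>
    rw [zero_smul, zero_add, pow_zero, one_mul]
    exact isHomogeneousAt_y_pow hX b
  | succ a ih =>
    rw [succ_nsmul', pow_succ', mul_assoc, add_assoc]
    exact ih.mul isHomogeneousAt_x

lemma isHomogeneousAt_ev {X : D.Obj} (hX : X.IsZero) {d : D.L} {h : MvPolynomial (Fin 2) ℂ}
    (hh : IsWeightedHomogeneous D.wt h d) : D.IsHomogeneousAt X d (D.ev h) := by
  intro Y hY
  rw [h.as_sum, map_sum, Finset.mul_sum, Finset.sum_mul]
  refine Finset.sum_eq_zero fun s hs => ?_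
  have h1 := hh (mem_support_iff.1 hs)
  rw [D.weight_eq, natCast_zsmul, natCast_zsmul] at h1
  rw [ev_monomial, mul_smul_comm, smul_mul_assoc,
    isHomogeneousAt_monomial hX _ _ Y (by rwa [h1]), smul_zero]

/-- A homogeneous element starting at a grid vertex ends only at grid vertices of one degree, and
there is only one such vertex. -/
lemma idem_mul_ev_mul_idem {X u : D.Obj} (hX : X.IsZero) (hu : u.IsZero)
    {h : MvPolynomial (Fin 2) ℂ}
    (hh : IsWeightedHomogeneous D.wt h (D.objDeg u - D.objDeg X)) :
    D.idem u * D.ev h * D.idem X = D.ev h * D.idem X := by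
  calc D.idem u * D.ev h * D.idem X = ∑ U, D.idem U * D.ev h * D.idem X := by
        symm
        refine Finset.sum_eq_single u (fun U _ hU => ?_)
          fun h => absurd (Finset.mem_univ _) h
        refine isHomogeneousAt_ev hX hh U fun h' => hU ?_
        exact h'.1.eq_of_objDeg hu (by rw [h'.2]; abel)
    _ = _ := by rw [← Finset.sum_mul, ← Finset.sum_mul, sum_idem, one_mul]

/-! #### The corners of the path algebra with relations -/

variable (D) in
/-- The elements whose corners have the expected form. -/
def HasCorners (z : D.QuiverAlgebra) : Prop :=
  (∀ X Y : D.Obj, X.IsZero → ∃ h, IsWeightedHomogeneous D.wt h (D.objDeg Y - D.objDeg X) ∧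
    D.idem Y * z * D.idem X = D.idem Y * (D.tailObj Y * D.ev h) * D.idem X) ∧
  ∀ (X : D.Line) (Y : D.Obj), ∃ c : ℂ,
    D.idem Y * z * D.idem X.obj = c • (D.idem Y * D.idem X.obj)

lemma HasCorners.add {z z' : D.QuiverAlgebra} (hz : D.HasCorners z) (hz' : D.HasCorners z') :
    D.HasCorners (z + z') := by
  refine ⟨fun X Y hX => ?_, fun X Y => ?_⟩
  · obtain ⟨h, h1, h2⟩ := hz.1 X Y hX
    obtain ⟨h', h1', h2'⟩ := hz'.1 X Y hX
    exact ⟨h + h', h1.add h1', by simp only [mul_add, add_mul, map_add, h2, h2']⟩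
  · obtain ⟨c, h⟩ := hz.2 X Y
    obtain ⟨c', h'⟩ := hz'.2 X Y
    exact ⟨c + c', by rw [mul_add, add_mul, h, h', add_smul]⟩

lemma HasCorners.smul {z : D.QuiverAlgebra} (hz : D.HasCorners z) (r : ℂ) :
    D.HasCorners (r • z) := by
  refine ⟨fun X Y hX => ?_, fun X Y => ?_⟩
  · obtain ⟨h, h1, h2⟩ := hz.1 X Y hX
    refine ⟨r • h, ?_, ?_⟩
    · rw [smul_eq_C_mul]
      exact h1.C_mul r
    · rw [mul_smul_comm, smul_mul_assoc, h2, map_smul, mul_smul_comm, mul_smul_comm,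
        smul_mul_assoc]
  · obtain ⟨c, h⟩ := hz.2 X Y
    exact ⟨r * c, by rw [mul_smul_comm, smul_mul_assoc, h, smul_smul]⟩

lemma hasCorners_one : D.HasCorners 1 := by
  refine ⟨fun X Y hX => ?_, fun X Y => ⟨1, by rw [mul_one, one_smul]⟩⟩
  by_cases h : Y = X
  · subst h
    refine ⟨1, ?_, by rw [map_one, hX.tailObj, one_mul]⟩
    rw [sub_self]
    exact isWeightedHomogeneous_one ℂ D.wt
  · refine ⟨0, isWeightedHomogeneous_zero _ _ _, ?_⟩
    rw [map_zero, mul_zero, mul_zero, zero_mul, mul_one, idem_mul_idem h]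

lemma HasCorners.of_eq_zero {z : D.QuiverAlgebra} {v : D.Obj}
    (hz : ∀ Y, Y ≠ v → D.idem Y * z = 0)
    (h1 : ∀ X, X.IsZero → ∃ h, IsWeightedHomogeneous D.wt h (D.objDeg v - D.objDeg X) ∧
      D.idem v * z * D.idem X = D.idem v * (D.tailObj v * D.ev h) * D.idem X)
    (h2 : ∀ X : D.Line, ∃ c : ℂ, D.idem v * z * D.idem X.obj = c • (D.idem v * D.idem X.obj)) :
    D.HasCorners z := by
  refine ⟨fun X Y hX => ?_, fun X Y => ?_⟩
  · by_cases hY : Y = v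
    · subst hY
      exact h1 X hX
    · exact ⟨0, isWeightedHomogeneous_zero _ _ _, by
        rw [hz Y hY, map_zero, mul_zero, mul_zero]⟩
  · by_cases hY : Y = v
    · subst hY
      exact h2 X
    · exact ⟨0, by rw [hz Y hY, zero_smul, zero_mul]⟩

lemma HasCorners.idem_mul {z : D.QuiverAlgebra} (hz : D.HasCorners z) (v : D.Obj) :
    D.HasCorners (D.idem v * z) := by
  refine .of_eq_zero (v := v) (fun Y hY => ?_) (fun X hX => ?_) fun X => ?_
  · rw [← mul_assoc, idem_mul_idem hY, zero_mul]
  · rw [← mul_assoc, idem_mul_self]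
    exact hz.1 X v hX
  · rw [← mul_assoc, idem_mul_self]
    exact hz.2 X v

/-- An arrow starts in the grid, where the corner of `z` is a polynomial; multiplying by the label
gives the new one. Paths starting at a line cannot be continued. -/
lemma HasCorners.arrow_mul {z : D.QuiverAlgebra} (hz : D.HasCorners z) {u v : D.Obj}
    (α : D.Arrow u v) : D.HasCorners (D.arrow α * z) := by
  have e : ∀ X, D.idem v * (D.arrow α * z) * D.idem X =
      D.arrow α * (D.idem u * z * D.idem X) := fun X => by
    rw [← mul_assoc (D.idem v), idem_mul_arrow]
    conv_lhs => rw [← arrow_mul_idem α]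
    simp only [mul_assoc]
  refine .of_eq_zero (v := v) (fun Y hY => ?_) (fun X hX => ?_) fun X => ?_
  · rw [← mul_assoc, idem_mul_arrow_of_ne α hY, zero_mul]
  · obtain ⟨h, h1, h2⟩ := hz.1 X u hX
    refine ⟨α.label * h, ?_, ?_⟩
    · refine Eq.subst (motive := IsWeightedHomogeneous D.wt _) ?_ (α.label_homogeneous.mul h1)
      abel
    · rw [e, h2, α.isZero.tailObj, one_mul, idem_mul_ev_mul_idem hX α.isZero h1, arrow_eq,
        mul_assoc, ← mul_assoc (D.idem u), idem_mul_ev_mul_idem hX α.isZero h1, map_mul]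
      simp only [mul_assoc]
  · obtain ⟨c, hc⟩ := hz.2 X u
    refine ⟨0, ?_⟩
    rw [e, hc, idem_mul_idem fun h : u = X.obj => X.not_isZero (h ▸ α.isZero), smul_zero, mul_zero, zero_smul]

/-- The induction multiplies by words on the left of an arbitrary element with the property, since
the property is not visibly stable under products. -/
lemma hasCorners (z : D.QuiverAlgebra) : D.HasCorners z := by
  have key : ∀ w : FreeAlgebra ℂ (PathGen D.Obj), ∀ z, D.HasCorners z →
      D.HasCorners (D.toQuiver (RingQuot.mkAlgHom ℂ _ w) * z) := by
    intro w
    induction w using FreeAlgebra.induction with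
    | grade0 r =>
      intro z hz
      rw [AlgHom.commutes, AlgHom.commutes, ← Algebra.smul_def]
      exact hz.smul r
    | grade1 g =>
      intro z hz
      cases g with
      | idem v => exact hz.idem_mul v
      | arrow α => exact hz.arrow_mul α
    | mul a b ha hb =>
      intro z hz
      rw [map_mul, map_mul, mul_assoc]
      exact ha _ (hb _ hz)
    | add a b ha hb =>
      intro z hz
      rw [map_add, map_add, add_mul]
      exact (ha _ hz).add (hb _ hz)
  obtain ⟨z, rfl⟩ := RingQuot.mkAlgHom_surjective ℂ _ z
  obtain ⟨z, rfl⟩ := RingQuot.mkAlgHom_surjective ℂ _ z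
  have h := key z 1 hasCorners_one
  rwa [mul_one] at h

/-! #### The isomorphism -/

lemma quiverMap_idem (v : D.Obj) :
    D.quiverMap (D.idem v) = DirectSum.of _ 0 (D.B.cohomology.totalIdem v) :=
  (quiverMap_toQuiver _).trans (pathMap_idem v)

lemma toPoly_quiverMap_corner (z : D.QuiverAlgebra) (X Y : D.Obj) :
    D.toPoly (D.quiverMap (D.idem Y * z * D.idem X)) X Y = D.toPoly (D.quiverMap z) X Y := by
  rw [map_mul D.quiverMap, map_mul D.quiverMap, quiverMap_idem, quiverMap_idem, toPoly_corner]

lemma toPoly_ev {X Y : D.Obj} (hX : X.IsZero) (hY : Y.IsZero) {h : MvPolynomial (Fin 2) ℂ}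
    (hh : IsWeightedHomogeneous D.wt h (D.objDeg Y - D.objDeg X)) :
    D.toPoly (D.quiverMap (D.ev h)) X Y = h := by
  conv_lhs => rw [h.as_sum]
  conv_rhs => rw [h.as_sum]
  rw [map_sum, map_sum, map_sum, Finset.sum_apply, Finset.sum_apply]
  refine Finset.sum_congr rfl fun s hs => ?_
  have h1 := hh (mem_support_iff.1 hs)
  rw [D.weight_eq] at h1
  rw [ev_monomial, map_smul, map_mul, map_pow, map_pow, quiverMap_toQuiver, quiverMap_toQuiver,
    map_smul, Pi.smul_apply, Pi.smul_apply, toPoly_monomial _ _ hX, gridEntry,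
    if_pos ⟨hX, hY, by rw [h1]; abel⟩, monomial_eq_mul, smul_eq_C_mul]

lemma toPoly_ev_eq_zero {X Y : D.Obj} (hX : X.IsZero) {d : D.L} {h : MvPolynomial (Fin 2) ℂ}
    (hh : IsWeightedHomogeneous D.wt h d) (hY : ¬ (Y.IsZero ∧ D.objDeg Y = D.objDeg X + d)) :
    D.toPoly (D.quiverMap (D.ev h)) X Y = 0 := by
  rw [← toPoly_quiverMap_corner, isHomogeneousAt_ev hX hh Y hY, map_zero, map_zero]
  rfl

/-- For a line target the product passes through the single grid object of the same degree, whose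
arrow to the line contributes `1`; what remains is the value of `h` at the point. -/
lemma toPoly_tailObj_mul_ev {X : D.Obj} (hX : X.IsZero) (Y : D.Obj)
    {h : MvPolynomial (Fin 2) ℂ}
    (hh : IsWeightedHomogeneous D.wt h (D.objDeg Y - D.objDeg X)) :
    D.toPoly (D.quiverMap (D.tailObj Y * D.ev h)) X Y = D.rho Y h := by
  by_cases hY : Y.IsZero
  · rw [hY.tailObj, one_mul, toPoly_ev hX hY hh, hY.rho]
  · obtain ⟨V, rfl⟩ := Obj.exists_line hY
    obtain ⟨i, j, α, h1, h2, h3⟩ := V.exists_arrow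
    rw [map_mul D.quiverMap, toPoly_mul, Finset.sum_eq_single (.zero i j) (fun U _ hU => ?_)
      (by simp), tailObj_line, quiverMap_toQuiver, ← h1, toPoly_pathMap_labelSum, h2, one_mul,
      toPoly_ev hX (Y := .zero i j) trivial (by rwa [h3])]
    rw [toPoly_ev_eq_zero hX hh fun h' => hU (h'.1.eq_of_objDeg (Y := .zero i j) trivial (by rw [h'.2, h3]; abel)),
      mul_zero, map_zero]

lemma sum_corners (z : D.QuiverAlgebra) : ∑ X, ∑ Y, D.idem Y * z * D.idem X = z := by
  simp only [← Finset.sum_mul, sum_idem, one_mul]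
  rw [← Finset.mul_sum, sum_idem, mul_one]

/-- The corners of an element of the kernel vanish: between grid objects the polynomial itself is
zero; towards a line it vanishes at the point, so it is divisible by the factor, which the tail
kills; from a line it is a scalar multiple of the trivial path. -/
lemma quiverMap_injective : Function.Injective D.quiverMap := by
  refine (injective_iff_map_eq_zero _).2 fun z hz => ?_
  rw [← sum_corners z]
  refine Finset.sum_eq_zero fun X _ => Finset.sum_eq_zero fun Y _ => ?_
  have h0 : D.toPoly (D.quiverMap (D.idem Y * z * D.idem X)) X Y = 0 := by
    rw [toPoly_quiverMap_corner, hz, map_zero]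
    rfl
  by_cases hX : X.IsZero
  · obtain ⟨h, h1, h2⟩ := (hasCorners z).1 X Y hX
    rw [h2, toPoly_quiverMap_corner, toPoly_tailObj_mul_ev hX Y h1] at h0
    rw [h2]
    by_cases hY : Y.IsZero
    · rw [hY.rho] at h0
      rw [h0, map_zero, mul_zero, mul_zero, zero_mul]
    · obtain ⟨V, rfl⟩ := Obj.exists_line hY
      rw [rho_line, map_eq_zero_iff C (C_injective _ _)] at h0
      obtain ⟨g, rfl⟩ := V.factor_dvd h1 h0
      rw [map_mul, ← mul_assoc (D.tailObj _), tailObj_mul_factor, zero_mul, mul_zero, zero_mul]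
  · obtain ⟨V, rfl⟩ := Obj.exists_line hX
    obtain ⟨c, hc⟩ := (hasCorners z).2 V Y
    by_cases hY : Y = V.obj
    · subst hY
      have h1 := toPoly_quiverMap_corner (1 : D.QuiverAlgebra) V.obj V.obj
      rw [map_one, toPoly_one_self, mul_one] at h1
      rw [hc, map_smul, map_smul, Pi.smul_apply, Pi.smul_apply, h1, smul_eq_C_mul, mul_one,
        map_eq_zero_iff C (C_injective _ _)] at h0
      rw [hc, h0, zero_smul]
    · rw [hc, idem_mul_idem hY, smul_zero]

lemma exists_corner (F : D.B.cohomology.TotalEnd) (X Y : D.Obj) :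
    ∃ z : D.QuiverAlgebra, D.toPoly (D.quiverMap z) X Y = D.toPoly F X Y := by
  by_cases hX : X.IsZero
  · obtain ⟨i, j, rfl⟩ := hX.exists
    obtain ⟨h, h1, h2⟩ := exists_toPoly_zero i j Y F
    exact ⟨_, (toPoly_tailObj_mul_ev hX Y h1).trans h2.symm⟩
  · obtain ⟨V, rfl⟩ := Obj.exists_line hX
    by_cases hY : V.obj = Y
    · subst hY
      obtain ⟨c, hc⟩ := exists_toPoly_line V F
      refine ⟨c • 1, ?_⟩
      rw [map_smul, map_smul, map_one, Pi.smul_apply, Pi.smul_apply, toPoly_one_self, hc,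
        smul_eq_C_mul, mul_one]
    · exact ⟨0, by rw [toPoly_line_ne V hY, toPoly_line_ne V hY]⟩

/-- Each entry is attained separately; the trivial paths then cut out and assemble the chosen
preimages without interference. -/
lemma quiverMap_surjective : Function.Surjective D.quiverMap := by
  classical
  intro F
  choose z hz using exists_corner F
  refine ⟨∑ X, ∑ Y, D.idem Y * z X Y * D.idem X, toPoly_injective ?_⟩
  funext X Y
  rw [← toPoly_quiverMap_corner, ← hz]
  have h : D.idem Y * (∑ X, ∑ Y, D.idem Y * z X Y * D.idem X) * D.idem X =
      D.idem Y * z X Y * D.idem X := by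
    rw [Finset.mul_sum, Finset.sum_mul, Finset.sum_eq_single X (fun X' _ hX' => ?_) (by simp),
      Finset.mul_sum, Finset.sum_mul, Finset.sum_eq_single Y (fun Y' _ hY' => ?_) (by simp)]
    · rw [mul_assoc (D.idem Y), mul_assoc (D.idem Y * _), idem_mul_self, ← mul_assoc,
        ← mul_assoc, idem_mul_self]
    · rw [mul_assoc (D.idem Y'), ← mul_assoc (D.idem Y), idem_mul_idem hY'.symm, zero_mul,
        zero_mul]
    · rw [← Finset.sum_mul, ← mul_assoc, mul_assoc, idem_mul_idem hX', mul_zero]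
  rw [h, toPoly_quiverMap_corner]

variable (D) in
/-- The isomorphism from the path algebra with relations to the total endomorphism algebra. -/
def quiverEquiv : D.QuiverAlgebra ≃ₐ[ℂ] D.B.cohomology.TotalEnd :=
  AlgEquiv.ofBijective D.quiverMap ⟨quiverMap_injective, quiverMap_surjective⟩

lemma quiverEquiv_idem (v : D.Obj) :
    D.quiverEquiv (D.idem v) = DirectSum.of _ 0 (D.B.cohomology.totalIdem v) := quiverMap_idem v

lemma quiverEquiv_arrow {u v : D.Obj} (α : D.Arrow u v) :
    D.quiverEquiv (D.arrow α) = DirectSum.of _ 0 (D.genImage (.arrow (V := D.Obj) α)) :=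
  (quiverMap_toQuiver _).trans (pathMap_arrow (D := D) α)

end LoopDatum

end

theorem mainTheorem3 (p q ℓ : ℕ) (hp : 2 ≤ p) (hq : 2 ≤ q) (Γ : Subgroup (ℂˣ × ℂˣ))
    (hΓ : Γ ≤ loopSymmetryGroup p q) (hℓ : ℓ ≠ 0)
    (hidx : Γ.relIndex (loopSymmetryGroup p q) = ℓ) (η : ℂ) (hη : IsPrimitiveRoot η ℓ) :
    ∃ D : LoopDatum, D.p = p ∧ D.q = q ∧ D.l = ℓ ∧ D.η = η ∧
      (∀ a b : ℤ, a • D.xv + b • D.yv = 0 ↔ ∀ g ∈ Γ, g.1 ^ a * g.2 ^ b = 1) ∧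
      Fintype.card D.Obj = (p * q - 1) / ℓ + ℓ ∧
      (∃ Φ : D.QuiverAlgebra ≃ₐ[ℂ] D.B.cohomology.TotalEnd,
        (∀ v : D.Obj, Φ (D.idem v) = DirectSum.of _ 0 (D.B.cohomology.totalIdem v)) ∧
        (∀ (u v : D.Obj) (α : D.Arrow u v),
          ∃ f : D.B.cohomology.totalPart 0, Φ (D.arrow α) = DirectSum.of _ 0 f)) ∧
      (∀ (X Y : D.Obj) (n : ℤ), n ≠ 0 → Subsingleton (D.B.cohomology.hom X Y n)) ∧
      D.B.cohomology.IntrinsicallyFormal ∧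
      QuasiIsomorphic D.B.toAInf D.B.cohomology.toAInf := by 
  -- Intrinsic formality and the quasi-isomorphism for the category itself are two instances of
  -- formality for cohomology in degree zero; the second needs no separate model of `D.B`.
  obtain ⟨D, rfl, rfl, rfl, rfl, hD⟩ := exists_loopDatum p q ℓ hp hq Γ hΓ hℓ hidx η hη
  have hH : ∀ (X Y : D.Obj) (n : ℤ), n ≠ 0 → Subsingleton (D.B.cohomology.hom X Y n) :=
    fun X Y n hn => have : NeZero n := ⟨hn⟩; inferInstance
  exact ⟨D, rfl, rfl, rfl, rfl, hD, D.card_obj,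
    ⟨D.quiverEquiv, LoopDatum.quiverEquiv_idem, fun _ _ α => ⟨_, LoopDatum.quiverEquiv_arrow α⟩⟩,
    hH, DGCat.intrinsicallyFormal_of_concentrated _ hH,
    AInfCat.quasiIsomorphic_of_concentrated (DGCat.toAInfCohomologyIso _) hH⟩
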